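/- Let $\mathbb F$ be a finite field with $q$ elements, $C$ a smooth projective geometrically irreducible curve over $\mathbb F$ with function field $K$, $\infty$ a closed point of $C$, and $A\subset K$ the ring of functions that are regular away from $\infty$. Let $K_\infty$ be the completion of $K$ at $\infty$, $K_\infty^s$ a separable closure, $G_\infty=\operatorname{Gal}(K_\infty^s|K_\infty)$, and $\mathbb C_\infty$ the completion of $K_\infty^s$. Unlabelled tensor products are over $\mathbb F$. For a field $L\supseteq K$ let $\mathfrak j$ be the kernel of $A\otimes L\to L$, $a\otimes l\mapsto al$, let $L[\![\mathfrak j]\!]$ be the $\mathfrak j$-adic completion of $A\otimes L$, and $L(\!(\mathfrak j)\!)$ its ring of fractions. Let $\mathbb C_\infty\langle A\rangle$ be the completion of $A\otimes\mathbb C_\infty$ for the Gauss norm $\|f\|=\inf\max_i|l_i|$ (infimum over all $f=\sum a_i\otimes l_i$). Let $\tau$ be the endomorphism $a\otimes l\mapsto a\otimes l^q$ of $A\otimes K$ and its continuous extension to $\mathbb C_\infty\langle A\rangle$. An *$A$-motive* over $K$ is a finite locally free $A\otimes K$-module $M$ with an isomorphism $\tau_M:\tau^*M\to M$ of its restrictions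 to the complement of $V(\mathfrak j)$ in $\operatorname{Spec}(A\otimes K)$; a morphism is a linear map $f$ with $f\circ\tau_M=\tau_N\circ\tau^*f$. Its *Betti realization* is the $A[G_\infty]$-module $M_B=\{\omega\in M\otimes_{A\otimes K}\mathbb C_\infty\langle A\rangle:\omega=\tau_M(\tau^*\omega)\}$ (note that $\mathfrak j$ generates the unit ideal of $\mathbb C_\infty\langle A\rangle$), and $M$ is *rigid analytically trivial* if $M_B\otimes_A\mathbb C_\infty\langle A\rangle\to M\otimes_{A\otimes K}\mathbb C_\infty\langle A\rangle$ is bijective. A sequence of $A$-motives is exact if the underlying sequence of modules is. Let $A\mathbf{Mot}_K^{\mathrm{rat}}$ be the category of rigid analytically trivial $A$-motives. Let $R$ be a Noetherian ring with $A\subseteq R\subseteq K_\infty$. Given a homomorphism $\nu:K_\infty\to K_\infty^s[\![\mathfrak j]\!]$, a *Hodge–Pink structure* (base field $K_\infty^s$, coefficient ring $R$) is a finitely generated $R$-module $H$ with a $K_\infty^s[\![\mathfrak j]\!]$-lattice $\mathfrak q_H$ in $H\otimes_{R,\nu}K_\infty^s(\!(\mathfrak j)\!)$, i.e. a finitely generated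 submodule that spans; morphisms are the $R$-linear maps $f$ with $f(\mathfrak q_H)\subseteq\mathfrak q_{H'}$, and $f$ is *strict* if $f(\mathfrak q_H)=\mathfrak q_{H'}\cap\operatorname{im}(f\otimes\operatorname{id})$. An *infinite Frobenius* for $H$ is an $R$-linear representation $\phi$ of $G_\infty$ on $H$, continuous for the profinite topology on $G_\infty$ and the discrete topology on $H$, such that each $\phi(\sigma)\otimes\sigma$ preserves $\mathfrak q_H$. Let $\mathbf{HPk}$ (resp. $\mathbf{HPk}^+$) be the category of Hodge–Pink structures (resp. of those with an infinite Frobenius, with morphisms commuting with the Frobenii). A *strict exact sequence* is a sequence $0\to H'\to H\to H''\to0$ that is exact on underlying $R$-modules and whose maps are strict. **Proposition.** 1. There is exactly one ring homomorphism $\nu:K_\infty\to K_\infty^s[\![\mathfrak j]\!]$ with $\nu(a)=a\otimes1$ for $a\in A$ that coincides modulo $\mathfrak j$ with the inclusion $K_\infty\subset K_\infty^s$, and its image is fixed by $G_\infty$. 2. For every rigid analytically trivial $M$, each $\omega\in M_B$ has a meromorphic continuation to the rigid analytic space of $\operatorname{Spec}(A\otimes L)$ for some finite extension $L$ of $K_\infty$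 in $K_\infty^s$ (that is, $d\,\omega$ is entire for a non-zero entire function $d$). Its germ at $\mathfrak j$ is a uniquely determined element of $M\otimes_{A\otimes K}K_\infty^s(\!(\mathfrak j)\!)$, it depends $A$-linearly on $\omega$, and it induces an isomorphism $\gamma_M:M_B\otimes_{A,\nu}K_\infty^s(\!(\mathfrak j)\!)\to M\otimes_{A\otimes K}K_\infty^s(\!(\mathfrak j)\!)$. 3. $A\mathbf{Mot}_K^{\mathrm{rat}}$ with the exact sequences, and $\mathbf{HPk}$ and $\mathbf{HPk}^+$ with the strict exact sequences, are exact categories in the sense of Quillen. 4. $\mathcal H_R(M)=\bigl(M_B\otimes_AR,\ \gamma_M^{-1}(M\otimes_{A\otimes K}K_\infty^s[\![\mathfrak j]\!])\bigr)$ is a Hodge–Pink structure, for which the action of $G_\infty$ on $M_B$ induces an infinite Frobenius; denote the resulting object of $\mathbf{HPk}^+$ by $\mathcal H_R^+(M)$. Then $M\mapsto\mathcal H_R(M)$ and $M\mapsto\mathcal H_R^+(M)$ (with $f\mapsto f_B\otimes_AR$ on morphisms) are exact functors of exact categories $A\mathbf{Mot}_K^{\mathrm{rat}}\to\mathbf{HPk}$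 and $A\mathbf{Mot}_K^{\mathrm{rat}}\to\mathbf{HPk}^+$: they are additive and send exact sequences to strict exact sequences. -/

import Mathlib

open scoped TensorProduct
open CategoryTheory

universe u

noncomputable section

namespace HodgePink

/-- `K / F` is a function field in one variable with exact field of constants `F`, i.e. (for finite
`F`) the function field of a smooth projective geometrically irreducible curve over `F`. -/
structure IsFunctionField (F K : Type u) [Field F] [Field K] [Algebra F K] : Prop where
  exists_finite : ∃ t : K, Transcendental F t ∧
    FiniteDimensional (IntermediateField.adjoin F {t}) K
  exact_constants : ∀ x : K, IsAlgebraic F x → x ∈ (algebraMap F K).range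

/-- A closed point of the curve with function field `K / F`: a nontrivial non-archimedean absolute
value on `K`, trivial on `F`. Equivalent absolute values represent the same closed point. -/
structure Place (F K : Type u) [Field F] [Field K] [Algebra F K] where
  abs : AbsoluteValue K ℝ
  nontrivial : abs.IsNontrivial
  nonarch : IsNonarchimedean abs
  trivial_on_base : ∀ c : F, c ≠ 0 → abs (algebraMap F K c) = 1

namespace Place

variable {F K : Type u} [Field F] [Field K] [Algebra F K] (v : Place F K)

/-- The ring `A` of functions that are regular away from the closed point `v` (which is `∞`). -/
def A : Subalgebra F K where
  carrier := {x | ∀ w : Place F K, ¬ w.abs.IsEquiv v.abs → w.abs x ≤ 1}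
  mul_mem' := fun {x y} hx hy w hw => by
    rw [map_mul]; exact mul_le_one₀ (hx w hw) (w.abs.nonneg y) (hy w hw)
  add_mem' := fun {x y} hx hy w hw => (w.nonarch x y).trans (max_le (hx w hw) (hy w hw))
  algebraMap_mem' := fun c w _ => by
    by_cases hc : c = 0
    · simp [hc]
    · exact (w.trivial_on_base c hc).le

/-- The local field `K_∞`: the completion of `K` at `∞`. -/
def Kinf : Type u := v.abs.Completion

instance : NormedField v.Kinf := inferInstanceAs (NormedField v.abs.Completion)
instance : CompleteSpace v.Kinf := inferInstanceAs (CompleteSpace v.abs.Completion)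
instance {S : Type*} [CommRing S] [Algebra S K] : Algebra S v.Kinf :=
  inferInstanceAs (Algebra S v.abs.Completion)
instance {S T : Type*} [CommRing S] [CommRing T] [Algebra S T] [Algebra T K] [Algebra S K] [IsScalarTower S T K] :
    IsScalarTower S T v.Kinf :=
  inferInstanceAs (IsScalarTower S T v.abs.Completion)

lemma norm_algebraMap_Kinf (x : K) : ‖algebraMap K v.Kinf x‖ = v.abs x := by
  have h : (algebraMap K v.Kinf x : v.abs.Completion) =
      ((WithAbs.toAbs v.abs x : WithAbs v.abs) : v.abs.Completion) := rfl
  exact (congrArg norm h).trans (UniformSpace.Completion.norm_coe _)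

instance : NontriviallyNormedField v.Kinf where
  non_trivial := by
    obtain ⟨x, hx, h1⟩ := v.nontrivial
    rcases lt_or_gt_of_ne h1 with h | h
    · refine ⟨algebraMap K v.Kinf x⁻¹, ?_⟩
      rw [norm_algebraMap_Kinf, map_inv₀]
      exact (one_lt_inv₀ (v.abs.pos hx)).2 h
    · exact ⟨algebraMap K v.Kinf x, by rwa [norm_algebraMap_Kinf]⟩

instance : IsUltrametricDist v.Kinf := by
  refine IsUltrametricDist.isUltrametricDist_of_forall_norm_natCast_le_one fun n => ?_
  rw [← map_natCast (algebraMap K v.Kinf) n, norm_algebraMap_Kinf]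
  induction n with
  | zero => simp
  | succ n ih =>
    rw [Nat.cast_succ]
    exact (v.nonarch _ _).trans (max_le ih v.abs.map_one.le)

/-- The separable closure `K_∞^s` of `K_∞`. -/
def Ks : Type u := SeparableClosure v.Kinf

instance : NormedField v.Ks := spectralNorm.normedField v.Kinf (SeparableClosure v.Kinf)
instance {S : Type*} [CommRing S] [Algebra S K] : Algebra S v.Ks :=
  inferInstanceAs (Algebra S (SeparableClosure v.Kinf))
instance : NormedAlgebra v.Kinf v.Ks :=
  spectralNorm.normedAlgebra v.Kinf (SeparableClosure v.Kinf)
instance {S : Type*} [CommRing S] [Algebra S K] :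
    IsScalarTower S v.Kinf v.Ks :=
  inferInstanceAs (IsScalarTower S v.Kinf (SeparableClosure v.Kinf))
instance {S T : Type*} [CommRing S] [CommRing T] [Algebra S T] [Algebra T K] [Algebra S K] [IsScalarTower S T K] :
    IsScalarTower S T v.Ks :=
  IsScalarTower.of_algebraMap_eq fun x => by
    rw [IsScalarTower.algebraMap_apply S v.Kinf v.Ks, IsScalarTower.algebraMap_apply T v.Kinf v.Ks,
      ← IsScalarTower.algebraMap_apply S T v.Kinf]
instance {S T : Type*} [CommRing S] [CommRing T] [Algebra S T] [Algebra T K] [Algebra S K]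
    [IsScalarTower S T K] (L : IntermediateField v.Kinf v.Ks) : IsScalarTower S T L :=
  IsScalarTower.of_algebraMap_eq fun x =>
    Subtype.ext (IsScalarTower.algebraMap_apply S T v.Ks x)
instance : IsSepClosure v.Kinf v.Ks :=
  inferInstanceAs (IsSepClosure v.Kinf (SeparableClosure v.Kinf))

abbrev Ginf : Type u := v.Ks ≃ₐ[v.Kinf] v.Ks

/-- The field `ℂ_∞`: the completion of `K_∞^s`. -/
def Cinf : Type u := UniformSpace.Completion v.Ks

instance : NormedField v.Cinf := inferInstanceAs (NormedField (UniformSpace.Completion v.Ks))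
instance : CompleteSpace v.Cinf := inferInstanceAs (CompleteSpace (UniformSpace.Completion v.Ks))

/-- The embedding of `K_∞^s` in `ℂ_∞`. -/
def toCinf : v.Ks →+* v.Cinf := (UniformSpace.Completion.coeRingHom : v.Ks →+* _)

lemma norm_toCinf (x : v.Ks) : ‖v.toCinf x‖ = ‖x‖ := UniformSpace.Completion.norm_coe x

instance {S : Type*} [CommRing S] [Algebra S K] : Algebra S v.Cinf :=
  (v.toCinf.comp (algebraMap S v.Ks)).toAlgebra
instance {S T : Type*} [CommRing S] [CommRing T] [Algebra S T] [Algebra T K] [Algebra S K]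
    [IsScalarTower S T K] : IsScalarTower S T v.Cinf :=
  IsScalarTower.of_algebraMap_eq fun x =>
    congrArg v.toCinf (IsScalarTower.algebraMap_apply S T v.Ks x)

/-- The embedding of `K_∞^s` in `ℂ_∞` as a map of `F`-algebras. -/
def toCinfAlg : v.Ks →ₐ[F] v.Cinf := { v.toCinf with commutes' := fun _ => rfl }

lemma norm_galois (σ : v.Ginf) (x : v.Ks) : ‖σ x‖ = ‖x‖ :=
  (spectralNorm_eq_of_equiv σ x).symm

/-- The action of `G_∞` on `ℂ_∞`, extended by continuity from `K_∞^s`. -/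
def galoisCinf (σ : v.Ginf) : v.Cinf →+* v.Cinf :=
  UniformSpace.Completion.mapRingHom (σ : v.Ks →+* v.Ks)
    (AddMonoidHomClass.isometry_of_norm σ (v.norm_galois σ)).continuous

lemma galoisCinf_coe (σ : v.Ginf) (x : v.Ks) : v.galoisCinf σ (v.toCinf x) = v.toCinf (σ x) :=
  UniformSpace.Completion.mapRingHom_coe (f := (σ : v.Ks →+* v.Ks))
    (AddMonoidHomClass.isometry_of_norm σ (v.norm_galois σ)).continuous x

lemma norm_galoisCinf (σ : v.Ginf) (x : v.Cinf) : ‖v.galoisCinf σ x‖ = ‖x‖ := by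
  refine UniformSpace.Completion.induction_on x ?_ fun y => ?_
  · exact isClosed_eq ((UniformSpace.Completion.continuous_map).norm) continuous_norm
  · exact (congrArg norm (v.galoisCinf_coe σ y)).trans
      ((v.norm_toCinf _).trans ((v.norm_galois σ y).trans (v.norm_toCinf y).symm))

/-- The action of `σ ∈ G_∞` on `ℂ_∞` as a map of `K`-algebras. -/
def galoisCinfAlg (σ : v.Ginf) : v.Cinf →ₐ[K] v.Cinf :=
  { v.galoisCinf σ with
    commutes' := fun x => by
      refine (v.galoisCinf_coe σ (algebraMap K v.Ks x)).trans (congrArg v.toCinf ?_)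
      rw [IsScalarTower.algebraMap_apply K v.Kinf v.Ks, σ.commutes] }

section Gauss

variable (L : Type u) [NormedField L] [Algebra F L]

/-- The ring `A ⊗ L` (tensor product over `F`). -/
def Coeff (L : Type u) [Field L] [Algebra F L] : Type u := v.A ⊗[F] L

section Coeff

variable {L L' L'' : Type u} [Field L] [Algebra F L] [Field L'] [Algebra F L'] [Field L'']
  [Algebra F L'']

instance : CommRing (v.Coeff L) := inferInstanceAs (CommRing (v.A ⊗[F] L))
instance : Algebra v.A (v.Coeff L) := inferInstanceAs (Algebra v.A (v.A ⊗[F] L))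

/-- The pure tensor `a ⊗ l`. -/
def tens (a : v.A) (l : L) : v.Coeff L := a ⊗ₜ[F] l

lemma tens_mul_tens (a b : v.A) (l m : L) : v.tens a l * v.tens b m = v.tens (a * b) (l * m) :=
  Algebra.TensorProduct.tmul_mul_tmul ..

@[elab_as_elim]
lemma coeff_induction {p : v.Coeff L → Prop} (f : v.Coeff L) (h0 : p 0)
    (h1 : ∀ a l, p (v.tens a l)) (h2 : ∀ f g, p f → p g → p (f + g)) : p f :=
  TensorProduct.induction_on f h0 h1 h2

/-- `id ⊗ φ : A ⊗ L → A ⊗ L'`. -/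
def coeffMap (φ : L →ₐ[F] L') : v.Coeff L →ₐ[v.A] v.Coeff L' :=
  (Algebra.TensorProduct.map (AlgHom.id v.A v.A) φ : v.A ⊗[F] L →ₐ[v.A] v.A ⊗[F] L')

lemma coeffMap_tens (φ : L →ₐ[F] L') (a : v.A) (l : L) :
    v.coeffMap φ (v.tens a l) = v.tens a (φ l) := rfl

lemma coeffMap_id (f : v.Coeff L) : v.coeffMap (AlgHom.id F L) f = f := by
  refine v.coeff_induction f (map_zero _) (fun a l => rfl) fun f g hf hg => ?_
  rw [map_add, hf, hg]

lemma coeffMap_comp (ψ : L' →ₐ[F] L'') (φ : L →ₐ[F] L') (f : v.Coeff L) :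
    v.coeffMap (ψ.comp φ) f = v.coeffMap ψ (v.coeffMap φ f) := by
  refine v.coeff_induction f (by simp only [map_zero]) (fun a l => rfl) fun f g hf hg => ?_
  simp only [map_add, hf, hg]

end Coeff

/-- The finite sums of pure tensors `a ⊗ l` with `|l| * max(1, |a|)^s ≤ r`. -/
def gaussBall (s : ℕ) (r : ℝ) : AddSubgroup (v.Coeff L) :=
  AddSubgroup.closure
    {f | ∃ (a : v.A) (l : L), f = v.tens a l ∧ ‖l‖ * max 1 (v.abs (a : K)) ^ s ≤ r}

/-- The Gauss norm on `A ⊗ L`: the infimum over all representations `f = ∑ aᵢ ⊗ lᵢ` of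
`maxᵢ |lᵢ| * |aᵢ|^s`, where `|a| = ρ₀ ^ deg a ≥ 1` for `a ≠ 0` in `A`; it is the Gauss norm of
radius `ρ = ρ₀ ^ s`. -/
def gaussNorm (s : ℕ) (f : v.Coeff L) : ℝ := sInf {r | 0 ≤ r ∧ f ∈ v.gaussBall L s r}

variable {L}

lemma gaussBall_mono (s : ℕ) {r r' : ℝ} (h : r ≤ r') : v.gaussBall L s r ≤ v.gaussBall L s r' :=
  AddSubgroup.closure_mono fun _ ⟨a, l, hf, hl⟩ => ⟨a, l, hf, hl.trans h⟩

lemma exists_mem_gaussBall (s : ℕ) (f : v.Coeff L) : ∃ r, 0 ≤ r ∧ f ∈ v.gaussBall L s r := by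
  refine v.coeff_induction f ⟨0, le_rfl, zero_mem _⟩
    (fun a l => ⟨_, by positivity, AddSubgroup.subset_closure ⟨a, l, rfl, le_rfl⟩⟩) ?_
  rintro f g ⟨r, hr, hf⟩ ⟨r', _, hg⟩
  exact ⟨max r r', hr.trans (le_max_left _ _),
    add_mem (v.gaussBall_mono s (le_max_left _ _) hf) (v.gaussBall_mono s (le_max_right _ _) hg)⟩

lemma gaussNorm_nonneg (s : ℕ) (f : v.Coeff L) : 0 ≤ v.gaussNorm L s f :=
  Real.sInf_nonneg fun _ h => h.1

lemma gaussNorm_le {s : ℕ} {f : v.Coeff L} {r : ℝ} (hr : 0 ≤ r) (h : f ∈ v.gaussBall L s r) :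
    v.gaussNorm L s f ≤ r :=
  csInf_le ⟨0, fun _ h => h.1⟩ ⟨hr, h⟩

lemma mem_gaussBall_of_lt {s : ℕ} {f : v.Coeff L} {r : ℝ} (h : v.gaussNorm L s f < r) :
    f ∈ v.gaussBall L s r := by
  obtain ⟨r', ⟨_, hf⟩, hr⟩ := exists_lt_of_csInf_lt (v.exists_mem_gaussBall s f) h
  exact v.gaussBall_mono s hr.le hf

lemma mul_mem_gaussBall {s : ℕ} {f g : v.Coeff L} {r r' : ℝ} (hr : 0 ≤ r)
    (hf : f ∈ v.gaussBall L s r) (hg : g ∈ v.gaussBall L s r') :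
    f * g ∈ v.gaussBall L s (r * r') := by
  induction hf using AddSubgroup.closure_induction with
  | zero => simp
  | add x y _ _ hx hy => rw [add_mul]; exact add_mem hx hy
  | neg x _ hx => rw [neg_mul]; exact neg_mem hx
  | mem x hx =>
    obtain ⟨a, l, rfl, hl⟩ := hx
    induction hg using AddSubgroup.closure_induction with
    | zero => simp
    | add x y _ _ hx hy => rw [mul_add]; exact add_mem hx hy
    | neg x _ hx => rw [mul_neg]; exact neg_mem hx
    | mem y hy =>
      obtain ⟨b, m, rfl, hm⟩ := hy
      refine AddSubgroup.subset_closure ⟨a * b, l * m, v.tens_mul_tens .., ?_⟩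
      have h1 : max 1 (v.abs ((a * b : v.A) : K)) ≤
          max 1 (v.abs (a : K)) * max 1 (v.abs (b : K)) := by
        rw [MulMemClass.coe_mul, map_mul]
        refine max_le (one_le_mul_of_one_le_of_one_le (le_max_left _ _) (le_max_left _ _)) ?_
        exact mul_le_mul (le_max_right _ _) (le_max_right _ _) (v.abs.nonneg _) (by positivity)
      calc ‖l * m‖ * max 1 (v.abs ((a * b : v.A) : K)) ^ s
          ≤ ‖l * m‖ * (max 1 (v.abs (a : K)) * max 1 (v.abs (b : K))) ^ s := by gcongr
        _ = (‖l‖ * max 1 (v.abs (a : K)) ^ s) * (‖m‖ * max 1 (v.abs (b : K)) ^ s) := by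
            rw [norm_mul, mul_pow]; ring
        _ ≤ r * r' := mul_le_mul hl hm (by positivity) hr

variable (L)

/-- The Gauss norm as a ring seminorm. -/
def gaussSeminorm (s : ℕ) : RingSeminorm (v.Coeff L) where
  toFun := v.gaussNorm L s
  map_zero' := le_antisymm (v.gaussNorm_le le_rfl (zero_mem _)) (v.gaussNorm_nonneg s 0)
  add_le' f g := by
    refine le_of_forall_pos_le_add fun ε hε => ?_
    have hf := v.mem_gaussBall_of_lt (lt_add_of_pos_right (v.gaussNorm L s f) hε)
    have hg := v.mem_gaussBall_of_lt (lt_add_of_pos_right (v.gaussNorm L s g) hε)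
    have h1 := v.gaussNorm_nonneg s f
    have h2 := v.gaussNorm_nonneg s g
    refine v.gaussNorm_le (by positivity) (add_mem (v.gaussBall_mono s ?_ hf)
      (v.gaussBall_mono s ?_ hg)) <;> linarith
  neg' f := by
    have : ∀ r, -f ∈ v.gaussBall L s r ↔ f ∈ v.gaussBall L s r := fun r => neg_mem_iff
    simp only [gaussNorm, this]
  mul_le' f g := by
    have h1 := v.gaussNorm_nonneg s f
    have h2 := v.gaussNorm_nonneg s g
    have h3 : Filter.Tendsto (fun ε : ℝ => (v.gaussNorm L s f + ε) * (v.gaussNorm L s g + ε))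
        (nhdsWithin 0 (Set.Ioi 0)) (nhds (v.gaussNorm L s f * v.gaussNorm L s g)) := by
      have : Continuous fun ε : ℝ => (v.gaussNorm L s f + ε) * (v.gaussNorm L s g + ε) := by
        fun_prop
      simpa using (this.tendsto 0).mono_left nhdsWithin_le_nhds
    refine ge_of_tendsto h3 (eventually_nhdsWithin_of_forall fun ε hε => ?_)
    have hε : 0 < ε := hε
    exact v.gaussNorm_le (by positivity) (v.mul_mem_gaussBall (by positivity)
      (v.mem_gaussBall_of_lt (by linarith)) (v.mem_gaussBall_of_lt (by linarith)))

/-- The ring `A ⊗ L`, equipped with the Gauss norm. -/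
def GaussRing (_s : ℕ) : Type u := v.Coeff L

instance (s : ℕ) : SeminormedCommRing (v.GaussRing L s) :=
  { (v.gaussSeminorm L s).toSeminormedRing with
    mul_comm := fun x y => mul_comm (G := v.Coeff L) x y }

/-- The completion of `A ⊗ L` for the Gauss norm of radius `ρ₀ ^ s`. For `s = 0` it is `L⟨A⟩`, the
ring of functions on the closed unit disc. -/
def Tate (s : ℕ) : Type u := UniformSpace.Completion (v.GaussRing L s)

instance (s : ℕ) : NormedCommRing (v.Tate L s) :=
  inferInstanceAs (NormedCommRing (UniformSpace.Completion (v.GaussRing L s)))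
instance (s : ℕ) : CompleteSpace (v.Tate L s) :=
  inferInstanceAs (CompleteSpace (UniformSpace.Completion (v.GaussRing L s)))

/-- The canonical map from `A ⊗ L` to its completion. -/
def toTate (s : ℕ) : v.Coeff L →+* v.Tate L s :=
  (UniformSpace.Completion.coeRingHom : v.GaussRing L s →+* _)

variable {L} {L' : Type u} [NormedField L'] [Algebra F L']

/-- `id ⊗ φ` as a map between the normed rings `A ⊗ L` and `A ⊗ L'`. -/
def gaussMap (φ : L →ₐ[F] L') (s s' : ℕ) : v.GaussRing L s →+* v.GaussRing L' s' :=
  (v.coeffMap φ : v.Coeff L →+* v.Coeff L')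

lemma continuous_gaussMap (φ : L →ₐ[F] L') (hφ : ∀ l, ‖l‖ ≤ 1 → ‖φ l‖ ≤ ‖l‖) {s s' : ℕ}
    (hs : s' ≤ s) : Continuous (v.gaussMap φ s s') := by
  refine continuous_of_continuousAt_zero (v.gaussMap φ s s') ?_
  have key : ∀ r ≤ 1, ∀ f ∈ v.gaussBall L s r, v.coeffMap φ f ∈ v.gaussBall L' s' r := by
    intro r hr f hf
    induction hf using AddSubgroup.closure_induction with
    | zero => simp
    | add x y _ _ hx hy => rw [map_add]; exact add_mem hx hy
    | neg x _ hx => rw [map_neg]; exact neg_mem hx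
    | mem x hx =>
      obtain ⟨a, l, rfl, hl⟩ := hx
      refine AddSubgroup.subset_closure ⟨a, φ l, rfl, ?_⟩
      have h1 : 1 ≤ max 1 (v.abs (a : K)) := le_max_left _ _
      have h2 : ‖l‖ ≤ ‖l‖ * max 1 (v.abs (a : K)) ^ s :=
        le_mul_of_one_le_right (norm_nonneg _) (one_le_pow₀ h1)
      calc ‖φ l‖ * max 1 (v.abs (a : K)) ^ s' ≤ ‖l‖ * max 1 (v.abs (a : K)) ^ s := by
            gcongr
            · exact hφ l (h2.trans (hl.trans hr))
        _ ≤ r := hl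
  rw [Metric.continuousAt_iff]
  intro ε hε
  refine ⟨min (ε / 2) 1, by positivity, fun {f} hf => ?_⟩
  rw [map_zero, dist_zero_right]
  rw [dist_zero_right] at hf
  have h1 := key _ (min_le_right _ _) f (v.mem_gaussBall_of_lt hf)
  refine (v.gaussNorm_le (by positivity) h1).trans_lt ?_
  exact (min_le_left _ _).trans_lt (by linarith)

/-- The continuous extension of `id ⊗ φ` to the completions. -/
def tateMap (φ : L →ₐ[F] L') (hφ : ∀ l, ‖l‖ ≤ 1 → ‖φ l‖ ≤ ‖l‖) {s s' : ℕ} (hs : s' ≤ s) :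
    v.Tate L s →+* v.Tate L' s' :=
  UniformSpace.Completion.mapRingHom (v.gaussMap φ s s') (v.continuous_gaussMap φ hφ hs)

lemma continuous_tateMap (φ : L →ₐ[F] L') (hφ : ∀ l, ‖l‖ ≤ 1 → ‖φ l‖ ≤ ‖l‖) {s s' : ℕ}
    (hs : s' ≤ s) : Continuous (v.tateMap φ hφ hs) :=
  UniformSpace.Completion.continuous_map

lemma tateMap_toTate (φ : L →ₐ[F] L') (hφ : ∀ l, ‖l‖ ≤ 1 → ‖φ l‖ ≤ ‖l‖) {s s' : ℕ} (hs : s' ≤ s)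
    (f : v.Coeff L) : v.tateMap φ hφ hs (v.toTate L s f) = v.toTate L' s' (v.coeffMap φ f) :=
  UniformSpace.Completion.mapRingHom_coe (v.continuous_gaussMap φ hφ hs) f

@[elab_as_elim]
lemma tate_induction {s : ℕ} {p : v.Tate L s → Prop} (f : v.Tate L s) (hp : IsClosed {f | p f})
    (h : ∀ g, p (v.toTate L s g)) : p f :=
  UniformSpace.Completion.induction_on f hp h

end Gauss

/-! ### The ring `A ⊗ K`, Frobenius, the ideal `𝔧` and formal completions along `𝔧` -/

section Ideal

/-- The multiplication map `A ⊗ L → L`, `a ⊗ l ↦ a l`. -/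
def mulMap (L : Type u) [Field L] [Algebra F L] [Algebra K L] [IsScalarTower F K L] :
    v.Coeff L →+* L :=
  ((Algebra.TensorProduct.productMap (IsScalarTower.toAlgHom F v.A L) (AlgHom.id F L) :
    v.A ⊗[F] L →ₐ[F] L) : v.A ⊗[F] L →+* L)

/-- The kernel `𝔧` of the multiplication map `A ⊗ L → L`, `a ⊗ l ↦ a l`. -/
def jIdeal (L : Type u) [Field L] [Algebra F L] [Algebra K L] [IsScalarTower F K L] :
    Ideal (v.Coeff L) :=
  RingHom.ker (v.mulMap L)

/-- The completion `L[[𝔧]]` of `A ⊗ L` along `𝔧`. -/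
abbrev Jets (L : Type u) [Field L] [Algebra F L] [Algebra K L] [IsScalarTower F K L] : Type u :=
  AdicCompletion (v.jIdeal L) (v.Coeff L)

variable {L L' L'' : Type u} [Field L] [Algebra F L] [Algebra K L] [IsScalarTower F K L]
  [Field L'] [Algebra F L'] [Algebra K L'] [IsScalarTower F K L']
  [Field L''] [Algebra F L''] [Algebra K L''] [IsScalarTower F K L'']

lemma mulMap_tens (a : v.A) (l : L) : v.mulMap L (v.tens a l) = algebraMap K L a * l :=
  Algebra.TensorProduct.productMap_apply_tmul (IsScalarTower.toAlgHom F v.A L) (AlgHom.id F L) a l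

lemma mulMap_coeffMap (φ : L →ₐ[K] L') (f : v.Coeff L) :
    v.mulMap L' (v.coeffMap (φ.restrictScalars F) f) = φ (v.mulMap L f) := by
  refine v.coeff_induction f (by simp only [map_zero]) (fun a l => ?_) fun f g hf hg => ?_
  · rw [coeffMap_tens, mulMap_tens, mulMap_tens, map_mul, AlgHom.commutes]
    rfl
  · simp only [map_add, hf, hg]

lemma jIdeal_le_comap (φ : L →ₐ[K] L') :
    v.jIdeal L ≤ (v.jIdeal L').comap
      (v.coeffMap (φ.restrictScalars F) : v.Coeff L →+* v.Coeff L') := fun f hf =>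
  (v.mulMap_coeffMap φ f).trans ((congrArg φ (RingHom.mem_ker.1 hf)).trans (map_zero φ))

lemma jIdeal_pow_le_comap (φ : L →ₐ[K] L') (n : ℕ) :
    v.jIdeal L ^ n ≤ (v.jIdeal L' ^ n).comap
      (v.coeffMap (φ.restrictScalars F) : v.Coeff L →+* v.Coeff L') :=
  (Ideal.pow_right_mono (v.jIdeal_le_comap φ) n).trans (Ideal.le_comap_pow _ n)

/-- The map `L[[𝔧]] → (A ⊗ L') / 𝔧 ^ n` induced by `L → L'`. -/
def jetsMapAux (φ : L →ₐ[K] L') (n : ℕ) : v.Jets L →+* v.Coeff L' ⧸ v.jIdeal L' ^ n :=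
  (Ideal.quotientMap (v.jIdeal L' ^ n)
    (v.coeffMap (φ.restrictScalars F) : v.Coeff L →+* v.Coeff L')
    (v.jIdeal_pow_le_comap φ n)).comp (AdicCompletion.evalₐ (v.jIdeal L) n : v.Jets L →+* _)

lemma factorPow_comp_jetsMapAux (φ : L →ₐ[K] L') {m n : ℕ} (hle : m ≤ n) :
    (Ideal.Quotient.factorPow (v.jIdeal L') hle).comp (v.jetsMapAux φ n) = v.jetsMapAux φ m := by
  ext x
  obtain ⟨a, rfl⟩ := AdicCompletion.mk_surjective (v.jIdeal L) (v.Coeff L) x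
  simp only [jetsMapAux, RingHom.comp_apply, RingHom.coe_coe, AdicCompletion.evalₐ_mk,
    Ideal.quotientMap_mk]
  refine Ideal.Quotient.eq.2 ?_
  rw [← map_sub]
  refine v.jIdeal_pow_le_comap φ m (Ideal.Quotient.eq.1 ?_)
  have h := (a.2 hle).symm
  rw [smul_eq_mul, Ideal.mul_top, SModEq] at h
  exact h

/-- The functoriality of `L ↦ L[[𝔧]]`. -/
def jetsMap (φ : L →ₐ[K] L') : v.Jets L →+* v.Jets L' :=
  AdicCompletion.liftRingHom (v.jIdeal L') (v.jetsMapAux φ) (v.factorPow_comp_jetsMapAux φ)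

lemma evalₐ_jetsMap (φ : L →ₐ[K] L') (n : ℕ) (x : v.Jets L) :
    AdicCompletion.evalₐ (v.jIdeal L') n (v.jetsMap φ x) =
      Ideal.quotientMap (v.jIdeal L' ^ n)
        (v.coeffMap (φ.restrictScalars F) : v.Coeff L →+* v.Coeff L')
        (v.jIdeal_pow_le_comap φ n) (AdicCompletion.evalₐ (v.jIdeal L) n x) :=
  AdicCompletion.evalₐ_liftRingHom _ _ (v.factorPow_comp_jetsMapAux φ) n x

lemma evalₐ_jetsMap_of_eq (φ : L →ₐ[K] L') (n : ℕ) (x : v.Jets L) (y : v.Coeff L)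
    (h : AdicCompletion.evalₐ (v.jIdeal L) n x = Ideal.Quotient.mk _ y) :
    AdicCompletion.evalₐ (v.jIdeal L') n (v.jetsMap φ x) =
      Ideal.Quotient.mk _ (v.coeffMap (φ.restrictScalars F) y) := by
  rw [evalₐ_jetsMap, h, Ideal.quotientMap_mk]
  rfl

lemma jetsMap_id (x : v.Jets L) : v.jetsMap (AlgHom.id K L) x = x := by
  refine AdicCompletion.ext_evalₐ fun n => ?_
  obtain ⟨y, hy⟩ := Ideal.Quotient.mk_surjective (AdicCompletion.evalₐ (v.jIdeal L) n x)
  rw [v.evalₐ_jetsMap_of_eq _ n x y hy.symm, ← hy]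
  exact congrArg _ (v.coeffMap_id y)

lemma jetsMap_comp (ψ : L' →ₐ[K] L'') (φ : L →ₐ[K] L') (x : v.Jets L) :
    v.jetsMap (ψ.comp φ) x = v.jetsMap ψ (v.jetsMap φ x) := by
  refine AdicCompletion.ext_evalₐ fun n => ?_
  obtain ⟨y, hy⟩ := Ideal.Quotient.mk_surjective (AdicCompletion.evalₐ (v.jIdeal L) n x)
  rw [v.evalₐ_jetsMap_of_eq _ n x y hy.symm,
    v.evalₐ_jetsMap_of_eq ψ n _ _ (v.evalₐ_jetsMap_of_eq φ n x y hy.symm), ← coeffMap_comp]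
  rfl

lemma jetsMap_of (φ : L →ₐ[K] L') (f : v.Coeff L) :
    v.jetsMap φ (algebraMap _ _ f) = algebraMap _ _ (v.coeffMap (φ.restrictScalars F) f) := by
  refine AdicCompletion.ext_evalₐ fun n => ?_
  rw [evalₐ_jetsMap]
  simp only [AlgHom.commutes]
  rfl

end Ideal

/-- The coordinate ring `A ⊗ K`. -/
abbrev B : Type u := v.Coeff K

section Frobenius

variable [Fintype F]

/-- The endomorphism `τ` of `A ⊗ L`, `a ⊗ l ↦ a ⊗ l ^ q`, where `q = #F`. -/
def tau (L : Type u) [Field L] [Algebra F L] : v.Coeff L →ₐ[v.A] v.Coeff L :=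
  v.coeffMap (FiniteField.frobeniusAlgHom F L)

end Frobenius

/-! ### The Tate algebra `ℂ_∞⟨A⟩` -/

/-- The Tate algebra `ℂ_∞⟨A⟩`. -/
def T : Type u := v.Tate v.Cinf 0

instance : NormedCommRing v.T := inferInstanceAs (NormedCommRing (v.Tate v.Cinf 0))
instance : CompleteSpace v.T := inferInstanceAs (CompleteSpace (v.Tate v.Cinf 0))

instance : Algebra v.B v.T :=
  ((v.toTate v.Cinf 0).comp
    (v.coeffMap (IsScalarTower.toAlgHom F K v.Cinf) : v.B →+* v.Coeff v.Cinf)).toAlgebra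
instance : Algebra v.A v.T := ((algebraMap v.B v.T).comp (algebraMap v.A v.B)).toAlgebra
instance : IsScalarTower v.A v.B v.T := IsScalarTower.of_algebraMap_eq fun _ => rfl

@[elab_as_elim]
lemma T_induction {p : v.T → Prop} (f : v.T) (hp : IsClosed {f | p f})
    (h : ∀ g, p (v.toTate v.Cinf 0 g)) : p f :=
  v.tate_induction f hp h

/-- The continuous extension of `τ` to `ℂ_∞⟨A⟩`. -/
def tauT [Fintype F] : v.T →+* v.T :=
  v.tateMap (FiniteField.frobeniusAlgHom F v.Cinf) (fun l hl => by
    simp only [FiniteField.coe_frobeniusAlgHom, norm_pow]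
    exact pow_le_of_le_one (norm_nonneg _) hl Fintype.card_ne_zero) (le_refl 0)

lemma continuous_tauT [Fintype F] : Continuous v.tauT := v.continuous_tateMap _ _ _

lemma tauT_algebraMap [Fintype F] (b : v.B) :
    v.tauT (algebraMap v.B v.T b) = algebraMap v.B v.T (v.tau K b) := by
  refine (v.tateMap_toTate _ _ _ _).trans (congrArg (v.toTate v.Cinf 0) ?_)
  refine (v.coeffMap_comp _ _ b).symm.trans (Eq.trans ?_ (v.coeffMap_comp _ _ b))
  have h : (FiniteField.frobeniusAlgHom F v.Cinf).comp (IsScalarTower.toAlgHom F K v.Cinf) =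
      (IsScalarTower.toAlgHom F K v.Cinf).comp (FiniteField.frobeniusAlgHom F K) :=
    AlgHom.ext fun x => by simp
  rw [h]

/-- The action of `G_∞` on `ℂ_∞⟨A⟩`, continuous, and trivial on `A`. -/
def galT (σ : v.Ginf) : v.T →+* v.T :=
  v.tateMap ((v.galoisCinfAlg σ).restrictScalars F)
    (fun l _ => (v.norm_galoisCinf σ l).le) (le_refl 0)

lemma continuous_galT (σ : v.Ginf) : Continuous (v.galT σ) := v.continuous_tateMap _ _ _

lemma galT_algebraMap (σ : v.Ginf) (b : v.B) :
    v.galT σ (algebraMap v.B v.T b) = algebraMap v.B v.T b := by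
  refine (v.tateMap_toTate _ _ _ _).trans (congrArg (v.toTate v.Cinf 0) ?_)
  refine (v.coeffMap_comp _ _ b).symm.trans ?_
  have h : ((v.galoisCinfAlg σ).restrictScalars F).comp (IsScalarTower.toAlgHom F K v.Cinf) =
      IsScalarTower.toAlgHom F K v.Cinf :=
    AlgHom.ext fun x => (v.galoisCinfAlg σ).commutes x
  rw [h]
  rfl

/-- The action of `σ ∈ G_∞` on `ℂ_∞⟨A⟩` as a map of `A ⊗ K`-algebras. -/
def galTAlg (σ : v.Ginf) : v.T →ₐ[v.B] v.T := { v.galT σ with commutes' := v.galT_algebraMap σ }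

lemma galT_tauT [Fintype F] (σ : v.Ginf) (t : v.T) : v.galT σ (v.tauT t) = v.tauT (v.galT σ t) := by
  refine v.T_induction t (isClosed_eq ((v.continuous_galT σ).comp v.continuous_tauT)
    (v.continuous_tauT.comp (v.continuous_galT σ))) fun f => ?_
  · have h1 : v.galT σ (v.tauT (v.toTate v.Cinf 0 f)) = v.toTate v.Cinf 0
        (v.coeffMap ((v.galoisCinfAlg σ).restrictScalars F)
          (v.coeffMap (FiniteField.frobeniusAlgHom F v.Cinf) f)) :=
      (congrArg (v.galT σ) (v.tateMap_toTate _ _ _ f)).trans (v.tateMap_toTate _ _ _ _)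
    have h2 : v.tauT (v.galT σ (v.toTate v.Cinf 0 f)) = v.toTate v.Cinf 0
        (v.coeffMap (FiniteField.frobeniusAlgHom F v.Cinf)
          (v.coeffMap ((v.galoisCinfAlg σ).restrictScalars F) f)) :=
      (congrArg v.tauT (v.tateMap_toTate _ _ _ f)).trans (v.tateMap_toTate _ _ _ _)
    refine h1.trans (Eq.trans (congrArg _ ?_) h2.symm)
    rw [← coeffMap_comp, ← coeffMap_comp]
    have h : ((v.galoisCinfAlg σ).restrictScalars F).comp (FiniteField.frobeniusAlgHom F v.Cinf) =
        (FiniteField.frobeniusAlgHom F v.Cinf).comp ((v.galoisCinfAlg σ).restrictScalars F) :=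
      AlgHom.ext fun x => by simp
    rw [h]

lemma Cinf_dense {f g : v.Cinf → v.Cinf} (hf : Continuous f) (hg : Continuous g)
    (h : ∀ y, f (v.toCinf y) = g (v.toCinf y)) (x : v.Cinf) : f x = g x :=
  have h1 : DenseRange v.toCinf := UniformSpace.Completion.denseRange_coe
  congrFun (h1.equalizer hf hg (funext h)) x

lemma continuous_galoisCinf (σ : v.Ginf) : Continuous (v.galoisCinf σ) :=
  UniformSpace.Completion.continuous_map

lemma galoisCinf_one (x : v.Cinf) : v.galoisCinf 1 x = x :=
  v.Cinf_dense (v.continuous_galoisCinf 1) continuous_id (fun y => v.galoisCinf_coe 1 y) x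

lemma galoisCinf_mul (σ σ' : v.Ginf) (x : v.Cinf) :
    v.galoisCinf (σ * σ') x = v.galoisCinf σ (v.galoisCinf σ' x) :=
  v.Cinf_dense (v.continuous_galoisCinf _)
    ((v.continuous_galoisCinf σ).comp (v.continuous_galoisCinf σ'))
    (fun y => (v.galoisCinf_coe (σ * σ') y).trans
      ((congrArg (v.galoisCinf σ) (v.galoisCinf_coe σ' y)).trans (v.galoisCinf_coe σ _)).symm) x

lemma galT_one (t : v.T) : v.galT 1 t = t := by
  refine v.T_induction t (isClosed_eq (v.continuous_galT 1) continuous_id) fun f => ?_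
  refine (v.tateMap_toTate _ _ _ f).trans (congrArg _ ?_)
  refine Eq.trans ?_ (v.coeffMap_id f)
  have h : (v.galoisCinfAlg 1).restrictScalars F = AlgHom.id F v.Cinf :=
    AlgHom.ext fun x => v.galoisCinf_one x
  rw [h]

lemma galT_mul (σ σ' : v.Ginf) (t : v.T) : v.galT (σ * σ') t = v.galT σ (v.galT σ' t) := by
  refine v.T_induction t (isClosed_eq (v.continuous_galT _)
    ((v.continuous_galT σ).comp (v.continuous_galT σ'))) fun f => ?_
  have h2 : v.galT σ (v.galT σ' (v.toTate v.Cinf 0 f)) = v.toTate v.Cinf 0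
      (v.coeffMap ((v.galoisCinfAlg σ).restrictScalars F)
        (v.coeffMap ((v.galoisCinfAlg σ').restrictScalars F) f)) :=
    (congrArg (v.galT σ) (v.tateMap_toTate _ _ _ f)).trans (v.tateMap_toTate _ _ _ _)
  refine (v.tateMap_toTate _ _ _ f).trans (Eq.trans (congrArg _ ?_) h2.symm)
  rw [← coeffMap_comp]
  have h : (v.galoisCinfAlg (σ * σ')).restrictScalars F =
      ((v.galoisCinfAlg σ).restrictScalars F).comp ((v.galoisCinfAlg σ').restrictScalars F) :=
    AlgHom.ext fun x => v.galoisCinf_mul σ σ' x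
  rw [h]

/-! ### Entire functions and their expansions at `𝔧` -/

section Entire

/-- The ring `L⟨⟨A⟩⟩ = lim_s L⟨A⟩_{ρ₀ ^ s}` of global functions on the rigid analytic space attached
to `Spec (A ⊗ L)`. -/
def Entire (L : Type u) [NormedField L] [Algebra F L] : Subring (∀ s, v.Tate L s) where
  carrier := {f | ∀ s : ℕ, v.tateMap (AlgHom.id F L) (fun _ _ => le_rfl) (Nat.le_succ s) (f (s + 1)) =
    f s}
  mul_mem' hf hg s := by simp only [Pi.mul_apply, map_mul, hf s, hg s]
  one_mem' s := by simp only [Pi.one_apply, map_one]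
  add_mem' hf hg s := by simp only [Pi.add_apply, map_add, hf s, hg s]
  zero_mem' s := by simp only [Pi.zero_apply, map_zero]
  neg_mem' hf s := by simp only [Pi.neg_apply, map_neg, hf s]

/-- The inclusion of `A ⊗ L` in the ring of entire functions. -/
def toEntire (L : Type u) [NormedField L] [Algebra F L] : v.Coeff L →+* v.Entire L :=
  (RingHom.pi fun s => v.toTate L s).codRestrict (v.Entire L) fun f _ =>
    (v.tateMap_toTate _ _ _ f).trans (congrArg _ (v.coeffMap_id f))

/-- The restriction of entire functions to the closed unit disc, followed by the inclusion of
`L⟨A⟩` in `ℂ_∞⟨A⟩`, for a finite extension `L` of `K_∞` in `K_∞^s`. -/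
def entireToT (L : IntermediateField v.Kinf v.Ks) : v.Entire L →+* v.T :=
  (v.tateMap (v.toCinfAlg.comp (L.val.restrictScalars F))
      (fun l _ => (v.norm_toCinf (l : v.Ks)).le) (le_refl 0)).comp
    ((Pi.evalRingHom _ 0).comp (v.Entire L).subtype)

/-- The formal series `g ∈ L[[𝔧]]` is the expansion of the entire function `f` at the point `𝔧`:
modulo each power of `𝔧`, both are congruent to the same element of `A ⊗ L`. -/
def IsExpansion {L : Type u} [NormedField L] [Algebra F L] [Algebra K L] [IsScalarTower F K L]
    (f : v.Entire L) (g : v.Jets L) : Prop :=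
  ∀ n, ∃ b : v.Coeff L, f - v.toEntire L b ∈ (v.jIdeal L ^ n).map (v.toEntire L) ∧
    AdicCompletion.evalₐ (v.jIdeal L) n g = Ideal.Quotient.mk _ b

end Entire

/-! ### The field `K_∞^s((𝔧))` -/

section Laurent

/-- The action of `σ ∈ G_∞` on `K_∞^s` as a map of `K`-algebras. -/
def galKs (σ : v.Ginf) : v.Ks →ₐ[K] v.Ks := (σ : v.Ks →ₐ[v.Kinf] v.Ks).restrictScalars K

/-- The ring `K_∞^s[[𝔧]]`. -/
def O : Type u := v.Jets v.Ks

instance : CommRing v.O := inferInstanceAs (CommRing (v.Jets v.Ks))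

/-- The canonical map `A ⊗ K_∞^s → K_∞^s[[𝔧]]`. -/
def toO : v.Coeff v.Ks →+* v.O := algebraMap (v.Coeff v.Ks) (v.Jets v.Ks)

instance : Algebra v.B v.O :=
  (v.toO.comp (v.coeffMap (IsScalarTower.toAlgHom F K v.Ks) : v.B →+* v.Coeff v.Ks)).toAlgebra
instance : Algebra v.A v.O := ((algebraMap v.B v.O).comp (algebraMap v.A v.B)).toAlgebra
instance : IsScalarTower v.A v.B v.O := IsScalarTower.of_algebraMap_eq fun _ => rfl

/-- The action of `G_∞` on `K_∞^s[[𝔧]]` by functoriality. -/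
instance : MulSemiringAction v.Ginf v.O where
  smul σ x := v.jetsMap (v.galKs σ) x
  one_smul x := v.jetsMap_id x
  mul_smul σ σ' x := v.jetsMap_comp (v.galKs σ) (v.galKs σ') x
  smul_zero σ := map_zero (v.jetsMap (v.galKs σ))
  smul_add σ := map_add (v.jetsMap (v.galKs σ))
  smul_one σ := map_one (v.jetsMap (v.galKs σ))
  smul_mul σ := map_mul (v.jetsMap (v.galKs σ))

/-- The ring homomorphism `ν : K_∞ → K_∞^s[[𝔧]]` which extends `A → K_∞^s[[𝔧]]`, `a ↦ a ⊗ 1`, and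
coincides modulo `𝔧` with the inclusion of `K_∞` in `K_∞^s`. -/
structure IsNu (ν : v.Kinf →+* v.O) : Prop where
  map_A : ∀ a : v.A, ν (algebraMap v.A v.Kinf a) = v.toO (v.tens a 1)
  residue : ∀ x : v.Kinf, AdicCompletion.evalₐ (v.jIdeal v.Ks) 1 (ν x) =
    Ideal.Quotient.mk _ (v.tens 1 (algebraMap v.Kinf v.Ks x))

/-- A homomorphism `ν` as above; its image is fixed by `G_∞`. -/
structure Nu where
  toRingHom : v.Kinf →+* v.O
  isNu : v.IsNu toRingHom
  smul_eq : ∀ (σ : v.Ginf) (x : v.Kinf), σ • toRingHom x = toRingHom x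

variable {v}

/-- The field `K_∞^s((𝔧))`, a `K_∞`-algebra through `ν` and an `A ⊗ K`-algebra through the canonical
map. -/
def Laurent (_ν : v.Nu) : Type u := FractionRing v.O

variable (ν : v.Nu)

instance : CommRing (Laurent ν) := inferInstanceAs (CommRing (FractionRing v.O))
instance : Algebra v.O (Laurent ν) := inferInstanceAs (Algebra v.O (FractionRing v.O))
instance : IsFractionRing v.O (Laurent ν) :=
  inferInstanceAs (IsFractionRing v.O (FractionRing v.O))
instance : Algebra v.B (Laurent ν) :=
  ((algebraMap v.O (Laurent ν)).comp (algebraMap v.B v.O)).toAlgebra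
instance : IsScalarTower v.B v.O (Laurent ν) := IsScalarTower.of_algebraMap_eq fun _ => rfl
instance : Algebra v.A (Laurent ν) :=
  ((algebraMap v.B (Laurent ν)).comp (algebraMap v.A v.B)).toAlgebra
instance : IsScalarTower v.A v.B (Laurent ν) := IsScalarTower.of_algebraMap_eq fun _ => rfl
instance : Algebra v.Kinf (Laurent ν) :=
  ((algebraMap v.O (Laurent ν)).comp ν.toRingHom).toAlgebra
instance : IsScalarTower v.A v.Kinf (Laurent ν) := IsScalarTower.of_algebraMap_eq fun a => by
  have h : algebraMap v.A v.O a = v.toO (v.tens a 1) := by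
    change v.toO (v.coeffMap (IsScalarTower.toAlgHom F K v.Ks) (algebraMap v.A v.B a)) = _
    rw [AlgHom.commutes]; rfl
  exact congrArg (algebraMap v.O (Laurent ν)) (h.trans (ν.isNu.map_A a).symm)

/-- The action of `G_∞` on `K_∞^s((𝔧))`. -/
instance : MulSemiringAction v.Ginf (Laurent ν) :=
  MulSemiringAction.compHom (Laurent ν)
    ((IsFractionRing.ringEquivOfRingEquivHom v.O (Laurent ν)).comp
      (MulSemiringAction.toRingEquiv v.Ginf v.O))

lemma smul_algebraMap_Laurent (σ : v.Ginf) (x : v.O) :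
    σ • algebraMap v.O (Laurent ν) x = algebraMap v.O (Laurent ν) (σ • x) :=
  IsFractionRing.ringEquivOfRingEquiv_algebraMap _ x

instance : SMulCommClass v.Ginf v.Kinf (Laurent ν) where
  smul_comm σ x y := by
    rw [Algebra.smul_def, smul_mul', Algebra.smul_def]
    congr 1
    exact (smul_algebraMap_Laurent ν σ _).trans (congrArg _ (ν.smul_eq σ x))

variable (v) in
/-- The map `L[[𝔧]] → K_∞^s((𝔧))`, for `L ⊆ K_∞^s`. -/
def jetsToLaurent (L : IntermediateField v.Kinf v.Ks) : v.Jets L →+* Laurent ν :=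
  (algebraMap v.O (Laurent ν)).comp (v.jetsMap (L.val.restrictScalars K) : v.Jets L →+* v.Jets v.Ks)

end Laurent

/-! ### `A`-motives -/

/-- The ring of functions on the complement of `V(𝔧)` in `Spec (A ⊗ K)`: the elements `x` of the
total ring of fractions with `𝔧 ^ n x ⊆ A ⊗ K` for some `n`. -/
def JInvSub : Subalgebra v.B (FractionRing v.B) where
  carrier := {x | ∃ n, ∀ y ∈ v.jIdeal K ^ n, ∃ b : v.B, y • x = algebraMap v.B (FractionRing v.B) b}
  algebraMap_mem' b := ⟨0, fun y _ => ⟨y * b, by rw [map_mul, Algebra.smul_def]⟩⟩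
  add_mem' := by
    rintro x x' ⟨n, hx⟩ ⟨n', hx'⟩
    refine ⟨n + n', fun y hy => ?_⟩
    obtain ⟨b, hb⟩ := hx y (Ideal.pow_le_pow_right (Nat.le_add_right n n') hy)
    obtain ⟨b', hb'⟩ := hx' y (Ideal.pow_le_pow_right (Nat.le_add_left n' n) hy)
    exact ⟨b + b', by rw [smul_add, hb, hb', map_add]⟩
  mul_mem' := by
    rintro x x' ⟨n, hx⟩ ⟨n', hx'⟩
    refine ⟨n + n', fun y hy => ?_⟩
    rw [pow_add] at hy
    induction hy using Submodule.mul_induction_on' with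
    | mem_mul_mem y hy y' hy' =>
      obtain ⟨b, hb⟩ := hx y hy
      obtain ⟨b', hb'⟩ := hx' y' hy'
      exact ⟨b * b', by rw [map_mul, ← hb, ← hb', smul_mul_smul_comm]⟩
    | add y _ y' _ hy hy' =>
      obtain ⟨b, hb⟩ := hy
      obtain ⟨b', hb'⟩ := hy'
      exact ⟨b + b', by rw [add_smul, hb, hb', map_add]⟩

/-- The ring of functions on the complement of `V(𝔧)`, as a type. -/
def JInv : Type u := v.JInvSub

instance : CommRing v.JInv := inferInstanceAs (CommRing v.JInvSub)
instance : Algebra v.B v.JInv := inferInstanceAs (Algebra v.B v.JInvSub)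

variable [Fintype F]

/-- The same ring, viewed as an `A ⊗ K`-algebra through `τ`. For an `A ⊗ K`-module `M`, the module
`JTau ⊗ M` is the restriction of `τ^* M` to the complement of `V(𝔧)`. -/
def JTau : Type u := v.JInv

instance : CommRing v.JTau := inferInstanceAs (CommRing v.JInv)
instance : Algebra v.B v.JTau :=
  ((algebraMap v.B v.JInv).comp (v.tau K : v.B →+* v.B)).toAlgebra
instance : Algebra v.JInv v.JTau := Algebra.id v.JInv
instance : SMulCommClass v.B v.JInv v.JTau :=
  ⟨fun b x y => by simp only [Algebra.smul_def]; exact mul_left_comm _ _ _⟩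

/-- An `A`-motive over `K`: a finite locally free `A ⊗ K`-module `M` with an isomorphism `τ_M` from
`τ^* M` to `M` outside of `V(𝔧)`. -/
structure AMotive where
  carrier : Type u
  [addCommGroup : AddCommGroup carrier]
  [module : Module v.B carrier]
  [finite : Module.Finite v.B carrier]
  [projective : Module.Projective v.B carrier]
  tauM : (v.JTau ⊗[v.B] carrier) ≃ₗ[v.JInv] (v.JInv ⊗[v.B] carrier)

namespace AMotive

attribute [instance] addCommGroup module finite projective

variable {v}

/-- A morphism of `A`-motives: a linear map `f` with `f ∘ τ_M = τ_N ∘ τ^* f`. -/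
@[ext]
structure Hom (M N : v.AMotive) where
  toLin : M.carrier →ₗ[v.B] N.carrier
  comm : ∀ x, toLin.lTensor v.JInv (M.tauM x) = N.tauM (toLin.lTensor v.JTau x)

instance : Category v.AMotive where
  Hom M N := Hom M N
  id M := ⟨LinearMap.id, fun x => by simp⟩
  comp f g := ⟨g.toLin ∘ₗ f.toLin, fun x => by
    rw [LinearMap.lTensor_comp_apply, LinearMap.lTensor_comp_apply, f.comm, g.comm]⟩

lemma id_toLin (M : v.AMotive) : Hom.toLin (𝟙 M) = LinearMap.id := rfl
lemma comp_toLin {M N P : v.AMotive} (f : M ⟶ N) (g : N ⟶ P) :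
    Hom.toLin (f ≫ g) = g.toLin ∘ₗ f.toLin := rfl

variable {M N : v.AMotive}

instance : Zero (M ⟶ N) := ⟨⟨0, fun x => by simp⟩⟩
instance : Add (M ⟶ N) := ⟨fun f g => ⟨f.toLin + g.toLin, fun x => by
  simp only [LinearMap.lTensor_add, LinearMap.add_apply, f.comm, g.comm, map_add]⟩⟩
instance : Neg (M ⟶ N) := ⟨fun f => ⟨-f.toLin, fun x => by
  simp only [LinearMap.lTensor_neg, LinearMap.neg_apply, f.comm, map_neg]⟩⟩
instance : Sub (M ⟶ N) := ⟨fun f g => ⟨f.toLin - g.toLin, fun x => by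
  simp only [LinearMap.lTensor_sub, LinearMap.sub_apply, f.comm, g.comm, map_sub]⟩⟩
lemma nsmul_comm (f : M ⟶ N) (n : ℕ) (x : v.JTau ⊗[v.B] M.carrier) :
    (n • f.toLin).lTensor v.JInv (M.tauM x) = N.tauM ((n • f.toLin).lTensor v.JTau x) := by
  induction n with
  | zero => simp
  | succ n ih =>
    simp only [add_smul, one_smul, LinearMap.lTensor_add, LinearMap.add_apply, f.comm, map_add, ih]
instance : SMul ℕ (M ⟶ N) := ⟨fun n f => ⟨n • f.toLin, nsmul_comm f n⟩⟩
instance : SMul ℤ (M ⟶ N) := ⟨fun n f => ⟨n • f.toLin, fun x => by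
  cases n with
  | ofNat n =>
    rw [Int.ofNat_eq_natCast, natCast_zsmul]
    exact nsmul_comm f n x
  | negSucc n =>
    rw [negSucc_zsmul, LinearMap.lTensor_neg, LinearMap.lTensor_neg, LinearMap.neg_apply,
      LinearMap.neg_apply, map_neg, nsmul_comm]⟩⟩

lemma toLin_injective : Function.Injective (fun f : M ⟶ N => f.toLin) := fun _ _ h => Hom.ext h

instance : AddCommGroup (M ⟶ N) :=
  toLin_injective.addCommGroup _ rfl (fun _ _ => rfl) (fun _ => rfl) (fun _ _ => rfl)
    (fun _ _ => rfl) (fun _ _ => rfl)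

lemma add_toLin (f g : M ⟶ N) : Hom.toLin (f + g) = f.toLin + g.toLin := rfl

instance : Preadditive v.AMotive where
  add_comp _ _ _ f f' g := Hom.ext (LinearMap.comp_add _ _ _)
  comp_add _ _ _ f g g' := Hom.ext (LinearMap.add_comp _ _ _)

/-! ### The Betti realization -/

instance : SMulCommClass v.B v.A v.T :=
  ⟨fun b a t => by simp only [Algebra.smul_def]; exact mul_left_comm _ _ _⟩

variable (M)

/-- The map `T ⊗ M → T ⊗ M[𝔧⁻¹]`, where `T = ℂ_∞⟨A⟩`; it is bijective as `𝔧 T = T`. -/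
def inclT : v.T ⊗[v.B] M.carrier →ₗ[v.T] v.T ⊗[v.B] (v.JInv ⊗[v.B] M.carrier) :=
  (TensorProduct.mk v.B v.JInv M.carrier 1).baseChange v.T

/-- The `τ`-semilinear map `ω ↦ τ_M (τ^* ω)`, `t ⊗ m ↦ τ(t) ⊗ τ_M(1 ⊗ m)`. -/
def tauMT : v.T ⊗[v.B] M.carrier →+ v.T ⊗[v.B] (v.JInv ⊗[v.B] M.carrier) :=
  TensorProduct.liftAddHom
    { toFun := fun t =>
        { toFun := fun m => v.tauT t ⊗ₜ[v.B] M.tauM (1 ⊗ₜ[v.B] m)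
          map_zero' := by simp
          map_add' := fun m m' => by rw [TensorProduct.tmul_add, map_add, TensorProduct.tmul_add] }
      map_zero' := by ext m; simp
      map_add' := fun t t' => by ext m; simp [TensorProduct.add_tmul] }
    (fun b t m => by
      have h1 : v.tauT (b • t) = v.tau K b • v.tauT t := by
        rw [Algebra.smul_def, map_mul, tauT_algebraMap, ← Algebra.smul_def]
      have h2 : M.tauM ((1 : v.JTau) ⊗ₜ[v.B] (b • m)) =
          v.tau K b • M.tauM ((1 : v.JTau) ⊗ₜ[v.B] m) := by
        have h3 : (1 : v.JTau) ⊗ₜ[v.B] (b • m) =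
            (algebraMap v.B v.JInv (v.tau K b)) • ((1 : v.JTau) ⊗ₜ[v.B] m) := by
          rw [← TensorProduct.smul_tmul, TensorProduct.smul_tmul']
          congr 1
        rw [h3, map_smul, algebraMap_smul]
      change v.tauT (b • t) ⊗ₜ[v.B] M.tauM (1 ⊗ₜ[v.B] m) =
        v.tauT t ⊗ₜ[v.B] M.tauM (1 ⊗ₜ[v.B] (b • m))
      rw [h1, h2, TensorProduct.smul_tmul])

lemma tauMT_tmul (t : v.T) (m : M.carrier) :
    M.tauMT (t ⊗ₜ[v.B] m) = v.tauT t ⊗ₜ[v.B] M.tauM (1 ⊗ₜ[v.B] m) := rfl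

lemma inclT_tmul (t : v.T) (m : M.carrier) :
    M.inclT (t ⊗ₜ[v.B] m) = t ⊗ₜ[v.B] (1 ⊗ₜ[v.B] m) := rfl

lemma tauMT_smul (a : v.A) (x : v.T ⊗[v.B] M.carrier) : M.tauMT (a • x) = a • M.tauMT x := by
  induction x using TensorProduct.induction_on with
  | zero => simp
  | tmul t m =>
    have h : v.tauT (a • t) = a • v.tauT t := by
      rw [← algebraMap_smul v.B a t, Algebra.smul_def, map_mul, tauT_algebraMap, AlgHom.commutes,
        ← Algebra.smul_def, algebraMap_smul]
    rw [TensorProduct.smul_tmul', tauMT_tmul, tauMT_tmul, h, TensorProduct.smul_tmul']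
  | add x y hx hy => simp only [smul_add, map_add, hx, hy]

/-- The Betti realization `{ω ∈ T ⊗ M | ω = τ_M (τ^* ω)}`. -/
def betti : Submodule v.A (v.T ⊗[v.B] M.carrier) where
  carrier := {ω | M.inclT ω = M.tauMT ω}
  zero_mem' := by simp
  add_mem' {x y} hx hy := by
    change M.inclT (x + y) = M.tauMT (x + y)
    change M.inclT x = M.tauMT x at hx
    change M.inclT y = M.tauMT y at hy
    rw [map_add, map_add, hx, hy]
  smul_mem' a x hx := by
    change M.inclT (a • x) = M.tauMT (a • x)
    change M.inclT x = M.tauMT x at hx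
    rw [tauMT_smul, ← hx, ← algebraMap_smul v.T a x, map_smul, algebraMap_smul]

lemma mem_betti (ω : v.T ⊗[v.B] M.carrier) : ω ∈ M.betti ↔ M.inclT ω = M.tauMT ω := Iff.rfl

/-- The multiplication `T ⊗_A M_B → T ⊗ M`. -/
def bettiMul : v.T ⊗[v.A] M.betti →ₗ[v.T] v.T ⊗[v.B] M.carrier :=
  M.betti.subtype.liftBaseChange v.T

/-- `M` is rigid analytically trivial. -/
def IsRigidAnalyticallyTrivial : Prop := Function.Bijective M.bettiMul

variable {M}

/-- The map on Betti realizations induced by a morphism of `A`-motives. -/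
def bettiMap (f : M ⟶ N) : M.betti →ₗ[v.A] N.betti :=
  ((f.toLin.baseChange v.T).restrictScalars v.A).restrict fun x hx => by
    have h1 : ∀ y : v.T ⊗[v.B] M.carrier, N.inclT (f.toLin.baseChange v.T y) =
        (f.toLin.lTensor v.JInv).lTensor v.T (M.inclT y) := by
      intro y
      induction y using TensorProduct.induction_on with
      | zero => simp
      | tmul t m => rfl
      | add y z hy hz => simp only [map_add, hy, hz]
    have h2 : ∀ y : v.T ⊗[v.B] M.carrier, N.tauMT (f.toLin.baseChange v.T y) =
        (f.toLin.lTensor v.JInv).lTensor v.T (M.tauMT y) := by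
      intro y
      induction y using TensorProduct.induction_on with
      | zero => simp
      | tmul t m =>
        rw [LinearMap.baseChange_tmul, tauMT_tmul, tauMT_tmul, LinearMap.lTensor_tmul, f.comm,
          LinearMap.lTensor_tmul]
      | add y z hy hz => simp only [map_add, hy, hz]
    rw [mem_betti] at hx ⊢
    exact (h1 x).trans ((congrArg _ hx).trans (h2 x).symm)

lemma bettiMap_coe (f : M ⟶ N) (ω : M.betti) :
    (bettiMap f ω : v.T ⊗[v.B] N.carrier) = f.toLin.baseChange v.T ω := rfl

lemma bettiMap_id : bettiMap (𝟙 M) = LinearMap.id := by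
  ext ω
  rw [bettiMap_coe, id_toLin, LinearMap.baseChange_id]
  rfl

lemma bettiMap_comp {P : v.AMotive} (f : M ⟶ N) (g : N ⟶ P) :
    bettiMap (f ≫ g) = bettiMap g ∘ₗ bettiMap f := by
  ext ω
  rw [bettiMap_coe, comp_toLin, LinearMap.baseChange_comp]
  rfl

lemma bettiMap_add (f g : M ⟶ N) : bettiMap (f + g) = bettiMap f + bettiMap g := by
  ext ω
  rw [bettiMap_coe, add_toLin, LinearMap.baseChange_add]
  rfl

variable (M)

/-- The action of `σ ∈ G_∞` on `T ⊗ M`. -/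
def galTM (σ : v.Ginf) : v.T ⊗[v.B] M.carrier →ₗ[v.B] v.T ⊗[v.B] M.carrier :=
  (v.galTAlg σ).toLinearMap.rTensor M.carrier

lemma galTM_tmul (σ : v.Ginf) (t : v.T) (m : M.carrier) :
    M.galTM σ (t ⊗ₜ[v.B] m) = v.galT σ t ⊗ₜ[v.B] m := rfl

lemma galTM_mem (σ : v.Ginf) {x : v.T ⊗[v.B] M.carrier} (hx : x ∈ M.betti) :
    M.galTM σ x ∈ M.betti := by
  have h1 : ∀ y : v.T ⊗[v.B] M.carrier, M.inclT (M.galTM σ y) =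
      (v.galTAlg σ).toLinearMap.rTensor (v.JInv ⊗[v.B] M.carrier) (M.inclT y) := by
    intro y
    induction y using TensorProduct.induction_on with
    | zero => simp
    | tmul t m => rfl
    | add y z hy hz => simp only [map_add, hy, hz]
  have h2 : ∀ y : v.T ⊗[v.B] M.carrier, M.tauMT (M.galTM σ y) =
      (v.galTAlg σ).toLinearMap.rTensor (v.JInv ⊗[v.B] M.carrier) (M.tauMT y) := by
    intro y
    induction y using TensorProduct.induction_on with
    | zero => simp
    | tmul t m =>
      rw [galTM_tmul, tauMT_tmul, tauMT_tmul, ← galT_tauT, LinearMap.rTensor_tmul]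
      rfl
    | add y z hy hz => simp only [map_add, hy, hz]
  rw [mem_betti] at hx ⊢
  exact (h1 x).trans ((congrArg _ hx).trans (h2 x).symm)

/-- The action of `G_∞` on the Betti realization. -/
def bettiGal : v.Ginf →* Module.End v.A M.betti where
  toFun σ := ((M.galTM σ).restrictScalars v.A).restrict fun _ hx => M.galTM_mem σ hx
  map_one' := by
    ext ω
    have h : (v.galTAlg 1).toLinearMap = LinearMap.id := LinearMap.ext v.galT_one
    change (v.galTAlg 1).toLinearMap.rTensor M.carrier ω = ω
    rw [h, LinearMap.rTensor_id]
    rfl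
  map_mul' σ σ' := by
    ext ω
    have h : (v.galTAlg (σ * σ')).toLinearMap =
        (v.galTAlg σ).toLinearMap ∘ₗ (v.galTAlg σ').toLinearMap := LinearMap.ext (v.galT_mul σ σ')
    change (v.galTAlg (σ * σ')).toLinearMap.rTensor M.carrier ω = _
    rw [h, LinearMap.rTensor_comp]
    rfl

lemma bettiGal_coe (σ : v.Ginf) (ω : M.betti) :
    (M.bettiGal σ ω : v.T ⊗[v.B] M.carrier) = M.galTM σ ω := rfl

variable {M}

lemma bettiMap_bettiGal (f : M ⟶ N) (σ : v.Ginf) :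
    bettiMap f ∘ₗ M.bettiGal σ = N.bettiGal σ ∘ₗ bettiMap f := by
  ext ω
  change f.toLin.baseChange v.T (M.galTM σ ω) = N.galTM σ (f.toLin.baseChange v.T ω)
  generalize (ω : v.T ⊗[v.B] M.carrier) = y
  induction y using TensorProduct.induction_on with
  | zero => simp
  | tmul t m => rfl
  | add y z hy hz => simp only [map_add, hy, hz]

/-! ### Analytic continuation to `𝔧` -/

/-- `g` is the germ at the point `𝔧` of the meromorphic continuation of `ω ∈ ℂ_∞⟨A⟩ ⊗ M`: over a
finite extension `L` of `K_∞` in `K_∞^s`, there is a non-zero entire function `d` such that `d ω` is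
entire, that is, `d ω = ∑ fᵢ ⊗ mᵢ` with entire functions `fᵢ`, and `d g = ∑ fᵢ ⊗ mᵢ` holds with `d`
and `fᵢ` replaced by their expansions at `𝔧`. -/
def IsGerm (ν : v.Nu) (ω : v.T ⊗[v.B] M.carrier) (g : Laurent ν ⊗[v.B] M.carrier) : Prop :=
  ∃ (L : IntermediateField v.Kinf v.Ks) (_ : FiniteDimensional v.Kinf L)
    (d : v.Entire L) (d' : v.Jets L) (k : ℕ) (f : Fin k → v.Entire L) (f' : Fin k → v.Jets L)
    (m : Fin k → M.carrier),
    v.IsExpansion d d' ∧ d' ≠ 0 ∧ (∀ i, v.IsExpansion (f i) (f' i)) ∧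
    v.entireToT L d • ω = ∑ i, v.entireToT L (f i) ⊗ₜ[v.B] m i ∧
    v.jetsToLaurent ν L d' • g = ∑ i, v.jetsToLaurent ν L (f' i) ⊗ₜ[v.B] m i

end AMotive

end Place

/-! ### Exact categories -/

section ExactCategory

open Limits

/-- A class of composable pairs of morphisms. -/
abbrev SeqClass (C : Type*) [Category C] : Type _ :=
  ∀ ⦃X Y Z : C⦄, (X ⟶ Y) → (Y ⟶ Z) → Prop

variable {C D : Type*} [Category C] [Category D]

/-- The admissible monomorphisms of a class of sequences. -/
def SeqClass.Inflation (E : SeqClass C) {X Y : C} (f : X ⟶ Y) : Prop :=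
  ∃ (Z : C) (g : Y ⟶ Z), E f g

/-- The admissible epimorphisms of a class of sequences. -/
def SeqClass.Deflation (E : SeqClass C) {Y Z : C} (g : Y ⟶ Z) : Prop :=
  ∃ (X : C) (f : X ⟶ Y), E f g

/-- The class `E` of sequences `0 → X → Y → Z → 0` makes the additive category `C` an exact category
in the sense of Quillen. -/
structure IsExactCategory [Preadditive C] (E : SeqClass C) : Prop where
  hasFiniteBiproducts : HasFiniteBiproducts C
  iso_closed : ∀ ⦃X Y Z X' Y' Z' : C⦄ (f : X ⟶ Y) (g : Y ⟶ Z) (f' : X' ⟶ Y') (g' : Y' ⟶ Z')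
    (a : X ≅ X') (b : Y ≅ Y') (c : Z ≅ Z'), f ≫ b.hom = a.hom ≫ f' → g ≫ c.hom = b.hom ≫ g' →
    E f g → E f' g'
  kernel_cokernel : ∀ ⦃X Y Z : C⦄ (f : X ⟶ Y) (g : Y ⟶ Z), E f g → ∃ w : f ≫ g = 0,
    Nonempty (IsLimit (KernelFork.ofι f w)) ∧ Nonempty (IsColimit (CokernelCofork.ofπ g w))
  inflation_id : ∀ X : C, E.Inflation (𝟙 X)
  deflation_id : ∀ X : C, E.Deflation (𝟙 X)
  inflation_comp : ∀ ⦃X Y Z : C⦄ (f : X ⟶ Y) (g : Y ⟶ Z),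
    E.Inflation f → E.Inflation g → E.Inflation (f ≫ g)
  deflation_comp : ∀ ⦃X Y Z : C⦄ (f : X ⟶ Y) (g : Y ⟶ Z),
    E.Deflation f → E.Deflation g → E.Deflation (f ≫ g)
  pushout : ∀ ⦃X Y X' : C⦄ (f : X ⟶ Y) (h : X ⟶ X'), E.Inflation f →
    ∃ (Y' : C) (h' : Y ⟶ Y') (f' : X' ⟶ Y'), IsPushout f h h' f' ∧ E.Inflation f'
  pullback : ∀ ⦃Y Z Z' : C⦄ (g : Y ⟶ Z) (h : Z' ⟶ Z), E.Deflation g →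
    ∃ (Y' : C) (h' : Y' ⟶ Y) (g' : Y' ⟶ Z'), IsPullback h' g' g h ∧ E.Deflation g'

/-- An exact functor of exact categories: it is additive and preserves the exact sequences. -/
structure IsExactFunctor [Preadditive C] [Preadditive D] (E : SeqClass C) (E' : SeqClass D)
    (H : C ⥤ D) : Prop where
  additive : H.Additive
  map_exact : ∀ ⦃X Y Z : C⦄ (f : X ⟶ Y) (g : Y ⟶ Z), E f g → E' (H.map f) (H.map g)

end ExactCategory

/-! ### Hodge–Pink structures -/

section HodgePinkStructures

/-- A lattice in a vector space over the field of fractions `Q` of `O`: a finitely generated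
`O`-submodule which spans the vector space. -/
def IsLattice {O Q V : Type u} [CommRing O] [CommRing Q] [Algebra O Q] [AddCommGroup V] [Module Q V]
    [Module O V] (q : Submodule O V) : Prop :=
  q.FG ∧ Submodule.span Q (q : Set V) = ⊤

variable (R O Q : Type u) [CommRing R] [CommRing O] [CommRing Q] [Algebra R Q] [Algebra O Q]
  [SMulCommClass R O Q]

/-- A Hodge–Pink structure with coefficient ring `R`: a finitely generated `R`-module `H` with an
`O`-lattice in `Q ⊗ H`, where `O = L[[𝔧]]`, `Q = L((𝔧))`, and `Q` is an `R`-algebra through `ν`. -/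
structure HPk where
  carrier : Type u
  [addCommGroup : AddCommGroup carrier]
  [module : Module R carrier]
  [finite : Module.Finite R carrier]
  lattice : Submodule O (Q ⊗[R] carrier)
  isLattice : IsLattice (Q := Q) lattice

namespace HPk

attribute [instance] addCommGroup module finite

variable {R O Q}

/-- A morphism of Hodge–Pink structures: an `R`-linear map which preserves the lattices. -/
@[ext]
structure Hom (H H' : HPk R O Q) where
  toLin : H.carrier →ₗ[R] H'.carrier
  map_mem : ∀ x ∈ H.lattice, toLin.baseChange Q x ∈ H'.lattice

instance : Category (HPk R O Q) where
  Hom H H' := Hom H H'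
  id H := ⟨LinearMap.id, fun x hx => by rwa [LinearMap.baseChange_id]⟩
  comp f g := ⟨g.toLin ∘ₗ f.toLin, fun x hx => by
    rw [LinearMap.baseChange_comp]
    exact g.map_mem _ (f.map_mem x hx)⟩

variable {H H' H'' : HPk R O Q}

lemma id_toLin (H : HPk R O Q) : Hom.toLin (𝟙 H) = LinearMap.id := rfl
lemma comp_toLin (f : H ⟶ H') (g : H' ⟶ H'') : Hom.toLin (f ≫ g) = g.toLin ∘ₗ f.toLin := rfl

lemma nsmul_map_mem (f : H ⟶ H') (n : ℕ) (x : Q ⊗[R] H.carrier) (hx : x ∈ H.lattice) :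
    (n • f.toLin).baseChange Q x ∈ H'.lattice := by
  induction n with
  | zero => rw [zero_smul, LinearMap.baseChange_zero]; exact zero_mem _
  | succ n ih =>
    rw [add_smul, one_smul, LinearMap.baseChange_add]
    exact add_mem ih (f.map_mem x hx)

instance : Zero (H ⟶ H') := ⟨⟨0, fun x _ => by
  rw [LinearMap.baseChange_zero]; exact zero_mem _⟩⟩
instance : Add (H ⟶ H') := ⟨fun f g => ⟨f.toLin + g.toLin, fun x hx => by
  rw [LinearMap.baseChange_add]; exact add_mem (f.map_mem x hx) (g.map_mem x hx)⟩⟩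
instance : Neg (H ⟶ H') := ⟨fun f => ⟨-f.toLin, fun x hx => by
  rw [LinearMap.baseChange_neg]; exact neg_mem (f.map_mem x hx)⟩⟩
instance : Sub (H ⟶ H') := ⟨fun f g => ⟨f.toLin - g.toLin, fun x hx => by
  rw [LinearMap.baseChange_sub]; exact sub_mem (f.map_mem x hx) (g.map_mem x hx)⟩⟩
instance : SMul ℕ (H ⟶ H') := ⟨fun n f => ⟨n • f.toLin, nsmul_map_mem f n⟩⟩
instance : SMul ℤ (H ⟶ H') := ⟨fun n f => ⟨n • f.toLin, fun x hx => by
  cases n with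
  | ofNat n =>
    rw [Int.ofNat_eq_natCast, natCast_zsmul]
    exact nsmul_map_mem f n x hx
  | negSucc n =>
    rw [negSucc_zsmul, LinearMap.baseChange_neg]
    exact neg_mem (nsmul_map_mem f (n + 1) x hx)⟩⟩

lemma toLin_injective : Function.Injective (fun f : H ⟶ H' => f.toLin) := fun _ _ h => Hom.ext h

instance : AddCommGroup (H ⟶ H') :=
  toLin_injective.addCommGroup _ rfl (fun _ _ => rfl) (fun _ => rfl) (fun _ _ => rfl)
    (fun _ _ => rfl) (fun _ _ => rfl)

lemma add_toLin (f g : H ⟶ H') : Hom.toLin (f + g) = f.toLin + g.toLin := rfl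

instance : Preadditive (HPk R O Q) where
  add_comp _ _ _ f f' g := Hom.ext (LinearMap.comp_add _ _ _)
  comp_add _ _ _ f g g' := Hom.ext (LinearMap.add_comp _ _ _)

/-- Strict morphisms: `f (𝔮) = 𝔮' ∩ im f`. -/
def IsStrict (f : H ⟶ H') : Prop :=
  f.toLin.baseChange Q '' (H.lattice : Set (Q ⊗[R] H.carrier)) =
    (H'.lattice : Set (Q ⊗[R] H'.carrier)) ∩ Set.range (f.toLin.baseChange Q)

variable (R O Q) in
/-- The strict exact sequences `0 → H → H' → H'' → 0`. -/
def strictExact : SeqClass (HPk R O Q) := fun _ _ _ f g =>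
  (Function.Injective f.toLin ∧ Function.Exact f.toLin g.toLin ∧ Function.Surjective g.toLin) ∧
    IsStrict f ∧ IsStrict g

end HPk

variable (G : Type u) [Group G] [TopologicalSpace G] [MulSemiringAction G Q] [SMulCommClass G R Q]

/-- A Hodge–Pink structure with an infinite Frobenius: a continuous `R`-linear representation of `G`
on `H` (with the discrete topology) such that the lattice is preserved by `σ ⊗ frob σ`. -/
structure HPkFrob extends HPk R O Q where
  frob : G →* Module.End R carrier
  continuous_frob : ∀ h, IsLocallyConstant fun σ => frob σ h
  frob_mem : ∀ (σ : G), ∀ x ∈ lattice,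
    TensorProduct.map (DistribSMul.toLinearMap R Q σ) (frob σ) x ∈ lattice

namespace HPkFrob

variable {R O Q G}

/-- A morphism of Hodge–Pink structures which commutes with the infinite Frobenii. -/
@[ext]
structure Hom (H H' : HPkFrob R O Q G) where
  toHom : H.toHPk ⟶ H'.toHPk
  comm : ∀ σ, toHom.toLin ∘ₗ H.frob σ = H'.frob σ ∘ₗ toHom.toLin

instance : Category (HPkFrob R O Q G) where
  Hom H H' := Hom H H'
  id H := ⟨𝟙 H.toHPk, fun _ => rfl⟩
  comp f g := ⟨f.toHom ≫ g.toHom, fun σ => by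
    rw [HPk.comp_toLin, LinearMap.comp_assoc, f.comm, ← LinearMap.comp_assoc, g.comm,
      LinearMap.comp_assoc]⟩

variable {H H' H'' : HPkFrob R O Q G}

instance : Zero (H ⟶ H') := ⟨⟨0, fun σ => by
  change 0 ∘ₗ _ = _ ∘ₗ 0; rw [LinearMap.zero_comp, LinearMap.comp_zero]⟩⟩
instance : Add (H ⟶ H') := ⟨fun f g => ⟨f.toHom + g.toHom, fun σ => by
  change (f.toHom.toLin + g.toHom.toLin) ∘ₗ _ = _ ∘ₗ (f.toHom.toLin + g.toHom.toLin)
  rw [LinearMap.add_comp, LinearMap.comp_add, f.comm, g.comm]⟩⟩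
instance : Neg (H ⟶ H') := ⟨fun f => ⟨-f.toHom, fun σ => by
  change (-f.toHom.toLin) ∘ₗ _ = _ ∘ₗ (-f.toHom.toLin)
  rw [LinearMap.neg_comp, LinearMap.comp_neg, f.comm]⟩⟩
instance : Sub (H ⟶ H') := ⟨fun f g => ⟨f.toHom - g.toHom, fun σ => by
  change (f.toHom.toLin - g.toHom.toLin) ∘ₗ _ = _ ∘ₗ (f.toHom.toLin - g.toHom.toLin)
  rw [LinearMap.sub_comp, LinearMap.comp_sub, f.comm, g.comm]⟩⟩
instance : SMul ℕ (H ⟶ H') := ⟨fun n f => ⟨n • f.toHom, fun σ => by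
  change (n • f.toHom.toLin) ∘ₗ _ = _ ∘ₗ (n • f.toHom.toLin)
  ext x
  have h := LinearMap.congr_fun (f.comm σ) x
  simp only [LinearMap.comp_apply, LinearMap.smul_apply, map_nsmul] at h ⊢
  rw [h]⟩⟩
instance : SMul ℤ (H ⟶ H') := ⟨fun n f => ⟨n • f.toHom, fun σ => by
  change (n • f.toHom.toLin) ∘ₗ _ = _ ∘ₗ (n • f.toHom.toLin)
  ext x
  have h := LinearMap.congr_fun (f.comm σ) x
  simp only [LinearMap.comp_apply, LinearMap.smul_apply, map_zsmul] at h ⊢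
  rw [h]⟩⟩

lemma toHom_injective : Function.Injective (fun f : H ⟶ H' => f.toHom) := fun _ _ h => Hom.ext h

instance : AddCommGroup (H ⟶ H') :=
  toHom_injective.addCommGroup _ rfl (fun _ _ => rfl) (fun _ => rfl) (fun _ _ => rfl)
    (fun _ _ => rfl) (fun _ _ => rfl)

instance : Preadditive (HPkFrob R O Q G) where
  add_comp _ _ _ _ _ _ := Hom.ext (Preadditive.add_comp _ _ _ _ _ _)
  comp_add _ _ _ _ _ _ := Hom.ext (Preadditive.comp_add _ _ _ _ _ _)

variable (R O Q G) in
/-- The sequences whose underlying sequence of Hodge–Pink structures is strict exact. -/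
def strictExact : SeqClass (HPkFrob R O Q G) := fun _ _ _ f g =>
  HPk.strictExact R O Q f.toHom g.toHom

end HPkFrob

end HodgePinkStructures

/-! ### The Hodge–Pink realization -/

namespace Place

variable {F K : Type u} [Field F] [Fintype F] [Field K] [Algebra F K] (v : Place F K)

/-- The category of rigid analytically trivial `A`-motives over `K`. -/
abbrev AMotRat : Type (u + 1) :=
  ObjectProperty.FullSubcategory fun M : v.AMotive => M.IsRigidAnalyticallyTrivial

/-- The sequences of `A`-motives whose underlying sequence `0 → M' → M → M'' → 0` of modules is
exact. -/
def AMotRat.exact : SeqClass v.AMotRat := fun _ _ _ f g =>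
  Function.Injective f.hom.toLin ∧ Function.Exact f.hom.toLin g.hom.toLin ∧
    Function.Surjective g.hom.toLin

variable {v}

/-- The `A`-linear map which sends an element of the Betti realization to the germ at `𝔧` of its
meromorphic continuation. -/
structure GermMap (ν : v.Nu) (M : v.AMotive) where
  toLin : M.betti →ₗ[v.A] Laurent ν ⊗[v.B] M.carrier
  isGerm : ∀ ω : M.betti, AMotive.IsGerm ν (ω : v.T ⊗[v.B] M.carrier) (toLin ω)

namespace GermMap

variable {ν : v.Nu} {M : v.AMotive} (g : GermMap ν M)

/-- The map `γ_M : K_∞^s((𝔧)) ⊗_A M_B → K_∞^s((𝔧)) ⊗ M`. -/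
def gamma : Laurent ν ⊗[v.A] M.betti →ₗ[Laurent ν] Laurent ν ⊗[v.B] M.carrier :=
  g.toLin.liftBaseChange (Laurent ν)

variable (R : Subalgebra v.A v.Kinf)

/-- The map `γ_M` after the identification of `K_∞^s((𝔧)) ⊗_R (R ⊗_A M_B)` with
`K_∞^s((𝔧)) ⊗_A M_B`. -/
def gammaR : Laurent ν ⊗[R] (R ⊗[v.A] M.betti) →ₗ[Laurent ν] Laurent ν ⊗[v.B] M.carrier :=
  g.gamma ∘ₗ (TensorProduct.AlgebraTensorModule.cancelBaseChange v.A R (Laurent ν) (Laurent ν)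
    M.betti).toLinearMap

/-- The Hodge–Pink lattice `γ_M⁻¹ (K_∞^s[[𝔧]] ⊗ M)`. -/
def lattice : Submodule v.O (Laurent ν ⊗[R] (R ⊗[v.A] M.betti)) :=
  Submodule.comap ((g.gammaR R).restrictScalars v.O)
    (LinearMap.range (TensorProduct.AlgebraTensorModule.map
      (Algebra.linearMap v.O (Laurent ν)) (LinearMap.id : M.carrier →ₗ[v.B] M.carrier)))

end GermMap

section Realization

variable {F K : Type u} [Field F] [Fintype F] [Field K] [Algebra F K] {v : Place F K} {ν : v.Nu}
  (γ : ∀ M : v.AMotRat, GermMap ν M.obj) (R : Subalgebra v.A v.Kinf)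

instance (R : Subalgebra v.A v.Kinf) (M : v.AMotive) : AddCommGroup (R ⊗[v.A] M.betti) :=
  TensorProduct.addCommGroup

/-- The map `R ⊗_A M_B → R ⊗_A N_B` induced by a morphism of `A`-motives. -/
def hodgePinkMap {M N : v.AMotRat} (f : M ⟶ N) :
    R ⊗[v.A] M.obj.betti →ₗ[R] R ⊗[v.A] N.obj.betti :=
  (AMotive.bettiMap f.hom).baseChange R

/-- The action of `G_∞` on `R ⊗_A M_B`, through its action on `M_B`. -/
def hodgePinkGal (M : v.AMotRat) : v.Ginf →* Module.End R (R ⊗[v.A] M.obj.betti) :=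
  (Module.End.baseChangeHom v.A R M.obj.betti : _ →* _).comp M.obj.bettiGal

/-- The Hodge–Pink realization `M ↦ (R ⊗_A M_B, γ_M⁻¹ (K_∞^s[[𝔧]] ⊗ M))` is well-defined: it has
values in Hodge–Pink structures, and the morphisms of `A`-motives induce morphisms of Hodge–Pink
structures. -/
structure HodgePinkWellDefined : Prop where
  finite : ∀ M : v.AMotRat, Module.Finite R (R ⊗[v.A] M.obj.betti)
  isLattice : ∀ M : v.AMotRat, IsLattice (Q := Laurent ν) ((γ M).lattice R)
  map_mem : ∀ ⦃M N : v.AMotRat⦄ (f : M ⟶ N), ∀ x ∈ (γ M).lattice R,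
    (hodgePinkMap R f).baseChange (Laurent ν) x ∈ (γ N).lattice R

/-- The action of `G_∞` on `M_B` defines an infinite Frobenius for the Hodge–Pink realization. -/
structure FrobWellDefined : Prop where
  continuous : ∀ (M : v.AMotRat) (h : R ⊗[v.A] M.obj.betti),
    IsLocallyConstant fun σ => hodgePinkGal R M σ h
  mem : ∀ (M : v.AMotRat) (σ : v.Ginf), ∀ x ∈ (γ M).lattice R,
    TensorProduct.map (DistribSMul.toLinearMap R (Laurent ν) σ) (hodgePinkGal R M σ) x ∈
      (γ M).lattice R

variable {γ R}

/-- The functor `H_R`. -/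
def hodgePink (h : HodgePinkWellDefined γ R) : v.AMotRat ⥤ HPk R v.O (Laurent ν) where
  obj M :=
    { carrier := R ⊗[v.A] M.obj.betti
      finite := h.finite M
      lattice := (γ M).lattice R
      isLattice := h.isLattice M }
  map f := ⟨hodgePinkMap R f, h.map_mem f⟩
  map_id M := HPk.Hom.ext (by
    change (AMotive.bettiMap (𝟙 M.obj)).baseChange R = LinearMap.id
    rw [AMotive.bettiMap_id, LinearMap.baseChange_id])
  map_comp f g := HPk.Hom.ext (by
    change (AMotive.bettiMap (f.hom ≫ g.hom)).baseChange R = _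
    rw [AMotive.bettiMap_comp, LinearMap.baseChange_comp]
    rfl)

/-- The functor `H_R^+`. -/
def hodgePinkFrob (h : HodgePinkWellDefined γ R) (h' : FrobWellDefined γ R) :
    v.AMotRat ⥤ HPkFrob R v.O (Laurent ν) v.Ginf where
  obj M :=
    { (hodgePink h).obj M with
      frob := hodgePinkGal R M
      continuous_frob := h'.continuous M
      frob_mem := h'.mem M }
  map {M N} f := ⟨(hodgePink h).map f, fun σ => by
    change (AMotive.bettiMap f.hom).baseChange R ∘ₗ (M.obj.bettiGal σ).baseChange R =
      (N.obj.bettiGal σ).baseChange R ∘ₗ (AMotive.bettiMap f.hom).baseChange R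
    rw [← LinearMap.baseChange_comp, AMotive.bettiMap_bettiGal, LinearMap.baseChange_comp]⟩
  map_id M := HPkFrob.Hom.ext ((hodgePink h).map_id M)
  map_comp f g := HPkFrob.Hom.ext ((hodgePink h).map_comp f g)

end Realization

end Place
end HodgePink

end

noncomputable section
namespace HodgePink

/-- `t` is a `p`-basis of the field `E` of characteristic `p`: `E = E ^ p [t]` and `t ∉ E ^ p`. -/
structure IsPBasis (p : ℕ) {E : Type*} [Field E] (t : E) : Prop where
  mem_closure : ∀ x : E, x ∈ Subring.closure (Set.range (fun y : E => y ^ p) ∪ {t})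
  pow_ne : ∀ y : E, y ^ p ≠ t

section PBasis

variable {E : Type*} [Field E] (p : ℕ) [hp : Fact p.Prime] [CharP E p]

/-- Elements of `Eᵖ[t]` are polynomials in `t` with coefficients in `Eᵖ`. -/
lemma exists_sum_of_mem_closure {t x : E}
    (hx : x ∈ Subring.closure (Set.range (fun y : E => y ^ p) ∪ {t})) :
    ∃ b : Fin p → E, x = ∑ i, b i ^ p * t ^ (i : ℕ) := by
  have hp0 : 0 < p := hp.out.pos
  -- the set of polynomials in `t`
  have key : ∃ f : Polynomial E, x = (f.map (frobenius E p)).eval t := by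
    induction hx using Subring.closure_induction with
    | mem x hx =>
      rcases hx with ⟨y, rfl⟩ | rfl
      · exact ⟨Polynomial.C y, by simp [frobenius_def]⟩
      · exact ⟨Polynomial.X, by simp⟩
    | zero => exact ⟨0, by simp⟩
    | one => exact ⟨1, by simp⟩
    | add x y _ _ hx hy =>
      obtain ⟨f, rfl⟩ := hx
      obtain ⟨g, rfl⟩ := hy
      exact ⟨f + g, by simp⟩
    | neg x _ hx =>
      obtain ⟨f, rfl⟩ := hx
      exact ⟨-f, by simp⟩
    | mul x y _ _ hx hy =>
      obtain ⟨f, rfl⟩ := hx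
      obtain ⟨g, rfl⟩ := hy
      exact ⟨f * g, by simp⟩
  obtain ⟨f, rfl⟩ := key
  have hm : (Polynomial.X ^ p - Polynomial.C t).Monic := Polynomial.monic_X_pow_sub_C t hp0.ne'
  set g := f %ₘ (Polynomial.X ^ p - Polynomial.C t) with hg
  have h1 : (f.map (frobenius E p)).eval t = (g.map (frobenius E p)).eval t := by
    conv_lhs => rw [← Polynomial.modByMonic_add_div f (Polynomial.X ^ p - Polynomial.C t)]
    simp [frobenius_def, hg]
  have h2 : g.natDegree < p := by
    have := Polynomial.natDegree_modByMonic_lt f hm (by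
      intro h
      have := congrArg Polynomial.natDegree h
      rw [Polynomial.natDegree_X_pow_sub_C, Polynomial.natDegree_one] at this
      omega)
    rwa [Polynomial.natDegree_X_pow_sub_C] at this
  refine ⟨fun i => g.coeff i, ?_⟩
  rw [h1, Polynomial.eval_eq_sum_range' ((Polynomial.natDegree_map_le).trans_lt h2),
    ← Fin.sum_univ_eq_sum_range (fun i => (Polynomial.map (frobenius E p) g).coeff i * t ^ i)]
  simp [frobenius_def]

/-- If `E = Eᵖ[t₀]`, then every `t ∉ Eᵖ` is a `p`-basis. -/
lemma isPBasis_of_mem_closure {t₀ t : E}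
    (h₀ : ∀ x : E, x ∈ Subring.closure (Set.range (fun y : E => y ^ p) ∪ {t₀}))
    (ht : ∀ y : E, y ^ p ≠ t) : IsPBasis p t := by
  refine ⟨fun x => ?_, ht⟩
  have hp0 : 0 < p := hp.out.pos
  let k : Subfield E := (frobenius E p).fieldRange
  have hk : ∀ y : E, y ^ p ∈ k := fun y => ⟨y, rfl⟩
  have halg : ∀ s : E, algebraMap k E ⟨s ^ p, hk s⟩ = s ^ p := fun _ => rfl
  have hint : ∀ s : E, IsIntegral k s := fun s =>
    ⟨Polynomial.X ^ p - Polynomial.C ⟨s ^ p, hk s⟩, Polynomial.monic_X_pow_sub_C _ hp0.ne', by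
      simp [halg]⟩
  have htop : Algebra.adjoin k {t₀} = ⊤ := by
    rw [eq_top_iff]
    intro x _
    refine Subring.closure_induction (p := fun x _ => x ∈ Algebra.adjoin k {t₀}) ?_ (zero_mem _)
      (one_mem _) (fun _ _ _ _ => add_mem) (fun _ _ => neg_mem) (fun _ _ _ _ => mul_mem) (h₀ x)
    rintro x (⟨y, rfl⟩ | rfl)
    · exact (Algebra.adjoin k {t₀}).algebraMap_mem ⟨y ^ p, hk y⟩
    · exact Algebra.self_mem_adjoin_singleton k _
  have hdeg : ∀ s : E, (minpoly k s).natDegree ≤ p := fun s => by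
    have h1 : minpoly k s ∣ Polynomial.X ^ p - Polynomial.C (⟨s ^ p, hk s⟩ : k) :=
      minpoly.dvd _ _ (by simp [halg])
    have := Polynomial.natDegree_le_of_dvd h1 (Polynomial.monic_X_pow_sub_C _ hp0.ne').ne_zero
    rwa [Polynomial.natDegree_X_pow_sub_C] at this
  have hft : Module.Finite k E := by
    have := (Algebra.finite_adjoin_simple_of_isIntegral (hint t₀))
    rw [htop] at this
    exact Module.Finite.equiv (Subalgebra.topEquiv (R := k) (A := E)).toLinearEquiv
  have hfr : Module.finrank k E ≤ p := by
    have h1 := IntermediateField.adjoin.finrank (hint t₀)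
    have h2 : IntermediateField.adjoin k {t₀} = ⊤ := by
      rw [eq_top_iff]
      intro x _
      have : x ∈ Algebra.adjoin k {t₀} := htop ▸ trivial
      exact IntermediateField.algebra_adjoin_le_adjoin k _ this
    rw [h2, IntermediateField.finrank_top'] at h1
    exact h1 ▸ hdeg t₀
  have hirr : Irreducible (Polynomial.X ^ p - Polynomial.C (⟨t ^ p, hk t⟩ : k)) := by
    refine X_pow_sub_C_irreducible_of_prime hp.out fun b hb => ?_
    have h1 : (b : E) ^ p = t ^ p := congrArg Subtype.val hb
    have h2 : (b : E) = t := frobenius_inj E p h1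
    obtain ⟨y, hy⟩ := b.2
    exact ht y (hy.trans h2)
  have hmin : (minpoly k t).natDegree = p := by
    have := minpoly.eq_of_irreducible_of_monic hirr (x := t)
      (by simp [halg]) (Polynomial.monic_X_pow_sub_C _ hp0.ne')
    rw [← this, Polynomial.natDegree_X_pow_sub_C]
  have htop2 : IntermediateField.adjoin k {t} = ⊤ := by
    refine IntermediateField.eq_of_le_of_finrank_le le_top ?_
    rw [IntermediateField.finrank_top', IntermediateField.adjoin.finrank (hint t), hmin]
    exact hfr
  have hx : x ∈ (IntermediateField.adjoin k {t}).toSubalgebra := by rw [htop2]; trivial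
  rw [IntermediateField.adjoin_simple_toSubalgebra_of_isAlgebraic (hint t).isAlgebraic] at hx
  refine Algebra.adjoin_induction ?_ ?_ (fun _ _ _ _ => add_mem) (fun _ _ _ _ => mul_mem) hx
  · rintro x hx
    exact Subring.subset_closure (Or.inr hx)
  · rintro ⟨_, y, rfl⟩
    exact Subring.subset_closure (Or.inl ⟨y, rfl⟩)

variable {p}

/-- Iterating: `E = E ^ (p ^ n) [t]`. -/
lemma IsPBasis.mem_closure_pow {t : E} (h : IsPBasis p t) (n : ℕ) (x : E) :
    x ∈ Subring.closure (Set.range (fun y : E => y ^ p ^ n) ∪ {t}) := by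
  induction n generalizing x with
  | zero => exact Subring.subset_closure (Or.inl ⟨x, by simp⟩)
  | succ n ih =>
    have h1 : ∀ y : E, y ^ p ∈ Subring.closure (Set.range (fun y : E => y ^ p ^ (n + 1)) ∪ {t}) := by
      intro y
      have := Subring.mem_map.2 ⟨y, ih y, frobenius_def p y⟩
      rw [RingHom.map_closure] at this
      refine (Subring.closure_le.2 ?_) this
      rintro _ ⟨z, ⟨w, rfl⟩ | rfl, rfl⟩
      · exact Subring.subset_closure (Or.inl ⟨w, by simp [frobenius_def, pow_succ, pow_mul]⟩)
      · have h2 : z ∈ Subring.closure (Set.range (fun y : E => y ^ p ^ (n + 1)) ∪ {z}) :=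
          Subring.subset_closure (Or.inr rfl)
        exact pow_mem h2 p
    refine (Subring.closure_le.2 ?_) (h.mem_closure x)
    rintro _ (⟨y, rfl⟩ | rfl)
    · exact h1 y
    · exact Subring.subset_closure (Or.inr rfl)

/-- Two ring homomorphisms from `E` which agree on `t` and on `p`-th powers are equal. -/
lemma IsPBasis.hom_ext {t : E} (h : IsPBasis p t) (n : ℕ) {S : Type*} [Ring S] (f g : E →+* S)
    (ht : f t = g t) (hp : ∀ y, f (y ^ p ^ n) = g (y ^ p ^ n)) : f = g := by
  refine RingHom.ext fun x => ?_
  refine Subring.closure_induction (p := fun x _ => f x = g x) ?_ (by simp) (by simp)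
    (fun x y _ _ hx hy => by rw [map_add, map_add, hx, hy]) (fun x _ hx => by rw [map_neg, map_neg, hx])
    (fun x y _ _ hx hy => by rw [map_mul, map_mul, hx, hy]) (h.mem_closure_pow n x)
  rintro x (⟨y, rfl⟩ | rfl)
  · exact hp y
  · exact ht

end PBasis

section FunctionField

variable {F K : Type u} [Field F] [Field K] [Algebra F K]

lemma IsFunctionField.essFiniteType (hK : IsFunctionField F K) : Algebra.EssFiniteType F K := by
  obtain ⟨t₁, ht₁, hfin⟩ := hK.exists_finite
  have h1 : Algebra.EssFiniteType F (IntermediateField.adjoin F {t₁}) :=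
    IntermediateField.essFiniteType_iff.2
      (IntermediateField.fg_adjoin_of_finite (Set.finite_singleton t₁))
  exact Algebra.EssFiniteType.comp F (IntermediateField.adjoin F {t₁}) K

lemma inv_mem_closure_pow {E : Type*} [Field E] {p : ℕ} (hp : 0 < p) {s : Set E} {x : E}
    (hx : x ∈ Subring.closure (Set.range (fun y : E => y ^ p) ∪ s)) :
    x⁻¹ ∈ Subring.closure (Set.range (fun y : E => y ^ p) ∪ s) := by
  by_cases h : x = 0
  · simp [h, zero_mem]
  have : x⁻¹ = x ^ (p - 1) * (x⁻¹) ^ p := by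
    obtain ⟨n, rfl⟩ : ∃ n, p = n + 1 := ⟨p - 1, by omega⟩
    simp only [Nat.add_sub_cancel, pow_succ, inv_pow]
    field_simp
  rw [this]
  exact mul_mem (pow_mem hx _) (Subring.subset_closure (Or.inl ⟨_, rfl⟩))

/-- A function field over a finite field is generated by one element over its `p`-th powers. -/
lemma IsFunctionField.exists_mem_closure [Finite F] (hK : IsFunctionField F K) (p : ℕ)
    [hp : Fact p.Prime] [CharP K p] :
    ∃ t : K, ∀ x : K, x ∈ Subring.closure (Set.range (fun y : K => y ^ p) ∪ {t}) := by
  have := hK.essFiniteType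
  obtain ⟨s, hs, hsep⟩ := exists_isTranscendenceBasis_and_isSeparable_of_perfectField F K
  obtain ⟨t₁, ht₁, hfin⟩ := hK.exists_finite
  have ht : IsTranscendenceBasis F ((↑) : ({t₁} : Set K) → K) := by
    refine isTranscendenceBasis_iff_algebraicIndependent_isAlgebraic.2 ⟨?_, ?_⟩
    · exact (algebraicIndependent_singleton_iff (⟨t₁, rfl⟩ : ({t₁} : Set K))).2 ht₁
    · have h1 : Algebra.IsAlgebraic (IntermediateField.adjoin F {t₁}) K := inferInstance
      rw [Subtype.range_coe]
      exact IntermediateField.isAlgebraic_adjoin_iff_top.1 h1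
  have hcard := hs.cardinalMk_eq ht
  have hs1 : s.card = 1 := by
    simpa using hcard
  obtain ⟨t, rfl⟩ := Finset.card_eq_one.1 hs1
  refine ⟨t, fun x => ?_⟩
  have hpF : CharP F p := (algebraMap F K).charP (algebraMap F K).injective p
  have hF : ∀ c : F, algebraMap F K c ∈ Subring.closure (Set.range (fun y : K => y ^ p) ∪ {t}) := by
    intro c
    obtain ⟨d, hd⟩ := (PerfectRing.bijective_frobenius (R := F) (p := p)).2 c
    refine Subring.subset_closure (Or.inl ⟨algebraMap F K d, ?_⟩)
    change (algebraMap F K d) ^ p = _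
    rw [← map_pow]
    exact congrArg _ hd
  have hpK : ExpChar (IntermediateField.adjoin F ((({t} : Finset K)) : Set K)) p := by
    have : CharP (IntermediateField.adjoin F ((({t} : Finset K)) : Set K)) p :=
      (algebraMap (IntermediateField.adjoin F ((({t} : Finset K)) : Set K)) K).charP
        (algebraMap (IntermediateField.adjoin F ((({t} : Finset K)) : Set K)) K).injective p
    exact .prime hp.out
  have h1 := IntermediateField.adjoin_eq_adjoin_pow_expChar_of_isSeparable'
    (IntermediateField.adjoin F ((({t} : Finset K)) : Set K)) K Set.univ p
  have h2 : x ∈ IntermediateField.adjoin (IntermediateField.adjoin F ((({t} : Finset K)) : Set K))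
      (Set.univ : Set K) := IntermediateField.subset_adjoin _ _ trivial
  rw [h1] at h2
  refine IntermediateField.adjoin_induction _ (p := fun x _ => x ∈ Subring.closure
    (Set.range (fun y : K => y ^ p) ∪ {t})) ?_ ?_ (fun _ _ _ _ => add_mem)
    (fun _ _ => inv_mem_closure_pow hp.out.pos) (fun _ _ _ _ => mul_mem) h2
  · rintro _ ⟨y, -, rfl⟩
    exact Subring.subset_closure (Or.inl ⟨y, rfl⟩)
  · rintro ⟨y, hy⟩
    change y ∈ _
    refine IntermediateField.adjoin_induction _ (p := fun x _ => x ∈ Subring.closure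
      (Set.range (fun y : K => y ^ p) ∪ {t})) ?_ ?_ (fun _ _ _ _ => add_mem)
      (fun _ _ => inv_mem_closure_pow hp.out.pos) (fun _ _ _ _ => mul_mem) hy
    · intro y hy
      exact Subring.subset_closure (Or.inr (by simpa using hy))
    · exact hF

lemma IsFunctionField.isPBasis [Finite F] (hK : IsFunctionField F K) (p : ℕ)
    [hp : Fact p.Prime] [CharP K p] {t : K} (ht : ∀ y : K, y ^ p ≠ t) : IsPBasis p t := by
  obtain ⟨t₀, h⟩ := hK.exists_mem_closure p
  exact isPBasis_of_mem_closure p h ht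

lemma formallyUnramified_of_mem_closure {k E : Type*} [Field k] [Field E] [Algebra k E] (p : ℕ)
    [CharP E p] (T : Set E) (hT : T ⊆ Set.range (algebraMap k E))
    (h : ∀ x : E, x ∈ Subring.closure (Set.range (fun y : E => y ^ p) ∪ T)) :
    Algebra.FormallyUnramified k E := by
  have hD : ∀ x : E, KaehlerDifferential.D k E x = 0 := by
    intro x
    refine Subring.closure_induction (p := fun x _ => KaehlerDifferential.D k E x = 0) ?_ (by simp)
      (by simp) (fun x y _ _ hx hy => by rw [map_add, hx, hy, add_zero])
      (fun x _ hx => by rw [map_neg, hx, neg_zero])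
      (fun x y _ _ hx hy => by rw [Derivation.leibniz, hx, hy]; simp) (h x)
    rintro x (⟨y, rfl⟩ | hx)
    · change KaehlerDifferential.D k E (y ^ p) = 0
      rw [Derivation.leibniz_pow, ← Nat.cast_smul_eq_nsmul E, CharP.cast_eq_zero, zero_smul]
    · obtain ⟨c, rfl⟩ := hT hx
      exact Derivation.map_algebraMap _ c
  have h1 := KaehlerDifferential.span_range_derivation k E
  rw [Submodule.span_eq_bot.2 (by rintro _ ⟨x, rfl⟩; exact hD x)] at h1
  exact ⟨(Submodule.subsingleton_iff E).1 (subsingleton_of_bot_eq_top h1)⟩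

lemma IsFunctionField.exists_pow_ne [Finite F] (hK : IsFunctionField F K) (p : ℕ)
    [Fact p.Prime] [CharP K p] : ∃ t : K, ∀ y : K, y ^ p ≠ t := by
  by_contra! h
  have := hK.essFiniteType
  obtain ⟨t₁, ht₁, hfin⟩ := hK.exists_finite
  have hun : Algebra.FormallyUnramified F K := by
    refine formallyUnramified_of_mem_closure p ∅ (Set.empty_subset _) fun x => ?_
    obtain ⟨y, rfl⟩ := h x
    exact Subring.subset_closure (Or.inl ⟨y, rfl⟩)
  have := Algebra.FormallyUnramified.finite_of_free F K
  exact ht₁ (Algebra.IsAlgebraic.isAlgebraic t₁)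

/-- The field extension `K / F(s)` is finite and separable for every `p`-basis `s`. -/
lemma IsFunctionField.finite_separable [Finite F] (hK : IsFunctionField F K) (p : ℕ)
    [Fact p.Prime] [CharP K p] {s : K} (hs : ∀ y : K, y ^ p ≠ s) :
    FiniteDimensional (IntermediateField.adjoin F {s}) K ∧
      Algebra.IsSeparable (IntermediateField.adjoin F {s}) K := by
  have := hK.essFiniteType
  have h1 : Algebra.EssFiniteType (IntermediateField.adjoin F {s}) K :=
    Algebra.EssFiniteType.of_comp F _ K
  have hun : Algebra.FormallyUnramified (IntermediateField.adjoin F {s}) K :=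
    formallyUnramified_of_mem_closure p {s}
      (Set.singleton_subset_iff.2 ⟨⟨s, IntermediateField.mem_adjoin_simple_self F s⟩, rfl⟩)
      (hK.isPBasis p hs).mem_closure
  exact ⟨Algebra.FormallyUnramified.finite_of_free _ K,
    (Algebra.FormallyUnramified.iff_isSeparable _ K).1 hun⟩

end FunctionField

end HodgePink
end

noncomputable section
namespace HodgePink
namespace Place

variable {F K : Type u} [Field F] [Field K] [Algebra F K]

section Dedekind

variable {D : Type u} [CommRing D] [IsDedekindDomain D] [Algebra D K] [IsFractionRing D K]
  [Algebra F D] [IsScalarTower F D K]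

open IsDedekindDomain

/-- The closed point given by a maximal ideal of a Dedekind domain with field of fractions `K`. -/
def ofPrime (P : HeightOneSpectrum D) : Place F K where
  abs := P.adicAbv (one_lt_two)
  nontrivial := by
    obtain ⟨x, hx, h0⟩ := Submodule.exists_mem_ne_zero_of_ne_bot P.ne_bot
    refine ⟨algebraMap D K x, ?_, ?_⟩
    · rwa [ne_eq, FaithfulSMul.algebraMap_eq_zero_iff]
    · exact ((P.adicAbv_coe_lt_one_iff _ _).2 hx).ne
  nonarch := P.isNonarchimedean_adicAbv _
  trivial_on_base c hc := by
    rw [IsScalarTower.algebraMap_apply F D K, HeightOneSpectrum.adicAbv_coe_eq_one_iff]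
    intro h
    refine P.isPrime.ne_top (Ideal.eq_top_of_isUnit_mem _ h ?_)
    exact (IsUnit.mk0 c hc).map (algebraMap F D)

lemma ofPrime_algebraMap_le_one (P : HeightOneSpectrum D) (x : D) :
    (ofPrime P : Place F K).abs (algebraMap D K x) ≤ 1 := P.adicAbv_coe_le_one _ _

lemma ofPrime_lt_one_iff (P : HeightOneSpectrum D) (x : D) :
    (ofPrime P : Place F K).abs (algebraMap D K x) < 1 ↔ x ∈ P.asIdeal :=
  P.adicAbv_coe_lt_one_iff _ _

lemma abs_le_one_of_ofPrime (x : K) (h : ∀ P : HeightOneSpectrum D,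
    (ofPrime P : Place F K).abs x ≤ 1) : ∃ y : D, algebraMap D K y = x := by
  refine HeightOneSpectrum.mem_integers_of_valuation_le_one K x fun P => ?_
  have := h P
  change ((P.adicAbvDef (one_lt_two) x : NNReal) : ℝ) ≤ 1 at this
  rw [← NNReal.coe_one, NNReal.coe_le_coe, HeightOneSpectrum.adicAbvDef] at this
  rwa [← WithZeroMulInt.toNNReal_le_one_iff (one_lt_two)]

/-- The elements of `K` which are integral at `P` are fractions with denominator prime to `P`. -/
lemma exists_mul_eq_of_ofPrime_le_one (P : HeightOneSpectrum D) (x : K)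
    (h : (ofPrime P : Place F K).abs x ≤ 1) :
    ∃ n d : D, d ∉ P.asIdeal ∧ x * algebraMap D K d = algebraMap D K n := by
  change ((P.adicAbvDef (one_lt_two) x : NNReal) : ℝ) ≤ 1 at h
  rw [← NNReal.coe_one, NNReal.coe_le_coe, HeightOneSpectrum.adicAbvDef,
    WithZeroMulInt.toNNReal_le_one_iff (one_lt_two)] at h
  obtain ⟨n, d, hd⟩ := P.exists_primeCompl_mul_eq_of_integer x h
  exact ⟨n, d, d.2, hd⟩

variable (v : Place F K)

lemma exists_center (hv : ∀ x : D, v.abs (algebraMap D K x) ≤ 1) :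
    ∃ P : HeightOneSpectrum D, ∀ x : D, x ∈ P.asIdeal ↔ v.abs (algebraMap D K x) < 1 := by
  let I : Ideal D :=
    { carrier := {x | v.abs (algebraMap D K x) < 1}
      add_mem' := fun {x y} hx hy => by
        change v.abs (algebraMap D K (x + y)) < 1
        rw [map_add]
        exact (v.nonarch _ _).trans_lt (max_lt hx hy)
      zero_mem' := by simp
      smul_mem' := fun c x hx => by
        change v.abs (algebraMap D K (c * x)) < 1
        rw [map_mul, map_mul]
        exact mul_lt_one_of_nonneg_of_lt_one_right (hv c) (v.abs.nonneg _) hx }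
  have hI : ∀ x, x ∈ I ↔ v.abs (algebraMap D K x) < 1 := fun x => Iff.rfl
  refine ⟨⟨I, ⟨?_, ?_⟩, ?_⟩, hI⟩
  · rw [Ideal.ne_top_iff_one, hI]
    simp
  · intro x y hxy
    rw [hI, map_mul, map_mul] at hxy
    rw [hI, hI]
    by_contra! h
    have h1 := le_antisymm (hv x) h.1
    have h2 := le_antisymm (hv y) h.2
    rw [h1, h2] at hxy
    norm_num at hxy
  · intro hbot
    obtain ⟨x, hx, hx1⟩ := v.nontrivial
    obtain ⟨n, d, hd, rfl⟩ := IsFractionRing.div_surjective (A := D) x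
    have h1 : ∀ y : D, y ≠ 0 → v.abs (algebraMap D K y) = 1 := fun y hy =>
      le_antisymm (hv y) (by
        by_contra! h
        have : y ∈ I := h
        rw [hbot] at this
        exact hy this)
    rw [map_div₀, h1 d (nonZeroDivisors.ne_zero hd), h1 n (by rintro rfl; simp at hx)] at hx1
    norm_num at hx1

lemma ofPrime_isEquiv {P : HeightOneSpectrum D}
    (hP : ∀ x : D, x ∈ P.asIdeal ↔ v.abs (algebraMap D K x) < 1)
    (hv : ∀ x : D, v.abs (algebraMap D K x) ≤ 1) :
    (ofPrime P : Place F K).abs.IsEquiv v.abs := by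
  refine AbsoluteValue.isEquiv_of_lt_one_imp (ofPrime P : Place F K).nontrivial fun x hx => ?_
  obtain ⟨n, d, hd, h⟩ := exists_mul_eq_of_ofPrime_le_one (F := F) P x hx.le
  have hd' : v.abs (algebraMap D K d) = 1 := le_antisymm (hv d) (by
    rw [hP] at hd; exact not_lt.1 hd)
  have hd'' : (ofPrime P : Place F K).abs (algebraMap D K d) = 1 :=
    le_antisymm (ofPrime_algebraMap_le_one P d) (by
      rw [← ofPrime_lt_one_iff (F := F) (K := K)] at hd; exact not_lt.1 hd)
  have h1 := congrArg v.abs h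
  have h2 := congrArg (ofPrime P : Place F K).abs h
  rw [map_mul, hd', mul_one] at h1
  rw [map_mul, hd'', mul_one] at h2
  rw [h1, ← hP, ← ofPrime_lt_one_iff (F := F) (K := K), ← h2]
  exact hx

/-- A closed point with a center on a Dedekind domain is discrete. -/
lemma exists_uniformizer_of_dedekind (hv : ∀ x : D, v.abs (algebraMap D K x) ≤ 1) :
    ∃ ϖ : K, 0 < v.abs ϖ ∧ v.abs ϖ < 1 ∧ ∀ x : K, x ≠ 0 → ∃ k : ℤ, v.abs x = v.abs ϖ ^ k := by
  obtain ⟨P, hP⟩ := v.exists_center hv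
  have he := v.ofPrime_isEquiv hP hv
  obtain ⟨ϖ, hϖ⟩ := P.valuation_exists_uniformizer K
  have hϖ0 : ϖ ≠ 0 := by
    rintro rfl
    rw [map_zero] at hϖ
    exact WithZero.exp_ne_zero hϖ.symm
  refine ⟨ϖ, v.abs.pos hϖ0, ?_, fun x hx => ?_⟩
  · rw [← he.lt_one_iff]
    change ((P.adicAbvDef (one_lt_two) ϖ : NNReal) : ℝ) < 1
    rw [← NNReal.coe_one, NNReal.coe_lt_coe, HeightOneSpectrum.adicAbvDef,
      WithZeroMulInt.toNNReal_lt_one_iff (one_lt_two), hϖ]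
    rw [← WithZero.exp_zero, WithZero.exp_lt_exp]
    norm_num
  · have hvx : P.valuation K x ≠ 0 := by simpa using hx
    obtain ⟨m, hm⟩ : ∃ m : ℤ, P.valuation K x = WithZero.exp m := ⟨_, (WithZero.exp_log hvx).symm⟩
    refine ⟨-m, ?_⟩
    have h1 : P.valuation K (x * ϖ ^ m) = 1 := by
      rw [map_mul, map_zpow₀, hm, hϖ, ← WithZero.exp_zsmul, ← WithZero.exp_add]
      simp
    have h2 : (ofPrime P : Place F K).abs (x * ϖ ^ m) = 1 := by
      change ((P.adicAbvDef (one_lt_two) (x * ϖ ^ m) : NNReal) : ℝ) = 1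
      rw [HeightOneSpectrum.adicAbvDef, h1]
      simp
    rw [he.eq_one_iff, map_mul, map_zpow₀] at h2
    rw [zpow_neg]
    exact eq_inv_of_mul_eq_one_left h2

end Dedekind
end Place
end HodgePink
end

noncomputable section
namespace HodgePink

section IntegralClosure

lemma exists_char (F K : Type u) [Field F] [Finite F] [Field K] [Algebra F K] :
    ∃ p : ℕ, p.Prime ∧ CharP K p := by
  obtain ⟨p, hp⟩ := CharP.exists F
  have hp' : p ≠ 0 := by
    rintro rfl
    have := CharP.charP_to_charZero F
    exact not_finite F
  exact ⟨p, (CharP.char_is_prime_or_zero F p).resolve_right hp', charP_of_injective_algebraMap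
    (algebraMap F K).injective p⟩

variable {F K : Type u} [Field F] [Field K] [Algebra F K]

lemma isPrincipalIdealRing_adjoin_singleton (s : K) :
    IsPrincipalIdealRing (Algebra.adjoin F {s}) := by
  have h : (Polynomial.aeval (R := F) s).range = Algebra.adjoin F {s} :=
    (Algebra.adjoin_singleton_eq_range_aeval F s).symm
  rw [← h]
  exact IsPrincipalIdealRing.of_surjective _ (Polynomial.aeval (R := F) s).rangeRestrict_surjective

lemma mem_adjoin_singleton_iff {s x : K} :
    x ∈ Algebra.adjoin F {s} ↔ ∃ f : Polynomial F, Polynomial.aeval s f = x := by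
  rw [Algebra.adjoin_singleton_eq_range_aeval]; rfl

/-- A polynomial of degree at most `k` in `s⁻¹` is `s ^ (-k)` times a polynomial in `s`. -/
lemma exists_aeval_inv {s : K} (hs : s ≠ 0) (f : Polynomial F) {k : ℕ} (hk : f.natDegree ≤ k) :
    ∃ g : Polynomial F, g.natDegree ≤ k ∧
      s ^ k * Polynomial.aeval s⁻¹ f = Polynomial.aeval s g := by
  refine ⟨∑ i ∈ Finset.range (f.natDegree + 1), Polynomial.C (f.coeff i) * Polynomial.X ^ (k - i),
    ?_, ?_⟩
  · refine Polynomial.natDegree_sum_le_of_forall_le _ _ fun i _ => ?_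
    exact (Polynomial.natDegree_C_mul_X_pow_le _ _).trans (Nat.sub_le _ _)
  · rw [Polynomial.aeval_eq_sum_range, Finset.mul_sum, map_sum]
    refine Finset.sum_congr rfl fun i hi => ?_
    have hi' : i ≤ k := by have := Finset.mem_range.1 hi; omega
    rw [map_mul, Polynomial.aeval_C, map_pow, Polynomial.aeval_X, Algebra.smul_def, pow_sub₀ _ hs hi',
      inv_pow]
    ring

lemma Place.abs_algebraMap_le_one (w : Place F K) (c : F) : w.abs (algebraMap F K c) ≤ 1 := by
  by_cases hc : c = 0
  · simp [hc]
  · exact (w.trivial_on_base c hc).le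

lemma Place.abs_sum_le (w : Place F K) {ι : Type*} (S : Finset ι) (f : ι → K) {r : ℝ} (hr : 0 ≤ r)
    (h : ∀ i ∈ S, w.abs (f i) ≤ r) : w.abs (∑ i ∈ S, f i) ≤ r := by
  classical
  induction S using Finset.induction_on with
  | empty => simpa using hr
  | insert i S hi ih =>
    rw [Finset.sum_insert hi]
    refine (w.nonarch _ _).trans (max_le (h i (Finset.mem_insert_self _ _)) (ih fun j hj => ?_))
    exact h j (Finset.mem_insert_of_mem hj)

lemma Place.abs_aeval_le_one (w : Place F K) {s : K} (hs : w.abs s ≤ 1) (f : Polynomial F) :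
    w.abs (Polynomial.aeval s f) ≤ 1 := by
  rw [Polynomial.aeval_eq_sum_range]
  refine w.abs_sum_le _ _ zero_le_one fun i _ => ?_
  rw [Algebra.smul_def, map_mul, map_pow]
  exact mul_le_one₀ (w.abs_algebraMap_le_one _) (by positivity)
    (pow_le_one₀ (w.abs.nonneg _) hs)

lemma Place.abs_le_one_of_isIntegral (w : Place F K) {s : K} (hs : w.abs s ≤ 1) {x : K}
    (hx : IsIntegral (Algebra.adjoin F {s}) x) : w.abs x ≤ 1 := by
  obtain ⟨f, hf, hfx⟩ := hx
  by_contra! h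
  have hc : ∀ i, w.abs (f.coeff i : K) ≤ 1 := fun i => by
    obtain ⟨g, hg⟩ := mem_adjoin_singleton_iff.1 (f.coeff i).2
    rw [← hg]
    exact w.abs_aeval_le_one hs g
  have hx0 : 0 < w.abs x := zero_lt_one.trans h
  rw [Polynomial.eval₂_eq_sum_range, Finset.sum_range_succ, hf.coeff_natDegree, map_one,
    one_mul] at hfx
  by_cases hn : f.natDegree = 0
  · rw [hn] at hfx
    simp at hfx
  have h1 : x ^ f.natDegree = -∑ i ∈ Finset.range f.natDegree,
      (algebraMap (Algebra.adjoin F {s}) K) (f.coeff i) * x ^ i := by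
    rw [eq_neg_iff_add_eq_zero, add_comm]; exact hfx
  have h2 : w.abs (x ^ f.natDegree) ≤ w.abs x ^ (f.natDegree - 1) := by
    rw [h1, AbsoluteValue.map_neg]
    refine w.abs_sum_le _ _ (by positivity) fun i hi => ?_
    rw [map_mul, map_pow]
    have hi' : i ≤ f.natDegree - 1 := by have := Finset.mem_range.1 hi; omega
    calc _ ≤ 1 * w.abs x ^ (f.natDegree - 1) :=
          mul_le_mul (hc i) (pow_le_pow_right₀ h.le hi') (by positivity) zero_le_one
      _ = _ := one_mul _
  rw [map_pow] at h2
  have h3 : w.abs x ^ (f.natDegree - 1) < w.abs x ^ f.natDegree :=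
    pow_lt_pow_right₀ h (by omega)
  linarith

open scoped IntermediateField.algebraAdjoinAdjoin in
lemma minpoly_coeff_mem_adjoin (s : K) (E : IntermediateField F K)
    (hE : E = IntermediateField.adjoin F {s}) {a : K}
    (ha : IsIntegral (Algebra.adjoin F {s}) a) (i : ℕ) :
    (((minpoly E a).coeff i : E) : K) ∈ Algebra.adjoin F {s} := by
  subst hE
  have := isPrincipalIdealRing_adjoin_singleton (F := F) s
  rw [minpoly.isIntegrallyClosed_eq_field_fractions' (IntermediateField.adjoin F {s}) ha,
    Polynomial.coeff_map]
  exact ((minpoly (Algebra.adjoin F {s}) a).coeff i).2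

variable [Finite F] (hK : IsFunctionField F K) (p : ℕ) [Fact p.Prime] [CharP K p]
include hK

lemma IsFunctionField.transcendental {s : K} (hs : ∀ y : K, y ^ p ≠ s) : Transcendental F s := by
  intro h
  have h1 := (hK.finite_separable p hs).1
  have h2 := IntermediateField.adjoin.finiteDimensional h.isIntegral
  have h3 : FiniteDimensional F K := FiniteDimensional.trans F (IntermediateField.adjoin F {s}) K
  obtain ⟨t, ht, -⟩ := hK.exists_finite
  exact ht (Algebra.IsAlgebraic.isAlgebraic t)

open scoped IntermediateField.algebraAdjoinAdjoin in
lemma IsFunctionField.isAlgebraic_adjoin {s : K} (hs : ∀ y : K, y ^ p ≠ s) (x : K) :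
    IsAlgebraic (Algebra.adjoin F {s}) x := by
  have h1 := (hK.finite_separable p hs).1
  rw [IsFractionRing.isAlgebraic_iff (Algebra.adjoin F {s}) (IntermediateField.adjoin F {s}) K]
  exact Algebra.IsAlgebraic.isAlgebraic x

lemma IsFunctionField.exists_mul_le_one {s : K} (hs : ∀ y : K, y ^ p ≠ s) (x : K) :
    ∃ c : Polynomial F, c ≠ 0 ∧ ∀ w : Place F K, w.abs s ≤ 1 →
      w.abs (Polynomial.aeval s c * x) ≤ 1 := by
  obtain ⟨y, hy, h⟩ := (hK.isAlgebraic_adjoin p hs x).exists_integral_multiple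
  obtain ⟨c, hc⟩ := mem_adjoin_singleton_iff.1 y.2
  refine ⟨c, ?_, fun w hw => ?_⟩
  · rintro rfl
    apply hy
    ext
    rw [← hc]
    simp
  · have h2 : Polynomial.aeval s c * x = y • x := by
      rw [Algebra.smul_def]
      exact congrArg (· * x) hc
    rw [h2]
    exact w.abs_le_one_of_isIntegral hw h

open scoped IntermediateField.algebraAdjoinAdjoin in
/-- The integral closure of `F[s]` in a function field. -/
lemma IsFunctionField.exists_dedekind {s : K} (hs : ∀ y : K, y ^ p ≠ s) :
    ∃ D : Subalgebra F K, IsDedekindDomain D ∧ IsFractionRing D K ∧ s ∈ D ∧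
      (∀ x ∈ D, IsIntegral (Algebra.adjoin F {s}) x) ∧
      ∃ (n : ℕ) (b : Fin n → K), (∀ i, b i ∈ D) ∧
        (∀ x ∈ D, ∃ c : Fin n → Polynomial F, x = ∑ i, Polynomial.aeval s (c i) * b i) ∧
        LinearIndependent (IntermediateField.adjoin F {s}) b := by
  have h1 := (hK.finite_separable p hs).1
  have h2 := (hK.finite_separable p hs).2
  have h3 := isPrincipalIdealRing_adjoin_singleton (F := F) s
  let R := Algebra.adjoin F {s}
  let D' := integralClosure R K
  have h4 : IsDedekindDomain D' :=
    integralClosure.isDedekindDomain R (IntermediateField.adjoin F {s}) K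
  have h5 : IsFractionRing D' K :=
    integralClosure.isFractionRing_of_finite_extension (IntermediateField.adjoin F {s}) K
  have h6 : Module.Free R D' :=
    IsIntegralClosure.module_free R (IntermediateField.adjoin F {s}) K D'
  have h7 : Module.Finite R D' :=
    IsIntegralClosure.finite R (IntermediateField.adjoin F {s}) K D'
  let b := Module.finBasis R D'
  refine ⟨D'.restrictScalars F, h4, h5, ?_, fun x hx => hx, Module.finrank R D', fun i => b i,
    fun i => (b i).2, fun x hx => ?_, ?_⟩
  · exact D'.algebraMap_mem ⟨s, Algebra.self_mem_adjoin_singleton F s⟩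
  · have hb := congrArg Subtype.val (b.sum_repr ⟨x, hx⟩)
    have hc : ∀ i, ∃ c : Polynomial F, Polynomial.aeval s c = (b.repr ⟨x, hx⟩ i : K) := fun i =>
      mem_adjoin_singleton_iff.1 (b.repr ⟨x, hx⟩ i).2
    choose c hc using hc
    refine ⟨c, ?_⟩
    refine hb.symm.trans ?_
    rw [AddSubmonoidClass.coe_finsetSum]
    refine Finset.sum_congr rfl fun i _ => ?_
    rw [hc]
    rfl
  · have h8 : LinearIndependent R fun i => (b i : K) :=
      b.linearIndependent.map' (D'.val.toLinearMap)
        (LinearMap.ker_eq_bot.2 Subtype.val_injective)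
    exact (LinearIndependent.iff_fractionRing R (IntermediateField.adjoin F {s})).1 h8

/-- A function without poles is constant. -/
lemma IsFunctionField.mem_range_of_abs_le_one {a : K} (ha : ∀ w : Place F K, w.abs a ≤ 1) :
    a ∈ (algebraMap F K).range := by
  obtain ⟨p, hp, hpK⟩ := exists_char F K
  have := Fact.mk hp
  obtain ⟨s, hs⟩ := hK.exists_pow_ne p
  have hs' : ∀ y : K, y ^ p ≠ s⁻¹ := fun y hy => hs y⁻¹ (by rw [inv_pow, hy, inv_inv])
  have htr := hK.transcendental p hs
  have hs0 : s ≠ 0 := by rintro rfl; exact htr (isAlgebraic_zero)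
  have hint : ∀ t : K, (∀ y : K, y ^ p ≠ t) → IsIntegral (Algebra.adjoin F {t}) a := by
    intro t ht
    obtain ⟨D, hD1, hD2, -, hD, -⟩ := hK.exists_dedekind p ht
    obtain ⟨y, rfl⟩ := Place.abs_le_one_of_ofPrime (F := F) (D := D) a fun P => ha _
    exact hD y y.2
  have hE : IntermediateField.adjoin F {s} = IntermediateField.adjoin F {s⁻¹} := by
    refine le_antisymm ?_ ?_
    · rw [IntermediateField.adjoin_simple_le_iff]
      have := inv_mem (IntermediateField.mem_adjoin_simple_self F s⁻¹)
      rwa [inv_inv] at this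
    · rw [IntermediateField.adjoin_simple_le_iff]
      exact inv_mem (IntermediateField.mem_adjoin_simple_self F s)
  have hF : ∀ x : K, x ∈ Algebra.adjoin F {s} → x ∈ Algebra.adjoin F {s⁻¹} →
      ∃ c : F, algebraMap F K c = x := by
    intro x hx hx'
    obtain ⟨f, rfl⟩ := mem_adjoin_singleton_iff.1 hx
    obtain ⟨g, hg⟩ := mem_adjoin_singleton_iff.1 hx'
    obtain ⟨g', hg', h⟩ := exists_aeval_inv hs0 g le_rfl
    have h3 : Polynomial.X ^ g.natDegree * f = g' := by
      refine transcendental_iff_injective.1 htr ?_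
      rw [map_mul, map_pow, Polynomial.aeval_X, ← h, hg]
    have h4 : f.natDegree = 0 := by
      by_cases hf : f = 0
      · simp [hf]
      rw [← h3, Polynomial.natDegree_X_pow_mul _ hf] at hg'
      omega
    rw [Polynomial.eq_C_of_natDegree_eq_zero h4]
    exact ⟨_, (Polynomial.aeval_C _ _).symm⟩
  have h1 : ∀ i, ∃ c : F, algebraMap F K c =
      ((minpoly (IntermediateField.adjoin F {s}) a).coeff i : K) := fun i =>
    hF _ (minpoly_coeff_mem_adjoin s _ rfl (hint s hs) i)
      (minpoly_coeff_mem_adjoin s⁻¹ _ hE (hint _ hs') i)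
  choose c hc using h1
  set f := minpoly (IntermediateField.adjoin F {s}) a with hf
  have hfin := (hK.finite_separable p hs).1
  have hmonic : f.Monic := minpoly.monic (Algebra.IsIntegral.isIntegral a)
  refine hK.exact_constants a ⟨∑ i ∈ Finset.range (f.natDegree + 1),
    Polynomial.C (c i) * Polynomial.X ^ i, fun h0 => ?_, ?_⟩
  · have h2 := congrArg (fun g => g.coeff f.natDegree) h0
    simp only [Polynomial.finsetSum_coeff, Polynomial.coeff_C_mul_X_pow, Polynomial.coeff_zero] at h2
    rw [Finset.sum_ite_eq, if_pos (by simp)] at h2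
    have h3 := hc f.natDegree
    rw [h2, hmonic.coeff_natDegree, map_zero] at h3
    exact zero_ne_one h3
  · have h2 := minpoly.aeval (IntermediateField.adjoin F {s}) a
    rw [← hf, Polynomial.aeval_eq_sum_range] at h2
    rw [map_sum, ← h2]
    refine Finset.sum_congr rfl fun i _ => ?_
    rw [map_mul, Polynomial.aeval_C, map_pow, Polynomial.aeval_X, hc]
    rfl

end IntegralClosure

end HodgePink
end

noncomputable section
namespace HodgePink

section Pole

variable {F K : Type u} [Field F] [Field K] [Algebra F K]

open Polynomial in
/-- The absolute value of `f(s)` is `|s| ^ ord f` if `|s| < 1`. -/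
lemma Place.abs_aeval_eq (w : Place F K) {s : K} (hs : w.abs s < 1) {f : F[X]} (hf : f ≠ 0) :
    w.abs (aeval s f) = w.abs s ^ f.natTrailingDegree := by
  obtain ⟨g, hg⟩ : X ^ f.natTrailingDegree ∣ f := by
    rw [X_pow_dvd_iff]
    exact fun d hd => coeff_eq_zero_of_lt_natTrailingDegree hd
  have h0 : g.coeff 0 ≠ 0 := by
    have : f.coeff f.natTrailingDegree ≠ 0 := by
      rw [← trailingCoeff]; exact trailingCoeff_nonzero_iff_nonzero.2 hf
    generalize f.natTrailingDegree = e at hg this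
    rwa [hg, ← zero_add (e : ℕ), coeff_X_pow_mul', if_pos (by omega), zero_add, Nat.sub_self] at this
  have h1 : w.abs (aeval s g) = 1 := by
    obtain ⟨h, hh⟩ : X ∣ g - C (g.coeff 0) := by rw [X_dvd_iff]; simp
    have h2 : aeval s g = algebraMap F K (g.coeff 0) + s * aeval s h := by
      have := congrArg (aeval s) hh
      rw [map_sub, map_mul, aeval_X, aeval_C, sub_eq_iff_eq_add'] at this
      exact this
    have h3 : w.abs (s * aeval s h) < w.abs (algebraMap F K (g.coeff 0)) := by
      rw [w.trivial_on_base _ h0, map_mul]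
      exact mul_lt_one_of_nonneg_of_lt_one_left (w.abs.nonneg _) hs (w.abs_aeval_le_one hs.le h)
    rw [h2, ← w.trivial_on_base _ h0]
    exact w.nonarch.add_eq_left_of_lt h3
  conv_lhs => rw [hg]
  rw [map_mul, map_mul, map_pow, aeval_X, map_pow, h1, mul_one]

lemma Place.exists_pBasis_lt_one (v : Place F K) (p : ℕ) (hp : 0 < p) {t : K}
    (ht : ∀ y : K, y ^ p ≠ t) : ∃ s : K, (∀ y : K, y ^ p ≠ s) ∧ v.abs s < 1 := by
  obtain ⟨y, hy0, hy⟩ : ∃ y : K, y ≠ 0 ∧ v.abs y < 1 := by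
    obtain ⟨y, hy0, hy⟩ := v.nontrivial
    rcases lt_or_gt_of_ne hy with h | h
    · exact ⟨y, hy0, h⟩
    · exact ⟨y⁻¹, inv_ne_zero hy0, by rw [map_inv₀]; exact inv_lt_one_of_one_lt₀ h⟩
  obtain ⟨t', ht', h1⟩ : ∃ t' : K, (∀ y : K, y ^ p ≠ t') ∧ v.abs t' ≤ 1 := by
    rcases le_total (v.abs t) 1 with h | h
    · exact ⟨t, ht, h⟩
    · refine ⟨t⁻¹, fun y hy => ht y⁻¹ (by rw [inv_pow, hy, inv_inv]), ?_⟩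
      rw [map_inv₀]; exact inv_le_one_of_one_le₀ h
  refine ⟨y ^ p * t', fun z hz => ht' (z / y) ?_, ?_⟩
  · rw [div_pow, hz, mul_div_cancel_left₀ _ (pow_ne_zero _ hy0)]
  · rw [map_mul, map_pow]
    exact mul_lt_one_of_nonneg_of_lt_one_left (by positivity)
      (pow_lt_one₀ (v.abs.nonneg _) hy hp.ne') h1

/-- An element which is prime to `v` and divisible by the part of `s` prime to `v`. -/
lemma Place.exists_prime_to (v : Place F K) {D : Type u} [CommRing D] [IsDedekindDomain D]
    [Algebra D K] [IsFractionRing D K] [Algebra F D] [IsScalarTower F D K]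
    (hv : ∀ x : D, v.abs (algebraMap D K x) ≤ 1) {s : D} (hs : s ≠ 0) :
    ∃ u : D, v.abs (algebraMap D K u) = 1 ∧ ∀ w : Place F K, ¬ w.abs.IsEquiv v.abs →
      (∀ x : D, w.abs (algebraMap D K x) ≤ 1) →
      w.abs (algebraMap D K u) ≤ w.abs (algebraMap D K s) := by
  obtain ⟨P, hP⟩ := v.exists_center hv
  have hfin : FiniteMultiplicity P.asIdeal (Ideal.span {s}) :=
    FiniteMultiplicity.of_prime_left P.prime (by simpa using hs)
  obtain ⟨J, hJ, hJP⟩ := hfin.exists_eq_pow_mul_and_not_dvd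
  rw [Ideal.dvd_iff_le] at hJP
  obtain ⟨u, huJ, huP⟩ := Set.not_subset.1 hJP
  refine ⟨u, le_antisymm (hv u) (not_lt.1 fun h => huP ((hP u).2 h)), fun w hw hw1 => ?_⟩
  obtain ⟨P', hP'⟩ := w.exists_center hw1
  have hne : ¬ P.asIdeal ≤ P'.asIdeal := by
    intro h
    have h1 : P = P' := IsDedekindDomain.HeightOneSpectrum.ext (P.isMaximal.eq_of_le
      P'.isPrime.ne_top h)
    subst h1
    exact hw ((w.ofPrime_isEquiv hP' hw1).symm.trans (v.ofPrime_isEquiv hP hv))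
  obtain ⟨y, hyP, hyP'⟩ := Set.not_subset.1 hne
  have hy : w.abs (algebraMap D K y) = 1 :=
    le_antisymm (hw1 y) (not_lt.1 fun h => hyP' ((hP' y).2 h))
  set e := multiplicity P.asIdeal (Ideal.span {s})
  have h1 : y ^ e * u ∈ Ideal.span {s} := by
    rw [hJ]
    exact Ideal.mul_mem_mul (Ideal.pow_mem_pow hyP e) huJ
  obtain ⟨z, hz⟩ := Ideal.mem_span_singleton'.1 h1
  have h2 := congrArg (fun x => w.abs (algebraMap D K x)) hz
  simp only [map_mul, map_pow, hy, one_pow, one_mul] at h2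
  rw [← h2]
  exact mul_le_of_le_one_left (w.abs.nonneg _) (hw1 z)

lemma exists_not_mem_range_of_finrank {V Q : Type*} [AddCommGroup V] [Module F V] [Module.Finite F V]
    [AddCommGroup Q] [Module F Q] [Module.Finite F Q] (Φ : V →ₗ[F] Q) (G : V →ₗ[F] K)
    (h : Module.finrank F Q + 2 ≤ Module.finrank F V) (hG : ∀ x, Φ x = 0 → G x = 0 → x = 0) :
    ∃ x, Φ x = 0 ∧ G x ∉ (algebraMap F K).range := by
  by_contra! hcon
  have h1 := Φ.finrank_range_add_finrank_ker
  have h2 := (LinearMap.range Φ).finrank_le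
  let G' := G ∘ₗ (LinearMap.ker Φ).subtype
  have hinj : Function.Injective G' := by
    refine (injective_iff_map_eq_zero G').2 fun x hx => Subtype.ext (hG x.1 x.2 hx)
  have h3 : LinearMap.range G' ≤ LinearMap.range (Algebra.linearMap F K) := by
    rintro _ ⟨x, rfl⟩
    obtain ⟨c, hc⟩ := hcon x.1 x.2
    exact ⟨c, hc⟩
  have h4 := Submodule.finrank_mono h3
  rw [LinearMap.finrank_range_of_inj hinj] at h4
  have h5 := (Algebra.linearMap F K).finrank_range_le
  rw [Module.finrank_self] at h5
  omega

open Polynomial in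
/-- There is a function whose only pole is the given closed point. -/
lemma IsFunctionField.exists_pole [Finite F] (hK : IsFunctionField F K) (v : Place F K) :
    ∃ a ∈ v.A, 1 < v.abs a := by
  classical
  obtain ⟨p, hp, hpK⟩ := exists_char F K
  have := Fact.mk hp
  obtain ⟨t, ht⟩ := hK.exists_pow_ne p
  obtain ⟨s, hs, hs1⟩ := v.exists_pBasis_lt_one p hp.pos ht
  have htr := hK.transcendental p hs
  have hs0 : s ≠ 0 := by rintro rfl; exact htr isAlgebraic_zero
  obtain ⟨D, hD1, hD2, hsD, hDint, n, b, hb, hspan, hind⟩ := hK.exists_dedekind p hs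
  have hwD : ∀ w : Place F K, w.abs s ≤ 1 → ∀ x : D, w.abs (algebraMap D K x) ≤ 1 :=
    fun w hw x => w.abs_le_one_of_isIntegral hw (hDint x x.2)
  obtain ⟨u, hu, huw⟩ := v.exists_prime_to (hwD v hs1.le) (s := (⟨s, hsD⟩ : D))
    (fun h => hs0 (congrArg Subtype.val h))
  -- the pole order of the basis over the pole of `s`
  have hs' : ∀ y : K, y ^ p ≠ s⁻¹ := fun y hy => hs y⁻¹ (by rw [inv_pow, hy, inv_inv])
  have hd : ∀ i, ∃ d : ℕ, ∀ w : Place F K, 1 < w.abs s → w.abs (b i) ≤ w.abs s ^ d := by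
    intro i
    obtain ⟨c, hc0, hc⟩ := hK.exists_mul_le_one p hs' (b i)
    refine ⟨c.natTrailingDegree, fun w hw => ?_⟩
    have hw' : w.abs s⁻¹ < 1 := by rw [map_inv₀]; exact inv_lt_one_of_one_lt₀ hw
    have h1 := hc w hw'.le
    rw [map_mul, w.abs_aeval_eq hw' hc0, map_inv₀, inv_pow] at h1
    rwa [inv_mul_le_iff₀ (by positivity), mul_one] at h1
  choose d' hd' using hd
  obtain ⟨d, hd⟩ : ∃ d : ℕ, ∀ i (w : Place F K), 1 < w.abs s → w.abs (b i) ≤ w.abs s ^ d :=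
    ⟨Finset.univ.sup d', fun i w hw => (hd' i w hw).trans
      (pow_le_pow_right₀ hw.le (Finset.le_sup (Finset.mem_univ i)))⟩
  have hsum_inj : ∀ c : Fin n → F[X], ∑ i, aeval s (c i) * b i = 0 → c = 0 := by
    intro c hc
    have h1 := Fintype.linearIndependent_iff.1 hind
      (fun i => aeval (⟨s, IntermediateField.mem_adjoin_simple_self F s⟩ :
        IntermediateField.adjoin F {s}) (c i)) (by
        refine Eq.trans (Finset.sum_congr rfl fun i _ => ?_) hc
        rw [Algebra.smul_def, ← aeval_algebraMap_apply]
        rfl)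
    funext i
    have h2 := congrArg (algebraMap _ K) (h1 i)
    rw [← aeval_algebraMap_apply, map_zero] at h2
    exact transcendental_iff.1 htr _ h2
  obtain ⟨m, hm⟩ : ∃ m : ℕ, n * (m + d) + 2 ≤ n * m + (m + d) := ⟨n * d + 2, by nlinarith⟩
  set k := m + d with hk
  let W := Fin n → degreeLT F m
  let I : Ideal D := Ideal.span {(⟨s, hsD⟩ : D) ^ k}
  let bD : Fin n → D := fun i => ⟨b i, hb i⟩
  let sD : D := ⟨s, hsD⟩
  have hcoe : ∀ f : F[X], algebraMap D K (aeval sD f) = aeval s f := fun f =>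
    (aeval_algebraMap_apply K sD f).symm
  let σ : (Fin n → F[X]) →ₗ[F] D :=
    ∑ i, (LinearMap.mulRight F (bD i)) ∘ₗ (aeval sD).toLinearMap ∘ₗ LinearMap.proj i
  have hσ : ∀ c, σ c = ∑ i, aeval sD (c i) * bD i := fun c => by
    simp [σ, LinearMap.sum_apply]
  have hσK : ∀ c, algebraMap D K (σ c) = ∑ i, aeval s (c i) * b i := fun c => by
    rw [hσ, map_sum]
    exact Finset.sum_congr rfl fun i _ => by rw [map_mul, hcoe]; rfl
  let q : D →ₗ[F] D ⧸ I := (Ideal.Quotient.mkₐ F I).toLinearMap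
  have hq : ∀ x y : D, q x = q y → ∃ z : D, x - y = z * sD ^ k := fun x y h => by
    have h1 := Ideal.mem_span_singleton'.1 (Ideal.Quotient.eq.1 h)
    exact ⟨h1.choose, h1.choose_spec.symm⟩
  let incl (m : ℕ) : (Fin n → degreeLT F m) →ₗ[F] (Fin n → F[X]) :=
    LinearMap.pi fun i => (degreeLT F m).subtype ∘ₗ LinearMap.proj i
  have hsurj : Function.Surjective (q ∘ₗ σ ∘ₗ incl k) := by
    intro y
    obtain ⟨x, rfl⟩ := Ideal.Quotient.mk_surjective y
    obtain ⟨c, hc⟩ := hspan x x.2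
    refine ⟨fun i => ⟨c i %ₘ X ^ k, mem_degreeLT.2 ?_⟩, ?_⟩
    · simpa using degree_modByMonic_lt (c i) (monic_X_pow (R := F) k)
    · have hx : x = σ c := Subtype.ext (hc.trans (hσK c).symm)
      rw [hx]
      refine Ideal.Quotient.eq.2 (Ideal.mem_span_singleton'.2
        ⟨- σ (fun i => c i /ₘ X ^ k), ?_⟩)
      rw [LinearMap.comp_apply, ← map_sub, hσ, hσ, neg_mul, Finset.sum_mul, ← Finset.sum_neg_distrib]
      refine Finset.sum_congr rfl fun i _ => ?_
      have h1 := congrArg (aeval sD) (modByMonic_add_div (c i) (X ^ k))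
      simp only [map_add, map_mul, map_pow, aeval_X] at h1
      simp only [Pi.sub_apply]
      change _ = aeval sD (c i %ₘ X ^ k - c i) * bD i
      rw [map_sub, ← h1]
      ring
  have hdim : ∀ m, Module.finrank F (degreeLT F m) = m := fun m => by
    rw [(degreeLTEquiv F m).finrank_eq, Module.finrank_fin_fun]
  have hfinite : ∀ m, Module.Finite F (degreeLT F m) := fun m =>
    Module.Finite.equiv (degreeLTEquiv F m).symm
  have hQfin : Module.Finite F (D ⧸ I) := Module.Finite.of_surjective _ hsurj
  have hQ : Module.finrank F (D ⧸ I) ≤ n * k := by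
    have h1 := (q ∘ₗ σ ∘ₗ incl k).finrank_le_finrank_of_surjective hsurj
    rwa [Module.finrank_pi_fintype, Finset.sum_congr rfl fun i _ => hdim k, Finset.sum_const,
      Finset.card_univ, Fintype.card_fin, smul_eq_mul] at h1
  let Φ : ((Fin n → degreeLT F m) × degreeLT F k) →ₗ[F] D ⧸ I :=
    (q ∘ₗ σ ∘ₗ incl m).coprod
      (q ∘ₗ LinearMap.mulRight F (u ^ k) ∘ₗ (aeval sD).toLinearMap ∘ₗ (degreeLT F k).subtype)
  have hΦ : ∀ x, Φ x = 0 → ∃ z : D,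
      σ (incl m x.1) + aeval sD (x.2 : F[X]) * u ^ k = z * sD ^ k := by
    intro x hx
    have h1 : q (σ (incl m x.1) + aeval sD (x.2 : F[X]) * u ^ k) = q 0 := by
      rw [map_zero, map_add]; exact hx
    obtain ⟨z, hz⟩ := hq _ _ h1
    exact ⟨z, by rw [← hz, sub_zero]⟩
  let G : ((Fin n → degreeLT F m) × degreeLT F k) →ₗ[F] K :=
    LinearMap.mulLeft F (s⁻¹ ^ k) ∘ₗ (IsScalarTower.toAlgHom F D K).toLinearMap ∘ₗ σ ∘ₗ incl m ∘ₗ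
      LinearMap.fst F _ _
  have hG : ∀ x, G x = s⁻¹ ^ k * algebraMap D K (σ (incl m x.1)) := fun x => rfl
  have hGinj : ∀ x, Φ x = 0 → G x = 0 → x = 0 := by
    intro x hxΦ hx
    rw [hG, mul_eq_zero, or_iff_right (pow_ne_zero _ (inv_ne_zero hs0)), hσK] at hx
    have h1 := hsum_inj _ hx
    have h2 : x.1 = 0 := funext fun i => Subtype.ext (congrFun h1 i)
    obtain ⟨z, hz⟩ := hΦ x hxΦ
    rw [h2, map_zero, map_zero, zero_add] at hz
    have h3 := congrArg (fun y => v.abs (algebraMap D K y)) hz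
    simp only [map_mul, map_pow, hu, one_pow, mul_one, hcoe] at h3
    have h4 : v.abs (aeval s (x.2 : F[X])) ≤ v.abs s ^ k := by
      rw [h3]; exact mul_le_of_le_one_left (by positivity) (hwD v hs1.le z)
    have h5 : (x.2 : F[X]) = 0 := by
      by_contra h5
      rw [v.abs_aeval_eq hs1 h5, pow_le_pow_iff_right_of_lt_one₀ (v.abs.pos hs0) hs1] at h4
      have h6 := (natDegree_lt_iff_degree_lt h5).2 (mem_degreeLT.1 x.2.2)
      have h7 := natTrailingDegree_le_natDegree (x.2 : F[X])
      omega
    exact Prod.ext h2 (Subtype.ext h5)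
  have hGA : ∀ x, Φ x = 0 → G x ∈ v.A := by
    intro x hxΦ w hw
    rw [hG, map_mul, map_pow, map_inv₀, inv_pow, inv_mul_le_iff₀ (pow_pos (w.abs.pos hs0) _),
      mul_one]
    rcases le_or_gt (w.abs s) 1 with h1 | h1
    · obtain ⟨z, hz⟩ := hΦ x hxΦ
      rw [eq_sub_of_add_eq hz, map_sub, sub_eq_add_neg]
      refine (w.nonarch _ _).trans (max_le ?_ ?_)
      · rw [map_mul, map_mul, map_pow, map_pow]
        exact mul_le_of_le_one_left (by positivity) (hwD w h1 z)
      · rw [AbsoluteValue.map_neg, map_mul, map_mul, map_pow, map_pow]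
        exact (mul_le_of_le_one_left (pow_nonneg (w.abs.nonneg _) _) (hwD w h1 _)).trans
          (pow_le_pow_left₀ (w.abs.nonneg _) (huw w hw (hwD w h1)) k)
    · rw [hσK]
      refine w.abs_sum_le _ _ (by positivity) fun i _ => ?_
      have hk' : w.abs s ^ k = w.abs s ^ m * w.abs s ^ d := by rw [← pow_add]
      rw [map_mul, hk']
      refine mul_le_mul ?_ (hd i w h1) (w.abs.nonneg _) (by positivity)
      rw [aeval_eq_sum_range]
      refine w.abs_sum_le _ _ (by positivity) fun j hj => ?_
      rw [Algebra.smul_def, map_mul, map_pow]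
      refine (mul_le_of_le_one_left (by positivity) (w.abs_algebraMap_le_one _)).trans ?_
      by_cases h0 : (x.1 i : F[X]) = 0
      · have hj' : j = 0 := by
          have := Finset.mem_range.1 hj
          change j < (x.1 i : F[X]).natDegree + 1 at this
          rw [h0, natDegree_zero] at this
          omega
        rw [hj', pow_zero]
        exact one_le_pow₀ h1.le
      · refine pow_le_pow_right₀ h1.le ?_
        have h2 := (natDegree_lt_iff_degree_lt h0).2 (mem_degreeLT.1 (x.1 i).2)
        have := Finset.mem_range.1 hj
        change j < (x.1 i : F[X]).natDegree + 1 at this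
        omega
  have hdimV : Module.finrank F ((Fin n → degreeLT F m) × degreeLT F k) = n * m + k := by
    rw [Module.finrank_prod, Module.finrank_pi_fintype, Finset.sum_congr rfl fun i _ => hdim m,
      Finset.sum_const, Finset.card_univ, Fintype.card_fin, smul_eq_mul, hdim k]
  obtain ⟨x, hx, hxG⟩ := exists_not_mem_range_of_finrank Φ G (by omega) hGinj
  refine ⟨G x, hGA x hx, ?_⟩
  by_contra! hcon
  refine hxG (hK.mem_range_of_abs_le_one fun w => ?_)
  by_cases hw : w.abs.IsEquiv v.abs
  · exact hw.le_one_iff.2 hcon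
  · exact hGA x hx w hw

end Pole

end HodgePink
end

noncomputable section
namespace HodgePink

section RegularFunctions

variable {F K : Type u} [Field F] [Field K] [Algebra F K]

open Polynomial

lemma IsFunctionField.exists_uniformizer [Finite F] (hK : IsFunctionField F K) (v : Place F K) :
    ∃ ϖ : K, 0 < v.abs ϖ ∧ v.abs ϖ < 1 ∧ ∀ x : K, x ≠ 0 → ∃ k : ℤ, v.abs x = v.abs ϖ ^ k := by
  obtain ⟨p, hp, hpK⟩ := exists_char F K
  have := Fact.mk hp
  obtain ⟨t, ht⟩ := hK.exists_pow_ne p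
  obtain ⟨s, hs, hs1⟩ := v.exists_pBasis_lt_one p hp.pos ht
  obtain ⟨D, hD1, hD2, hsD, hDint, -⟩ := hK.exists_dedekind p hs
  exact v.exists_uniformizer_of_dedekind (D := D) fun x =>
    v.abs_le_one_of_isIntegral hs1.le (hDint x x.2)

lemma IsFunctionField.one_le_abs [Finite F] (hK : IsFunctionField F K) (v : Place F K) {x : K}
    (hx : x ∈ v.A) (h0 : x ≠ 0) : 1 ≤ v.abs x := by
  by_contra! h
  obtain ⟨c, rfl⟩ := hK.mem_range_of_abs_le_one (a := x) fun w => by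
    by_cases hw : w.abs.IsEquiv v.abs
    · exact hw.le_one_iff.2 h.le
    · exact hx w hw
  have hc : c ≠ 0 := by rintro rfl; simp at h0
  exact h.ne (v.trivial_on_base c hc)

/-- There is a regular function with a pole which is not a `p`-th power. -/
lemma IsFunctionField.exists_pole_pow_ne [Finite F] (hK : IsFunctionField F K) (v : Place F K)
    (p : ℕ) (hp : 1 < p) : ∃ a ∈ v.A, 1 < v.abs a ∧ ∀ y : K, y ^ p ≠ a := by
  obtain ⟨ϖ, h0, h1, hϖ⟩ := hK.exists_uniformizer v
  by_contra! hcon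
  have hval : ∀ a : K, 1 < v.abs a → ∃ k : ℕ, v.abs a = (v.abs ϖ)⁻¹ ^ k := fun a ha1 => by
    obtain ⟨k, hk⟩ := hϖ a (by rintro rfl; simp at ha1; linarith)
    have hk0 : k < 0 := by
      by_contra! hk0
      rw [hk] at ha1
      exact absurd (zpow_le_one₀ h0 h1.le hk0) (not_le.2 ha1)
    exact ⟨(-k).toNat, by rw [← zpow_natCast, Int.toNat_of_nonneg (by omega), inv_zpow', neg_neg, hk]⟩
  have hex : ∃ k : ℕ, ∃ a ∈ v.A, 1 < v.abs a ∧ v.abs a = (v.abs ϖ)⁻¹ ^ k := by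
    obtain ⟨a, ha, ha1⟩ := hK.exists_pole v
    obtain ⟨k, hk⟩ := hval a ha1
    exact ⟨k, a, ha, ha1, hk⟩
  classical
  obtain ⟨a, ha, ha1, hk⟩ := Nat.find_spec hex
  obtain ⟨y, rfl⟩ := hcon a ha ha1
  have hyA : y ∈ v.A := fun w hw => by
    have := ha w hw
    rw [map_pow] at this
    exact (pow_le_one_iff_of_nonneg (w.abs.nonneg _) (by omega)).1 this
  have hy1 : 1 < v.abs y := by
    rw [map_pow] at ha1
    exact (one_lt_pow_iff_of_nonneg (v.abs.nonneg _) (by omega)).1 ha1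
  obtain ⟨j, hj'⟩ := hval y hy1
  have hmin := Nat.find_min' hex ⟨y, hyA, hy1, hj'⟩
  rw [map_pow, hj', ← pow_mul] at hk
  have := pow_right_injective₀ (inv_pos.2 h0) (one_lt_inv_iff₀.2 ⟨h0, h1⟩).ne' hk
  have hle : j * p ≤ j := by omega
  have hj0 : 0 < j := by
    rcases Nat.eq_zero_or_pos j with rfl | h
    · rw [hj', pow_zero] at hy1
      exact absurd hy1 (lt_irrefl _)
    · exact h
  nlinarith

/-- The ring of regular functions is the integral closure of `F[a]`, for a function `a` with a pole
that is not a `p`-th power. -/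
lemma IsFunctionField.isDedekind_of_pole [Finite F] (hK : IsFunctionField F K) (v : Place F K)
    (p : ℕ) [Fact p.Prime] [CharP K p] (a : v.A) (ha1 : 1 < v.abs (a : K))
    (ha : ∀ y : K, y ^ p ≠ a) :
    IsDedekindDomain v.A ∧ IsFractionRing v.A K ∧ ∃ (n : ℕ) (b : Fin n → v.A),
      Submodule.span (Algebra.adjoin F {a}) (Set.range b) = ⊤ := by
  obtain ⟨D, hD1, hD2, haD, hDint, n, b, hb, hspan, -⟩ := hK.exists_dedekind p ha
  have hDA : D = v.A := by
    ext x
    refine ⟨fun hx w hw => w.abs_le_one_of_isIntegral (a.2 w hw) (hDint x hx), fun hx => ?_⟩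
    obtain ⟨y, rfl⟩ := Place.abs_le_one_of_ofPrime (F := F) (D := D) x fun P => hx _ fun h => by
      have h1 := Place.ofPrime_algebraMap_le_one (F := F) (K := K) P ⟨a, haD⟩
      exact absurd (h.le_one_iff.1 h1) (not_le.2 ha1)
    exact y.2
  subst hDA
  refine ⟨hD1, hD2, n, fun i => ⟨b i, hb i⟩, ?_⟩
  rw [eq_top_iff]
  intro x _
  obtain ⟨c, hc⟩ := hspan x x.2
  rw [Submodule.mem_span_range_iff_exists_fun]
  refine ⟨fun i => ⟨aeval a (c i), aeval_mem_adjoin_singleton F a⟩, Subtype.ext ?_⟩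
  rw [hc]
  rw [AddSubmonoidClass.coe_finsetSum]
  refine Finset.sum_congr rfl fun i _ => ?_
  change ((aeval a (c i) : v.A) : K) * b i = _
  congr 1
  exact (aeval_algebraMap_apply K a (c i)).symm

/-- The degree on the ring of regular functions. -/
lemma IsFunctionField.exists_degree [Finite F] (hK : IsFunctionField F K) (v : Place F K) :
    ∃ μ : v.A → ℕ, ∀ x y : v.A, v.abs (x : K) < v.abs (y : K) → μ x < μ y := by
  obtain ⟨ϖ, h0, h1, hϖ⟩ := hK.exists_uniformizer v
  have hex : ∀ x : v.A, ∃ k : ℕ, (x = 0 ∧ k = 0) ∨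
      (x ≠ 0 ∧ ∃ j : ℕ, k = j + 1 ∧ v.abs (x : K) = (v.abs ϖ)⁻¹ ^ j) := by
    intro x
    by_cases hx : x = 0
    · exact ⟨0, Or.inl ⟨hx, rfl⟩⟩
    · have hx' : (x : K) ≠ 0 := fun h => hx (Subtype.ext h)
      obtain ⟨k, hk⟩ := hϖ x hx'
      have hk0 : k ≤ 0 := by
        by_contra! hk0
        have := hK.one_le_abs v x.2 hx'
        rw [hk] at this
        exact absurd (zpow_lt_one₀ h0 h1 hk0) (not_lt.2 this)
      refine ⟨_, Or.inr ⟨hx, (-k).toNat, rfl, ?_⟩⟩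
      rw [← zpow_natCast, Int.toNat_of_nonneg (by omega), inv_zpow', neg_neg, hk]
  choose μ hμ using hex
  refine ⟨μ, fun x y hxy => ?_⟩
  rcases hμ x with ⟨rfl, hx⟩ | ⟨hx0, j, hx, hxj⟩ <;> rcases hμ y with ⟨rfl, hy⟩ | ⟨hy0, i, hy, hyi⟩
  · exact absurd hxy (lt_irrefl _)
  · omega
  · rw [ZeroMemClass.coe_zero, map_zero] at hxy
    exact absurd hxy (not_lt.2 (v.abs.nonneg _))
  · rw [hxj, hyi, pow_lt_pow_iff_right₀ (one_lt_inv_iff₀.2 ⟨h0, h1⟩)] at hxy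
    omega

/-- The leading term of a polynomial dominates at a pole. -/
lemma Place.abs_aeval_sub_lt (w : Place F K) {s : K} (hs : 1 < w.abs s) (f : F[X]) :
    w.abs (aeval s f - algebraMap F K f.leadingCoeff * s ^ f.natDegree) < w.abs s ^ f.natDegree := by
  rw [aeval_eq_sum_range, Finset.sum_range_succ, Algebra.smul_def, coeff_natDegree, add_sub_cancel_right]
  rcases Nat.eq_zero_or_pos f.natDegree with h | h
  · simp [h]
  · refine (w.abs_sum_le _ _ (r := w.abs s ^ (f.natDegree - 1)) (by positivity) fun i hi => ?_).trans_lt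
      (pow_lt_pow_right₀ hs (by omega))
    rw [Algebra.smul_def, map_mul, map_pow]
    have := Finset.mem_range.1 hi
    exact (mul_le_of_le_one_left (by positivity) (w.abs_algebraMap_le_one _)).trans
      (pow_le_pow_right₀ hs.le (by omega))

lemma Place.abs_aeval_of_one_lt (w : Place F K) {s : K} (hs : 1 < w.abs s) {f : F[X]} (hf : f ≠ 0) :
    w.abs (aeval s f) = w.abs s ^ f.natDegree := by
  have h1 := w.abs_aeval_sub_lt hs f
  have h2 : w.abs (algebraMap F K f.leadingCoeff * s ^ f.natDegree) = w.abs s ^ f.natDegree := by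
    rw [map_mul, map_pow, w.trivial_on_base _ (leadingCoeff_ne_zero.2 hf), one_mul]
  rw [← h2] at h1 ⊢
  have h3 := w.nonarch.add_eq_left_of_lt h1
  rwa [add_sub_cancel] at h3

/-- A generating family of minimal degree over `F[a]` is orthogonal. -/
lemma IsFunctionField.exists_orthogonal [Finite F] (hK : IsFunctionField F K) (v : Place F K)
    (a : v.A) (ha1 : 1 < v.abs (a : K)) {n : ℕ} (b₀ : Fin n → v.A)
    (hb₀ : Submodule.span (Algebra.adjoin F {a}) (Set.range b₀) = ⊤) :
    ∃ b : Fin n → v.A, Submodule.span (Algebra.adjoin F {a}) (Set.range b) = ⊤ ∧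
      ∀ (c : Fin n → F[X]) (i : Fin n), v.abs (aeval (a : K) (c i) * (b i : K)) ≤
        v.abs (∑ j, aeval (a : K) (c j) * (b j : K)) := by
  classical
  obtain ⟨μ, hμ⟩ := hK.exists_degree v
  obtain ⟨b, hb, hmin⟩ := WellFounded.has_min
    (measure fun b : Fin n → v.A => ∑ i, μ (b i)).wf
    {b | Submodule.span (Algebra.adjoin F {a}) (Set.range b) = ⊤} ⟨b₀, hb₀⟩
  refine ⟨b, hb, fun c i => ?_⟩
  by_contra! hlt
  obtain ⟨i₁, -, hi₁⟩ := Finset.exists_max_image Finset.univ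
    (fun i => v.abs (aeval (a : K) (c i) * (b i : K))) ⟨i, Finset.mem_univ i⟩
  set M := v.abs (aeval (a : K) (c i₁) * (b i₁ : K)) with hM
  have hM0 : v.abs (∑ j, aeval (a : K) (c j) * (b j : K)) < M :=
    hlt.trans_le (hi₁ i (Finset.mem_univ i))
  have hMpos : 0 < M := (v.abs.nonneg _).trans_lt hM0
  let S : Finset (Fin n) := Finset.univ.filter fun i => v.abs (aeval (a : K) (c i) * (b i : K)) = M
  have hS : ∀ j, j ∈ S ↔ v.abs (aeval (a : K) (c j) * (b j : K)) = M := fun j => by simp [S]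
  obtain ⟨i₀, hi₀S, hi₀⟩ := Finset.exists_max_image S (fun i => v.abs (b i : K)) ⟨i₁, (hS i₁).2 rfl⟩
  have hc0 : ∀ j ∈ S, c j ≠ 0 := fun j hj h => by
    have := (hS j).1 hj
    rw [h, map_zero, zero_mul, map_zero] at this
    exact hMpos.ne this
  have hSM : ∀ j ∈ S, v.abs (a : K) ^ (c j).natDegree * v.abs (b j : K) = M := fun j hj => by
    rw [← v.abs_aeval_of_one_lt ha1 (hc0 j hj), ← map_mul]
    exact (hS j).1 hj
  have hbpos : ∀ j ∈ S, 0 < v.abs (b j : K) := fun j hj => by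
    refine (v.abs.nonneg _).lt_of_ne fun h => hMpos.ne ?_
    rw [← hSM j hj, ← h, mul_zero]
  set d := (c i₀).natDegree with hd
  have hdeg : ∀ j ∈ S, d ≤ (c j).natDegree := fun j hj => by
    by_contra! h
    have h1 := pow_lt_pow_right₀ ha1 h
    have h2 := hSM j hj
    rw [← hSM i₀ hi₀S] at h2
    have h3 := hi₀ j hj
    have h4 := hbpos i₀ hi₀S
    have h5 : v.abs (a : K) ^ (c j).natDegree * v.abs (b j : K) ≤
      v.abs (a : K) ^ (c j).natDegree * v.abs (b i₀ : K) := by gcongr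
    have h6 : v.abs (a : K) ^ (c j).natDegree * v.abs (b i₀ : K) <
      v.abs (a : K) ^ d * v.abs (b i₀ : K) := by gcongr
    linarith
  let b' : v.A := ∑ j ∈ S, algebraMap F v.A (c j).leadingCoeff * a ^ ((c j).natDegree - d) * b j
  have hb' : v.abs (b' : K) < v.abs (b i₀ : K) := by
    have h1 : (a : K) ^ d * (b' : K) = ∑ j, aeval (a : K) (c j) * (b j : K) +
        (-(∑ j ∈ Finset.univ.filter (· ∉ S), aeval (a : K) (c j) * (b j : K)) +
        -∑ j ∈ S, (aeval (a : K) (c j) -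
          algebraMap F K (c j).leadingCoeff * (a : K) ^ (c j).natDegree) * (b j : K)) := by
      have h2 : ∑ j, aeval (a : K) (c j) * (b j : K) = ∑ j ∈ S, aeval (a : K) (c j) * (b j : K) +
          ∑ j ∈ Finset.univ.filter (· ∉ S), aeval (a : K) (c j) * (b j : K) := by
        rw [← Finset.sum_filter_add_sum_filter_not Finset.univ (· ∈ S)]
        congr 1
        exact Finset.sum_congr (by ext; simp) fun _ _ => rfl
      rw [h2]
      simp only [sub_mul, Finset.sum_sub_distrib]
      have h3 : (a : K) ^ d * (b' : K) =
          ∑ j ∈ S, algebraMap F K (c j).leadingCoeff * (a : K) ^ (c j).natDegree * (b j : K) := by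
        simp only [b', AddSubmonoidClass.coe_finsetSum, Finset.mul_sum]
        refine Finset.sum_congr rfl fun j hj => ?_
        rw [← Nat.sub_add_cancel (hdeg j hj), pow_add, Nat.add_sub_cancel]
        simp only [MulMemClass.coe_mul, SubmonoidClass.coe_pow]
        change _ * (algebraMap F K _ * _ * _) = _
        ring
      rw [h3]
      ring
    have h2 : v.abs ((a : K) ^ d * (b' : K)) < M := by
      have hsum : ∀ (U : Finset (Fin n)) (f : Fin n → K), (∀ j ∈ U, v.abs (f j) < M) →
          v.abs (-∑ j ∈ U, f j) < M := by
        intro U f hf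
        rw [AbsoluteValue.map_neg]
        induction U using Finset.induction_on with
        | empty => simpa using hMpos
        | insert j U hj ih =>
          rw [Finset.sum_insert hj]
          exact (v.nonarch _ _).trans_lt (max_lt (hf j (Finset.mem_insert_self _ _))
            (ih fun k hk => hf k (Finset.mem_insert_of_mem hk)))
      rw [h1]
      refine (v.nonarch _ _).trans_lt (max_lt hM0 ((v.nonarch _ _).trans_lt
        (max_lt (hsum _ _ fun j hj => ?_) (hsum _ _ fun j hj => ?_))))
      · refine (hi₁ j (Finset.mem_univ j)).lt_of_ne fun h => ?_
        exact (Finset.mem_filter.1 hj).2 ((hS j).2 h)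
      · rw [map_mul, ← hSM j hj]
        exact mul_lt_mul_of_pos_right (v.abs_aeval_sub_lt ha1 (c j)) (hbpos j hj)
    rw [map_mul, map_pow, ← hSM i₀ hi₀S] at h2
    exact lt_of_mul_lt_mul_left h2 (by positivity)
  refine hmin (Function.update b i₀ b') ?_ ?_
  · change Submodule.span (Algebra.adjoin F {a}) _ = ⊤
    rw [eq_top_iff, ← hb, Submodule.span_le]
    set N := Submodule.span (Algebra.adjoin F {a}) (Set.range (Function.update b i₀ b'))
    have hN : ∀ j, j ≠ i₀ → b j ∈ N := fun j hj =>
      Submodule.subset_span ⟨j, Function.update_of_ne hj _ _⟩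
    have hsmul : ∀ (r : v.A) (x : v.A), r ∈ Algebra.adjoin F {a} → x ∈ N → r * x ∈ N :=
      fun r x hr hx => N.smul_mem (⟨r, hr⟩ : Algebra.adjoin F {a}) hx
    rintro _ ⟨j, rfl⟩
    by_cases hj : j = i₀
    · subst hj
      have h1 : b' ∈ N := Submodule.subset_span ⟨j, Function.update_self _ _ _⟩
      have h2 : algebraMap F v.A (c j).leadingCoeff * b j = b' -
          ∑ k ∈ S.erase j, algebraMap F v.A (c k).leadingCoeff * a ^ ((c k).natDegree - d) * b k := by
        rw [eq_sub_iff_add_eq]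
        simp only [b']
        rw [← Finset.add_sum_erase S _ hi₀S, ← hd, Nat.sub_self, pow_zero, mul_one]
      have h3 : b j = algebraMap F v.A (c j).leadingCoeff⁻¹ *
          (algebraMap F v.A (c j).leadingCoeff * b j) := by
        rw [← mul_assoc, ← map_mul, inv_mul_cancel₀ (leadingCoeff_ne_zero.2 (hc0 j hi₀S)), map_one,
          one_mul]
      rw [h3, h2]
      refine hsmul _ _ (Subalgebra.algebraMap_mem _ _) (N.sub_mem h1 (N.sum_mem fun k hk => ?_))
      exact hsmul _ _ (mul_mem (Subalgebra.algebraMap_mem _ _)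
        (pow_mem (Algebra.self_mem_adjoin_singleton F a) _)) (hN k (Finset.ne_of_mem_erase hk))
    · exact hN j hj
  · change ∑ i, μ (Function.update b i₀ b' i) < ∑ i, μ (b i)
    refine Finset.sum_lt_sum (fun j _ => ?_) ⟨i₀, Finset.mem_univ _, ?_⟩
    · by_cases hj : j = i₀
      · subst hj
        rw [Function.update_self]
        exact (hμ _ _ hb').le
      · rw [Function.update_of_ne hj]
    · rw [Function.update_self]
      exact hμ _ _ hb'

end RegularFunctions

end HodgePink
end

noncomputable section
namespace HodgePink

section Coordinates

variable {F K : Type u} [Field F] [Field K] [Algebra F K]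

open Polynomial

/-- An orthogonal `F`-basis of the ring of regular functions which consists of the multiples
`bᵢ a ^ k` of finitely many elements by the powers of a function `a` with a pole. -/
structure Place.Coordinates (v : Place F K) where
  a : v.A
  one_lt : 1 < v.abs (a : K)
  n : ℕ
  basis : Module.Basis (Fin n × ℕ) F v.A
  basis_succ : ∀ i k, basis (i, k + 1) = a * basis (i, k)
  abs_le : ∀ (x : v.A) j, basis.repr x j ≠ 0 → v.abs (basis j : K) ≤ v.abs (x : K)
  one_le : ∀ x : v.A, x ≠ 0 → 1 ≤ v.abs (x : K)

lemma Place.transcendental_of_one_lt (v : Place F K) {a : K}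
    (ha : 1 < v.abs a) : Transcendental F a := by
  refine transcendental_iff.2 fun f hf => ?_
  by_contra h
  have h1 := v.abs_aeval_of_one_lt ha h
  rw [hf, map_zero] at h1
  exact (by positivity : (0 : ℝ) < v.abs a ^ f.natDegree).ne h1

lemma IsFunctionField.exists_coordinates [Finite F] (hK : IsFunctionField F K) (v : Place F K)
    (a : v.A) (ha1 : 1 < v.abs (a : K))
    (hspan : ∃ (n : ℕ) (b : Fin n → v.A), Submodule.span (Algebra.adjoin F {a}) (Set.range b) = ⊤) :
    ∃ x : v.Coordinates, x.a = a := by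
  classical
  obtain ⟨b₀, hb₀⟩ := Nat.find_spec hspan
  obtain ⟨b, hb, hort⟩ := hK.exists_orthogonal v a ha1 b₀ hb₀
  have hb0 : ∀ i, b i ≠ 0 := by
    intro i hi
    obtain ⟨m, hm⟩ : ∃ m, Nat.find hspan = m + 1 :=
      Nat.exists_eq_succ_of_ne_zero fun h => (h ▸ i).elim0
    refine Nat.find_min hspan (m := m) (by omega) ?_
    generalize Nat.find hspan = n at hm b i
    subst hm
    refine ⟨b ∘ i.succAbove, ?_⟩
    rw [eq_top_iff, ← hb, Submodule.span_le]
    rintro _ ⟨j, rfl⟩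
    rcases Fin.eq_self_or_eq_succAbove i j with rfl | ⟨k, rfl⟩
    · rw [hi]; exact zero_mem _
    · exact Submodule.subset_span ⟨k, rfl⟩
  have htr' : Transcendental F (a : K) := v.transcendental_of_one_lt ha1
  have htr : Transcendental F a := by
    intro h
    exact htr' (h.algebraMap (A := K))
  let e := algEquivOfTranscendental F a htr
  have he : ∀ f : F[X], (((e f : Algebra.adjoin F {a}) : v.A) : K) = aeval (a : K) f := fun f => by
    have h := aeval_algebraMap_apply v.A (⟨a, Algebra.self_mem_adjoin_singleton F a⟩ :
      Algebra.adjoin F {a}) f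
    exact (congrArg Subtype.val h.symm).trans (aeval_algebraMap_apply K a f).symm
  have hindep : LinearIndependent (Algebra.adjoin F {a}) b := by
    rw [Fintype.linearIndependent_iff]
    intro g hg i
    obtain ⟨c, rfl⟩ : ∃ c : Fin _ → F[X], g = fun i => e (c i) :=
      ⟨fun i => e.symm (g i), by simp⟩
    have h1 := hort c i
    have h2 : ∑ j, aeval (a : K) (c j) * (b j : K) = 0 := by
      have h3 := congrArg Subtype.val hg
      rw [AddSubmonoidClass.coe_finsetSum] at h3
      refine Eq.trans (Finset.sum_congr rfl fun j _ => ?_) h3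
      rw [← he]
      rfl
    rw [h2, map_zero, ← he] at h1
    have h3 := v.abs.eq_zero.1 (le_antisymm h1 (v.abs.nonneg _))
    rcases mul_eq_zero.1 h3 with h | h
    · exact Subtype.ext (Subtype.ext h)
    · exact absurd (Subtype.ext h) (hb0 i)
  let B₁ : Module.Basis (Fin (Nat.find hspan)) (Algebra.adjoin F {a}) v.A :=
    Module.Basis.mk hindep hb.ge
  let B₂ : Module.Basis ℕ F (Algebra.adjoin F {a}) := (basisMonomials F).map e.toLinearEquiv
  have hB₁ : ∀ i, B₁ i = b i := fun i => Module.Basis.mk_apply _ _ _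
  have hB₂ : ∀ k, ((B₂ k : Algebra.adjoin F {a}) : v.A) = a ^ k := fun k => by
    refine Subtype.ext ?_
    have : B₂ k = e (monomial k 1) := by simp [B₂]
    rw [this, he]
    simp [aeval_monomial]
  have hB : ∀ i k, B₂.smulTower' B₁ (i, k) = a ^ k * b i := fun i k => by
    rw [Module.Basis.smulTower'_apply, hB₁, ← hB₂]
    rfl
  refine ⟨⟨a, ha1, _, B₂.smulTower' B₁, fun i k => ?_, fun x j hj => ?_, fun x hx =>
    hK.one_le_abs v x.2 fun h => hx (Subtype.ext h)⟩, rfl⟩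
  · rw [hB, hB, pow_succ']
    ring
  · obtain ⟨i, k⟩ := j
    rw [Module.Basis.smulTower'_repr_mk] at hj
    set c : Fin _ → F[X] := fun i => e.symm (B₁.repr x i) with hc
    have hec : ∀ i, e (c i) = B₁.repr x i := fun i => e.apply_symm_apply _
    have hck : (c i).coeff k ≠ 0 := by
      have h1 : B₂.repr (B₁.repr x i) = (basisMonomials F).repr (c i) := by
        simp [B₂, hc]
      rw [h1] at hj
      exact hj
    have hx : (x : K) = ∑ j, aeval (a : K) (c j) * (b j : K) := by
      have h1 := congrArg Subtype.val (B₁.sum_repr x)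
      rw [← h1, AddSubmonoidClass.coe_finsetSum]
      refine Finset.sum_congr rfl fun j _ => ?_
      rw [← he, hec, hB₁]
      rfl
    rw [hB, hx]
    refine le_trans ?_ (hort c i)
    have hci : c i ≠ 0 := by rintro h; simp [h] at hck
    rw [MulMemClass.coe_mul, SubmonoidClass.coe_pow, map_mul, map_mul, map_pow,
      v.abs_aeval_of_one_lt ha1 hci]
    gcongr
    · exact ha1.le
    · exact le_natDegree_of_ne_zero hck

end Coordinates

/-! ### The local field -/

section Local

/-- A sum of terms with pairwise distinct absolute values is as large as each of its terms. -/
lemma norm_le_norm_sum_of_pairwise_ne {E : Type*} [SeminormedAddCommGroup E] [IsUltrametricDist E]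
    {ι : Type*} (S : Finset ι) (f : ι → E)
    (h : ∀ i ∈ S, ∀ j ∈ S, i ≠ j → ‖f i‖ ≠ 0 → ‖f i‖ ≠ ‖f j‖) {i : ι} (hi : i ∈ S) :
    ‖f i‖ ≤ ‖∑ j ∈ S, f j‖ := by
  classical
  suffices H : (∀ i ∈ S, ‖f i‖ ≤ ‖∑ j ∈ S, f j‖) ∧
      (‖∑ j ∈ S, f j‖ = 0 ∨ ∃ j ∈ S, ‖∑ j ∈ S, f j‖ = ‖f j‖) from H.1 i hi
  clear hi i
  induction S using Finset.induction_on with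
  | empty => simp
  | insert i S hi ih =>
    obtain ⟨h1, h2⟩ := ih fun j hj k hk =>
      h j (Finset.mem_insert_of_mem hj) k (Finset.mem_insert_of_mem hk)
    rw [Finset.sum_insert hi]
    by_cases hne : ‖f i‖ = ‖∑ j ∈ S, f j‖
    · have h0 : ‖f i‖ = 0 := by
        by_contra h0
        rcases h2 with h2 | ⟨j, hj, h2⟩
        · exact h0 (hne.trans h2)
        · exact h i (Finset.mem_insert_self _ _) j (Finset.mem_insert_of_mem hj)
            (by rintro rfl; exact hi hj) h0 (hne.trans h2)
      have h3 : ∀ j ∈ insert i S, ‖f j‖ = 0 := fun j hj => by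
        rcases Finset.mem_insert.1 hj with rfl | hj
        · exact h0
        · exact le_antisymm ((h1 j hj).trans (hne.symm.trans h0).le) (norm_nonneg _)
      refine ⟨fun j hj => (h3 j hj).le.trans (norm_nonneg _), Or.inl ?_⟩
      refine le_antisymm ((norm_add_le _ _).trans ?_) (norm_nonneg _)
      rw [← hne, h0, add_zero]
    · rw [IsUltrametricDist.norm_add_eq_max_of_norm_ne_norm hne]
      refine ⟨fun j hj => ?_, ?_⟩
      · rcases Finset.mem_insert.1 hj with rfl | hj
        · exact le_max_left _ _
        · exact (h1 j hj).trans (le_max_right _ _)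
      · rcases max_choice ‖f i‖ ‖∑ j ∈ S, f j‖ with h3 | h3
        · exact Or.inr ⟨i, Finset.mem_insert_self _ _, h3⟩
        · rw [h3]
          exact h2.imp_right fun ⟨j, hj, h⟩ => ⟨j, Finset.mem_insert_of_mem hj, h⟩

variable {F K : Type u} [Field F] [Field K] [Algebra F K]

instance (v : Place F K) (p : ℕ) [CharP K p] : CharP v.Kinf p :=
  charP_of_injective_algebraMap (algebraMap K v.Kinf).injective p

lemma Place.denseRange_algebraMap_Kinf (v : Place F K) : DenseRange (algebraMap K v.Kinf) := by
  have h : DenseRange ((↑) : WithAbs v.abs → v.abs.Completion) :=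
    UniformSpace.Completion.denseRange_coe
  exact h.comp (WithAbs.toAbs_surjective v.abs).denseRange (UniformSpace.Completion.continuous_coe _)

/-- A field as a vector space over itself through the `p`-th power map. -/
def FrobeniusModule (_p : ℕ) (E : Type*) : Type _ := E

namespace FrobeniusModule

variable (p : ℕ) [Fact p.Prime] (E : Type*) [NormedField E] [CharP E p]

instance : AddCommGroup (FrobeniusModule p E) := inferInstanceAs (AddCommGroup E)
instance : TopologicalSpace (FrobeniusModule p E) := inferInstanceAs (TopologicalSpace E)
instance : IsTopologicalAddGroup (FrobeniusModule p E) :=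
  inferInstanceAs (IsTopologicalAddGroup E)
instance : T2Space (FrobeniusModule p E) := inferInstanceAs (T2Space E)
instance : Module E (FrobeniusModule p E) := Module.compHom E (frobenius E p)
instance : ContinuousSMul E (FrobeniusModule p E) := ⟨by
  change Continuous fun q : E × E => q.1 ^ p * q.2
  fun_prop⟩

lemma isClosed_setOf_sum (E : Type*) [NontriviallyNormedField E] [CompleteSpace E] [CharP E p]
    (s : E) : IsClosed {x : E | ∃ b : Fin p → E, x = ∑ i, b i ^ p * s ^ (i : ℕ)} := by
  let f : Fin p → FrobeniusModule p E := fun i => (s ^ (i : ℕ) : E)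
  have : FiniteDimensional E (Submodule.span E (Set.range f)) :=
    FiniteDimensional.span_of_finite _ (Set.finite_range _)
  have h : IsClosed (Submodule.span E (Set.range f) : Set (FrobeniusModule p E)) :=
    Submodule.closed_of_finiteDimensional _
  have h2 : {x : E | ∃ b : Fin p → E, x = ∑ i, b i ^ p * s ^ (i : ℕ)} =
      (Submodule.span E (Set.range f) : Set (FrobeniusModule p E)) := by
    ext x
    refine Iff.trans ?_ (Submodule.mem_span_range_iff_exists_fun (R := E) (v := f) (x := x)).symm
    exact exists_congr fun b => eq_comm
  rw [h2]
  exact h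

end FrobeniusModule

/-- A `p`-basis of `K` is a `p`-basis of the completion. -/
lemma IsFunctionField.isPBasis_Kinf [Finite F] (hK : IsFunctionField F K) (v : Place F K) (p : ℕ)
    [hp : Fact p.Prime] [CharP K p] {t : K} (ht : ∀ y : K, y ^ p ≠ t) :
    IsPBasis p (algebraMap K v.Kinf t) := by
  have key : ∀ s : K, (∀ y : K, y ^ p ≠ s) → ∀ x : v.Kinf, ∃ b : Fin p → v.Kinf,
      x = ∑ i, b i ^ p * algebraMap K v.Kinf s ^ (i : ℕ) := by
    intro s hs
    intro x
    refine v.denseRange_algebraMap_Kinf.induction_on x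
      (FrobeniusModule.isClosed_setOf_sum p v.Kinf (algebraMap K v.Kinf s)) fun y => ?_
    obtain ⟨b, hb⟩ := exists_sum_of_mem_closure p ((hK.isPBasis p hs).mem_closure y)
    refine ⟨fun i => algebraMap K v.Kinf (b i), ?_⟩
    rw [hb, map_sum]
    exact Finset.sum_congr rfl fun i _ => by rw [map_mul, map_pow, map_pow]
  refine ⟨fun x => ?_, ?_⟩
  · obtain ⟨b, rfl⟩ := key t ht x
    refine sum_mem fun i _ => ?_
    refine mul_mem ?_ (pow_mem ?_ _)
    · exact Subring.subset_closure (Or.inl ⟨b i, rfl⟩)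
    · exact Subring.subset_closure (Or.inr (Set.mem_singleton _))
  · obtain ⟨ϖ, h0, h1, hϖ⟩ := hK.exists_uniformizer v
    have hϖ0 : ϖ ≠ 0 := by rintro rfl; simp at h0
    have hinj : ∀ m n : ℤ, v.abs ϖ ^ m = v.abs ϖ ^ n → m = n := fun m n h =>
      zpow_right_injective₀ h0 h1.ne h
    have hϖp : ∀ y : K, y ^ p ≠ ϖ := by
      rintro y rfl
      have hy : y ≠ 0 := by rintro rfl; exact hϖ0 (zero_pow hp.out.ne_zero)
      obtain ⟨k, hk⟩ := hϖ y hy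
      have h2 : v.abs (y ^ p) ^ (k * p) = v.abs (y ^ p) ^ (1 : ℤ) := by
        rw [zpow_mul, ← hk, zpow_one, map_pow, zpow_natCast]
      have h3 := hinj _ _ h2
      have h4 : (p : ℤ) ∣ 1 := ⟨k, by rw [mul_comm, h3]⟩
      have := Int.le_of_dvd one_pos h4
      have := hp.out.two_le
      omega
    intro y hy
    obtain ⟨b, hb⟩ := exists_sum_of_mem_closure p ((hK.isPBasis p hϖp).mem_closure t)
    have hb1 : ∃ i : Fin p, (i : ℕ) ≠ 0 ∧ b i ≠ 0 := by
      by_contra! hcon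
      refine ht (b ⟨0, hp.out.pos⟩) ?_
      rw [hb, Finset.sum_eq_single ⟨0, hp.out.pos⟩]
      · simp
      · intro i _ hi
        rw [hcon i fun h => hi (Fin.ext h), zero_pow hp.out.ne_zero, zero_mul]
      · simp
    obtain ⟨i, hi0, hbi⟩ := hb1
    have hdist : ∀ z : K, v.abs (b i ^ p * ϖ ^ (i : ℕ)) ≤ v.abs (t - z ^ p) := by
      intro z
      let c : Fin p → K := fun j => if (j : ℕ) = 0 then b j - z else b j
      have hc : t - z ^ p = ∑ j, c j ^ p * ϖ ^ (j : ℕ) := by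
        rw [hb, sub_eq_iff_eq_add, ← sub_eq_iff_eq_add', ← Finset.sum_sub_distrib,
          Finset.sum_eq_single ⟨0, hp.out.pos⟩]
        · simp only [c, if_true, pow_zero, mul_one]
          rw [sub_pow_char]
          ring
        · intro j _ hj
          simp only [c]
          rw [if_neg fun h => hj (Fin.ext h), sub_self]
        · simp
      have hval : ∀ j : Fin p, c j ≠ 0 → ∃ k : ℤ, v.abs (c j ^ p * ϖ ^ (j : ℕ)) =
          v.abs ϖ ^ (k * p + (j : ℕ)) := fun j hj => by
        obtain ⟨k, hk⟩ := hϖ (c j) hj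
        refine ⟨k, ?_⟩
        rw [map_mul, map_pow, map_pow, hk, zpow_add₀ h0.ne', zpow_mul, zpow_natCast, zpow_natCast]
      have h2 := norm_le_norm_sum_of_pairwise_ne Finset.univ
        (fun j => algebraMap K v.Kinf (c j ^ p * ϖ ^ (j : ℕ))) (fun j _ k _ hjk hj0 heq => by
          rw [heq] at hj0
          have hck : c k ≠ 0 := by
            intro h; rw [h, zero_pow hp.out.ne_zero, zero_mul, map_zero, norm_zero] at hj0
            exact hj0 rfl
          rw [← heq] at hj0
          have hcj : c j ≠ 0 := by
            intro h; rw [h, zero_pow hp.out.ne_zero, zero_mul, map_zero, norm_zero] at hj0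
            exact hj0 rfl
          rw [v.norm_algebraMap_Kinf, v.norm_algebraMap_Kinf] at heq
          obtain ⟨m, hm⟩ := hval j hcj
          obtain ⟨m', hm'⟩ := hval k hck
          rw [hm, hm'] at heq
          have h3 : (m * p + (j : ℕ)) % (p : ℤ) = (m' * p + (k : ℕ)) % p := by rw [hinj _ _ heq]
          rw [add_comm (m * _), add_comm (m' * _), Int.add_mul_emod_self_right,
            Int.add_mul_emod_self_right, Int.emod_eq_of_lt (by positivity) (by exact_mod_cast j.2),
            Int.emod_eq_of_lt (by positivity) (by exact_mod_cast k.2)] at h3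
          exact hjk (Fin.ext (by exact_mod_cast h3))) (Finset.mem_univ i)
      rw [← map_sum, ← hc, v.norm_algebraMap_Kinf, v.norm_algebraMap_Kinf] at h2
      simpa only [c, if_neg hi0] using h2
    have h2 : v.abs (b i ^ p * ϖ ^ (i : ℕ)) ≤ ‖algebraMap K v.Kinf t - y ^ p‖ := by
      refine v.denseRange_algebraMap_Kinf.induction_on
        (p := fun y => v.abs (b i ^ p * ϖ ^ (i : ℕ)) ≤ ‖algebraMap K v.Kinf t - y ^ p‖) y
        (isClosed_le continuous_const (by fun_prop)) fun z => ?_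
      rw [← map_pow, ← map_sub, v.norm_algebraMap_Kinf]
      exact hdist z
    rw [hy, sub_self, norm_zero] at h2
    exact absurd h2 (not_le.2 (v.abs.pos (mul_ne_zero (pow_ne_zero _ hbi) (pow_ne_zero _ hϖ0))))

end Local

end HodgePink
end

noncomputable section
namespace HodgePink

set_option linter.unusedSectionVars false

namespace Place

section GaussNorm

variable {F K : Type u} [Field F] [Fintype F] [Field K] [Algebra F K] (v : Place F K)
variable {L : Type u} [NormedField L] [Algebra F L]

lemma norm_algebraMap_base_le_one (c : F) : ‖algebraMap F L c‖ ≤ 1 := by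
  by_contra! h
  have h1 : ‖algebraMap F L c‖ ^ Fintype.card F = ‖algebraMap F L c‖ := by
    rw [← norm_pow, ← map_pow, FiniteField.pow_card]
  have h2 := pow_lt_pow_right₀ h (Fintype.one_lt_card (α := F))
  rw [h1, pow_one] at h2
  exact lt_irrefl _ h2

lemma norm_toTate (s : ℕ) (f : v.Coeff L) : ‖v.toTate L s f‖ = v.gaussNorm L s f :=
  UniformSpace.Completion.norm_coe _

lemma denseRange_toTate (s : ℕ) : DenseRange (v.toTate L s) :=
  UniformSpace.Completion.denseRange_coe (α := v.GaussRing L s)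

/-- The continuous extension of a bounded additive map to the completion of `A ⊗ L`. -/
def tateLift {E : Type*} [NormedAddCommGroup E] [CompleteSpace E] (s : ℕ) (f : v.Coeff L →+ E)
    (hf : ∀ x, ‖f x‖ ≤ v.gaussNorm L s x) : v.Tate L s →+ E :=
  (AddMonoidHom.mkNormedAddGroupHom (show v.GaussRing L s →+ E from f) 1
    fun x => (hf x).trans (one_mul _).ge).extension.toAddMonoidHom

section tateLift

variable {v} {E : Type*} [NormedAddCommGroup E] [CompleteSpace E] {s : ℕ} (f : v.Coeff L →+ E)
    (hf : ∀ x, ‖f x‖ ≤ v.gaussNorm L s x)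

lemma tateLift_toTate (x : v.Coeff L) : v.tateLift s f hf (v.toTate L s x) = f x :=
  NormedAddGroupHom.extension_coe (G := v.GaussRing L s) _ _

lemma continuous_tateLift : Continuous (v.tateLift s f hf) :=
  NormedAddGroupHom.continuous (AddMonoidHom.mkNormedAddGroupHom
    (show v.GaussRing L s →+ E from f) 1 fun x => (hf x).trans (one_mul _).ge).extension

lemma norm_tateLift_le (t : v.Tate L s) : ‖v.tateLift s f hf t‖ ≤ ‖t‖ := by
  refine v.tate_induction t (isClosed_le (continuous_tateLift f hf).norm continuous_norm) fun g => ?_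
  rw [tateLift_toTate, norm_toTate]
  exact hf g

end tateLift

variable (L) in
/-- The restriction to a smaller disc. -/
def res {s s' : ℕ} (h : s' ≤ s) : v.Tate L s →+* v.Tate L s' :=
  v.tateMap (AlgHom.id F L) (fun _ _ => le_rfl) h

lemma res_toTate {s s' : ℕ} (h : s' ≤ s) (f : v.Coeff L) :
    v.res L h (v.toTate L s f) = v.toTate L s' f :=
  (v.tateMap_toTate _ _ _ f).trans (congrArg _ (v.coeffMap_id f))

lemma continuous_res {s s' : ℕ} (h : s' ≤ s) : Continuous (v.res L h) := v.continuous_tateMap _ _ _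

lemma tate_ext {s : ℕ} {E : Type*} [TopologicalSpace E] [T2Space E] {f g : v.Tate L s → E}
    (hf : Continuous f) (hg : Continuous g) (h : ∀ x, f (v.toTate L s x) = g (v.toTate L s x))
    (t : v.Tate L s) : f t = g t :=
  v.tate_induction t (isClosed_eq hf hg) h

namespace Coordinates

variable {v} (x : v.Coordinates)

section Algebraic

variable {L : Type u} [Field L] [Algebra F L]

/-- The coordinates of an element of `A ⊗ L` for the `L`-basis `eⱼ ⊗ 1`. -/
def coord (L : Type u) [Field L] [Algebra F L] : v.Coeff L ≃+ (Fin x.n × ℕ →₀ L) :=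
  (TensorProduct.equivFinsuppOfBasisLeft (N := L) x.basis).toAddEquiv

lemma coord_tens (a : v.A) (l : L) (j : Fin x.n × ℕ) :
    x.coord L (v.tens a l) j = x.basis.repr a j • l :=
  TensorProduct.equivFinsuppOfBasisLeft_apply_tmul_apply _ _ _ _

lemma coord_tens_basis (j : Fin x.n × ℕ) (l : L) :
    x.coord L (v.tens (x.basis j) l) = Finsupp.single j l := by
  classical
  ext i
  rw [coord_tens, x.basis.repr_self, Finsupp.single_apply, Finsupp.single_apply]
  split_ifs <;> simp

lemma sum_coord (f : v.Coeff L) :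
    (x.coord L f).sum (fun j l => v.tens (x.basis j) l) = f := by
  refine Eq.trans ?_ ((TensorProduct.equivFinsuppOfBasisLeft (N := L) x.basis).symm_apply_apply f)
  exact (TensorProduct.equivFinsuppOfBasisLeft_symm_apply _ _).symm

@[elab_as_elim]
lemma coord_induction {p : v.Coeff L → Prop} (f : v.Coeff L) (h0 : p 0)
    (h1 : ∀ j l, p (v.tens (x.basis j) l)) (h2 : ∀ f g, p f → p g → p (f + g)) : p f := by
  rw [← x.sum_coord f, Finsupp.sum]
  exact Finset.sum_induction _ p h2 h0 fun j _ => h1 _ _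

lemma coord_coeffMap {L' : Type u} [Field L'] [Algebra F L']
    (φ : L →ₐ[F] L') (f : v.Coeff L) (j : Fin x.n × ℕ) :
    x.coord L' (v.coeffMap φ f) j = φ (x.coord L f j) := by
  refine v.coeff_induction f (by simp) (fun a l => ?_) fun f g hf hg => ?_
  · rw [coeffMap_tens, coord_tens, coord_tens, map_smul]
  · simp only [map_add, Finsupp.add_apply, hf, hg]

end Algebraic

/-- The absolute value of a basis element. -/
def w (j : Fin x.n × ℕ) : ℝ := v.abs (x.basis j : K)

lemma one_le_w (j : Fin x.n × ℕ) : 1 ≤ x.w j := x.one_le _ (x.basis.ne_zero j)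

lemma w_pos (j : Fin x.n × ℕ) : 0 < x.w j := zero_lt_one.trans_le (x.one_le_w j)

lemma w_succ (i : Fin x.n) (k : ℕ) : x.w (i, k + 1) = v.abs (x.a : K) * x.w (i, k) := by
  rw [w, basis_succ, MulMemClass.coe_mul, map_mul]; rfl

lemma w_eq (i : Fin x.n) (k : ℕ) : x.w (i, k) = v.abs (x.a : K) ^ k * x.w (i, 0) := by
  induction k with
  | zero => simp
  | succ k ih => rw [w_succ, ih, pow_succ']; ring

lemma tens_basis_mem_gaussBall {s : ℕ} {r : ℝ} {j : Fin x.n × ℕ} {l : L}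
    (h : ‖l‖ * x.w j ^ s ≤ r) : v.tens (x.basis j) l ∈ v.gaussBall L s r := by
  refine AddSubgroup.subset_closure ⟨_, _, rfl, ?_⟩
  rwa [max_eq_right (show 1 ≤ v.abs (x.basis j : K) from x.one_le_w j)]

variable [IsUltrametricDist L]

lemma mem_gaussBall_iff {s : ℕ} {r : ℝ} (hr : 0 ≤ r) {f : v.Coeff L} :
    f ∈ v.gaussBall L s r ↔ ∀ j, ‖x.coord L f j‖ * x.w j ^ s ≤ r := by
  constructor
  · intro hf j
    induction hf using AddSubgroup.closure_induction with
    | zero => simpa using hr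
    | add f g _ _ hf hg =>
      rw [map_add, Finsupp.add_apply]
      have h1 : ‖x.coord L f j + x.coord L g j‖ ≤ max ‖x.coord L f j‖ ‖x.coord L g j‖ :=
        IsUltrametricDist.norm_add_le_max _ _
      have h2 : 0 ≤ x.w j ^ s := pow_nonneg (x.w_pos j).le s
      refine (mul_le_mul_of_nonneg_right h1 h2).trans ?_
      rw [max_mul_of_nonneg _ _ h2]
      exact max_le hf hg
    | neg f _ hf => rwa [map_neg, Finsupp.neg_apply, norm_neg]
    | mem f hf =>
      obtain ⟨a, l, rfl, hl⟩ := hf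
      rw [coord_tens, Algebra.smul_def, norm_mul]
      by_cases h0 : x.basis.repr a j = 0
      · simpa [h0] using hr
      · refine le_trans ?_ hl
        have h1 := x.abs_le a j h0
        have h2 := x.w_pos j
        calc ‖algebraMap F L (x.basis.repr a j)‖ * ‖l‖ * x.w j ^ s ≤ 1 * ‖l‖ * x.w j ^ s := by
              gcongr
              exact norm_algebraMap_base_le_one _
          _ ≤ ‖l‖ * max 1 (v.abs (a : K)) ^ s := by
              rw [one_mul]
              gcongr
              exact h1.trans (le_max_right _ _)
  · intro h
    rw [← x.sum_coord f]
    exact sum_mem fun j _ => x.tens_basis_mem_gaussBall (h j)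

lemma gaussNorm_le_iff {s : ℕ} {r : ℝ} (hr : 0 ≤ r) {f : v.Coeff L} :
    v.gaussNorm L s f ≤ r ↔ ∀ j, ‖x.coord L f j‖ * x.w j ^ s ≤ r := by
  refine ⟨fun h j => le_of_forall_gt_imp_ge_of_dense fun r' hr' => ?_, fun h =>
    v.gaussNorm_le hr ((x.mem_gaussBall_iff hr).2 h)⟩
  exact (x.mem_gaussBall_iff (hr.trans hr'.le)).1 (v.mem_gaussBall_of_lt (h.trans_lt hr')) j

lemma norm_coord_le (s : ℕ) (f : v.Coeff L) (j : Fin x.n × ℕ) :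
    ‖x.coord L f j‖ * x.w j ^ s ≤ v.gaussNorm L s f :=
  (x.gaussNorm_le_iff (v.gaussNorm_nonneg s f)).1 le_rfl j

lemma gaussNorm_tens_basis_le (s : ℕ) (j : Fin x.n × ℕ) (l : L) :
    v.gaussNorm L s (v.tens (x.basis j) l) ≤ ‖l‖ * x.w j ^ s :=
  v.gaussNorm_le (mul_nonneg (norm_nonneg _) (pow_nonneg (x.w_pos j).le s))
    (x.tens_basis_mem_gaussBall le_rfl)

include x in
lemma gaussNorm_add_le_max (s : ℕ) (f g : v.Coeff L) :
    v.gaussNorm L s (f + g) ≤ max (v.gaussNorm L s f) (v.gaussNorm L s g) := by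
  refine v.gaussNorm_le ((v.gaussNorm_nonneg s f).trans (le_max_left _ _)) (add_mem ?_ ?_)
  · exact v.gaussBall_mono s (le_max_left _ _)
      ((x.mem_gaussBall_iff (v.gaussNorm_nonneg s f)).2 fun j => x.norm_coord_le s f j)
  · exact v.gaussBall_mono s (le_max_right _ _)
      ((x.mem_gaussBall_iff (v.gaussNorm_nonneg s g)).2 fun j => x.norm_coord_le s g j)

include x in
lemma isUltrametricDist_tate (s : ℕ) : IsUltrametricDist (v.Tate L s) := by
  refine IsUltrametricDist.isUltrametricDist_of_isNonarchimedean_norm fun t t' => ?_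
  refine v.tate_induction t (isClosed_le (by fun_prop) (by fun_prop)) fun f => ?_
  refine v.tate_induction t' (isClosed_le (by fun_prop) (by fun_prop)) fun g => ?_
  rw [← map_add, norm_toTate, norm_toTate, norm_toTate]
  exact x.gaussNorm_add_le_max s f g

variable [CompleteSpace L]

/-- The coordinates of an element of the completion of `A ⊗ L`. -/
def coordT (L : Type u) [NormedField L] [Algebra F L] [IsUltrametricDist L] [CompleteSpace L]
    (s : ℕ) (j : Fin x.n × ℕ) : v.Tate L s →+ L :=
  v.tateLift s ((Finsupp.applyAddHom j).comp (x.coord L).toAddMonoidHom) fun f =>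
    (le_mul_of_one_le_right (norm_nonneg _) (one_le_pow₀ (x.one_le_w j))).trans
      (x.norm_coord_le s f j)

lemma coordT_toTate (s : ℕ) (j : Fin x.n × ℕ) (f : v.Coeff L) :
    x.coordT L s j (v.toTate L s f) = x.coord L f j := tateLift_toTate _ _ f

lemma continuous_coordT (s : ℕ) (j : Fin x.n × ℕ) : Continuous (x.coordT L s j) :=
  continuous_tateLift _ _

lemma norm_coordT_le (s : ℕ) (j : Fin x.n × ℕ) (t : v.Tate L s) :
    ‖x.coordT L s j t‖ * x.w j ^ s ≤ ‖t‖ := by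
  refine v.tate_induction t (isClosed_le ((x.continuous_coordT s j).norm.mul continuous_const)
    continuous_norm) fun g => ?_
  rw [coordT_toTate, norm_toTate]
  exact x.norm_coord_le s g j

lemma norm_le_iff {s : ℕ} {r : ℝ} (hr : 0 ≤ r) {t : v.Tate L s} :
    ‖t‖ ≤ r ↔ ∀ j, ‖x.coordT L s j t‖ * x.w j ^ s ≤ r := by
  refine ⟨fun h j => (x.norm_coordT_le s j t).trans h, fun h => ?_⟩
  have := x.isUltrametricDist_tate (L := L) s
  refine le_of_forall_pos_le_add fun ε hε => ?_
  obtain ⟨f, hf⟩ := (v.denseRange_toTate (L := L) s).exists_dist_lt t hε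
  rw [dist_eq_norm] at hf
  have h1 : ‖v.toTate L s f‖ ≤ r + ε := by
    rw [norm_toTate, x.gaussNorm_le_iff (by positivity)]
    intro j
    have h2 := x.norm_coordT_le s j (t - v.toTate L s f)
    rw [map_sub, coordT_toTate, norm_sub_rev] at h2
    have h3 : ‖x.coord L f j‖ ≤ ‖x.coord L f j - x.coordT L s j t‖ + ‖x.coordT L s j t‖ := by
      have := norm_add_le (x.coord L f j - x.coordT L s j t) (x.coordT L s j t)
      rwa [sub_add_cancel] at this
    have h4 := mul_le_mul_of_nonneg_right h3 (pow_nonneg (x.w_pos j).le s)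
    rw [add_mul] at h4
    linarith [h j]
  have h2 := IsUltrametricDist.norm_add_le_max (t - v.toTate L s f) (v.toTate L s f)
  rw [sub_add_cancel] at h2
  exact h2.trans (max_le (hf.le.trans (by linarith)) h1)

lemma coordT_ext {s : ℕ} {t t' : v.Tate L s} (h : ∀ j, x.coordT L s j t = x.coordT L s j t') :
    t = t' := by
  rw [← sub_eq_zero, ← norm_le_zero_iff, x.norm_le_iff le_rfl]
  intro j
  rw [map_sub, h, sub_self, norm_zero, zero_mul]

variable {L' : Type u} [NormedField L'] [Algebra F L'] [IsUltrametricDist L'] [CompleteSpace L']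

omit [IsUltrametricDist L] [CompleteSpace L] [IsUltrametricDist L'] [CompleteSpace L'] in
lemma continuous_of_norm_le (φ : L →ₐ[F] L') (hφ : ∀ l, ‖l‖ ≤ 1 → ‖φ l‖ ≤ ‖l‖) :
    Continuous φ := by
  refine continuous_of_continuousAt_zero φ ?_
  rw [Metric.continuousAt_iff]
  intro ε hε
  refine ⟨min ε 1, by positivity, fun {l} hl => ?_⟩
  rw [map_zero, dist_zero_right]
  rw [dist_zero_right] at hl
  exact (hφ l (hl.le.trans (min_le_right _ _))).trans_lt (hl.trans_le (min_le_left _ _))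

lemma coordT_tateMap (φ : L →ₐ[F] L') (hφ : ∀ l, ‖l‖ ≤ 1 → ‖φ l‖ ≤ ‖l‖) {s s' : ℕ} (h : s' ≤ s)
    (t : v.Tate L s) (j : Fin x.n × ℕ) :
    x.coordT L' s' j (v.tateMap φ hφ h t) = φ (x.coordT L s j t) := by
  refine v.tate_ext (f := fun t => x.coordT L' s' j (v.tateMap φ hφ h t))
    (g := fun t => φ (x.coordT L s j t))
    ((x.continuous_coordT s' j).comp (v.continuous_tateMap φ hφ h))
    ((continuous_of_norm_le φ hφ).comp (x.continuous_coordT s j)) (fun f => ?_) t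
  rw [tateMap_toTate, coordT_toTate, coordT_toTate, coord_coeffMap]

lemma coordT_res {s s' : ℕ} (h : s' ≤ s) (t : v.Tate L s) (j : Fin x.n × ℕ) :
    x.coordT L s' j (v.res L h t) = x.coordT L s j t := x.coordT_tateMap _ _ h t j

include x in
lemma tateMap_injective (φ : L →ₐ[F] L') (hφ : ∀ l, ‖l‖ ≤ 1 → ‖φ l‖ ≤ ‖l‖) {s s' : ℕ}
    (h : s' ≤ s) : Function.Injective (v.tateMap φ hφ h) := fun t t' htt' =>
  x.coordT_ext fun j => φ.toRingHom.injective (by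
    have := congrArg (x.coordT L' s' j) htt'
    rwa [coordT_tateMap, coordT_tateMap] at this)

include x in
lemma norm_tateMap (φ : L →ₐ[F] L') (hφ : ∀ l, ‖φ l‖ = ‖l‖) (s : ℕ) (t : v.Tate L s) :
    ‖v.tateMap φ (fun l _ => (hφ l).le) le_rfl t‖ = ‖t‖ := by
  refine le_antisymm ((x.norm_le_iff (norm_nonneg _)).2 fun j => ?_)
    ((x.norm_le_iff (norm_nonneg _)).2 fun j => ?_)
  · rw [coordT_tateMap, hφ]
    exact x.norm_coordT_le s j t
  · rw [← hφ, ← x.coordT_tateMap φ (fun l _ => (hφ l).le) le_rfl t j]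
    exact x.norm_coordT_le s j _

end Coordinates

end GaussNorm

end Place
end HodgePink
end

noncomputable section
namespace HodgePink

set_option linter.unusedSectionVars false

namespace Place
namespace Coordinates

section Division

variable {F K : Type u} [Field F] [Fintype F] [Field K] [Algebra F K] {v : Place F K}
  (x : v.Coordinates) (L : Type u)

section Algebraic

variable [Field L] [Algebra F L] [Algebra K L]

/-- The image in `L` of the coordinate function. -/
def θ : L := algebraMap K L (x.a : K)

/-- The function `a ⊗ 1 - 1 ⊗ a` on `Spec (A ⊗ L)`, which vanishes at `𝔧`. -/
def z : v.Coeff L := v.tens x.a 1 - v.tens 1 (x.θ L)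

lemma z_mem [IsScalarTower F K L] : x.z L ∈ v.jIdeal L := by
  rw [jIdeal, RingHom.mem_ker, z, map_sub, mulMap_tens, mulMap_tens]
  simp [θ]

lemma z_mul_tens_basis (i : Fin x.n) (k : ℕ) (l : L) :
    x.z L * v.tens (x.basis (i, k)) l =
      v.tens (x.basis (i, k + 1)) l - v.tens (x.basis (i, k)) (x.θ L * l) := by
  rw [z, sub_mul, tens_mul_tens, tens_mul_tens, basis_succ, one_mul, one_mul]

/-- The tensor `a ⊗ l` is additive in `l`. -/
def tensHom (a : v.A) : L →+ v.Coeff L where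
  toFun := v.tens a
  map_zero' := TensorProduct.tmul_zero L a
  map_add' := TensorProduct.tmul_add a

/-- The division with remainder by `a ⊗ 1 - 1 ⊗ a`. -/
def divZ : v.Coeff L →+ v.Coeff L :=
  (Finsupp.liftAddHom fun j : Fin x.n × ℕ => ∑ m ∈ Finset.range j.2,
    (tensHom L (x.basis (j.1, m))).comp (AddMonoidHom.mulLeft (x.θ L ^ (j.2 - 1 - m)))).comp
      (x.coord L).toAddMonoidHom

/-- The coefficients of the remainder of the division by `a ⊗ 1 - 1 ⊗ a`. -/
def modZ (i : Fin x.n) : v.Coeff L →+ L :=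
  (Finsupp.liftAddHom fun j : Fin x.n × ℕ => if j.1 = i then AddMonoidHom.mulLeft (x.θ L ^ j.2)
    else 0).comp (x.coord L).toAddMonoidHom

lemma divZ_tens (i : Fin x.n) (k : ℕ) (l : L) : x.divZ L (v.tens (x.basis (i, k)) l) =
    ∑ m ∈ Finset.range k, v.tens (x.basis (i, m)) (x.θ L ^ (k - 1 - m) * l) := by
  change Finsupp.liftAddHom _ (x.coord L (v.tens (x.basis (i, k)) l)) = _
  rw [coord_tens_basis, Finsupp.liftAddHom_apply_single, AddMonoidHom.finsetSum_apply]
  rfl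

lemma modZ_tens (i' i : Fin x.n) (k : ℕ) (l : L) : x.modZ L i' (v.tens (x.basis (i, k)) l) =
    if i = i' then x.θ L ^ k * l else 0 := by
  change Finsupp.liftAddHom _ (x.coord L (v.tens (x.basis (i, k)) l)) = _
  rw [coord_tens_basis, Finsupp.liftAddHom_apply_single]
  split_ifs <;> rfl

lemma divZ_mul (f : v.Coeff L) : x.divZ L (x.z L * f) = f := by
  refine x.coord_induction f (by simp) (fun ⟨i, k⟩ l => ?_) fun f g hf hg => by
    rw [mul_add, map_add, hf, hg]
  rw [z_mul_tens_basis, map_sub, divZ_tens, divZ_tens, Finset.sum_range_succ, sub_eq_iff_eq_add,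
    Nat.add_sub_cancel, Nat.sub_self, pow_zero, one_mul, add_comm]
  congr 1
  refine Finset.sum_congr rfl fun m hm => ?_
  rw [← mul_assoc, ← pow_succ]
  congr 3
  have := Finset.mem_range.1 hm
  omega

lemma modZ_mul (i : Fin x.n) (f : v.Coeff L) : x.modZ L i (x.z L * f) = 0 := by
  refine x.coord_induction f (by simp) (fun ⟨i, k⟩ l => ?_) fun f g hf hg => by
    rw [mul_add, map_add, hf, hg, add_zero]
  rw [z_mul_tens_basis, map_sub, modZ_tens, modZ_tens]
  split_ifs
  · ring
  · simp

/-- The remainder as an element of `A ⊗ L`. -/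
def remZ (c : Fin x.n → L) : v.Coeff L := ∑ i, v.tens (x.basis (i, 0)) (c i)

lemma remZ_add (c c' : Fin x.n → L) : x.remZ L (c + c') = x.remZ L c + x.remZ L c' := by
  rw [remZ, remZ, remZ, ← Finset.sum_add_distrib]
  exact Finset.sum_congr rfl fun i _ => map_add (tensHom L (x.basis (i, 0))) _ _

lemma remZ_add_mul_divZ (f : v.Coeff L) :
    x.remZ L (fun i => x.modZ L i f) + x.z L * x.divZ L f = f := by
  refine x.coord_induction f ?_ (fun ⟨i, k⟩ l => ?_) fun f g hf hg => ?_
  · simp only [map_zero, mul_zero, add_zero, remZ]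
    exact Finset.sum_eq_zero fun i _ => map_zero (tensHom L (x.basis (i, 0)))
  · have h1 : x.remZ L (fun i' => x.modZ L i' (v.tens (x.basis (i, k)) l)) =
        v.tens (x.basis (i, 0)) (x.θ L ^ k * l) := by
      rw [remZ, Finset.sum_eq_single i]
      · rw [modZ_tens, if_pos rfl]
      · intro i' _ hi'
        rw [modZ_tens, if_neg (Ne.symm hi')]
        exact map_zero (tensHom L (x.basis (i', 0)))
      · simp
    rw [h1, divZ_tens]
    induction k with
    | zero => simp
    | succ k ih =>
      have h2 : ∑ m ∈ Finset.range (k + 1),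
          v.tens (x.basis (i, m)) (x.θ L ^ (k + 1 - 1 - m) * l) =
          v.tens (x.basis (i, k)) l + v.tens 1 (x.θ L) *
            ∑ m ∈ Finset.range k, v.tens (x.basis (i, m)) (x.θ L ^ (k - 1 - m) * l) := by
        rw [Finset.sum_range_succ, Nat.add_sub_cancel, Nat.sub_self, pow_zero, one_mul, add_comm,
          Finset.mul_sum]
        congr 1
        refine Finset.sum_congr rfl fun m hm => ?_
        rw [tens_mul_tens, one_mul, ← mul_assoc, ← pow_succ']
        congr 3
        have := Finset.mem_range.1 hm
        omega
      have h3 : v.tens (x.basis (i, 0)) (x.θ L ^ (k + 1) * l) =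
          v.tens 1 (x.θ L) * v.tens (x.basis (i, 0)) (x.θ L ^ k * l) := by
        rw [tens_mul_tens, one_mul, ← mul_assoc, ← pow_succ']
      have h4 := ih (by rw [remZ, Finset.sum_eq_single i]
                        · rw [modZ_tens, if_pos rfl]
                        · intro i' _ hi'
                          rw [modZ_tens, if_neg (Ne.symm hi')]
                          exact map_zero (tensHom L (x.basis (i', 0)))
                        · simp)
      rw [h2, h3, mul_add, mul_left_comm, ← add_assoc, add_right_comm, ← mul_add, h4,
        tens_mul_tens, one_mul, z_mul_tens_basis]
      ring
  · have h : (fun i => x.modZ L i (f + g)) =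
        (fun i => x.modZ L i f) + fun i => x.modZ L i g := by ext i; simp
    rw [h, remZ_add, map_add, mul_add]
    nth_rewrite 3 [← hf]
    nth_rewrite 3 [← hg]
    ring

end Algebraic

variable [NormedField L] [Algebra F L] [Algebra K L] [IsUltrametricDist L]
  (hL : ∀ c : K, ‖algebraMap K L c‖ = v.abs c)
include hL

lemma gaussNorm_divZ_le {s : ℕ} (hs : 1 ≤ s) (f : v.Coeff L) :
    v.gaussNorm L s (x.divZ L f) ≤ v.gaussNorm L s f := by
  have hα : ‖x.θ L‖ = v.abs (x.a : K) := hL _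
  have hr := v.gaussNorm_nonneg s f
  have key : ∀ i k l, ‖l‖ * x.w (i, k) ^ s ≤ v.gaussNorm L s f →
      x.divZ L (v.tens (x.basis (i, k)) l) ∈ v.gaussBall L s (v.gaussNorm L s f) := by
    intro i k l hl
    rw [divZ_tens]
    refine sum_mem fun m hm => x.tens_basis_mem_gaussBall (le_trans ?_ hl)
    have hm' := Finset.mem_range.1 hm
    have h0 := x.w_pos (i, m)
    have h1 : x.w (i, k) = v.abs (x.a : K) ^ (k - m) * x.w (i, m) := by
      rw [x.w_eq i k, x.w_eq i m, ← mul_assoc, ← pow_add, Nat.sub_add_cancel hm'.le]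
    have h2 := x.one_lt
    rw [norm_mul, norm_pow, hα, h1, mul_pow, ← pow_mul]
    calc v.abs (x.a : K) ^ (k - 1 - m) * ‖l‖ * x.w (i, m) ^ s
        ≤ v.abs (x.a : K) ^ ((k - m) * s) * ‖l‖ * x.w (i, m) ^ s := by
          gcongr
          · exact h2.le
          · nlinarith [Nat.sub_le_sub_right (Nat.sub_le k 1) m]
      _ = _ := by ring
  refine v.gaussNorm_le hr ?_
  have h1 := congrArg (x.divZ L) (x.sum_coord f)
  rw [← h1, Finsupp.sum, map_sum]
  exact sum_mem fun j _ => key _ _ _ (x.norm_coord_le s f j)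

lemma norm_modZ_le {s : ℕ} (hs : 1 ≤ s) (i : Fin x.n) (f : v.Coeff L) :
    ‖x.modZ L i f‖ ≤ v.gaussNorm L s f := by
  have hα : ‖x.θ L‖ = v.abs (x.a : K) := hL _
  conv_lhs => rw [← x.sum_coord f]
  rw [Finsupp.sum, map_sum]
  refine IsUltrametricDist.norm_sum_le_of_forall_le_of_nonneg (v.gaussNorm_nonneg s f) fun j _ => ?_
  rw [modZ_tens]
  split_ifs
  · refine le_trans ?_ (x.norm_coord_le s f j)
    rw [norm_mul, norm_pow, hα, mul_comm, show j = (j.1, j.2) from rfl, x.w_eq j.1 j.2]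
    have h1 := x.one_le_w (j.1, 0)
    have h2 : v.abs (x.a : K) ^ j.2 ≤ v.abs (x.a : K) ^ j.2 * x.w (j.1, 0) :=
      le_mul_of_one_le_right (by positivity) h1
    have h3 : 1 ≤ v.abs (x.a : K) ^ j.2 * x.w (j.1, 0) := by
      rw [← x.w_eq]; exact x.one_le_w _
    gcongr
    exact h2.trans (le_self_pow₀ h3 (by omega))
  · rw [norm_zero]; exact v.gaussNorm_nonneg s f

variable [CompleteSpace L]

/-- The quotient of the division by `a ⊗ 1 - 1 ⊗ a` in the completions of `A ⊗ L`. -/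
def divZT (s : ℕ) (hs : 1 ≤ s) : v.Tate L s →+ v.Tate L s :=
  v.tateLift s ((v.toTate L s).toAddMonoidHom.comp (x.divZ L)) fun f => by
    refine (v.norm_toTate s _).le.trans ?_
    exact x.gaussNorm_divZ_le L hL hs f

/-- The remainder of the division by `a ⊗ 1 - 1 ⊗ a` in the completions of `A ⊗ L`. -/
def modZT (s : ℕ) (hs : 1 ≤ s) (i : Fin x.n) : v.Tate L s →+ L :=
  v.tateLift s (x.modZ L i) fun f => x.norm_modZ_le L hL hs i f

lemma divZT_toTate (s : ℕ) (hs : 1 ≤ s) (f : v.Coeff L) :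
    x.divZT L hL s hs (v.toTate L s f) = v.toTate L s (x.divZ L f) := tateLift_toTate _ _ f

lemma modZT_toTate (s : ℕ) (hs : 1 ≤ s) (i : Fin x.n) (f : v.Coeff L) :
    x.modZT L hL s hs i (v.toTate L s f) = x.modZ L i f := tateLift_toTate _ _ f

lemma continuous_divZT (s : ℕ) (hs : 1 ≤ s) : Continuous (x.divZT L hL s hs) :=
  continuous_tateLift _ _

lemma continuous_modZT (s : ℕ) (hs : 1 ≤ s) (i : Fin x.n) : Continuous (x.modZT L hL s hs i) :=
  continuous_tateLift _ _

lemma divZT_mul (s : ℕ) (hs : 1 ≤ s) (t : v.Tate L s) :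
    x.divZT L hL s hs (v.toTate L s (x.z L) * t) = t :=
  v.tate_ext ((x.continuous_divZT L hL s hs).comp (continuous_const.mul continuous_id))
    continuous_id (fun f => by
      change x.divZT L hL s hs (v.toTate L s (x.z L) * v.toTate L s f) = _
      rw [← map_mul, divZT_toTate, divZ_mul]
      rfl) t

lemma modZT_mul (s : ℕ) (hs : 1 ≤ s) (i : Fin x.n) (t : v.Tate L s) :
    x.modZT L hL s hs i (v.toTate L s (x.z L) * t) = 0 :=
  v.tate_ext (g := fun _ => 0) ((x.continuous_modZT L hL s hs i).comp
    (continuous_const.mul continuous_id)) continuous_const (fun f => by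
      change x.modZT L hL s hs i (v.toTate L s (x.z L) * v.toTate L s f) = _
      rw [← map_mul, modZT_toTate, modZ_mul]) t

lemma continuous_toTate_remZ (s : ℕ) : Continuous fun c => v.toTate L s (x.remZ L c) := by
  have h1 : ∀ i, Continuous fun l : L => v.toTate L s (v.tens (x.basis (i, 0)) l) := fun i => by
    refine ((((v.toTate L s).toAddMonoidHom.comp (tensHom L (x.basis (i, 0)))).mkNormedAddGroupHom
      (x.w (i, 0) ^ s) fun l => ?_)).continuous
    refine (v.norm_toTate s _).le.trans ((x.gaussNorm_tens_basis_le s _ l).trans (mul_comm _ _).le)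
  simp only [remZ, map_sum]
  exact continuous_finsetSum _ fun i _ => (h1 i).comp (continuous_apply i)

lemma remZ_add_mul_divZT (s : ℕ) (hs : 1 ≤ s) (t : v.Tate L s) :
    v.toTate L s (x.remZ L fun i => x.modZT L hL s hs i t) +
      v.toTate L s (x.z L) * x.divZT L hL s hs t = t :=
  v.tate_ext (((x.continuous_toTate_remZ L hL s).comp
    (continuous_pi fun i => x.continuous_modZT L hL s hs i)).add
      (continuous_const.mul (x.continuous_divZT L hL s hs))) continuous_id (fun f => by
      change v.toTate L s (x.remZ L fun i => x.modZT L hL s hs i (v.toTate L s f)) +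
        v.toTate L s (x.z L) * x.divZT L hL s hs (v.toTate L s f) = _
      simp only [modZT_toTate, divZT_toTate]
      rw [← map_mul, ← map_add, remZ_add_mul_divZ]
      rfl) t

lemma res_divZT {s s' : ℕ} (hs : 1 ≤ s) (hs' : 1 ≤ s') (h : s' ≤ s) (t : v.Tate L s) :
    v.res L h (x.divZT L hL s hs t) = x.divZT L hL s' hs' (v.res L h t) :=
  v.tate_ext ((v.continuous_res h).comp (x.continuous_divZT L hL s hs))
    ((x.continuous_divZT L hL s' hs').comp (v.continuous_res h)) (fun f => by
      change v.res L h (x.divZT L hL s hs (v.toTate L s f)) =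
        x.divZT L hL s' hs' (v.res L h (v.toTate L s f))
      rw [divZT_toTate, res_toTate, res_toTate, divZT_toTate]) t

lemma modZT_res {s s' : ℕ} (hs : 1 ≤ s) (hs' : 1 ≤ s') (h : s' ≤ s) (i : Fin x.n)
    (t : v.Tate L s) : x.modZT L hL s' hs' i (v.res L h t) = x.modZT L hL s hs i t :=
  v.tate_ext ((x.continuous_modZT L hL s' hs' i).comp (v.continuous_res h))
    (x.continuous_modZT L hL s hs i) (fun f => by
      change x.modZT L hL s' hs' i (v.res L h (v.toTate L s f)) = _
      rw [res_toTate, modZT_toTate, modZT_toTate]) t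

end Division

end Coordinates

section Entire

variable {F K : Type u} [Field F] [Fintype F] [Field K] [Algebra F K] {v : Place F K}
  {L : Type u} [NormedField L] [Algebra F L]

lemma Entire.res_succ (f : v.Entire L) (s : ℕ) :
    v.res L (Nat.le_succ s) (f.1 (s + 1)) = f.1 s := f.2 s

/-- The restriction of an entire function to a disc. -/
def evalTate (L : Type u) [NormedField L] [Algebra F L] (s : ℕ) : v.Entire L →+* v.Tate L s :=
  (Pi.evalRingHom _ s).comp (v.Entire L).subtype

lemma evalTate_toEntire (s : ℕ) (f : v.Coeff L) :
    evalTate L s (v.toEntire L f) = v.toTate L s f := rfl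

variable [Algebra K L] [IsUltrametricDist L] [CompleteSpace L]
  (hL : ∀ c : K, ‖algebraMap K L c‖ = v.abs c) (x : v.Coordinates)
include hL x

/-- Division by `a ⊗ 1 - 1 ⊗ a` in the ring of entire functions. -/
lemma Entire.exists_div (f : v.Entire L) : ∃ (b : v.Coeff L) (g : v.Entire L),
    f = v.toEntire L b + v.toEntire L (x.z L) * g := by
  have hmod : ∀ s i, x.modZT L hL (s + 1) (Nat.le_add_left 1 s) i (f.1 (s + 1)) =
      x.modZT L hL 1 le_rfl i (f.1 1) := by
    intro s i
    induction s with
    | zero => rfl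
    | succ s ih =>
      rw [← ih, ← Entire.res_succ f (s + 1), x.modZT_res L hL]
  refine ⟨x.remZ L fun i => x.modZT L hL 1 le_rfl i (f.1 1),
    ⟨fun s => v.res L (Nat.le_succ s) (x.divZT L hL (s + 1) (Nat.le_add_left 1 s) (f.1 (s + 1))),
      fun s => ?_⟩, Subtype.ext (funext fun s => ?_)⟩
  · change v.res L (Nat.le_succ s) (v.res L _ _) = _
    rw [x.res_divZT L hL _ (Nat.le_add_left 1 s), Entire.res_succ]
  · have h := x.remZ_add_mul_divZT L hL (s + 1) (Nat.le_add_left 1 s) (f.1 (s + 1))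
    have h2 := congrArg (v.res L (Nat.le_succ s)) h
    rw [map_add, map_mul, res_toTate, res_toTate, Entire.res_succ] at h2
    rw [← h2]
    have h3 : (fun i => x.modZT L hL (s + 1) (Nat.le_add_left 1 s) i (f.1 (s + 1))) =
        fun i => x.modZT L hL 1 le_rfl i (f.1 1) := funext fun i => hmod s i
    rw [h3]
    rfl

lemma Entire.exists_div_pow (f : v.Entire L) (n : ℕ) : ∃ (b : v.Coeff L) (g : v.Entire L),
    f = v.toEntire L b + v.toEntire L (x.z L ^ n) * g := by
  induction n with
  | zero => exact ⟨0, f, by simp⟩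
  | succ n ih =>
    obtain ⟨b, g, hg⟩ := ih
    obtain ⟨b', g', hg'⟩ := Entire.exists_div hL x g
    refine ⟨b + x.z L ^ n * b', g', ?_⟩
    rw [hg, hg', map_add, map_mul, pow_succ, map_mul]
    ring

lemma mem_span_z_pow (n : ℕ) (b : v.Coeff L) (t : v.Tate L 1)
    (h : v.toTate L 1 b = v.toTate L 1 (x.z L ^ n) * t) : ∃ c, b = x.z L ^ n * c := by
  induction n generalizing b with
  | zero => exact ⟨b, by simp⟩
  | succ n ih =>
    rw [pow_succ', map_mul, mul_assoc] at h
    have h1 : ∀ i, x.modZ L i b = 0 := fun i => by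
      rw [← x.modZT_toTate L hL 1 le_rfl, h, Coordinates.modZT_mul]
    have h2 : v.toTate L 1 (x.divZ L b) = v.toTate L 1 (x.z L ^ n) * t := by
      rw [← x.divZT_toTate L hL 1 le_rfl, h, Coordinates.divZT_mul]
    obtain ⟨c, hc⟩ := ih _ h2
    refine ⟨c, ?_⟩
    have h3 := x.remZ_add_mul_divZ L b
    have h4 : x.remZ L (fun i => x.modZ L i b) = 0 := by
      rw [Coordinates.remZ]
      refine Finset.sum_eq_zero fun i _ => ?_
      rw [h1]
      exact map_zero (Coordinates.tensHom L (x.basis (i, 0)))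
    rw [h4, zero_add, hc] at h3
    rw [← h3]
    ring

variable [IsScalarTower F K L]

/-- The powers of `𝔧` are contracted from the ring of entire functions. -/
lemma mem_jIdeal_pow_of_toEntire (n : ℕ) (b : v.Coeff L)
    (h : v.toEntire L b ∈ (v.jIdeal L ^ n).map (v.toEntire L)) : b ∈ v.jIdeal L ^ n := by
  have key : ∀ f ∈ (v.jIdeal L ^ n).map (v.toEntire L), ∃ c ∈ v.jIdeal L ^ n, ∃ g : v.Entire L,
      f = v.toEntire L c + v.toEntire L (x.z L ^ n) * g := by
    intro f hf
    refine Submodule.span_induction ?_ ⟨0, zero_mem _, 0, by simp⟩ ?_ ?_ hf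
    · rintro _ ⟨c, hc, rfl⟩
      exact ⟨c, hc, 0, by simp⟩
    · rintro f f' - - ⟨c, hc, g, rfl⟩ ⟨c', hc', g', rfl⟩
      exact ⟨c + c', add_mem hc hc', g + g', by rw [map_add]; ring⟩
    · rintro h f - ⟨c, hc, g, rfl⟩
      obtain ⟨b, h', hh'⟩ := Entire.exists_div_pow hL x h n
      refine ⟨b * c, Ideal.mul_mem_left _ _ hc, h' * v.toEntire L c + h * g, ?_⟩
      have h1 : h * v.toEntire L c = (v.toEntire L b + v.toEntire L (x.z L ^ n) * h') *
          v.toEntire L c := by rw [← hh']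
      rw [smul_eq_mul, mul_add, h1, map_mul]
      ring
  obtain ⟨c, hc, g, hg⟩ := key _ h
  have h1 : v.toTate L 1 (b - c) = v.toTate L 1 (x.z L ^ n) * g.1 1 := by
    have h2 := congrArg (evalTate L 1) hg
    rw [map_add, map_mul, evalTate_toEntire, evalTate_toEntire, evalTate_toEntire] at h2
    rw [map_sub, h2]
    exact add_sub_cancel_left _ _
  obtain ⟨d, hd⟩ := mem_span_z_pow hL x n _ _ h1
  rw [sub_eq_iff_eq_add] at hd
  rw [hd]
  exact add_mem (Ideal.mul_mem_right _ _ (Ideal.pow_mem_pow (x.z_mem L) n)) hc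

end Entire

end Place
end HodgePink
end

noncomputable section
namespace HodgePink

section FormallySmooth

variable {F : Type u} [Field F] {E : Type u} [Field E] [Algebra F E] {p : ℕ} [hp : Fact p.Prime]
  [CharP E p] [CharP F p] [PerfectRing F p] {t : E}

/-- A field with a `p`-basis `t` is formally smooth over `F[t]`, `F` perfect. -/
lemma IsPBasis.formallySmooth (h : IsPBasis p t) [Algebra (Polynomial F) E]
    [IsScalarTower F (Polynomial F) E]
    (ht : algebraMap (Polynomial F) E Polynomial.X = t) :
    Algebra.FormallySmooth (Polynomial F) E := by
  refine Algebra.FormallySmooth.of_comp_surjective fun B _ _ I hI φ => ?_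
  rcases subsingleton_or_nontrivial B with hB | hB
  · exact ⟨{ (0 : E →+ B) with
      map_one' := Subsingleton.elim _ _
      map_mul' := fun _ _ => Subsingleton.elim _ _
      commutes' := fun _ => Subsingleton.elim _ _ },
      AlgHom.ext fun x => (Ideal.Quotient.mk_surjective.subsingleton : Subsingleton (B ⧸ I)).elim _ _⟩
  let i : F →+* B := (algebraMap (Polynomial F) B).comp Polynomial.C
  have : CharP B p := charP_of_injective_ringHom i.injective p
  set x : B := algebraMap (Polynomial F) B Polynomial.X with hx
  have hI0 : ∀ y ∈ I, frobenius B p y = 0 := fun y hy => by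
    have h2 : y ^ 2 ∈ I ^ 2 := Ideal.pow_mem_pow hy 2
    rw [hI, Ideal.mem_bot] at h2
    rw [frobenius_def]
    exact pow_eq_zero_of_le hp.out.two_le h2
  let σ : B ⧸ I →+* B := Ideal.Quotient.lift I (frobenius B p) hI0
  have hφ : φ t = Ideal.Quotient.mk I x := by rw [← ht, φ.commutes]; rfl
  have : Fact (Irreducible (Polynomial.X ^ p - Polynomial.C t)) :=
    ⟨X_pow_sub_C_irreducible_of_prime hp.out h.pow_ne⟩
  let e : AdjoinRoot (Polynomial.X ^ p - Polynomial.C t) →+* E :=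
    AdjoinRoot.lift (frobenius E p) t (by simp [frobenius_def])
  let g : AdjoinRoot (Polynomial.X ^ p - Polynomial.C t) →+* B :=
    AdjoinRoot.lift (σ.comp (φ : E →+* B ⧸ I)) x (by
      simp [hφ, σ, frobenius_def])
  have he : Function.Bijective e := by
    refine ⟨e.injective, fun y => ?_⟩
    obtain ⟨b, rfl⟩ := exists_sum_of_mem_closure p (h.mem_closure y)
    refine ⟨∑ j, AdjoinRoot.of _ (b j) * AdjoinRoot.root _ ^ (j : ℕ), ?_⟩
    simp [e, frobenius_def]
  let e' := RingEquiv.ofBijective e he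
  have he' : ∀ y, e' y = e y := fun _ => rfl
  have hroot : e'.symm t = AdjoinRoot.root _ := by
    rw [RingEquiv.symm_apply_eq]; simp [he', e]
  refine ⟨{ g.comp (e'.symm : E →+* _) with
    commutes' := fun f => ?_ }, AlgHom.ext fun y => ?_⟩
  · have : ((g.comp (e'.symm : E →+* _)).comp (algebraMap (Polynomial F) E)) =
        algebraMap (Polynomial F) B := by
      refine Polynomial.ringHom_ext' (RingHom.ext fun c => ?_) ?_
      · obtain ⟨d, rfl⟩ := (PerfectRing.bijective_frobenius (R := F) (p := p)).2 c
        change g (e'.symm (algebraMap _ _ (Polynomial.C (frobenius F p d)))) = i (frobenius F p d)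
        have h1 : algebraMap (Polynomial F) E (Polynomial.C (frobenius F p d)) =
            e' (AdjoinRoot.of _ (algebraMap F E d)) := by
          rw [he', ← Polynomial.algebraMap_eq, ← IsScalarTower.algebraMap_apply]
          simp [e, frobenius_def]
        have h2 : φ (algebraMap F E d) = Ideal.Quotient.mk I (i d) := by
          rw [IsScalarTower.algebraMap_apply F (Polynomial F) E, φ.commutes]; rfl
        rw [h1, RingEquiv.symm_apply_apply]
        simp [g, h2, σ, frobenius_def]
      change g (e'.symm (algebraMap _ _ Polynomial.X)) = _
      rw [ht, hroot]
      exact AdjoinRoot.lift_root _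
    exact RingHom.congr_fun this f
  · obtain ⟨z, rfl⟩ := e'.surjective y
    change Ideal.Quotient.mk I (g (e'.symm (e' z))) = φ (e z)
    rw [RingEquiv.symm_apply_apply]
    have : (Ideal.Quotient.mk I).comp g = (φ : E →+* B ⧸ I).comp e := by
      refine AdjoinRoot.ringHom_ext (RingHom.ext fun c => ?_) ?_
      · obtain ⟨d, hd⟩ := Ideal.Quotient.mk_surjective (φ c)
        simp [g, e, frobenius_def, ← hd, σ]
      · simp [g, e, hφ]
    exact RingHom.congr_fun this z

/-- Lifting of ring homomorphisms from a field with a `p`-basis to an adic completion. -/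
lemma IsPBasis.exists_lift (h : IsPBasis p t) {S : Type*} [CommRing S] (i : F →+* S)
    (I : Ideal S) (f : E →+* S ⧸ I) (hf : ∀ c, f (algebraMap F E c) = Ideal.Quotient.mk I (i c))
    (s : S) (hs : f t = Ideal.Quotient.mk I s) :
    ∃ g : E →+* AdicCompletion I S, (∀ x, AdicCompletion.evalOneₐ I (g x) = f x) ∧
      (∀ c, g (algebraMap F E c) = algebraMap S _ (i c)) ∧ g t = algebraMap S _ s := by
  let a1 : Algebra (Polynomial F) E := (Polynomial.aeval (R := F) t).toAlgebra
  let a2 : Algebra (Polynomial F) S := (Polynomial.eval₂RingHom i s).toAlgebra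
  have h1 : algebraMap (Polynomial F) E Polynomial.X = t := Polynomial.aeval_X t
  have h2 : algebraMap (Polynomial F) S Polynomial.X = s := Polynomial.eval₂_X i s
  have h3 (c : F) : algebraMap (Polynomial F) E (Polynomial.C c) = algebraMap F E c :=
    Polynomial.aeval_C t c
  have h4 (c : F) : algebraMap (Polynomial F) S (Polynomial.C c) = i c := Polynomial.eval₂_C i s
  have : IsScalarTower F (Polynomial F) E := IsScalarTower.of_algebraMap_eq fun c => (h3 c).symm
  have := h.formallySmooth h1
  let f' : E →ₐ[Polynomial F] S ⧸ I :=
    { f with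
      commutes' := fun y => by
        have : f.comp (algebraMap (Polynomial F) E) =
            (Ideal.Quotient.mk I).comp (algebraMap (Polynomial F) S) := by
          refine Polynomial.ringHom_ext' (RingHom.ext fun c => ?_) ?_
          · simp only [RingHom.comp_apply]
            rw [h3, h4, hf]
          · rw [RingHom.comp_apply, RingHom.comp_apply, h1, h2, hs]
        exact RingHom.congr_fun this y }
  obtain ⟨g, hg⟩ := Algebra.FormallySmooth.exists_adicCompletionEvalOneₐ_comp_eq f'
  have hg' (y : Polynomial F) : g (algebraMap _ _ y) = algebraMap S _ (algebraMap _ S y) := by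
    rw [g.commutes, IsScalarTower.algebraMap_apply (Polynomial F) S]
  refine ⟨g, fun x => AlgHom.congr_fun hg x, fun c => ?_, ?_⟩
  · change g _ = _
    rw [← h3, hg', h4]
  · change g _ = _
    rw [← h1, hg', h2]

end FormallySmooth

end HodgePink
end

noncomputable section
namespace HodgePink

set_option linter.unusedSectionVars false
set_option linter.unusedVariables false

namespace Place

variable {F K : Type u} [Field F] [Fintype F] [Field K] [Algebra F K] {v : Place F K}

section

variable (L : Type u) [Field L] [Algebra F L] [Algebra K L] [IsScalarTower F K L]

/-- The ring homomorphism `K → (A ⊗ L) / 𝔧 ^ n` which extends `a ↦ a ⊗ 1`. -/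
lemma exists_extend_left [IsFractionRing v.A K] (n : ℕ) :
    ∃ g : K →+* v.Coeff L ⧸ v.jIdeal L ^ n,
      (∀ b : v.A, g (b : K) = Ideal.Quotient.mk _ (v.tens b 1)) ∧
      ∀ c, ∃ y, g c = Ideal.Quotient.mk _ y ∧ v.mulMap L y = algebraMap K L c := by
  let i : v.A →+* v.Coeff L := algebraMap v.A (v.Coeff L)
  have hi (b : v.A) : i b = v.tens b 1 := rfl
  have hunit : ∀ b : nonZeroDivisors v.A,
      IsUnit (((Ideal.Quotient.mk (v.jIdeal L ^ n)).comp i) b) := by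
    rintro ⟨b, hb⟩
    have hb0 : algebraMap K L (b : K) ≠ 0 := by
      rw [Ne, map_eq_zero_iff _ (algebraMap K L).injective]
      intro h
      exact nonZeroDivisors.ne_zero hb (Subtype.ext h)
    set x := v.tens b (1 : L)
    set y := v.tens 1 (algebraMap K L (b : K))
    have hxy : x - y ∈ v.jIdeal L := by
      rw [jIdeal, RingHom.mem_ker, map_sub]
      simp [x, y, mulMap_tens]
    have hy : IsUnit y := by
      refine IsUnit.of_mul_eq_one (v.tens 1 (algebraMap K L (b : K))⁻¹) ?_
      rw [tens_mul_tens, mul_inv_cancel₀ hb0]; simp; rfl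
    have hnil : IsNilpotent (Ideal.Quotient.mk (v.jIdeal L ^ n) (x - y)) :=
      ⟨n, by rw [← map_pow]; exact Ideal.Quotient.eq_zero_iff_mem.2 (Ideal.pow_mem_pow hxy n)⟩
    have := hnil.isUnit_add_left_of_commute (hy.map (Ideal.Quotient.mk (v.jIdeal L ^ n)))
      (Commute.all _ _)
    rw [← map_add, add_sub_cancel] at this
    exact this
  set g : K →+* v.Coeff L ⧸ v.jIdeal L ^ n := IsLocalization.lift (M := nonZeroDivisors v.A) hunit
  have hg (b : v.A) : g (b : K) = Ideal.Quotient.mk _ (v.tens b 1) := IsLocalization.lift_eq hunit b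
  refine ⟨g, hg, fun c => ?_⟩
  rcases Nat.eq_zero_or_pos n with rfl | hn
  · have : Subsingleton (v.Coeff L ⧸ v.jIdeal L ^ 0) := Ideal.Quotient.subsingleton_iff.2 (by simp)
    exact ⟨v.tens 1 (algebraMap K L c), Subsingleton.elim _ _, by simp [mulMap_tens]⟩
  let m : v.Coeff L ⧸ v.jIdeal L ^ n →+* L := Ideal.Quotient.lift _ (v.mulMap L) fun y hy =>
    RingHom.mem_ker.1 (Ideal.pow_le_self hn.ne' hy)
  have hm : m.comp g = algebraMap K L := by
    refine IsLocalization.ringHom_ext (nonZeroDivisors v.A) (RingHom.ext fun b => ?_)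
    change m (g (b : K)) = algebraMap K L (b : K)
    rw [hg]
    exact (v.mulMap_tens b 1).trans (mul_one _)
  obtain ⟨y, hy⟩ := Ideal.Quotient.mk_surjective (g c)
  refine ⟨y, hy.symm, ?_⟩
  rw [← hm, RingHom.comp_apply, ← hy]
  rfl

/-- The ring homomorphism `l ↦ 1 ⊗ l`. -/
def tensRight (L : Type u) [Field L] [Algebra F L] : L →+* v.Coeff L :=
  ((Algebra.TensorProduct.includeRight : L →ₐ[F] v.A ⊗[F] L) : L →+* v.A ⊗[F] L)

lemma tensRight_apply (l : L) : tensRight L l = v.tens 1 l := rfl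

/-- Two ring homomorphisms to `S / J`, `I ^ n ≤ J`, which agree on a `p`-basis and modulo `I`
are equal. -/
lemma hom_ext_quotient {S : Type*} [CommRing S] (p : ℕ) [hp : Fact p.Prime] [CharP S p]
    {I J : Ideal S} {n : ℕ} (hIJ : I ^ n ≤ J)
    {E : Type*} [Field E] [CharP E p] {t : E} (ht : IsPBasis p t)
    (f g : E →+* S ⧸ J) (h : f t = g t)
    (hfg : ∀ x, ∃ y z, f x = Ideal.Quotient.mk _ y ∧ g x = Ideal.Quotient.mk _ z ∧ y - z ∈ I) :
    f = g := by
  have : ExpChar S p := ExpChar.prime hp.out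
  refine ht.hom_ext n f g h fun x => ?_
  obtain ⟨y, z, hy, hz, hyz⟩ := hfg x
  rw [map_pow, map_pow, hy, hz, ← map_pow, ← map_pow, Ideal.Quotient.eq, ← sub_pow_expChar_pow]
  exact hIJ <| Ideal.pow_le_pow_right (Nat.lt_pow_self hp.out.one_lt).le (Ideal.pow_mem_pow hyz _)


variable {L}

lemma sub_tens_mulMap_mem {J : Ideal (v.Coeff L)}
    (h : ∀ b : v.A, v.tens b 1 - v.tens 1 (algebraMap K L (b : K)) ∈ J) (f : v.Coeff L) :
    f - v.tens 1 (v.mulMap L f) ∈ J := by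
  refine v.coeff_induction f ?_ (fun b l => ?_) fun f g hf hg => ?_
  · have : v.tens 1 (0 : L) = 0 := TensorProduct.tmul_zero _ _
    simp [this]
  · have h1 : v.tens b l - v.tens 1 (v.mulMap L (v.tens b l)) =
        (v.tens b 1 - v.tens 1 (algebraMap K L (b : K))) * v.tens 1 l := by
      rw [sub_mul, tens_mul_tens, tens_mul_tens, mulMap_tens, one_mul, one_mul, mul_one]
    rw [h1]
    exact Ideal.mul_mem_right _ _ (h b)
  · have : v.tens 1 (v.mulMap L (f + g)) = v.tens 1 (v.mulMap L f) + v.tens 1 (v.mulMap L g) := by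
      rw [map_add]; exact TensorProduct.tmul_add _ _ _
    rw [this, add_sub_add_comm]
    exact J.add_mem hf hg

lemma coeff_charP (p : ℕ) [CharP F p] [hp : Fact p.Prime] : CharP (v.Coeff L) p := by
  have : Nontrivial (v.Coeff L) := (v.mulMap L).domain_nontrivial
  exact charP_of_injective_ringHom
    (f := (algebraMap F (v.A ⊗[F] L) : F →+* v.Coeff L)) (RingHom.injective _) p

/-- `𝔧` is generated by `a ⊗ 1 - 1 ⊗ a` modulo `𝔧 ^ n`. -/
lemma Coordinates.jIdeal_le [IsFractionRing v.A K] (x : v.Coordinates) (p : ℕ) [hp : Fact p.Prime]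
    [CharP F p] (ht : IsPBasis p (x.a : K)) (n : ℕ) :
    v.jIdeal L ≤ Ideal.span {x.z L} ⊔ v.jIdeal L ^ n := by
  have := coeff_charP (v := v) (L := L) p
  have : CharP K p := charP_of_injective_algebraMap (algebraMap F K).injective p
  set J : Ideal (v.Coeff L) := Ideal.span {x.z L} ⊔ v.jIdeal L ^ n with hJ
  obtain ⟨g, hg, hg'⟩ := exists_extend_left (v := v) L n
  let d₁ : K →+* v.Coeff L ⧸ J := (Ideal.Quotient.factor (le_sup_right (a := Ideal.span {x.z L}))).comp g
  have hd₁ (b : v.A) : d₁ (b : K) = Ideal.Quotient.mk _ (v.tens b 1) := by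
    simp only [d₁, RingHom.comp_apply, hg]; rfl
  let d₂ : K →+* v.Coeff L ⧸ J := ((Ideal.Quotient.mk J).comp (tensRight L)).comp (algebraMap K L)
  have h12 : d₁ = d₂ := by
    refine hom_ext_quotient p (I := v.jIdeal L) (n := n) (J := J) le_sup_right ht d₁ d₂ ?_ fun c => ?_
    · rw [hd₁]
      refine Ideal.Quotient.eq.2 (Ideal.mem_sup_left (Ideal.subset_span rfl))
    · obtain ⟨y, hy, hyc⟩ := hg' c
      refine ⟨y, tensRight L (algebraMap K L c), ?_, rfl, ?_⟩
      · simp only [d₁, RingHom.comp_apply, hy]; rfl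
      · rw [jIdeal, RingHom.mem_ker, map_sub, hyc, tensRight_apply]; simp [mulMap_tens]
  have h3 (b : v.A) : v.tens b 1 - v.tens 1 (algebraMap K L (b : K)) ∈ J := by
    refine Ideal.Quotient.eq.1 ?_
    rw [← hd₁, h12]; rfl
  intro f hf
  have h4 := sub_tens_mulMap_mem h3 f
  rw [RingHom.mem_ker.1 hf] at h4
  have h5 : v.tens 1 (0 : L) = 0 := TensorProduct.tmul_zero _ _
  rwa [h5, sub_zero] at h4

/-- Modulo `𝔧 ^ (n + 1)`, the elements of `𝔧 ^ n` are multiples of `z ^ n` by constants. -/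
lemma Coordinates.exists_sub_mem [IsFractionRing v.A K] (x : v.Coordinates) (p : ℕ)
    [hp : Fact p.Prime] [CharP F p] (ht : IsPBasis p (x.a : K)) (n : ℕ) (f : v.Coeff L)
    (hf : f ∈ v.jIdeal L ^ n) :
    ∃ l : L, f - v.tens 1 l * x.z L ^ n ∈ v.jIdeal L ^ (n + 1) := by
  have h1 : v.jIdeal L ^ n ≤ Ideal.span {x.z L ^ n} ⊔ v.jIdeal L ^ (n + 1) := by
    induction n with
    | zero => simp
    | succ n ih =>
      have hz : Ideal.span {x.z L} ≤ v.jIdeal L := by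
        rw [Ideal.span_singleton_le_iff_mem]; exact x.z_mem L
      calc v.jIdeal L ^ (n + 1) = v.jIdeal L ^ n * v.jIdeal L := pow_succ _ _
        _ ≤ (Ideal.span {x.z L ^ n} ⊔ v.jIdeal L ^ (n + 1)) *
            (Ideal.span {x.z L} ⊔ v.jIdeal L ^ 2) :=
          Ideal.mul_mono (ih (Ideal.pow_le_pow_right (Nat.le_succ n) hf)) (x.jIdeal_le p ht 2)
        _ ≤ _ := by
          rw [Ideal.sup_mul, Ideal.mul_sup, Ideal.mul_sup, Ideal.span_singleton_mul_span_singleton,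
            ← pow_succ]
          refine sup_le (sup_le le_sup_left (le_sup_of_le_right ?_))
            (sup_le (le_sup_of_le_right ?_) (le_sup_of_le_right ?_))
          · rw [← Ideal.span_singleton_pow, pow_add _ n 2]
            exact Ideal.mul_mono_left (Ideal.pow_right_mono hz n)
          · rw [pow_succ _ (n + 1)]
            exact Ideal.mul_mono_right hz
          · rw [← pow_add]
            exact Ideal.pow_le_pow_right (by omega)
  obtain ⟨y, hy, w, hw, rfl⟩ := Submodule.mem_sup.1 (h1 hf)
  obtain ⟨c, rfl⟩ := Ideal.mem_span_singleton'.1 hy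
  refine ⟨v.mulMap L c, ?_⟩
  rw [add_sub_right_comm, ← sub_mul]
  refine Ideal.add_mem _ ?_ hw
  rw [pow_succ']
  refine Ideal.mul_mem_mul ?_ (Ideal.pow_mem_pow (x.z_mem L) n)
  rw [jIdeal, RingHom.mem_ker, map_sub]
  simp [mulMap_tens]

end

end Place

end HodgePink
end

noncomputable section
namespace HodgePink

set_option linter.unusedSectionVars false
set_option linter.unusedVariables false

open PowerSeries in
/-- The Taylor expansion with respect to a `p`-basis. -/
lemma IsPBasis.exists_taylor {F K : Type u} [Field F] [Field K] [Algebra F K] {p : ℕ}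
    [hp : Fact p.Prime] [CharP F p] [PerfectRing F p] {t : K} (h : IsPBasis p t) :
    ∃ Θ : K →ₐ[F] PowerSeries K, (∀ x, constantCoeff (Θ x) = x) ∧ Θ t = C t + X := by
  have : CharP K p := charP_of_injective_algebraMap (algebraMap F K).injective p
  set I : Ideal (PowerSeries K) := Ideal.span {X} with hI
  have hX : Ideal.Quotient.mk I X = 0 := Ideal.Quotient.eq_zero_iff_mem.2 (Ideal.subset_span rfl)
  obtain ⟨g, hg, hgF, hgt⟩ := h.exists_lift (S := PowerSeries K) (C.comp (algebraMap F K)) I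
    ((Ideal.Quotient.mk I).comp C) (fun c => rfl) (C t + X) (by simp [hX])
  let e := AdicCompletion.ofAlgEquiv I
  have he (y) : e.symm (algebraMap (PowerSeries K) _ y) = y := by
    rw [e.symm_apply_eq]; rfl
  refine ⟨{ (e.symm : _ →+* PowerSeries K).comp g with commutes' := fun c => ?_ }, fun x => ?_, ?_⟩
  · change e.symm (g _) = _
    rw [hgF, he]; rw [IsScalarTower.algebraMap_apply F K]; rfl
  · change constantCoeff (e.symm (g x)) = x
    have h1 := hg x
    rw [← AdicCompletion.mk_ofAlgEquiv_symm_eq_evalOneₐ, RingHom.comp_apply, Ideal.Quotient.eq,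
      Ideal.mem_span_singleton, X_dvd_iff, map_sub, sub_eq_zero] at h1
    exact h1.trans (constantCoeff_C x)
  · change e.symm (g t) = _
    rw [hgt, he]

namespace Place

variable {F K : Type u} [Field F] [Fintype F] [Field K] [Algebra F K] {v : Place F K}

section

variable (Θ : K →ₐ[F] PowerSeries K) (L : Type u) [Field L] [Algebra F L] [Algebra K L]
  [IsScalarTower F K L]

open PowerSeries

/-- The Taylor expansion of functions in `A ⊗ L` at `𝔧`. -/
def taylor : v.Coeff L →+* PowerSeries L :=
  ((Algebra.TensorProduct.productMap
    (((PowerSeries.mapAlgHom (IsScalarTower.toAlgHom F K L)).comp Θ).comp v.A.val)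
    (IsScalarTower.toAlgHom F L (PowerSeries L)) : v.A ⊗[F] L →ₐ[F] PowerSeries L) :
    v.A ⊗[F] L →+* PowerSeries L)

variable {L}

lemma taylor_tens (b : v.A) (l : L) :
    taylor Θ L (v.tens b l) = PowerSeries.map (algebraMap K L) (Θ (b : K)) * C l :=
  Algebra.TensorProduct.productMap_apply_tmul _ _ _ _

variable (hΘ : ∀ x, constantCoeff (Θ x) = x)
include hΘ

lemma constantCoeff_taylor (f : v.Coeff L) : constantCoeff (taylor Θ L f) = v.mulMap L f := by
  refine v.coeff_induction f (by simp) (fun b l => ?_) fun f g hf hg => ?_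
  · rw [taylor_tens, mulMap_tens]
    simp [← coeff_zero_eq_constantCoeff_apply, coeff_map, hΘ]
  · rw [map_add, map_add, map_add, hf, hg]

lemma jIdeal_le_comap_taylor : v.jIdeal L ≤ (Ideal.span {X}).comap (taylor Θ L) := fun f hf => by
  rw [Ideal.mem_comap, Ideal.mem_span_singleton, X_dvd_iff, constantCoeff_taylor Θ hΘ]
  exact hf

lemma jIdeal_pow_le_comap_taylor (n : ℕ) :
    v.jIdeal L ^ n ≤ (Ideal.span {X} ^ n).comap (taylor Θ L) :=
  (Ideal.pow_right_mono (jIdeal_le_comap_taylor Θ hΘ) n).trans (Ideal.le_comap_pow _ n)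

omit hΘ in
lemma taylor_z (x : v.Coordinates) (hx : Θ (x.a : K) = C (x.a : K) + X) :
    taylor Θ L (x.z L) = X := by
  rw [Coordinates.z, map_sub, taylor_tens, taylor_tens, hx]
  simp [Coordinates.θ]

variable (L)

/-- The Taylor expansion of jets modulo `X ^ n`. -/
def jetsTaylorAux (n : ℕ) : v.Jets L →+* PowerSeries L ⧸ Ideal.span {(X : PowerSeries L)} ^ n :=
  (Ideal.quotientMap (Ideal.span {X} ^ n) (taylor (v := v) Θ L)
    (jIdeal_pow_le_comap_taylor Θ hΘ n)).comp
      (AdicCompletion.evalₐ (v.jIdeal L) n : v.Jets L →+* _)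

lemma factorPow_comp_jetsTaylorAux {m n : ℕ} (hle : m ≤ n) :
    (Ideal.Quotient.factorPow (Ideal.span {(X : PowerSeries L)}) hle).comp
      (jetsTaylorAux (v := v) Θ L hΘ n) = jetsTaylorAux Θ L hΘ m := by
  refine RingHom.ext fun x => ?_
  obtain ⟨a, rfl⟩ := AdicCompletion.mk_surjective (v.jIdeal L) (v.Coeff L) x
  simp only [jetsTaylorAux, RingHom.comp_apply, RingHom.coe_coe, AdicCompletion.evalₐ_mk,
    Ideal.quotientMap_mk]
  refine Ideal.Quotient.eq.2 ?_
  rw [← map_sub]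
  refine jIdeal_pow_le_comap_taylor Θ hΘ m (Ideal.Quotient.eq.1 ?_)
  have h := (a.2 hle).symm
  rw [smul_eq_mul, Ideal.mul_top, SModEq] at h
  exact h

/-- The Taylor expansion of jets. -/
def jetsTaylor : v.Jets L →+* PowerSeries L :=
  IsAdicComplete.liftRingHom (Ideal.span {(X : PowerSeries L)}) (jetsTaylorAux Θ L hΘ)
    (factorPow_comp_jetsTaylorAux Θ L hΘ)

variable {L}

lemma jetsTaylor_sub_mem {n : ℕ} {g : v.Jets L} {y : v.Coeff L}
    (h : AdicCompletion.evalₐ (v.jIdeal L) n g = Ideal.Quotient.mk _ y) :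
    X ^ n ∣ jetsTaylor (v := v) Θ L hΘ g - taylor Θ L y := by
  rw [← Ideal.mem_span_singleton, ← Ideal.span_singleton_pow, ← Ideal.Quotient.eq]
  refine (IsAdicComplete.mk_liftRingHom _ _ _ n g).trans ?_
  rw [jetsTaylorAux, RingHom.comp_apply, RingHom.coe_coe, h, Ideal.quotientMap_mk]

omit hΘ in
lemma eq_of_X_pow_dvd {f g : PowerSeries L} (h : ∀ n, X ^ n ∣ f - g) : f = g := by
  ext n
  have := X_pow_dvd_iff.1 (h (n + 1)) n (Nat.lt_succ_self n)
  rwa [map_sub, sub_eq_zero] at this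

lemma jetsTaylor_algebraMap (f : v.Coeff L) :
    jetsTaylor Θ L hΘ (algebraMap _ (v.Jets L) f) = taylor Θ L f :=
  eq_of_X_pow_dvd fun n => jetsTaylor_sub_mem Θ hΘ (by rw [AlgHom.commutes]; rfl)

lemma jetsTaylor_jetsMap {L' : Type u} [Field L'] [Algebra F L'] [Algebra K L']
    [IsScalarTower F K L'] (φ : L →ₐ[K] L') (g : v.Jets L) :
    jetsTaylor Θ L' hΘ (v.jetsMap φ g) = PowerSeries.map (φ : L →+* L') (jetsTaylor Θ L hΘ g) := by
  refine eq_of_X_pow_dvd fun n => ?_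
  obtain ⟨y, hy⟩ := Ideal.Quotient.mk_surjective (AdicCompletion.evalₐ (v.jIdeal L) n g)
  have h1 := jetsTaylor_sub_mem Θ hΘ (v.evalₐ_jetsMap_of_eq φ n g y hy.symm)
  have h2 := map_dvd (PowerSeries.map (φ : L →+* L')) (jetsTaylor_sub_mem Θ hΘ hy.symm)
  have h3 : taylor Θ L' (v.coeffMap (φ.restrictScalars F) y) =
      PowerSeries.map (φ : L →+* L') (taylor Θ L y) := by
    refine v.coeff_induction y (by simp) (fun b l => ?_) fun f g hf hg => ?_
    · rw [coeffMap_tens, taylor_tens, taylor_tens, map_mul, ← RingHom.comp_apply, ← PowerSeries.map_comp]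
      simp
    · simp only [map_add, hf, hg]
  rw [map_pow, map_X, map_sub, ← h3] at h2
  simpa using dvd_sub h1 h2

variable [IsFractionRing v.A K] (x : v.Coordinates) (p : ℕ) [hp : Fact p.Prime]
    [CharP F p] (ht : IsPBasis p (x.a : K)) (hx : Θ (x.a : K) = C (x.a : K) + X)
include ht hx

lemma mem_jIdeal_pow_iff (n : ℕ) (f : v.Coeff L) :
    f ∈ v.jIdeal L ^ n ↔ X ^ n ∣ taylor Θ L f := by
  constructor
  · intro h
    have := jIdeal_pow_le_comap_taylor Θ hΘ n h
    rwa [Ideal.mem_comap, Ideal.span_singleton_pow, Ideal.mem_span_singleton] at this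
  · intro h
    induction n with
    | zero => simp
    | succ n ih =>
      have h1 := ih ((pow_dvd_pow X (Nat.le_succ n)).trans h)
      obtain ⟨l, hl⟩ := x.exists_sub_mem p ht n f h1
      have h2 := jIdeal_pow_le_comap_taylor Θ hΘ (n + 1) hl
      rw [Ideal.mem_comap, Ideal.span_singleton_pow, Ideal.mem_span_singleton, map_sub, map_mul,
        map_pow, taylor_z Θ x hx, taylor_tens] at h2
      have h3 := X_pow_dvd_iff.1 (dvd_sub h h2) n (Nat.lt_succ_self n)
      have h4 : l = 0 := by simpa [coeff_C_mul] using h3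
      have h5 : v.tens 1 (0 : L) = 0 := TensorProduct.tmul_zero _ _
      rwa [h4, h5, zero_mul, sub_zero] at hl

lemma jetsTaylor_injective : Function.Injective (jetsTaylor (v := v) Θ L hΘ) := by
  rw [injective_iff_map_eq_zero]
  intro g hg
  refine AdicCompletion.ext_evalₐ fun n => ?_
  obtain ⟨y, hy⟩ := Ideal.Quotient.mk_surjective (AdicCompletion.evalₐ (v.jIdeal L) n g)
  have h1 := jetsTaylor_sub_mem Θ hΘ hy.symm
  rw [hg, zero_sub, dvd_neg] at h1
  rw [map_zero, ← hy]
  exact Ideal.Quotient.eq_zero_iff_mem.2 ((mem_jIdeal_pow_iff Θ hΘ x p ht hx n y).2 h1)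

lemma jetsTaylor_surjective : Function.Surjective (jetsTaylor (v := v) Θ L hΘ) := by
  intro f
  let s : ℕ → v.Coeff L := fun n => ∑ i ∈ Finset.range n, v.tens 1 (coeff i f) * x.z L ^ i
  have hs (n : ℕ) : taylor Θ L (s n) = ∑ i ∈ Finset.range n, C (coeff i f) * X ^ i := by
    simp [s, taylor_tens, taylor_z Θ x hx]
  let a : AdicCompletion.AdicCauchySequence (v.jIdeal L) (v.Coeff L) :=
    AdicCompletion.AdicCauchySequence.mk _ _ s fun n => by
      rw [smul_eq_mul, Ideal.mul_top, SModEq.comm]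
      refine Ideal.Quotient.eq.2 ?_
      simp only [s, Finset.sum_range_succ, add_sub_cancel_left]
      exact Ideal.mul_mem_left _ _ (Ideal.pow_mem_pow (x.z_mem L) n)
  refine ⟨AdicCompletion.mk _ _ a, eq_of_X_pow_dvd fun n => ?_⟩
  have h1 := jetsTaylor_sub_mem Θ hΘ (AdicCompletion.evalₐ_mk (v.jIdeal L) n a)
  have ha : a n = s n := rfl
  rw [ha] at h1
  have h2 : X ^ n ∣ f - taylor Θ L (s n) := by
    rw [hs, X_pow_dvd_iff]
    intro m hm
    simp [coeff_C_mul, coeff_X_pow, hm]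
  simpa using dvd_sub h1 h2

/-- `L[[𝔧]]` is isomorphic to the ring of formal power series over `L`. -/
def jetsEquiv : v.Jets L ≃+* PowerSeries L :=
  RingEquiv.ofBijective (jetsTaylor Θ L hΘ)
    ⟨jetsTaylor_injective Θ hΘ x p ht hx, jetsTaylor_surjective Θ hΘ x p ht hx⟩

end

end Place

end HodgePink
end

noncomputable section
namespace HodgePink

set_option linter.unusedSectionVars false
set_option linter.unusedVariables false

namespace Place

variable {F K : Type u} [Field F] [Fintype F] [Field K] [Algebra F K]

lemma _root_.HodgePink.IsFunctionField.exists_coordinates_pBasis (hK : IsFunctionField F K)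
    (v : Place F K) :
    ∃ p : ℕ, p.Prime ∧ CharP F p ∧ CharP K p ∧ IsDedekindDomain v.A ∧ IsFractionRing v.A K ∧
      ∃ x : v.Coordinates, IsPBasis p (x.a : K) ∧ IsPBasis p (algebraMap K v.Kinf x.a) := by
  obtain ⟨p, hp, hp'⟩ := exists_char F K
  have : Fact p.Prime := ⟨hp⟩
  obtain ⟨a, ha, ha1, hap⟩ := hK.exists_pole_pow_ne v p hp.one_lt
  obtain ⟨h1, h2, h3⟩ := hK.isDedekind_of_pole v p ⟨a, ha⟩ ha1 hap
  obtain ⟨x, hx⟩ := hK.exists_coordinates v ⟨a, ha⟩ ha1 h3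
  refine ⟨p, hp, (RingHom.charP_iff_charP (algebraMap F K) p).2 hp', hp', h1, h2, x, ?_, ?_⟩
  · rw [hx]; exact hK.isPBasis p hap
  · rw [hx]; exact hK.isPBasis_Kinf v p hap

variable (v : Place F K)

instance : IsUltrametricDist v.Ks := IsUltrametricDist.of_normedAlgebra v.Kinf

lemma denseRange_toCinf : DenseRange v.toCinf := UniformSpace.Completion.denseRange_coe

instance : IsUltrametricDist v.Cinf := by
  refine IsUltrametricDist.isUltrametricDist_of_forall_norm_natCast_le_one fun n => ?_
  rw [← map_natCast v.toCinf n, norm_toCinf]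
  exact IsUltrametricDist.norm_natCast_le_one v.Ks n

instance (L : IntermediateField v.Kinf v.Ks) : IsUltrametricDist L :=
  IsUltrametricDist.subtype _

lemma completeSpace_of_finiteDimensional (L : IntermediateField v.Kinf v.Ks)
    [FiniteDimensional v.Kinf L] : CompleteSpace L :=
  FiniteDimensional.complete v.Kinf L

lemma norm_algebraMap_Ks (c : K) : ‖algebraMap K v.Ks c‖ = v.abs c := by
  rw [IsScalarTower.algebraMap_apply K v.Kinf v.Ks, norm_algebraMap', norm_algebraMap_Kinf]

lemma norm_algebraMap_Cinf (c : K) : ‖algebraMap K v.Cinf c‖ = v.abs c :=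
  (v.norm_toCinf _).trans (v.norm_algebraMap_Ks c)

lemma norm_algebraMap_intermediate (L : IntermediateField v.Kinf v.Ks) (c : K) :
    ‖algebraMap K L c‖ = v.abs c :=
  v.norm_algebraMap_Ks c

lemma _root_.HodgePink.evalₐ_eq_mk_of_le {S : Type*} [CommRing S] {I : Ideal S} {m n : ℕ}
    (hmn : m ≤ n) {g : AdicCompletion I S} {y : S}
    (h : AdicCompletion.evalₐ I n g = Ideal.Quotient.mk _ y) :
    AdicCompletion.evalₐ I m g = Ideal.Quotient.mk _ y := by
  obtain ⟨a, rfl⟩ := AdicCompletion.mk_surjective I S g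
  rw [AdicCompletion.evalₐ_mk] at h ⊢
  have h1 := (a.2 hmn).symm
  rw [smul_eq_mul, Ideal.mul_top, SModEq] at h1
  have h2 : Ideal.Quotient.mk (I ^ m) (a n) = Ideal.Quotient.mk (I ^ m) y :=
    Ideal.Quotient.eq.2 (Ideal.pow_le_pow_right hmn (Ideal.Quotient.eq.1 h))
  exact h1.symm.trans h2

section

variable {v} (hK : IsFunctionField F K)
include hK

lemma exists_taylor_equiv : ∃ (Θ : K →ₐ[F] PowerSeries K)
    (hΘ : ∀ x, PowerSeries.constantCoeff (Θ x) = x),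
    ∀ (L : Type u) [Field L] [Algebra F L] [Algebra K L] [IsScalarTower F K L],
      Function.Bijective (jetsTaylor (v := v) Θ L hΘ) := by
  obtain ⟨p, hp, _, _, _, _, x, hx, -⟩ := hK.exists_coordinates_pBasis v
  have : Fact p.Prime := ⟨hp⟩
  obtain ⟨Θ, hΘ, hΘx⟩ := hx.exists_taylor (F := F)
  exact ⟨Θ, hΘ, fun L _ _ _ _ => (jetsEquiv Θ hΘ x p hx hΘx).bijective⟩

lemma jetsMap_injective {L L' : Type u} [Field L] [Algebra F L] [Algebra K L] [IsScalarTower F K L]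
    [Field L'] [Algebra F L'] [Algebra K L'] [IsScalarTower F K L'] (φ : L →ₐ[K] L') :
    Function.Injective (v.jetsMap φ) := by
  obtain ⟨Θ, hΘ, h⟩ := exists_taylor_equiv (v := v) hK
  intro f g hfg
  apply (h L).1
  refine PowerSeries.map_injective (φ : L →+* L') (φ : L →+* L').injective ?_
  rw [← jetsTaylor_jetsMap, ← jetsTaylor_jetsMap, hfg]

lemma jets_ringEquiv (L : Type u) [Field L] [Algebra F L] [Algebra K L] [IsScalarTower F K L] :
    Nonempty (v.Jets L ≃+* PowerSeries L) := by
  obtain ⟨Θ, hΘ, h⟩ := exists_taylor_equiv (v := v) hK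
  exact ⟨RingEquiv.ofBijective _ (h L)⟩

lemma isDomain_jets (L : Type u) [Field L] [Algebra F L] [Algebra K L] [IsScalarTower F K L] :
    IsDomain (v.Jets L) := by
  obtain ⟨e⟩ := jets_ringEquiv (v := v) hK L
  exact e.toMulEquiv.isDomain

lemma isDomain_O : IsDomain v.O := isDomain_jets hK v.Ks

lemma isNoetherianRing_O : IsNoetherianRing v.O := by
  obtain ⟨e⟩ := jets_ringEquiv (v := v) hK v.Ks
  exact isNoetherianRing_of_ringEquiv _ e.symm

lemma jetsToLaurent_injective (ν : v.Nu) (L : IntermediateField v.Kinf v.Ks) :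
    Function.Injective (v.jetsToLaurent ν L) := by
  have := isDomain_O (v := v) hK
  exact (IsFractionRing.injective v.O (Laurent ν)).comp (jetsMap_injective hK _)

lemma isField_Laurent (ν : v.Nu) : IsField (Laurent ν) := by
  have := isDomain_O (v := v) hK
  exact (IsFractionRing.toField v.O (K := Laurent ν)).toIsField

lemma nu_unique {ν ν' : v.Kinf →+* v.O} (h : v.IsNu ν) (h' : v.IsNu ν') : ν = ν' := by
  obtain ⟨p, hp, _, _, _, _, x, -, hx⟩ := hK.exists_coordinates_pBasis v
  have : Fact p.Prime := ⟨hp⟩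
  have := coeff_charP (v := v) (L := v.Ks) p
  refine RingHom.ext fun y => AdicCompletion.ext_evalₐ fun n => ?_
  let e : v.O →+* v.Coeff v.Ks ⧸ v.jIdeal v.Ks ^ n :=
    (AdicCompletion.evalₐ (v.jIdeal v.Ks) n : v.Jets v.Ks →+* _)
  refine RingHom.congr_fun (f := e.comp ν) (g := e.comp ν') ?_ y
  refine hom_ext_quotient p (I := v.jIdeal v.Ks) (n := n) le_rfl hx _ _ ?_ fun c => ?_
  · have h1 := h.map_A x.a
    have h2 := h'.map_A x.a
    exact congrArg e (h1.trans h2.symm)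
  · rcases Nat.eq_zero_or_pos n with rfl | hn
    · have : Subsingleton (v.Coeff v.Ks ⧸ v.jIdeal v.Ks ^ 0) :=
        Ideal.Quotient.subsingleton_iff.2 (by simp)
      exact ⟨0, 0, Subsingleton.elim _ _, Subsingleton.elim _ _, by simp⟩
    obtain ⟨y, hy⟩ := Ideal.Quotient.mk_surjective (AdicCompletion.evalₐ (v.jIdeal v.Ks) n (ν c))
    obtain ⟨z, hz⟩ := Ideal.Quotient.mk_surjective (AdicCompletion.evalₐ (v.jIdeal v.Ks) n (ν' c))
    refine ⟨y, z, hy.symm, hz.symm, ?_⟩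
    have h4 := (evalₐ_eq_mk_of_le hn hy.symm).symm.trans
      (((h.residue c).trans (h'.residue c).symm).trans (evalₐ_eq_mk_of_le hn hz.symm))
    rw [← pow_one (v.jIdeal v.Ks)]
    exact Ideal.Quotient.eq.1 h4

lemma isNu_smul {ν : v.Kinf →+* v.O} (h : v.IsNu ν) (σ : v.Ginf) :
    v.IsNu ((MulSemiringAction.toRingHom v.Ginf v.O σ).comp ν) where
  map_A a := by
    refine (congrArg (v.jetsMap (v.galKs σ)) (h.map_A a)).trans ((v.jetsMap_of (v.galKs σ) _).trans ?_)
    rw [coeffMap_tens, map_one]; rfl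
  residue x := by
    refine (v.evalₐ_jetsMap_of_eq (v.galKs σ) _ _ _ (h.residue x)).trans ?_
    rw [coeffMap_tens]
    congr 2
    exact σ.commutes x

lemma exists_nu : Nonempty v.Nu := by
  obtain ⟨p, hp, _, _, _, _, x, hxK, hx⟩ := hK.exists_coordinates_pBasis v
  have : Fact p.Prime := ⟨hp⟩
  have := coeff_charP (v := v) (L := v.Ks) p
  have hdiff (c : K) (b : v.Coeff v.Ks) (hb : v.mulMap v.Ks b = algebraMap K v.Ks c) :
      b - v.tens 1 (algebraMap K v.Ks c) ∈ v.jIdeal v.Ks := by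
    rw [jIdeal, RingHom.mem_ker, map_sub, hb]; simp [mulMap_tens]
  obtain ⟨g, hg, hgF, hga⟩ := hx.exists_lift (F := F) (S := v.Coeff v.Ks)
    ((tensRight v.Ks).comp (algebraMap F v.Ks)) (v.jIdeal v.Ks)
    (((Ideal.Quotient.mk _).comp (tensRight v.Ks)).comp (algebraMap v.Kinf v.Ks))
    (fun c => by
      rw [RingHom.comp_apply, RingHom.comp_apply, RingHom.comp_apply,
        ← IsScalarTower.algebraMap_apply F v.Kinf v.Ks])
    (v.tens x.a 1) (by
      rw [RingHom.comp_apply, RingHom.comp_apply, ← IsScalarTower.algebraMap_apply K v.Kinf v.Ks,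
        eq_comm, Ideal.Quotient.eq]
      exact hdiff _ _ (by simp [mulMap_tens]))
  have hev (y : v.Jets v.Ks) (n : ℕ) (b : v.Coeff v.Ks)
      (hb : AdicCompletion.evalₐ (v.jIdeal v.Ks) n y = Ideal.Quotient.mk _ b) (hn : 0 < n) :
      AdicCompletion.evalOneₐ (v.jIdeal v.Ks) y = Ideal.Quotient.mk _ b := by
    rw [← AdicCompletion.factorₐ_evalₐ_one, evalₐ_eq_mk_of_le hn hb]
    rfl
  have hnu : v.IsNu g := by
    refine ⟨fun b => AdicCompletion.ext_evalₐ fun n => ?_, fun y => ?_⟩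
    · obtain ⟨d, hd, hd'⟩ := exists_extend_left (v := v) v.Ks n
      let e : v.O →+* v.Coeff v.Ks ⧸ v.jIdeal v.Ks ^ n :=
        (AdicCompletion.evalₐ (v.jIdeal v.Ks) n : v.Jets v.Ks →+* _)
      have key : (e.comp g).comp (algebraMap K v.Kinf) = d := by
        refine hom_ext_quotient p (I := v.jIdeal v.Ks) (n := n) le_rfl hxK _ _ ?_ fun c => ?_
        · rw [hd]
          exact (congrArg e hga)
        · rcases Nat.eq_zero_or_pos n with rfl | hn
          · have : Subsingleton (v.Coeff v.Ks ⧸ v.jIdeal v.Ks ^ 0) :=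
              Ideal.Quotient.subsingleton_iff.2 (by simp)
            exact ⟨0, 0, Subsingleton.elim _ _, Subsingleton.elim _ _, by simp⟩
          obtain ⟨y, hy, hyc⟩ := hd' c
          obtain ⟨w, hw⟩ := Ideal.Quotient.mk_surjective
            (AdicCompletion.evalₐ (v.jIdeal v.Ks) n (g (algebraMap K v.Kinf c)))
          refine ⟨w, y, hw.symm, hy, ?_⟩
          have h1 := (hev _ n w hw.symm hn).symm.trans (hg _)
          rw [RingHom.comp_apply, RingHom.comp_apply,
            ← IsScalarTower.algebraMap_apply K v.Kinf v.Ks, Ideal.Quotient.eq] at h1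
          have h2 := hdiff c y hyc
          have h3 := Ideal.sub_mem _ h1 h2
          rwa [tensRight_apply, sub_sub_sub_cancel_right] at h3
      have h1 := RingHom.congr_fun key (b : K)
      rw [hd] at h1
      exact h1
    · obtain ⟨w, hw⟩ := Ideal.Quotient.mk_surjective (AdicCompletion.evalₐ (v.jIdeal v.Ks) 1 (g y))
      have h1 := (hev _ 1 w hw.symm one_pos).symm.trans (hg y)
      rw [RingHom.comp_apply, RingHom.comp_apply, Ideal.Quotient.eq] at h1
      refine hw.symm.trans (Ideal.Quotient.eq.2 ?_)
      rw [pow_one]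
      exact h1
  exact ⟨⟨g, hnu, fun σ y => RingHom.congr_fun (nu_unique hK (isNu_smul hK hnu σ) hnu) y⟩⟩

end

end Place

end HodgePink
end

noncomputable section
namespace HodgePink

set_option linter.unusedSectionVars false
set_option linter.unusedVariables false

namespace Place

variable {F K : Type u} [Field F] [Fintype F] [Field K] [Algebra F K] {v : Place F K}

section Expansion

variable {L : Type u} [NormedField L] [Algebra F L] [Algebra K L] [IsScalarTower F K L]

lemma IsExpansion.add {f f' : v.Entire L} {g g' : v.Jets L} (h : v.IsExpansion f g)
    (h' : v.IsExpansion f' g') : v.IsExpansion (f + f') (g + g') := fun n => by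
  obtain ⟨b, hb, hg⟩ := h n
  obtain ⟨b', hb', hg'⟩ := h' n
  refine ⟨b + b', ?_, by rw [map_add, map_add, hg, hg']⟩
  rw [map_add, add_sub_add_comm]
  exact Ideal.add_mem _ hb hb'

lemma IsExpansion.mul {f f' : v.Entire L} {g g' : v.Jets L} (h : v.IsExpansion f g)
    (h' : v.IsExpansion f' g') : v.IsExpansion (f * f') (g * g') := fun n => by
  obtain ⟨b, hb, hg⟩ := h n
  obtain ⟨b', hb', hg'⟩ := h' n
  refine ⟨b * b', ?_, by rw [map_mul, map_mul, hg, hg']⟩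
  have : f * f' - v.toEntire L (b * b') =
      f' * (f - v.toEntire L b) + v.toEntire L b * (f' - v.toEntire L b') := by
    rw [map_mul]; ring
  rw [this]
  exact Ideal.add_mem _ (Ideal.mul_mem_left _ _ hb) (Ideal.mul_mem_left _ _ hb')

lemma isExpansion_toEntire (b : v.Coeff L) :
    v.IsExpansion (v.toEntire L b) (algebraMap _ _ b) := fun n =>
  ⟨b, by rw [sub_self]; exact zero_mem _, AlgHom.commutes _ _⟩

variable [IsUltrametricDist L] [CompleteSpace L]
  (hL : ∀ c : K, ‖algebraMap K L c‖ = v.abs c) (x : v.Coordinates)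
include hL x

lemma IsExpansion.unique {f : v.Entire L} {g g' : v.Jets L} (h : v.IsExpansion f g)
    (h' : v.IsExpansion f g') : g = g' := by
  refine AdicCompletion.ext_evalₐ fun n => ?_
  obtain ⟨b, hb, hg⟩ := h n
  obtain ⟨b', hb', hg'⟩ := h' n
  rw [hg, hg', Ideal.Quotient.eq]
  refine mem_jIdeal_pow_of_toEntire hL x n _ ?_
  have := Ideal.sub_mem _ hb' hb
  rwa [sub_sub_sub_cancel_left, ← map_sub] at this

lemma IsExpansion.exists (f : v.Entire L) : ∃ g, v.IsExpansion f g := by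
  have key (n : ℕ) : ∃ b : v.Coeff L, f - v.toEntire L b ∈ (v.jIdeal L ^ n).map (v.toEntire L) := by
    obtain ⟨b, g, hg⟩ := Entire.exists_div_pow hL x f n
    refine ⟨b, ?_⟩
    rw [hg, add_sub_cancel_left]
    exact Ideal.mul_mem_right _ _
      (Ideal.mem_map_of_mem _ (Ideal.pow_mem_pow (x.z_mem L) n))
  choose b hb using key
  let a : AdicCompletion.AdicCauchySequence (v.jIdeal L) (v.Coeff L) :=
    AdicCompletion.AdicCauchySequence.mk _ _ b fun n => by
      rw [smul_eq_mul, Ideal.mul_top]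
      refine Ideal.Quotient.eq.2 (mem_jIdeal_pow_of_toEntire hL x n _ ?_)
      have := Ideal.sub_mem _ (Ideal.map_mono (Ideal.pow_le_pow_right (Nat.le_succ n)) (hb (n + 1)))
        (hb n)
      rwa [sub_sub_sub_cancel_left, ← map_sub] at this
  exact ⟨AdicCompletion.mk _ _ a, fun n => ⟨b n, hb n, AdicCompletion.evalₐ_mk (v.jIdeal L) n a⟩⟩

/-- The expansion of entire functions at `𝔧`. -/
def expand : v.Entire L →+* v.Jets L where
  toFun f := (IsExpansion.exists hL x f).choose
  map_one' := (IsExpansion.exists hL x 1).choose_spec.unique hL x (by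
    simpa using isExpansion_toEntire (v := v) (L := L) 1)
  map_zero' := (IsExpansion.exists hL x 0).choose_spec.unique hL x (by
    simpa using isExpansion_toEntire (v := v) (L := L) 0)
  map_add' f f' := (IsExpansion.exists hL x (f + f')).choose_spec.unique hL x
    ((IsExpansion.exists hL x f).choose_spec.add (IsExpansion.exists hL x f').choose_spec)
  map_mul' f f' := (IsExpansion.exists hL x (f * f')).choose_spec.unique hL x
    ((IsExpansion.exists hL x f).choose_spec.mul (IsExpansion.exists hL x f').choose_spec)

lemma isExpansion_expand (f : v.Entire L) : v.IsExpansion f (expand hL x f) :=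
  (IsExpansion.exists hL x f).choose_spec

lemma isExpansion_iff {f : v.Entire L} {g : v.Jets L} : v.IsExpansion f g ↔ expand hL x f = g :=
  ⟨fun h => (isExpansion_expand hL x f).unique hL x h, fun h => h ▸ isExpansion_expand hL x f⟩

lemma expand_toEntire (b : v.Coeff L) : expand hL x (v.toEntire L b) = algebraMap _ _ b :=
  (isExpansion_iff hL x).1 (isExpansion_toEntire b)

end Expansion

section BaseChange

variable {L L' L'' : Type u} [NormedField L] [Algebra F L] [Algebra K L] [IsScalarTower F K L]
  [NormedField L'] [Algebra F L'] [Algebra K L'] [IsScalarTower F K L']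
  [NormedField L''] [Algebra F L''] [Algebra K L''] [IsScalarTower F K L'']

lemma tateMap_comp {L L' L'' : Type u} [NormedField L] [Algebra F L] [NormedField L'] [Algebra F L']
    [NormedField L''] [Algebra F L''] (φ : L →ₐ[F] L') (hφ : ∀ l, ‖l‖ ≤ 1 → ‖φ l‖ ≤ ‖l‖)
    (ψ : L' →ₐ[F] L'') (hψ : ∀ l, ‖l‖ ≤ 1 → ‖ψ l‖ ≤ ‖l‖) (χ : L →ₐ[F] L'')
    (hχ : ∀ l, ‖l‖ ≤ 1 → ‖χ l‖ ≤ ‖l‖) (h : ∀ l, ψ (φ l) = χ l) {s s' s'' : ℕ} (hs : s' ≤ s)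
    (hs' : s'' ≤ s') (t : v.Tate L s) :
    v.tateMap ψ hψ hs' (v.tateMap φ hφ hs t) = v.tateMap χ hχ (hs'.trans hs) t := by
  refine v.tate_induction t (isClosed_eq ((v.continuous_tateMap _ _ _).comp
    (v.continuous_tateMap _ _ _)) (v.continuous_tateMap _ _ _)) fun f => ?_
  rw [tateMap_toTate, tateMap_toTate, tateMap_toTate, ← coeffMap_comp]
  have h' : ψ.comp φ = χ := AlgHom.ext h
  rw [h']

section

variable {L L' : Type u} [NormedField L] [Algebra F L] [NormedField L'] [Algebra F L']

/-- Base change of entire functions. -/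
def entireMap (φ : L →ₐ[F] L') (hφ : ∀ l, ‖l‖ ≤ 1 → ‖φ l‖ ≤ ‖l‖) : v.Entire L →+* v.Entire L' :=
  (RingHom.pi fun s => (v.tateMap φ hφ (le_refl s)).comp
    (evalTate L s)).codRestrict (v.Entire L') fun f s => by
      have h1 := tateMap_comp φ hφ (AlgHom.id F L') (fun _ _ => le_rfl) φ
        hφ (fun _ => rfl) (le_refl (s + 1)) (Nat.le_succ s) (f.1 (s + 1))
      have h2 := tateMap_comp (AlgHom.id F L) (fun _ _ => le_rfl) φ hφ φ
        hφ (fun _ => rfl) (Nat.le_succ s) (le_refl s) (f.1 (s + 1))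
      rw [f.2 s] at h2
      exact h1.trans h2.symm

lemma entireMap_toEntire (φ : L →ₐ[F] L') (hφ : ∀ l, ‖l‖ ≤ 1 → ‖φ l‖ ≤ ‖l‖) (b : v.Coeff L) :
    entireMap φ hφ (v.toEntire L b) = v.toEntire L' (v.coeffMap φ b) :=
  Subtype.ext (funext fun s => v.tateMap_toTate φ hφ (le_refl s) b)

end

lemma IsExpansion.map {f : v.Entire L} {g : v.Jets L} (h : v.IsExpansion f g) (φ : L →ₐ[K] L')
    (hφ : ∀ l, ‖l‖ ≤ 1 → ‖φ l‖ ≤ ‖l‖) :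
    v.IsExpansion (entireMap (φ.restrictScalars F) hφ f) (v.jetsMap φ g) := fun n => by
  obtain ⟨b, hb, hg⟩ := h n
  refine ⟨v.coeffMap (φ.restrictScalars F) b, ?_, v.evalₐ_jetsMap_of_eq φ n g b hg⟩
  rw [← entireMap_toEntire (φ.restrictScalars F) hφ, ← map_sub]
  have hle : (v.jIdeal L ^ n).map (v.toEntire L) ≤
      ((v.jIdeal L' ^ n).map (v.toEntire L')).comap (entireMap (φ.restrictScalars F) hφ) :=
    Ideal.map_le_iff_le_comap.2 fun y hy => by
      have h1 := entireMap_toEntire (v := v) (φ.restrictScalars F) hφ y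
      rw [Ideal.mem_comap, Ideal.mem_comap]
      exact h1 ▸ Ideal.mem_map_of_mem _ (v.jIdeal_pow_le_comap φ n hy)
  exact hle hb

end BaseChange

section Intermediate

variable (L : IntermediateField v.Kinf v.Ks)

lemma entireToT_toEntire (b : v.Coeff L) :
    v.entireToT L (v.toEntire L b) =
      v.toTate v.Cinf 0 (v.coeffMap (v.toCinfAlg.comp (L.val.restrictScalars F)) b) :=
  v.tateMap_toTate (v.toCinfAlg.comp (L.val.restrictScalars F))
    (fun l _ => (v.norm_toCinf (l : v.Ks)).le) (le_refl 0) b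

lemma entireToT_entireMap {L L' : IntermediateField v.Kinf v.Ks} (h : L ≤ L') (f : v.Entire L) :
    v.entireToT L' (entireMap ((IntermediateField.inclusion h).restrictScalars F)
      (fun _ _ => le_rfl) f) = v.entireToT L f := by
  exact tateMap_comp ((IntermediateField.inclusion h).restrictScalars F) (fun _ _ => le_rfl)
    (v.toCinfAlg.comp (L'.val.restrictScalars F)) (fun l _ => (v.norm_toCinf (l : v.Ks)).le)
    (v.toCinfAlg.comp (L.val.restrictScalars F)) (fun l _ => (v.norm_toCinf (l : v.Ks)).le)
    (fun _ => rfl) (le_refl 0) (le_refl 0) (f.1 0)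

lemma jetsToLaurent_jetsMap (ν : v.Nu) {L L' : IntermediateField v.Kinf v.Ks} (h : L ≤ L')
    (g : v.Jets L) :
    v.jetsToLaurent ν L' (v.jetsMap ((IntermediateField.inclusion h).restrictScalars K) g) =
      v.jetsToLaurent ν L g := by
  exact congrArg (algebraMap v.O (Laurent ν)) (v.jetsMap_comp (L'.val.restrictScalars K)
    ((IntermediateField.inclusion h).restrictScalars K) g).symm

/-- Entire functions are determined by their restriction to a disc. -/
lemma entire_ext (x : v.Coordinates) {L : Type u} [NormedField L] [Algebra F L]
    [IsUltrametricDist L] [CompleteSpace L] {f g : v.Entire L} (h : f.1 0 = g.1 0) : f = g := by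
  refine Subtype.ext (funext fun s => ?_)
  induction s with
  | zero => exact h
  | succ s ih =>
    refine x.tateMap_injective (AlgHom.id F L) (fun _ _ => le_rfl) (Nat.le_succ s) ?_
    rw [f.2 s, g.2 s, ih]

lemma entireToT_injective (x : v.Coordinates) [FiniteDimensional v.Kinf L] :
    Function.Injective (v.entireToT L) := fun f g hfg => by
  have := v.completeSpace_of_finiteDimensional L
  exact entire_ext x (x.tateMap_injective (v.toCinfAlg.comp (L.val.restrictScalars F))
    (fun l _ => (v.norm_toCinf (l : v.Ks)).le) (le_refl 0) hfg)

end Intermediate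

end Place

end HodgePink
end

noncomputable section
namespace HodgePink

set_option linter.unusedSectionVars false
set_option linter.unusedVariables false

namespace Place

variable {F K : Type u} [Field F] [Fintype F] [Field K] [Algebra F K] {v : Place F K}

section Box

variable (v) (L : Type u) [NormedField L] [Algebra F L]

/-- The finite sums of pure tensors `a ⊗ l` with `max(1, |a|) ≤ R` and `|l| ≤ r`. -/
def box (R r : ℝ) : AddSubgroup (v.Coeff L) :=
  AddSubgroup.closure {f | ∃ (a : v.A) (l : L), f = v.tens a l ∧ max 1 (v.abs (a : K)) ≤ R ∧ ‖l‖ ≤ r}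

variable {v L}

lemma box_mono {R R' r r' : ℝ} (hR : R ≤ R') (hr : r ≤ r') : v.box L R r ≤ v.box L R' r' :=
  AddSubgroup.closure_mono fun _ ⟨a, l, hf, ha, hl⟩ => ⟨a, l, hf, ha.trans hR, hl.trans hr⟩

lemma mul_mem_box {R r R' r' : ℝ} (hr : 0 ≤ r) {f g : v.Coeff L} (hf : f ∈ v.box L R r)
    (hg : g ∈ v.box L R' r') : f * g ∈ v.box L (R * R') (r * r') := by
  induction hf using AddSubgroup.closure_induction with
  | zero => simp
  | add x y _ _ hx hy => rw [add_mul]; exact add_mem hx hy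
  | neg x _ hx => rw [neg_mul]; exact neg_mem hx
  | mem x hx =>
    obtain ⟨a, l, rfl, ha, hl⟩ := hx
    induction hg using AddSubgroup.closure_induction with
    | zero => simp
    | add x y _ _ hx hy => rw [mul_add]; exact add_mem hx hy
    | neg x _ hx => rw [mul_neg]; exact neg_mem hx
    | mem y hy =>
      obtain ⟨b, m, rfl, hb, hm⟩ := hy
      refine AddSubgroup.subset_closure ⟨a * b, l * m, v.tens_mul_tens .., ?_, ?_⟩
      · have h1 : max 1 (v.abs ((a * b : v.A) : K)) ≤
            max 1 (v.abs (a : K)) * max 1 (v.abs (b : K)) := by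
          rw [MulMemClass.coe_mul, map_mul]
          refine max_le (one_le_mul_of_one_le_of_one_le (le_max_left _ _) (le_max_left _ _)) ?_
          exact mul_le_mul (le_max_right _ _) (le_max_right _ _) (v.abs.nonneg _) (by positivity)
        have h2 : 0 ≤ R := le_trans (by positivity) ha
        exact h1.trans (mul_le_mul ha hb (by positivity) h2)
      · rw [norm_mul]
        exact mul_le_mul hl hm (norm_nonneg _) hr

lemma tau_mem_box {R r : ℝ} {f : v.Coeff L} (hf : f ∈ v.box L R r) :
    v.tau L f ∈ v.box L R (r ^ Fintype.card F) := by
  induction hf using AddSubgroup.closure_induction with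
  | zero => simp
  | add x y _ _ hx hy => rw [map_add]; exact add_mem hx hy
  | neg x _ hx => rw [map_neg]; exact neg_mem hx
  | mem x hx =>
    obtain ⟨a, l, rfl, ha, hl⟩ := hx
    refine AddSubgroup.subset_closure ⟨a, l ^ Fintype.card F, rfl, ha, ?_⟩
    rw [norm_pow]
    exact pow_le_pow_left₀ (norm_nonneg _) hl _

lemma box_le_gaussBall (s : ℕ) {R r : ℝ} (hr : 0 ≤ r) :
    v.box L R r ≤ v.gaussBall L s (r * R ^ s) :=
  AddSubgroup.closure_mono fun _ ⟨a, l, hf, ha, hl⟩ => ⟨a, l, hf, by gcongr⟩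

lemma exists_mem_box {r : ℝ} {f : v.Coeff L} (hf : f ∈ v.gaussBall L 0 r) :
    ∃ R, 1 ≤ R ∧ f ∈ v.box L R r := by
  induction hf using AddSubgroup.closure_induction with
  | zero => exact ⟨1, le_rfl, zero_mem _⟩
  | add x y _ _ hx hy =>
    obtain ⟨R, hR, hx⟩ := hx
    obtain ⟨R', hR', hy⟩ := hy
    exact ⟨max R R', hR.trans (le_max_left _ _), add_mem (box_mono (le_max_left _ _) le_rfl hx)
      (box_mono (le_max_right _ _) le_rfl hy)⟩
  | neg x _ hx =>
    obtain ⟨R, hR, hx⟩ := hx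
    exact ⟨R, hR, neg_mem hx⟩
  | mem x hx =>
    obtain ⟨a, l, rfl, hl⟩ := hx
    refine ⟨max 1 (v.abs (a : K)), le_max_left _ _, AddSubgroup.subset_closure ⟨a, l, rfl, le_rfl, ?_⟩⟩
    simpa using hl

lemma exists_forall_mem_box {ι : Type*} [Fintype ι] {r : ℝ} (f : ι → v.Coeff L)
    (hf : ∀ i, f i ∈ v.gaussBall L 0 r) : ∃ R, 1 ≤ R ∧ ∀ i, f i ∈ v.box L R r := by
  choose R hR hRf using fun i => exists_mem_box (hf i)
  have h0 (i : ι) : 0 ≤ R i := zero_le_one.trans (hR i)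
  refine ⟨1 + ∑ i, R i, le_add_of_nonneg_right (Finset.sum_nonneg fun i _ => h0 i), fun i => ?_⟩
  refine box_mono ?_ le_rfl (hRf i)
  have := Finset.single_le_sum (f := R) (fun i _ => h0 i) (Finset.mem_univ i)
  linarith

end Box

section Tau

variable (L : Type u) [NormedField L] [Algebra F L]

lemma norm_frobenius_le (l : L) (hl : ‖l‖ ≤ 1) : ‖FiniteField.frobeniusAlgHom F L l‖ ≤ ‖l‖ := by
  simp only [FiniteField.coe_frobeniusAlgHom, norm_pow]
  exact pow_le_of_le_one (norm_nonneg _) hl Fintype.card_ne_zero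

/-- The continuous extension of `τ` to the completions of `A ⊗ L`. -/
def tauTate (s : ℕ) : v.Tate L s →+* v.Tate L s :=
  v.tateMap (FiniteField.frobeniusAlgHom F L) (norm_frobenius_le L) (le_refl s)

/-- The extension of `τ` to entire functions. -/
def tauEntire : v.Entire L →+* v.Entire L :=
  entireMap (FiniteField.frobeniusAlgHom F L) (norm_frobenius_le L)

variable {L}

lemma continuous_tauTate (s : ℕ) : Continuous (tauTate (v := v) L s) := v.continuous_tateMap _ _ _

lemma tauTate_toTate (s : ℕ) (f : v.Coeff L) :
    tauTate L s (v.toTate L s f) = v.toTate L s (v.tau L f) := v.tateMap_toTate _ _ _ f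

lemma norm_tauTate_le (t : v.Tate L 0) : ‖tauTate L 0 t‖ ≤ ‖t‖ ^ Fintype.card F := by
  refine v.tate_induction t (isClosed_le (continuous_tauTate 0).norm (continuous_norm.pow _))
    fun f => ?_
  rw [tauTate_toTate, norm_toTate, norm_toTate]
  have h1 (r : ℝ) (hr : v.gaussNorm L 0 f < r) :
      v.gaussNorm L 0 (v.tau L f) ≤ r ^ Fintype.card F := by
    have h0 : 0 ≤ r := (v.gaussNorm_nonneg 0 f).trans hr.le
    obtain ⟨R, hR, hf⟩ := exists_mem_box (v.mem_gaussBall_of_lt hr)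
    refine v.gaussNorm_le (by positivity) ?_
    simpa using box_le_gaussBall 0 (by positivity) (tau_mem_box hf)
  refine ge_of_tendsto (f := fun r : ℝ => r ^ Fintype.card F)
    (x := nhdsWithin (v.gaussNorm L 0 f) (Set.Ioi (v.gaussNorm L 0 f))) ?_
    (eventually_nhdsWithin_of_forall fun r hr => h1 r hr)
  exact ((continuous_pow _).tendsto _).mono_left nhdsWithin_le_nhds

end Tau

section FixedPoint

variable {L : Type u} [NormedField L] [Algebra F L] [IsUltrametricDist L] [CompleteSpace L]
  (x : v.Coordinates) {k : ℕ} (Ψ : Fin k → Fin k → v.Coeff L)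

/-- The iterates of `y ↦ Ψ τ(y)`. -/
def iter (y : Fin k → v.Coeff L) : ℕ → Fin k → v.Coeff L
  | 0 => y
  | m + 1 => fun i => ∑ j, Ψ i j * v.tau L (iter y m j)

lemma summable_superexponential {δ K : ℝ} (hδ0 : 0 < δ) (hδ : δ < 1) (hK : 0 < K) :
    Summable fun m : ℕ => δ ^ 2 ^ m * K ^ m := by
  refine summable_of_ratio_test_tendsto_lt_one (l := 0) one_pos
    (Filter.Eventually.of_forall fun m => by positivity) ?_
  have h1 : ∀ m : ℕ, ‖δ ^ 2 ^ (m + 1) * K ^ (m + 1)‖ / ‖δ ^ 2 ^ m * K ^ m‖ = δ ^ 2 ^ m * K := by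
    intro m
    rw [Real.norm_of_nonneg (by positivity), Real.norm_of_nonneg (by positivity),
      div_eq_iff (by positivity)]
    ring
  simp_rw [h1]
  have h2 : Filter.Tendsto (fun m : ℕ => δ ^ 2 ^ m) Filter.atTop (nhds 0) :=
    (tendsto_pow_atTop_nhds_zero_of_lt_one hδ0.le hδ).comp (tendsto_pow_atTop_atTop_of_one_lt one_lt_two)
  simpa using h2.mul_const K

lemma iter_mem_box {C r R R' : ℝ} (hC : 1 ≤ C) (hr : 0 ≤ r) (hCr : C * r < 1)
    (hΨ : ∀ i j, Ψ i j ∈ v.box L R' C) (y : Fin k → v.Coeff L) (hy : ∀ i, y i ∈ v.box L R r)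
    (m : ℕ) (i : Fin k) :
    iter Ψ y m i ∈ v.box L (R * R' ^ m) ((C * r) ^ 2 ^ m / C) := by
  have hC0 : 0 < C := zero_lt_one.trans_le hC
  induction m generalizing i with
  | zero => simpa [iter, hC0.ne', mul_div_cancel_left₀] using hy i
  | succ m ih =>
    refine sum_mem fun j _ => ?_
    have h1 := mul_mem_box hC0.le (hΨ i j) (tau_mem_box (ih j))
    refine box_mono (le_of_eq (by ring)) ?_ h1
    have h2 : (C * r) ^ 2 ^ m / C ≤ 1 := by
      rw [div_le_one hC0]
      exact (pow_le_one₀ (by positivity) hCr.le).trans hC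
    have h3 := pow_le_pow_of_le_one (by positivity) h2 (Fintype.one_lt_card (α := F))
    calc C * ((C * r) ^ 2 ^ m / C) ^ Fintype.card F ≤ C * ((C * r) ^ 2 ^ m / C) ^ 2 := by gcongr
      _ = (C * r) ^ 2 ^ (m + 1) / C := by
        field_simp
        ring

lemma hasSum_of_succ {V : Type*} [NormedCommRing V] {f : ℕ → V} {a : V}
    (h : HasSum (fun m => f (m + 1)) a) : HasSum f (f 0 + a) := h.zero_add

/-- A convergent sum of entire functions. -/
def entireSum (f : ℕ → v.Coeff L) (h : ∀ s, Summable fun m => v.toTate L s (f m)) : v.Entire L :=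
  ⟨fun s => ∑' m, v.toTate L s (f m), fun s => by
    refine ((h (s + 1)).map_tsum (v.tateMap (AlgHom.id F L) (fun _ _ => le_rfl) (Nat.le_succ s))
      (v.continuous_tateMap _ _ _)).trans (tsum_congr fun m => ?_)
    exact (v.tateMap_toTate _ _ _ _).trans (congrArg _ (v.coeffMap_id _))⟩

include x in
/-- The equation `η = y + Ψ τ(η)` has a solution in entire functions, if `y` is small. -/
lemma exists_entire_eq {C r : ℝ} (hC : 1 ≤ C) (hr : 0 < r) (hCr : C * r < 1)
    (hΨ : ∀ i j, Ψ i j ∈ v.gaussBall L 0 C) (y : Fin k → v.Coeff L)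
    (hy : ∀ i, y i ∈ v.gaussBall L 0 r) :
    ∃ η : Fin k → v.Entire L,
      (∀ i, η i = v.toEntire L (y i) + ∑ j, v.toEntire L (Ψ i j) * tauEntire L (η j)) ∧
      ∀ i, ‖evalTate L 0 (η i)‖ ≤ r := by
  obtain ⟨R, hR, hyR⟩ := exists_forall_mem_box y hy
  obtain ⟨R', hR', hΨR⟩ := exists_forall_mem_box (fun ij : Fin k × Fin k => Ψ ij.1 ij.2)
    fun ij => hΨ ij.1 ij.2
  have hC0 : 0 < C := zero_lt_one.trans_le hC
  have hR0 : 0 < R := zero_lt_one.trans_le hR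
  have hR'0 : 0 < R' := zero_lt_one.trans_le hR'
  have hbox := iter_mem_box Ψ hC hr.le hCr (fun i j => hΨR (i, j)) y hyR
  have hnorm (s m : ℕ) (i : Fin k) : ‖v.toTate L s (iter Ψ y m i)‖ ≤
      (C * r) ^ 2 ^ m / C * (R * R' ^ m) ^ s := by
    rw [norm_toTate]
    exact v.gaussNorm_le (by positivity) (box_le_gaussBall s (by positivity) (hbox m i))
  have hsum (s : ℕ) (i : Fin k) : Summable fun m => v.toTate L s (iter Ψ y m i) := by
    refine Summable.of_norm_bounded (g := fun m => R ^ s / C * ((C * r) ^ 2 ^ m * (R' ^ s) ^ m))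
      ((summable_superexponential (by positivity) hCr (by positivity)).mul_left _) fun m => ?_
    refine (hnorm s m i).trans (le_of_eq ?_)
    have h1 : (R' ^ s) ^ m = (R' ^ m) ^ s := by rw [← pow_mul, ← pow_mul, mul_comm]
    rw [mul_pow R, h1]
    ring
  let e (i : Fin k) : v.Entire L := entireSum (fun m => iter Ψ y m i) fun s => hsum s i
  have he (i : Fin k) (s : ℕ) : HasSum (fun m => v.toTate L s (iter Ψ y m i)) (evalTate L s (e i)) :=
    (hsum s i).hasSum
  refine ⟨e, fun i => Subtype.ext (funext fun s => ?_), fun i => ?_⟩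
  · change evalTate L s (e i) = evalTate L s (v.toEntire L (y i) +
      ∑ j, v.toEntire L (Ψ i j) * tauEntire L (e j))
    have h1 : HasSum (fun m => v.toTate L s (iter Ψ y (m + 1) i))
        (∑ j, v.toTate L s (Ψ i j) * tauTate L s (evalTate L s (e j))) := by
      have h2 (j : Fin k) : HasSum
          (fun m => v.toTate L s (Ψ i j) * v.toTate L s (v.tau L (iter Ψ y m j)))
          (v.toTate L s (Ψ i j) * tauTate L s (evalTate L s (e j))) := by
        have := ((he j s).map (tauTate L s) (continuous_tauTate s)).mul_left (v.toTate L s (Ψ i j))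
        exact this.congr_fun fun m => congrArg _ (tauTate_toTate s _).symm
      have h3 := hasSum_sum (s := Finset.univ) fun j _ => h2 j
      refine h3.congr_fun fun m => ?_
      rw [iter, map_sum]
      exact Finset.sum_congr rfl fun j _ => map_mul _ _ _
    have h4 := hasSum_of_succ (f := fun m => v.toTate L s (iter Ψ y m i)) h1
    rw [(he i s).unique h4, map_add, map_sum]
    congr 1
  · have := x.isUltrametricDist_tate (L := L) 0
    refine le_of_tendsto (he i 0).norm (Filter.Eventually.of_forall fun u => ?_)
    refine IsUltrametricDist.norm_sum_le_of_forall_le_of_nonneg hr.le fun m _ => ?_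
    refine (hnorm 0 m i).trans ?_
    rw [pow_zero, mul_one, div_le_iff₀ hC0, mul_comm r]
    exact pow_le_of_le_one (by positivity) hCr.le (by positivity)

include x in
lemma eq_zero_of_fixed {C r : ℝ} (hC : 1 ≤ C) (hCr : C * r < 1) 
    (Φ : Fin k → Fin k → v.Tate L 0) (hΦ : ∀ i j, ‖Φ i j‖ ≤ C) (t : Fin k → v.Tate L 0)
    (ht : ∀ i, ‖t i‖ ≤ r) (h : ∀ i, t i = ∑ j, Φ i j * tauTate L 0 (t j)) (i : Fin k) : t i = 0 := by
  have := x.isUltrametricDist_tate (L := L) 0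
  obtain ⟨i₀, -, hi₀⟩ := Finset.exists_max_image Finset.univ (fun i => ‖t i‖) ⟨i, Finset.mem_univ i⟩
  have hC0 : 0 < C := zero_lt_one.trans_le hC
  have hM0 := norm_nonneg (t i₀)
  have hM1 : ‖t i₀‖ ≤ 1 := by nlinarith [ht i₀]
  have h1 : ‖t i₀‖ ≤ C * ‖t i₀‖ ^ 2 := by
    nth_rw 1 [h i₀]
    refine IsUltrametricDist.norm_sum_le_of_forall_le_of_nonneg (by positivity) fun j _ => ?_
    refine (norm_mul_le _ _).trans (mul_le_mul (hΦ _ _) ?_ (norm_nonneg _) hC0.le)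
    refine (norm_tauTate_le _).trans ?_
    refine (pow_le_pow_left₀ (norm_nonneg _) (hi₀ j (Finset.mem_univ j)) _).trans ?_
    exact pow_le_pow_of_le_one hM0 hM1 (Fintype.one_lt_card (α := F))
  have h2 : ‖t i₀‖ = 0 := by
    by_contra hne
    have h3 : 0 < ‖t i₀‖ := lt_of_le_of_ne hM0 (Ne.symm hne)
    have h4 : C * ‖t i₀‖ < 1 := lt_of_le_of_lt (mul_le_mul_of_nonneg_left (ht i₀) hC0.le) hCr
    nlinarith
  exact norm_le_zero_iff.1 ((hi₀ i (Finset.mem_univ i)).trans h2.le)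

end FixedPoint

end Place

end HodgePink
end

noncomputable section
namespace HodgePink

set_option linter.unusedSectionVars false
set_option linter.unusedVariables false

namespace Place

variable {F K : Type u} [Field F] [Fintype F] [Field K] [Algebra F K] {v : Place F K}

lemma tauT_entireToT (L : IntermediateField v.Kinf v.Ks) (f : v.Entire L) :
    v.tauT (v.entireToT L f) = v.entireToT L (tauEntire L f) := by
  have h1 := tateMap_comp (v.toCinfAlg.comp (L.val.restrictScalars F))
    (fun l _ => (v.norm_toCinf (l : v.Ks)).le) (FiniteField.frobeniusAlgHom F v.Cinf)
    (norm_frobenius_le v.Cinf) ((FiniteField.frobeniusAlgHom F v.Cinf).comp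
      (v.toCinfAlg.comp (L.val.restrictScalars F)))
    (fun l hl => (norm_frobenius_le v.Cinf _ ((v.norm_toCinf (l : v.Ks)).le.trans hl)).trans
      (v.norm_toCinf (l : v.Ks)).le) (fun _ => rfl) (le_refl 0) (le_refl 0) (f.1 0)
  have h2 := tateMap_comp (FiniteField.frobeniusAlgHom F L) (norm_frobenius_le L)
    (v.toCinfAlg.comp (L.val.restrictScalars F)) (fun l _ => (v.norm_toCinf (l : v.Ks)).le)
    ((FiniteField.frobeniusAlgHom F v.Cinf).comp (v.toCinfAlg.comp (L.val.restrictScalars F)))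
    (fun l hl => (norm_frobenius_le v.Cinf _ ((v.norm_toCinf (l : v.Ks)).le.trans hl)).trans
      (v.norm_toCinf (l : v.Ks)).le)
    (fun l => by simp) (le_refl 0) (le_refl 0) (f.1 0)
  exact h1.trans h2.symm

lemma entireToT_algebraMap (L : IntermediateField v.Kinf v.Ks) (b : v.B) :
    v.entireToT L (v.toEntire L (v.coeffMap (IsScalarTower.toAlgHom F K L) b)) =
      algebraMap v.B v.T b := by
  rw [entireToT_toEntire, ← coeffMap_comp]
  rfl

lemma norm_entireToT (x : v.Coordinates) (L : IntermediateField v.Kinf v.Ks)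
    [FiniteDimensional v.Kinf L] (f : v.Entire L) : ‖v.entireToT L f‖ = ‖evalTate L 0 f‖ := by
  have := v.completeSpace_of_finiteDimensional L
  exact x.norm_tateMap (v.toCinfAlg.comp (L.val.restrictScalars F))
    (fun l => v.norm_toCinf (l : v.Ks)) 0 (f.1 0)

/-- The map `A ⊗ K_∞^s → ℂ_∞⟨A⟩`. -/
def coeffToT : v.Coeff v.Ks →+* v.T :=
  (v.toTate v.Cinf 0).comp (v.coeffMap v.toCinfAlg : v.Coeff v.Ks →+* v.Coeff v.Cinf)

/-- The elements of `A ⊗ K_∞^s` are dense in `ℂ_∞⟨A⟩`. -/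
lemma exists_coeff_Ks_near_tate (t : v.Tate v.Cinf 0) {ε : ℝ} (hε : 0 < ε) :
    ∃ b : v.Coeff v.Ks, ‖t - v.toTate v.Cinf 0 (v.coeffMap v.toCinfAlg b)‖ < ε := by
  obtain ⟨c, hc⟩ := (denseRange_toTate (v := v) (L := v.Cinf) 0).exists_dist_lt t (half_pos hε)
  rw [dist_eq_norm] at hc
  have key : ∀ c : v.Coeff v.Cinf, ∀ ε > 0, ∃ b : v.Coeff v.Ks,
      ‖v.toTate v.Cinf 0 c - v.toTate v.Cinf 0 (v.coeffMap v.toCinfAlg b)‖ < ε := by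
    intro c
    refine v.coeff_induction c (fun ε hε => ⟨0, by simpa using hε⟩) (fun a l ε hε => ?_)
      fun f g hf hg ε hε => ?_
    · obtain ⟨l', hl'⟩ := v.denseRange_toCinf.exists_dist_lt l hε
      rw [dist_eq_norm] at hl'
      refine ⟨v.tens a l', ?_⟩
      rw [coeffMap_tens, ← map_sub, norm_toTate]
      have h1 : v.tens a l - v.tens a (v.toCinfAlg l') = v.tens a (l - v.toCinf l') :=
        (TensorProduct.tmul_sub _ _ _).symm
      rw [h1]
      refine (v.gaussNorm_le (norm_nonneg _) (AddSubgroup.subset_closure ⟨a, _, rfl, ?_⟩)).trans_lt hl'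
      simp
    · obtain ⟨b, hb⟩ := hf _ (half_pos hε)
      obtain ⟨b', hb'⟩ := hg _ (half_pos hε)
      refine ⟨b + b', ?_⟩
      rw [map_add, map_add, map_add, add_sub_add_comm]
      exact (norm_add_le _ _).trans_lt (by linarith)
  obtain ⟨b, hb⟩ := key c _ (half_pos hε)
  refine ⟨b, ?_⟩
  rw [← sub_add_sub_cancel]
  exact (norm_add_le _ _).trans_lt (by linarith)

lemma exists_coeff_Ks_near (t : v.T) {ε : ℝ} (hε : 0 < ε) :
    ∃ b : v.Coeff v.Ks, ‖t - coeffToT b‖ < ε := exists_coeff_Ks_near_tate t hε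

/-- The elements of `A ⊗ K_∞^s` are defined over finite extensions of `K_∞`. -/
lemma exists_finite_coeff (b : v.Coeff v.Ks) : ∃ (L : IntermediateField v.Kinf v.Ks),
    FiniteDimensional v.Kinf L ∧ ∀ L', L ≤ L' → ∃ c : v.Coeff L',
      v.coeffMap (L'.val.restrictScalars F) c = b := by
  refine v.coeff_induction b ⟨⊥, inferInstance, fun L' _ => ⟨0, map_zero _⟩⟩ (fun a l => ?_)
    fun f g hf hg => ?_
  · have hl : IsIntegral v.Kinf l := Algebra.IsIntegral.isIntegral l
    refine ⟨IntermediateField.adjoin v.Kinf {l}, IntermediateField.adjoin.finiteDimensional hl,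
      fun L' hL => ?_⟩
    exact ⟨v.tens a ⟨l, hL (IntermediateField.mem_adjoin_simple_self v.Kinf l)⟩, rfl⟩
  · obtain ⟨L, hL, h⟩ := hf
    obtain ⟨L', hL', h'⟩ := hg
    refine ⟨L ⊔ L', IntermediateField.finiteDimensional_sup L L', fun L'' hL'' => ?_⟩
    obtain ⟨c, rfl⟩ := h L'' (le_sup_left.trans hL'')
    obtain ⟨c', rfl⟩ := h' L'' (le_sup_right.trans hL'')
    exact ⟨c + c', map_add _ _ _⟩

lemma exists_gaussBall (L : Type u) [NormedField L] [Algebra F L] {ι : Type*} [Fintype ι]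
    (f : ι → v.Coeff L) : ∃ C, 1 ≤ C ∧ ∀ i, f i ∈ v.gaussBall L 0 C := by
  refine ⟨1 + ∑ i, (v.gaussNorm L 0 (f i) + 1), le_add_of_nonneg_right (Finset.sum_nonneg
    fun i _ => add_nonneg (v.gaussNorm_nonneg 0 _) zero_le_one), fun i => ?_⟩
  refine v.mem_gaussBall_of_lt ?_
  have := Finset.single_le_sum (f := fun i => v.gaussNorm L 0 (f i) + 1)
    (fun i _ => add_nonneg (v.gaussNorm_nonneg 0 _) zero_le_one) (Finset.mem_univ i)
  linarith [v.gaussNorm_nonneg 0 (f i)]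

/-- The solutions of `w = Ψ τ(w)` in `ℂ_∞⟨A⟩` are entire. -/
lemma exists_entire_of_fixed (x : v.Coordinates) {k : ℕ} (Ψ : Fin k → Fin k → v.B) (w : Fin k → v.T)
    (hw : ∀ i, w i = ∑ j, algebraMap v.B v.T (Ψ i j) * v.tauT (w j)) :
    ∃ (L : IntermediateField v.Kinf v.Ks) (_ : FiniteDimensional v.Kinf L)
      (f : Fin k → v.Entire L), ∀ i, v.entireToT L (f i) = w i := by
  have hult : IsUltrametricDist v.T := x.isUltrametricDist_tate (L := v.Cinf) 0
  let ΨT : Fin k → Fin k → v.Coeff v.Cinf :=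
    fun i j => v.coeffMap (IsScalarTower.toAlgHom F K v.Cinf) (Ψ i j)
  obtain ⟨C', hC', hΨC⟩ := exists_gaussBall v.Cinf fun ij : Fin k × Fin k => ΨT ij.1 ij.2
  set C : ℝ := C' + 1 with hCdef
  have hC : 1 ≤ C := by linarith
  have hC0 : 0 < C := zero_lt_one.trans_le hC
  have hΨn' (i j) : ‖algebraMap v.B v.T (Ψ i j)‖ ≤ C' :=
    (norm_toTate (v := v) (L := v.Cinf) 0 _).le.trans (v.gaussNorm_le (by linarith) (hΨC (i, j)))
  have hΨn (i j) : ‖algebraMap v.B v.T (Ψ i j)‖ ≤ C := (hΨn' i j).trans (by linarith)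
  set r : ℝ := 1 / (2 * C) with hr
  have hr0 : 0 < r := by positivity
  have hCr : C * r < 1 := by rw [hr]; field_simp; norm_num
  have hr1 : r ≤ 1 := by rw [hr, div_le_one (by positivity)]; linarith
  choose b hb using fun i => exists_coeff_Ks_near (w i) (half_pos hr0)
  choose L hL hLb using fun i => exists_finite_coeff (b i)
  have hfin : FiniteDimensional v.Kinf (⨆ i, L i : IntermediateField v.Kinf v.Ks) :=
    IntermediateField.finiteDimensional_iSup_of_finite
  set N : IntermediateField v.Kinf v.Ks := ⨆ i, L i with hN
  have := v.completeSpace_of_finiteDimensional N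
  choose c hc using fun i => hLb i N (le_iSup L i)
  have hcw (i : Fin k) : ‖v.entireToT N (v.toEntire N (c i)) - w i‖ < r / 2 := by
    have h1 : v.entireToT N (v.toEntire N (c i)) = coeffToT (b i) := by
      rw [← hc i]
      exact (entireToT_toEntire N _).trans (congrArg _ (v.coeffMap_comp _ _ _))
    rw [h1, norm_sub_rev]
    exact hb i
  let ΨN : Fin k → Fin k → v.Coeff N :=
    fun i j => v.coeffMap (IsScalarTower.toAlgHom F K N) (Ψ i j)
  let y : Fin k → v.Coeff N := fun i => ∑ j, ΨN i j * v.tau N (c j) - c i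
  have hyT (i : Fin k) : v.entireToT N (v.toEntire N (y i)) =
      ∑ j, algebraMap v.B v.T (Ψ i j) * v.tauT (v.entireToT N (v.toEntire N (c j)) - w j) -
        (v.entireToT N (v.toEntire N (c i)) - w i) := by
    have h1 (j : Fin k) : v.entireToT N (v.toEntire N (v.tau N (c j))) =
        v.tauT (v.entireToT N (v.toEntire N (c j))) := by
      rw [tauT_entireToT, tauEntire, entireMap_toEntire]; rfl
    have h2 : v.entireToT N (v.toEntire N (y i)) =
        ∑ j, algebraMap v.B v.T (Ψ i j) * v.tauT (v.entireToT N (v.toEntire N (c j))) -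
          v.entireToT N (v.toEntire N (c i)) := by
      simp only [y, map_sub, map_sum, map_mul, h1, ΨN, entireToT_algebraMap]
    simp only [h2, map_sub, mul_sub, Finset.sum_sub_distrib, ← hw i]
    ring
  have hτ (t : v.T) (ht : ‖t‖ < r / 2) : ‖v.tauT t‖ ≤ (r / 2) ^ 2 := by
    refine (norm_tauTate_le t).trans ?_
    have h1 : r / 2 ≤ 1 := by linarith
    exact (pow_le_pow_left₀ (norm_nonneg _) ht.le _).trans
      (pow_le_pow_of_le_one (by positivity) h1 (Fintype.one_lt_card (α := F)))
  have hnorm (f : v.Coeff N) : v.gaussNorm N 0 f = ‖v.entireToT N (v.toEntire N f)‖ := by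
    rw [norm_entireToT x, evalTate_toEntire, norm_toTate]
  have hy (i : Fin k) : y i ∈ v.gaussBall N 0 r := by
    refine v.mem_gaussBall_of_lt ?_
    rw [hnorm, hyT]
    have h2 : ‖∑ j, algebraMap v.B v.T (Ψ i j) *
        v.tauT (v.entireToT N (v.toEntire N (c j)) - w j)‖ ≤ r / 2 := by
      refine IsUltrametricDist.norm_sum_le_of_forall_le_of_nonneg (by positivity) fun j _ => ?_
      refine (norm_mul_le _ _).trans
        ((mul_le_mul (hΨn i j) (hτ _ (hcw j)) (norm_nonneg _) hC0.le).trans ?_)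
      nlinarith
    refine (norm_sub_le _ _).trans_lt ?_
    linarith [hcw i]
  have hΨCN (i j) : ΨN i j ∈ v.gaussBall N 0 C := by
    refine v.mem_gaussBall_of_lt ?_
    rw [hnorm, entireToT_algebraMap]
    exact (hΨn' i j).trans_lt (by linarith)
  obtain ⟨η, hη, hηr⟩ := exists_entire_eq x ΨN hC hr0 hCr hΨCN y hy
  refine ⟨N, hfin, fun i => v.toEntire N (c i) + η i, fun i => ?_⟩
  have hfix := eq_zero_of_fixed x (L := v.Cinf) (r := r) hC hCr
    (fun i j => algebraMap v.B v.T (Ψ i j)) hΨn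
    (fun i => v.entireToT N (v.toEntire N (c i) + η i) - w i) (fun i => ?_) (fun i => ?_) i
  · exact sub_eq_zero.1 hfix
  · rw [map_add, add_sub_right_comm]
    refine (hult.norm_add_le_max _ _).trans (max_le ((hcw i).le.trans (by linarith)) ?_)
    rw [norm_entireToT x]
    exact hηr i
  · have h1 : v.entireToT N (v.toEntire N (c i) + η i) =
        ∑ j, algebraMap v.B v.T (Ψ i j) * v.tauT (v.entireToT N (v.toEntire N (c j) + η j)) := by
      rw [hη i]
      have h2 (j : Fin k) : tauEntire N (v.toEntire N (c j)) = v.toEntire N (v.tau N (c j)) :=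
        entireMap_toEntire _ _ _
      simp only [y, map_add, map_sub, map_sum, map_mul, tauT_entireToT, h2, ΨN,
        entireToT_algebraMap, mul_add, Finset.sum_add_distrib]
      ring
    have h3 : ∑ j, algebraMap v.B v.T (Ψ i j) *
        v.tauT (v.entireToT N (v.toEntire N (c j) + η j) - w j) =
        v.entireToT N (v.toEntire N (c i) + η i) - w i := by
      rw [h1, hw i, ← Finset.sum_sub_distrib]
      exact Finset.sum_congr rfl fun j _ => by rw [map_sub, mul_sub]
    exact h3.symm

end Place

end HodgePink
end

noncomputable section
namespace HodgePink

set_option linter.unusedSectionVars false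
set_option linter.unusedVariables false

namespace Place

variable {F K : Type u} [Field F] [Fintype F] [Field K] [Algebra F K] {v : Place F K}

section Value

variable {L : Type u} [NormedField L] [Algebra F L] [Algebra K L] [IsScalarTower F K L]
  [IsUltrametricDist L] [CompleteSpace L] (hL : ∀ c : K, ‖algebraMap K L c‖ = v.abs c)
include hL

lemma norm_mulMap_le (f : v.Coeff L) : ‖v.mulMap L f‖ ≤ v.gaussNorm L 1 f := by
  have key {r : ℝ} (hr : 0 ≤ r) (hf : f ∈ v.gaussBall L 1 r) : ‖v.mulMap L f‖ ≤ r := by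
    induction hf using AddSubgroup.closure_induction with
    | zero => rwa [map_zero, norm_zero]
    | add x y _ _ hx hy =>
      rw [map_add]; exact (IsUltrametricDist.norm_add_le_max _ _).trans (max_le hx hy)
    | neg x _ hx => rwa [map_neg, norm_neg]
    | mem x hx =>
      obtain ⟨a, l, rfl, hl⟩ := hx
      rw [mulMap_tens, norm_mul, mul_comm]
      have h : ‖algebraMap K L (a : K)‖ ≤ max 1 (v.abs (a : K)) ^ 1 := by
        rw [hL, pow_one]; exact le_max_right _ _
      exact (mul_le_mul_of_nonneg_left h (norm_nonneg _)).trans hl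
  refine le_of_forall_pos_le_add fun ε hε => key ?_ (v.mem_gaussBall_of_lt (by linarith))
  have := v.gaussNorm_nonneg 1 f
  positivity

/-- The value at `𝔧` of a function on the disc of radius `ρ₀`. -/
def valueT : v.Tate L 1 →+ L := v.tateLift 1 (v.mulMap L).toAddMonoidHom (norm_mulMap_le hL)

lemma valueT_toTate (f : v.Coeff L) : valueT hL (v.toTate L 1 f) = v.mulMap L f :=
  tateLift_toTate _ _ f

lemma norm_valueT_le (t : v.Tate L 1) : ‖valueT hL t‖ ≤ ‖t‖ := norm_tateLift_le _ _ t

lemma valueT_toTate_mul (f : v.Coeff L) (t : v.Tate L 1) :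
    valueT hL (v.toTate L 1 f * t) = v.mulMap L f * valueT hL t := by
  have hc : Continuous (valueT (v := v) hL) := continuous_tateLift _ _
  refine v.tate_ext (f := fun t => valueT hL (v.toTate L 1 f * t))
    (g := fun t => v.mulMap L f * valueT hL t) (hc.comp (continuous_const.mul continuous_id))
    (continuous_const.mul hc) (fun g => ?_) t
  rw [← map_mul, valueT_toTate, valueT_toTate, map_mul]

lemma valueT_mul (s t : v.Tate L 1) : valueT hL (s * t) = valueT hL s * valueT hL t := by
  have hc : Continuous (valueT (v := v) hL) := continuous_tateLift _ _
  refine v.tate_ext (f := fun s => valueT hL (s * t)) (g := fun s => valueT hL s * valueT hL t)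
    (hc.comp (continuous_id.mul continuous_const)) (hc.mul continuous_const) (fun g => ?_) s
  rw [valueT_toTate_mul, valueT_toTate]

lemma valueT_eq_zero_of_expand (x : v.Coordinates) {f : v.Entire L} (hf : expand hL x f = 0) :
    valueT hL (f.1 1) = 0 := by
  obtain ⟨b, hb, hb'⟩ := (isExpansion_iff hL x).2 hf 1
  rw [map_zero] at hb'
  have h1 : v.mulMap L b = 0 := by
    have := Ideal.Quotient.eq_zero_iff_mem.1 hb'.symm
    rwa [pow_one] at this
  have h2 (g : v.Entire L) (hg : g ∈ (v.jIdeal L ^ 1).map (v.toEntire L)) :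
      valueT hL (g.1 1) = 0 := by
    rw [pow_one] at hg
    refine Submodule.span_induction (p := fun g _ => valueT hL (g.1 1) = 0) ?_ ?_ ?_ ?_ hg
    · rintro _ ⟨c, hc, rfl⟩
      exact (valueT_toTate hL c).trans hc
    · exact map_zero _
    · intro g g' _ _ hg hg'
      change valueT hL (g.1 1 + g'.1 1) = 0
      rw [map_add, hg, hg', add_zero]
    · intro e g _ hg
      exact (valueT_mul hL (e.1 1) (g.1 1)).trans ((congrArg _ hg).trans (mul_zero _))
  have h3 := h2 _ hb
  change valueT hL (f.1 1 - v.toTate L 1 b) = 0 at h3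
  rwa [map_sub, valueT_toTate, h1, sub_zero] at h3

omit [Algebra K L] [IsScalarTower F K L] hL in
lemma norm_tauTate_one_le (x : v.Coordinates) {r : ℝ} (hr : r ≤ 1) (t : v.Tate L 1)
    (ht : ‖v.res L (Nat.le_succ 0) t‖ ≤ r) : ‖tauTate L 1 t‖ ≤ r * ‖t‖ := by
  have hr0 : 0 ≤ r := (norm_nonneg _).trans ht
  rw [x.norm_le_iff (by positivity)]
  intro j
  have h1 : x.coordT L 1 j (tauTate L 1 t) = x.coordT L 1 j t ^ Fintype.card F :=
    (x.coordT_tateMap _ (norm_frobenius_le L) (le_refl 1) t j).trans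
      (congrFun (FiniteField.coe_frobeniusAlgHom F L) _)
  have h2 : ‖x.coordT L 1 j t‖ ≤ r := by
    have := x.norm_coordT_le 0 j (v.res L (Nat.le_succ 0) t)
    rw [x.coordT_res, pow_zero, mul_one] at this
    exact this.trans ht
  have h3 := x.norm_coordT_le 1 j t
  have h4 : ‖x.coordT L 1 j t‖ ^ Fintype.card F ≤ ‖x.coordT L 1 j t‖ ^ 2 :=
    pow_le_pow_of_le_one (norm_nonneg _) (h2.trans hr) Fintype.one_lt_card
  rw [h1, norm_pow]
  have hw := (x.w_pos j).le
  calc ‖x.coordT L 1 j t‖ ^ Fintype.card F * x.w j ^ 1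
      ≤ ‖x.coordT L 1 j t‖ ^ 2 * x.w j ^ 1 := by gcongr
    _ = ‖x.coordT L 1 j t‖ * (‖x.coordT L 1 j t‖ * x.w j ^ 1) := by ring
    _ ≤ r * ‖t‖ := by gcongr

omit hL in
lemma _root_.HodgePink.isUnit_one_add_of_norm_lt_one {S : Type*} [NormedCommRing S] [CompleteSpace S]
    {t : S} (h : ‖t‖ < 1) : IsUnit (1 + t) := by
  rw [← sub_neg_eq_add]
  exact isUnit_one_sub_of_norm_lt_one (by rwa [norm_neg])

/-- The function `1 - a ⊗ θ⁻¹`, which vanishes at `𝔧` and generates the unit ideal on the closed unit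
disc. -/
def Coordinates.unif (x : v.Coordinates) (L : Type u) [Field L] [Algebra F L] [Algebra K L] :
    v.Coeff L := 1 - v.tens x.a (x.θ L)⁻¹


namespace Coordinates

variable (x : v.Coordinates)

omit [IsUltrametricDist L] [CompleteSpace L] [IsScalarTower F K L] in
lemma tens_inv_mem_gaussBall (s : ℕ) : v.tens x.a (x.θ L)⁻¹ ∈
    v.gaussBall L s ((v.abs (x.a : K))⁻¹ * v.abs (x.a : K) ^ s) := by
  refine AddSubgroup.subset_closure ⟨_, _, rfl, le_of_eq ?_⟩
  have h : ‖x.θ L‖ = v.abs (x.a : K) := hL _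
  rw [norm_inv, h, max_eq_right x.one_lt.le]

omit [Algebra K L] [IsUltrametricDist L] [CompleteSpace L] [IsScalarTower F K L] hL in
lemma _root_.HodgePink.Place.one_mem_gaussBall (s : ℕ) : (1 : v.Coeff L) ∈ v.gaussBall L s 1 :=
  AddSubgroup.subset_closure ⟨1, 1, rfl, by simp⟩

omit [IsUltrametricDist L] [CompleteSpace L] [IsScalarTower F K L] in
lemma unif_mem_gaussBall {s : ℕ} (hs : s ≤ 1) : x.unif L ∈ v.gaussBall L s 1 := by
  refine sub_mem (one_mem_gaussBall s) (v.gaussBall_mono s ?_ (x.tens_inv_mem_gaussBall hL s))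
  have h := x.one_lt
  calc (v.abs (x.a : K))⁻¹ * v.abs (x.a : K) ^ s
      ≤ (v.abs (x.a : K))⁻¹ * v.abs (x.a : K) ^ 1 := by gcongr; exact h.le
    _ = 1 := by rw [pow_one, inv_mul_cancel₀ (by positivity)]

/-- The solution of the equation `P = (1 - a ⊗ θ⁻¹) τ(P)`. -/
lemma exists_period_entire [IsDomain (v.Jets L)]
    (hU : (algebraMap (v.Coeff L) (v.Jets L)) (x.unif L) ≠ 0) :
    ∃ P : v.Entire L, P = v.toEntire L (x.unif L) * tauEntire L P ∧ ‖evalTate L 0 (P - 1)‖ < 1 ∧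
      expand hL x P ≠ 0 := by
  have h1 := x.one_lt
  have hr : 0 < (v.abs (x.a : K))⁻¹ := by positivity
  have hr1 : (v.abs (x.a : K))⁻¹ < 1 := inv_lt_one_of_one_lt₀ h1
  obtain ⟨η, hη, hηr⟩ := exists_entire_eq (k := 1) x (fun _ _ => x.unif L) le_rfl hr
    (by rwa [one_mul]) (fun _ _ => x.unif_mem_gaussBall hL zero_le_one)
    (fun _ => -v.tens x.a (x.θ L)⁻¹) (fun _ => neg_mem (by simpa using x.tens_inv_mem_gaussBall hL 0))
  replace hη := hη 0
  replace hηr := hηr 0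
  rw [Fin.sum_univ_one] at hη
  set y := η 0
  have hP : 1 + y = v.toEntire L (x.unif L) * tauEntire L (1 + y) := by
    rw [map_add, map_one, mul_add, mul_one]
    nth_rw 1 [hη]
    rw [← add_assoc, ← map_one (v.toEntire L), ← map_add, ← sub_eq_add_neg]
    rfl
  have hult := x.isUltrametricDist_tate (L := L) 1
  have hτ : ‖tauTate L 1 (y.1 1)‖ ≤ (v.abs (x.a : K))⁻¹ * ‖y.1 1‖ :=
    norm_tauTate_one_le x hr1.le (y.1 1) (by rw [Entire.res_succ y 0]; exact hηr)
  have hy1 : y.1 1 = v.toTate L 1 (-v.tens x.a (x.θ L)⁻¹) +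
      v.toTate L 1 (x.unif L) * tauTate L 1 (y.1 1) := congrArg (fun f : v.Entire L => f.1 1) hη
  have hy2 : ‖v.toTate L 1 (-v.tens x.a (x.θ L)⁻¹)‖ ≤ 1 := by
    rw [map_neg, norm_neg, norm_toTate]
    refine v.gaussNorm_le zero_le_one (v.gaussBall_mono 1 ?_ (x.tens_inv_mem_gaussBall hL 1))
    rw [pow_one, inv_mul_cancel₀ (by positivity)]
  have hy3 : ‖v.toTate L 1 (x.unif L)‖ ≤ 1 := by
    rw [norm_toTate]; exact v.gaussNorm_le zero_le_one (x.unif_mem_gaussBall hL le_rfl)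
  have hy4 : ‖v.toTate L 1 (x.unif L) * tauTate L 1 (y.1 1)‖ ≤ (v.abs (x.a : K))⁻¹ * ‖y.1 1‖ :=
    (norm_mul_le _ _).trans ((mul_le_of_le_one_left (norm_nonneg _) hy3).trans hτ)
  have hy5 : ‖y.1 1‖ ≤ 1 := by
    by_contra! hlt
    have h2 := IsUltrametricDist.norm_add_le_max (v.toTate L 1 (-v.tens x.a (x.θ L)⁻¹))
      (v.toTate L 1 (x.unif L) * tauTate L 1 (y.1 1))
    rw [← hy1] at h2
    rcases le_max_iff.1 h2 with h | h
    · linarith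
    · nlinarith [h.trans hy4]
  refine ⟨1 + y, hP, by rw [add_sub_cancel_left]; exact hηr.trans_lt hr1, fun h0 => ?_⟩
  rw [hP, map_mul, expand_toEntire] at h0
  rcases mul_eq_zero.1 h0 with h | h
  · exact hU h
  · have h2 := valueT_eq_zero_of_expand hL x h
    have h3 : (tauEntire L (1 + y)).1 1 = v.toTate L 1 1 + tauTate L 1 (y.1 1) := by
      rw [map_add, map_one, map_one]
      rfl
    rw [h3, map_add, valueT_toTate, map_one, add_eq_zero_iff_eq_neg] at h2
    have h4 := norm_valueT_le hL (tauTate L 1 (y.1 1))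
    rw [← norm_neg, ← h2, norm_one] at h4
    have h5 : (v.abs (x.a : K))⁻¹ * ‖y.1 1‖ ≤ (v.abs (x.a : K))⁻¹ * 1 := by gcongr
    linarith

end Coordinates

end Value

lemma isUnit_entireToT (x : v.Coordinates) (L : IntermediateField v.Kinf v.Ks)
    [FiniteDimensional v.Kinf L] (f : v.Entire L) (hf : ‖evalTate L 0 (f - 1)‖ < 1) :
    IsUnit (v.entireToT L f) := by
  have h : v.entireToT L f = 1 + v.entireToT L (f - 1) :=
    (congrArg (v.entireToT L) (add_sub_cancel 1 f).symm).trans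
      ((map_add _ _ _).trans (congrArg (· + _) (map_one _)))
  exact (congrArg IsUnit h).mpr (isUnit_one_add_of_norm_lt_one
    ((norm_entireToT x L (f - 1)).trans_lt hf))

variable (hK : IsFunctionField F K)
include hK

lemma exists_period : ∃ (x : v.Coordinates) (b : v.B) (P : v.Entire (⊥ : IntermediateField v.Kinf v.Ks))
    (P' : v.Jets (⊥ : IntermediateField v.Kinf v.Ks)),
    b ∈ v.jIdeal K ∧ IsUnit (algebraMap v.B v.T b) ∧ v.IsExpansion P P' ∧ P' ≠ 0 ∧
    IsUnit (v.entireToT ⊥ P) ∧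
    v.entireToT ⊥ P = algebraMap v.B v.T b * v.tauT (v.entireToT ⊥ P) := by
  obtain ⟨p, hp, _, _, _, _, x, hx, -⟩ := hK.exists_coordinates_pBasis v
  have : Fact p.Prime := ⟨hp⟩
  obtain ⟨Θ, hΘ, hΘx⟩ := hx.exists_taylor (F := F)
  let L : IntermediateField v.Kinf v.Ks := ⊥
  have hL := v.norm_algebraMap_intermediate L
  have := v.completeSpace_of_finiteDimensional L
  have := isDomain_jets (v := v) hK L
  have hθ (E : Type u) [Field E] [Algebra F E] [Algebra K E] [IsScalarTower F K E] : x.θ E ≠ 0 := by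
    rw [Coordinates.θ, map_ne_zero]
    intro h
    have := x.one_lt
    rw [h, map_zero] at this
    linarith
  have hU : (algebraMap (v.Coeff L) (v.Jets L)) (x.unif L) ≠ 0 := fun h0 => by
    have h1 := congrArg (jetsTaylor Θ L hΘ) h0
    rw [map_zero, jetsTaylor_algebraMap, Coordinates.unif, map_sub, map_one, taylor_tens, hΘx,
      map_add, PowerSeries.map_C, PowerSeries.map_X] at h1
    have h2 := congrArg (PowerSeries.coeff 1) h1
    simp [PowerSeries.coeff_one] at h2
    exact hθ L h2
  obtain ⟨P, hP, hP1, hP0⟩ := x.exists_period_entire hL hU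
  have hb : v.toEntire L (x.unif L) =
      v.toEntire L (v.coeffMap (IsScalarTower.toAlgHom F K L) (x.unif K)) := by
    refine congrArg _ ?_
    rw [Coordinates.unif, Coordinates.unif, map_sub, map_one, coeffMap_tens]
    congr 2
    exact (map_inv₀ (algebraMap K L) (x.a : K)).symm
  refine ⟨x, x.unif K, P, _, ?_, ?_, isExpansion_expand hL x P, hP0, ?_, ?_⟩
  · rw [jIdeal, RingHom.mem_ker, Coordinates.unif, map_sub, map_one, mulMap_tens]
    exact sub_eq_zero.2 (mul_inv_cancel₀ (hθ K)).symm
  · rw [← entireToT_algebraMap L, ← hb]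
    refine isUnit_entireToT x L _ ?_
    have h1 := x.one_lt
    rw [Coordinates.unif, map_sub (v.toEntire L), map_one (v.toEntire L), sub_sub_cancel_left,
      map_neg, norm_neg, evalTate_toEntire, norm_toTate]
    refine (v.gaussNorm_le (by positivity) (x.tens_inv_mem_gaussBall hL 0)).trans_lt ?_
    rw [pow_zero, mul_one]
    exact inv_lt_one_of_one_lt₀ h1
  · exact isUnit_entireToT x L P hP1
  · have h := congrArg (v.entireToT L) hP
    rwa [map_mul, hb, entireToT_algebraMap, ← tauT_entireToT] at h

end Place
end HodgePink
end

noncomputable section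
namespace HodgePink

set_option linter.unusedSectionVars false
set_option linter.unusedVariables false

namespace Place

variable {F K : Type u} [Field F] [Fintype F] [Field K] [Algebra F K] {v : Place F K}

/-- A function `b` on `Spec (A ⊗ K)` which vanishes at `𝔧` and is invertible on the closed unit disc,
and an entire function `P` without zeros in the closed unit disc with `P = b τ(P)`. -/
structure Period (v : Place F K) where
  coords : v.Coordinates
  b : v.B
  P : v.Entire (⊥ : IntermediateField v.Kinf v.Ks)
  P' : v.Jets (⊥ : IntermediateField v.Kinf v.Ks)
  b_mem : b ∈ v.jIdeal K
  isUnit_b : IsUnit (algebraMap v.B v.T b)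
  isExpansion : v.IsExpansion P P'
  ne_zero : P' ≠ 0
  isUnit_P : IsUnit (v.entireToT ⊥ P)
  eq_mul : v.entireToT ⊥ P = algebraMap v.B v.T b * v.tauT (v.entireToT ⊥ P)

lemma nonempty_period (hK : IsFunctionField F K) : Nonempty v.Period := by
  obtain ⟨x, b, P, P', h1, h2, h3, h4, h5, h6⟩ := exists_period (v := v) hK
  exact ⟨⟨x, b, P, P', h1, h2, h3, h4, h5, h6⟩⟩

lemma algebraMap_JInv_injective : Function.Injective (algebraMap v.B v.JInv) := fun a b h =>
  IsFractionRing.injective v.B (FractionRing v.B) (congrArg Subtype.val h)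

namespace Period

variable (D : v.Period)

lemma exists_pow_mul (y : v.JInv) :
    ∃ (n : ℕ) (c : v.B), algebraMap v.B v.JInv D.b ^ n * y = algebraMap v.B v.JInv c := by
  obtain ⟨n, hn⟩ := y.2
  obtain ⟨c, hc⟩ := hn _ (Ideal.pow_mem_pow D.b_mem n)
  refine ⟨n, c, Subtype.ext ?_⟩
  rw [← map_pow]
  exact (Algebra.smul_def _ _).symm.trans hc

/-- The value on the closed unit disc of a function on the complement of `V(𝔧)`. -/
def evalFun (y : v.JInv) : v.T :=
  ((D.isUnit_b.pow (D.exists_pow_mul y).choose).unit⁻¹ : v.Tˣ) *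
    algebraMap v.B v.T (D.exists_pow_mul y).choose_spec.choose

lemma pow_mul_evalFun {y : v.JInv} {n : ℕ} {c : v.B}
    (h : algebraMap v.B v.JInv D.b ^ n * y = algebraMap v.B v.JInv c) :
    algebraMap v.B v.T D.b ^ n * D.evalFun y = algebraMap v.B v.T c := by
  set n₀ := (D.exists_pow_mul y).choose
  set c₀ := (D.exists_pow_mul y).choose_spec.choose
  have h₀ : algebraMap v.B v.JInv D.b ^ n₀ * y = algebraMap v.B v.JInv c₀ :=
    (D.exists_pow_mul y).choose_spec.choose_spec
  have h1 : D.b ^ n * c₀ = D.b ^ n₀ * c := algebraMap_JInv_injective (by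
    rw [map_mul, map_mul, map_pow, map_pow, ← h, ← h₀]; ring)
  have h2 := congrArg (algebraMap v.B v.T) h1
  rw [map_mul, map_mul, map_pow, map_pow] at h2
  have h3 : D.evalFun y = ((D.isUnit_b.pow n₀).unit⁻¹ : v.Tˣ) * algebraMap v.B v.T c₀ := rfl
  rw [h3, mul_left_comm, Units.inv_mul_eq_iff_eq_mul, h2]
  rfl

lemma eq_evalFun {y : v.JInv} {n : ℕ} {c : v.B}
    (h : algebraMap v.B v.JInv D.b ^ n * y = algebraMap v.B v.JInv c) {t : v.T}
    (ht : algebraMap v.B v.T D.b ^ n * t = algebraMap v.B v.T c) : D.evalFun y = t :=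
  (D.isUnit_b.pow n).mul_left_cancel ((D.pow_mul_evalFun h).trans ht.symm)

/-- The restriction to the closed unit disc of functions on the complement of `V(𝔧)`. -/
def eval : v.JInv →+* v.T where
  toFun := D.evalFun
  map_zero' := D.eq_evalFun (n := 0) (c := 0) (by simp) (by simp)
  map_one' := D.eq_evalFun (n := 0) (c := 1) (by simp) (by simp)
  map_add' y y' := by
    obtain ⟨n, c, h⟩ := D.exists_pow_mul y
    obtain ⟨n', c', h'⟩ := D.exists_pow_mul y'
    refine D.eq_evalFun (n := n + n') (c := D.b ^ n' * c + D.b ^ n * c') ?_ ?_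
    · rw [map_add, map_mul, map_mul, ← h, ← h', map_pow, map_pow]; ring
    · rw [map_add, map_mul, map_mul, ← D.pow_mul_evalFun h, ← D.pow_mul_evalFun h', map_pow,
        map_pow]; ring
  map_mul' y y' := by
    obtain ⟨n, c, h⟩ := D.exists_pow_mul y
    obtain ⟨n', c', h'⟩ := D.exists_pow_mul y'
    refine D.eq_evalFun (n := n + n') (c := c * c') ?_ ?_
    · rw [map_mul, ← h, ← h']; ring
    · rw [map_mul, ← D.pow_mul_evalFun h, ← D.pow_mul_evalFun h']; ring

lemma eval_algebraMap (c : v.B) : D.eval (algebraMap v.B v.JInv c) = algebraMap v.B v.T c :=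
  D.eq_evalFun (n := 0) (c := c) (by simp) (by simp)

lemma exists_pow_mul_eval {ι : Type*} [Fintype ι] (y : ι → v.JInv) :
    ∃ (n : ℕ) (c : ι → v.B), ∀ i,
      algebraMap v.B v.T (c i) = algebraMap v.B v.T D.b ^ n * D.eval (y i) := by
  choose n c h using fun i => D.exists_pow_mul (y i)
  refine ⟨∑ i, n i, fun i => D.b ^ (∑ i, n i - n i) * c i, fun i => ?_⟩
  rw [map_mul, ← D.pow_mul_evalFun (h i), map_pow, ← mul_assoc, ← pow_add, Nat.sub_add_cancel
    (Finset.single_le_sum (fun i _ => Nat.zero_le _) (Finset.mem_univ i))]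
  rfl

/-- The base change of the period to a finite extension. -/
def PL (L : IntermediateField v.Kinf v.Ks) : v.Entire L :=
  entireMap ((IntermediateField.inclusion (bot_le : ⊥ ≤ L)).restrictScalars F) (fun _ _ => le_rfl) D.P

lemma entireToT_PL (L : IntermediateField v.Kinf v.Ks) :
    v.entireToT L (D.PL L) = v.entireToT ⊥ D.P := entireToT_entireMap bot_le D.P

lemma exists_isExpansion_PL (hK : IsFunctionField F K) (L : IntermediateField v.Kinf v.Ks) :
    ∃ g, v.IsExpansion (D.PL L) g ∧ g ≠ 0 :=
  ⟨_, D.isExpansion.map ((IntermediateField.inclusion (bot_le : ⊥ ≤ L)).restrictScalars K)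
    (fun _ _ => le_rfl), fun h => D.ne_zero (jetsMap_injective hK _ (h.trans (map_zero _).symm))⟩

/-- The solutions of a system of Frobenius equations with poles at `𝔧` are meromorphic. -/
lemma exists_meromorphic {k : ℕ} (Ψ : Fin k → Fin k → v.JInv) (t : Fin k → v.T)
    (ht : ∀ i, t i = ∑ j, D.eval (Ψ i j) * v.tauT (t j)) :
    ∃ (L : IntermediateField v.Kinf v.Ks) (_ : FiniteDimensional v.Kinf L) (n : ℕ)
      (f : Fin k → v.Entire L), ∀ i, v.entireToT L (D.PL L) ^ n * t i = v.entireToT L (f i) := by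
  obtain ⟨n, c, hc⟩ := D.exists_pow_mul_eval fun ij : Fin k × Fin k => Ψ ij.1 ij.2
  set Q := v.entireToT ⊥ D.P
  have hw (i : Fin k) : Q ^ n * t i =
      ∑ j, algebraMap v.B v.T (c (i, j)) * v.tauT (Q ^ n * t j) := by
    have hQ' : Q ^ n = (algebraMap v.B v.T D.b * v.tauT Q) ^ n := congrArg (· ^ n) D.eq_mul
    nth_rw 1 [ht i]
    rw [Finset.mul_sum]
    refine Finset.sum_congr rfl fun j _ => ?_
    rw [hc (i, j), map_mul, map_pow, hQ']
    ring
  obtain ⟨L, hL, f, hf⟩ := exists_entire_of_fixed D.coords (fun i j => c (i, j)) _ hw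
  exact ⟨L, hL, n, f, fun i => by rw [entireToT_PL, hf i]⟩

end Period

/-- `g` is the germ at `𝔧` of the meromorphic continuation of `t`. -/
def HasGerm (ν : v.Nu) (t : v.T) (g : Laurent ν) : Prop :=
  ∃ (L : IntermediateField v.Kinf v.Ks) (_ : FiniteDimensional v.Kinf L)
    (d f : v.Entire L) (d' f' : v.Jets L), v.IsExpansion d d' ∧ d' ≠ 0 ∧ v.IsExpansion f f' ∧
    v.entireToT L d * t = v.entireToT L f ∧ v.jetsToLaurent ν L d' * g = v.jetsToLaurent ν L f'

variable {ν : v.Nu}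

/-- Germs may be computed after a finite extension. -/
lemma hasGerm_data_mono {t : v.T} {g : Laurent ν} {L L' : IntermediateField v.Kinf v.Ks}
    (hK : IsFunctionField F K) (h : L ≤ L')
    {d f : v.Entire L} {d' f' : v.Jets L} (h1 : v.IsExpansion d d') (h2 : d' ≠ 0)
    (h3 : v.IsExpansion f f') (h4 : v.entireToT L d * t = v.entireToT L f)
    (h5 : v.jetsToLaurent ν L d' * g = v.jetsToLaurent ν L f') :
    ∃ (d f : v.Entire L') (d' f' : v.Jets L'), v.IsExpansion d d' ∧ d' ≠ 0 ∧ v.IsExpansion f f' ∧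
    v.entireToT L' d * t = v.entireToT L' f ∧
      v.jetsToLaurent ν L' d' * g = v.jetsToLaurent ν L' f' := by
  refine ⟨_, _, _, _, h1.map ((IntermediateField.inclusion h).restrictScalars K)
    (fun _ _ => le_rfl), ?_, h3.map ((IntermediateField.inclusion h).restrictScalars K)
    (fun _ _ => le_rfl), ?_, ?_⟩
  · exact fun h0 => h2 (jetsMap_injective hK _ (h0.trans (map_zero _).symm))
  · have e := entireToT_entireMap (v := v) h
    exact (congrArg (· * t) (e d)).trans (h4.trans (e f).symm)
  · rw [jetsToLaurent_jetsMap, jetsToLaurent_jetsMap, h5]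

namespace HasGerm

variable (hK : IsFunctionField F K) {t t' : v.T} {g g' : Laurent ν}
include hK

lemma common (h : HasGerm ν t g) (h' : HasGerm ν t' g') :
    ∃ (L : IntermediateField v.Kinf v.Ks) (_ : FiniteDimensional v.Kinf L)
      (d f e k : v.Entire L) (d' f' e' k' : v.Jets L),
    (v.IsExpansion d d' ∧ d' ≠ 0 ∧ v.IsExpansion f f' ∧ v.entireToT L d * t = v.entireToT L f ∧
      v.jetsToLaurent ν L d' * g = v.jetsToLaurent ν L f') ∧
    (v.IsExpansion e e' ∧ e' ≠ 0 ∧ v.IsExpansion k k' ∧ v.entireToT L e * t' = v.entireToT L k ∧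
      v.jetsToLaurent ν L e' * g' = v.jetsToLaurent ν L k') := by
  obtain ⟨L, hL, d, f, d', f', h1, h2, h3, h4, h5⟩ := h
  obtain ⟨L', hL', e, k, e', k', h1', h2', h3', h4', h5'⟩ := h'
  obtain ⟨d, f, d', f', H⟩ := hasGerm_data_mono hK (le_sup_left : L ≤ L ⊔ L') h1 h2 h3 h4 h5
  obtain ⟨e, k, e', k', H'⟩ := hasGerm_data_mono hK (le_sup_right : L' ≤ L ⊔ L') h1' h2' h3' h4' h5'
  exact ⟨L ⊔ L', inferInstance, d, f, e, k, d', f', e', k', H, H'⟩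

lemma add (h : HasGerm ν t g) (h' : HasGerm ν t' g') : HasGerm ν (t + t') (g + g') := by
  obtain ⟨L, hL, d, f, e, k, d', f', e', k', ⟨h1, h2, h3, h4, h5⟩, h1', h2', h3', h4', h5'⟩ :=
    common hK h h'
  have := isDomain_jets (v := v) hK L
  refine ⟨L, hL, d * e, f * e + d * k, d' * e', f' * e' + d' * k', h1.mul h1', mul_ne_zero h2 h2',
    (h3.mul h1').add (h1.mul h3'), ?_, ?_⟩
  · simp only [map_mul, map_add, ← h4, ← h4']; ring
  · simp only [map_mul, map_add, ← h5, ← h5']; ring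

lemma mul (h : HasGerm ν t g) (h' : HasGerm ν t' g') : HasGerm ν (t * t') (g * g') := by
  obtain ⟨L, hL, d, f, e, k, d', f', e', k', ⟨h1, h2, h3, h4, h5⟩, h1', h2', h3', h4', h5'⟩ :=
    common hK h h'
  have := isDomain_jets (v := v) hK L
  refine ⟨L, hL, d * e, f * k, d' * e', f' * k', h1.mul h1', mul_ne_zero h2 h2', h3.mul h3', ?_, ?_⟩
  · simp only [map_mul, ← h4, ← h4']; ring
  · simp only [map_mul, ← h5, ← h5']; ring

lemma unique (h : HasGerm ν t g) (h' : HasGerm ν t g') : g = g' := by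
  obtain ⟨L, hL, d, f, e, k, d', f', e', k', ⟨h1, h2, h3, h4, h5⟩, h1', h2', h3', h4', h5'⟩ :=
    common hK h h'
  obtain ⟨D⟩ := nonempty_period (v := v) hK
  have := v.completeSpace_of_finiteDimensional L
  have hL' := v.norm_algebraMap_intermediate L
  have h6 : f * e = d * k := entireToT_injective L D.coords (by
    simp only [map_mul, ← h4, ← h4']; ring)
  have h7 : f' * e' = d' * k' := (h3.mul h1').unique hL' D.coords (h6 ▸ h1.mul h3')
  have h8 := congrArg (v.jetsToLaurent ν L) h7
  rw [map_mul, map_mul, ← h5, ← h5'] at h8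
  let _ := (isField_Laurent hK ν).toField
  have hne (x : v.Jets L) (hx : x ≠ 0) : v.jetsToLaurent ν L x ≠ 0 := fun h0 =>
    hx (jetsToLaurent_injective hK ν L (h0.trans (map_zero _).symm))
  refine mul_left_cancel₀ (mul_ne_zero (hne _ h2) (hne _ h2')) ?_
  linear_combination h8

end HasGerm

lemma jetsToLaurent_algebraMap (L : IntermediateField v.Kinf v.Ks) (c : v.B) :
    v.jetsToLaurent ν L (algebraMap _ _ (v.coeffMap (IsScalarTower.toAlgHom F K L) c)) =
      algebraMap v.B (Laurent ν) c :=
  congrArg (algebraMap v.O (Laurent ν)) ((v.jetsMap_of _ _).trans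
    (congrArg v.toO (v.coeffMap_comp _ _ c).symm))

lemma hasGerm_algebraMap (hK : IsFunctionField F K) (c : v.B) :
    HasGerm ν (algebraMap v.B v.T c) (algebraMap v.B (Laurent ν) c) := by
  have := isDomain_jets (v := v) hK (⊥ : IntermediateField v.Kinf v.Ks)
  refine ⟨⊥, inferInstance, 1, v.toEntire _ (v.coeffMap (IsScalarTower.toAlgHom F K _) c), 1,
    algebraMap _ _ (v.coeffMap (IsScalarTower.toAlgHom F K _) c), ?_, one_ne_zero,
    isExpansion_toEntire _, ?_, ?_⟩
  · simpa using isExpansion_toEntire (v := v) (L := (⊥ : IntermediateField v.Kinf v.Ks)) 1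
  · rw [map_one, one_mul, entireToT_algebraMap]
  · rw [map_one, one_mul, jetsToLaurent_algebraMap]

/-- The germs of a solution of a system of Frobenius equations. -/
lemma Period.exists_germ_family (D : v.Period) (hK : IsFunctionField F K) (ν : v.Nu) {k : ℕ}
    (Ψ : Fin k → Fin k → v.JInv) (t : Fin k → v.T)
    (ht : ∀ i, t i = ∑ j, D.eval (Ψ i j) * v.tauT (t j)) :
    ∃ (L : IntermediateField v.Kinf v.Ks) (_ : FiniteDimensional v.Kinf L) (d : v.Entire L)
      (d' : v.Jets L) (f : Fin k → v.Entire L) (f' : Fin k → v.Jets L) (g : Fin k → Laurent ν),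
      v.IsExpansion d d' ∧ d' ≠ 0 ∧ ∀ i, v.IsExpansion (f i) (f' i) ∧
        v.entireToT L d * t i = v.entireToT L (f i) ∧
        v.jetsToLaurent ν L d' * g i = v.jetsToLaurent ν L (f' i) := by
  obtain ⟨L, hL, n, f, hf⟩ := D.exists_meromorphic Ψ t ht
  have := v.completeSpace_of_finiteDimensional L
  have hL' := v.norm_algebraMap_intermediate L
  have := isDomain_jets (v := v) hK L
  obtain ⟨d', hd', hd0⟩ := D.exists_isExpansion_PL hK L
  choose f' hf' using fun i => IsExpansion.exists hL' D.coords (f i)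
  let _ := (isField_Laurent hK ν).toField
  have hne : v.jetsToLaurent ν L (d' ^ n) ≠ 0 := fun h0 =>
    pow_ne_zero n hd0 (jetsToLaurent_injective hK ν L (h0.trans (map_zero _).symm))
  refine ⟨L, hL, D.PL L ^ n, d' ^ n, f, f',
    fun i => (v.jetsToLaurent ν L (d' ^ n))⁻¹ * v.jetsToLaurent ν L (f' i), ?_, pow_ne_zero n hd0,
    fun i => ⟨hf' i, by rw [map_pow, hf i], mul_inv_cancel_left₀ hne _⟩⟩
  rw [isExpansion_iff hL' D.coords] at hd' ⊢
  rw [map_pow, hd']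

lemma Period.exists_hasGerm (D : v.Period) (hK : IsFunctionField F K) {k : ℕ}
    (Ψ : Fin k → Fin k → v.JInv) (t : Fin k → v.T)
    (ht : ∀ i, t i = ∑ j, D.eval (Ψ i j) * v.tauT (t j)) (i : Fin k) : ∃ g, HasGerm ν (t i) g := by
  obtain ⟨L, hL, d, d', f, f', g, h1, h2, h⟩ := D.exists_germ_family hK ν Ψ t ht
  exact ⟨g i, L, hL, d, f i, d', f' i, h1, h2, h i⟩

lemma galT_entireToT (σ : v.Ginf) {L L' : IntermediateField v.Kinf v.Ks} (φ : L →ₐ[K] L')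
    (hφ : ∀ l, (φ l : v.Ks) = σ l) (hφ' : ∀ l, ‖l‖ ≤ 1 → ‖φ l‖ ≤ ‖l‖) (f : v.Entire L) :
    v.galT σ (v.entireToT L f) = v.entireToT L' (entireMap (φ.restrictScalars F) hφ' f) := by
  have h1 := tateMap_comp (v.toCinfAlg.comp (L.val.restrictScalars F))
    (fun l _ => (v.norm_toCinf (l : v.Ks)).le) ((v.galoisCinfAlg σ).restrictScalars F)
    (fun l _ => (v.norm_galoisCinf σ l).le)
    (((v.galoisCinfAlg σ).restrictScalars F).comp (v.toCinfAlg.comp (L.val.restrictScalars F)))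
    (fun l _ => ((v.norm_galoisCinf σ _).trans (v.norm_toCinf (l : v.Ks))).le) (fun _ => rfl)
    (le_refl 0) (le_refl 0) (f.1 0)
  have h2 := tateMap_comp (φ.restrictScalars F) hφ' (v.toCinfAlg.comp (L'.val.restrictScalars F))
    (fun l _ => (v.norm_toCinf (l : v.Ks)).le)
    (((v.galoisCinfAlg σ).restrictScalars F).comp (v.toCinfAlg.comp (L.val.restrictScalars F)))
    (fun l _ => ((v.norm_galoisCinf σ _).trans (v.norm_toCinf (l : v.Ks))).le)
    (fun l => (congrArg v.toCinf (hφ l)).trans (v.galoisCinf_coe σ l).symm)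
    (le_refl 0) (le_refl 0) (f.1 0)
  exact h1.trans h2.symm

lemma HasGerm.smul (hK : IsFunctionField F K) (σ : v.Ginf) {t : v.T} {g : Laurent ν}
    (h : HasGerm ν t g) : HasGerm ν (v.galT σ t) (σ • g) := by
  obtain ⟨L, hL, d, f, d', f', h1, h2, h3, h4, h5⟩ := h
  let L' : IntermediateField v.Kinf v.Ks := L.map (σ : v.Ks →ₐ[v.Kinf] v.Ks)
  let φ : L →ₐ[K] L' := (L.equivMap (σ : v.Ks →ₐ[v.Kinf] v.Ks)).toAlgHom.restrictScalars K
  have hφ (l : L) : (φ l : v.Ks) = σ l := rfl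
  have hφ' (l : L) (_ : ‖l‖ ≤ 1) : ‖φ l‖ ≤ ‖l‖ := (v.norm_galois σ l).le
  have hL' : FiniteDimensional v.Kinf L' :=
    (L.equivMap (σ : v.Ks →ₐ[v.Kinf] v.Ks)).toLinearEquiv.finiteDimensional
  have hJ (g : v.Jets L) : v.jetsToLaurent ν L' (v.jetsMap φ g) = σ • v.jetsToLaurent ν L g := by
    refine Eq.trans ?_ (smul_algebraMap_Laurent ν σ _).symm
    refine congrArg (algebraMap v.O (Laurent ν)) ?_
    exact (v.jetsMap_comp (L'.val.restrictScalars K) φ g).symm.trans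
      (v.jetsMap_comp (v.galKs σ) (L.val.restrictScalars K) g)
  refine ⟨L', hL', _, _, _, _, h1.map φ hφ', fun h0 => h2 (jetsMap_injective hK φ
    (h0.trans (map_zero _).symm)), h3.map φ hφ', ?_, ?_⟩
  · rw [← galT_entireToT σ φ hφ hφ', ← galT_entireToT σ φ hφ hφ', ← h4, map_mul]
  · rw [hJ, hJ, ← smul_mul', h5]

lemma Period.exists_fixing (D : v.Period) {k : ℕ} (Ψ : Fin k → Fin k → v.JInv) (t : Fin k → v.T)
    (ht : ∀ i, t i = ∑ j, D.eval (Ψ i j) * v.tauT (t j)) :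
    ∃ (L : IntermediateField v.Kinf v.Ks) (_ : FiniteDimensional v.Kinf L),
      ∀ σ ∈ L.fixingSubgroup, ∀ i, v.galT σ (t i) = t i := by
  obtain ⟨L, hL, n, f, hf⟩ := D.exists_meromorphic Ψ t ht
  refine ⟨L, hL, fun σ hσ i => ?_⟩
  have h (g : v.Entire L) : v.galT σ (v.entireToT L g) = v.entireToT L g := by
    refine (galT_entireToT σ (AlgHom.id K L) (fun l => ?_) (fun _ _ => le_rfl) g).trans
      (entireToT_entireMap le_rfl g)
    exact (((IntermediateField.mem_fixingSubgroup_iff L σ).1 hσ l l.2)).symm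
  have h1 := congrArg (v.galT σ) (hf i)
  rw [map_mul, map_pow, h, h, ← hf i] at h1
  exact (((D.entireToT_PL L).symm ▸ D.isUnit_P).pow n).mul_left_cancel h1

end Place
end HodgePink
end

noncomputable section
namespace HodgePink

set_option linter.unusedSectionVars false
set_option linter.unusedVariables false

namespace Place

variable {F K : Type u} [Field F] [Fintype F] [Field K] [Algebra F K] {v : Place F K}

/-- The map `id ⊗ φ : A ⊗ ℂ_∞ → A` for an `F`-linear form `φ` on `ℂ_∞`. -/
def contract (φ : v.Cinf →ₗ[F] F) : v.Coeff v.Cinf →ₗ[v.A] v.A :=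
  ((TensorProduct.AlgebraTensorModule.rid F v.A v.A).toLinearMap ∘ₗ
    TensorProduct.AlgebraTensorModule.map (LinearMap.id : v.A →ₗ[v.A] v.A) φ :
      v.A ⊗[F] v.Cinf →ₗ[v.A] v.A)

lemma contract_tens (φ : v.Cinf →ₗ[F] F) (a : v.A) (l : v.Cinf) :
    contract φ (v.tens a l) = φ l • a := rfl

lemma contract_eq_zero {φ : v.Cinf →ₗ[F] F} {r : ℝ} (hφ : ∀ l, ‖l‖ ≤ r → φ l = 0)
    {f : v.Coeff v.Cinf} (hf : f ∈ v.gaussBall v.Cinf 0 r) : contract φ f = 0 := by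
  induction hf using AddSubgroup.closure_induction with
  | zero => exact map_zero _
  | add x y _ _ hx hy => rw [map_add, hx, hy, add_zero]
  | neg x _ hx => rw [map_neg, hx, neg_zero]
  | mem x hx =>
    obtain ⟨a, l, rfl, hl⟩ := hx
    rw [contract_tens, hφ l (by simpa using hl), zero_smul]

lemma repr_contract (x : v.Coordinates) (φ : v.Cinf →ₗ[F] F) (f : v.Coeff v.Cinf)
    (j : Fin x.n × ℕ) : x.basis.repr (contract φ f) j = φ (x.coord v.Cinf f j) := by
  refine v.coeff_induction f (by simp) (fun a l => ?_) fun f g hf hg => ?_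
  · rw [contract_tens, Coordinates.coord_tens, map_smul, map_smul, Finsupp.smul_apply, smul_eq_mul,
      smul_eq_mul, mul_comm]
  · simp only [map_add, Finsupp.add_apply, hf, hg]

lemma norm_algebraMap_A_le (a : v.A) : ‖algebraMap v.A v.T a‖ ≤ 1 := by
  have h : algebraMap v.A v.T a = v.toTate v.Cinf 0 (v.tens a 1) := by
    change v.toTate v.Cinf 0 (v.coeffMap (IsScalarTower.toAlgHom F K v.Cinf) (v.tens a 1)) = _
    rw [coeffMap_tens, map_one]
  rw [h]
  exact (v.norm_toTate 0 _).le.trans (v.gaussNorm_le zero_le_one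
    (AddSubgroup.subset_closure ⟨a, 1, rfl, by simp⟩))

lemma norm_smul_A_le (a : v.A) (t : v.T) : ‖a • t‖ ≤ ‖t‖ := by
  rw [Algebra.smul_def]
  exact (norm_mul_le _ _).trans (mul_le_of_le_one_left (norm_nonneg _) (norm_algebraMap_A_le a))

/-- The map `A ⊗ ℂ_∞ → ℂ_∞⟨A⟩` as an `A`-linear map. -/
def coeffToTLin : v.Coeff v.Cinf →ₗ[v.A] v.T where
  toFun := v.toTate v.Cinf 0
  map_add' := map_add _
  map_smul' a f := by
    have h : algebraMap v.A v.T a = v.toTate v.Cinf 0 (v.tens a 1) := by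
      change v.toTate v.Cinf 0 (v.coeffMap (IsScalarTower.toAlgHom F K v.Cinf) (v.tens a 1)) = _
      rw [coeffMap_tens, map_one]
    exact (congrArg (v.toTate v.Cinf 0) (Algebra.smul_def a f)).trans
      ((map_mul (v.toTate v.Cinf 0) _ _).trans ((congrArg
        (fun s : v.T => s * (id (v.toTate v.Cinf 0 f : v.Tate v.Cinf 0) : v.T)) h.symm).trans (Algebra.smul_def (A := v.T) a _).symm))

lemma norm_coeffToTLin (f : v.Coeff v.Cinf) : ‖coeffToTLin f‖ = v.gaussNorm v.Cinf 0 f :=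
  v.norm_toTate 0 f

lemma exists_coeffToTLin_near (t : v.T) {r : ℝ} (hr : 0 < r) : ∃ f, ‖t - coeffToTLin f‖ < r := by
  obtain ⟨f, hf⟩ := (denseRange_toTate (v := v) (L := v.Cinf) 0).exists_dist_lt t hr
  exact ⟨f, (dist_eq_norm (E := v.Tate v.Cinf 0) _ _).symm.trans_lt hf⟩

/-- The extension of `id ⊗ φ` to `ℂ_∞⟨A⟩` for a continuous `F`-linear form `φ` on `ℂ_∞`. -/
lemma exists_functional (φ : v.Cinf →ₗ[F] F) {r : ℝ} (hr : 0 < r) (hφ : ∀ l, ‖l‖ ≤ r → φ l = 0) :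
    ∃ Φ : v.T →ₗ[v.A] v.A, ∀ t f, ‖t - coeffToTLin f‖ < r / 2 → Φ t = contract φ f := by
  have hr2 : 0 < r / 2 / 2 := by positivity
  choose g hg using fun t : v.T => exists_coeffToTLin_near t hr2
  have key {t : v.T} {f f' : v.Coeff v.Cinf} (h : ‖t - coeffToTLin f‖ < r / 2)
      (h' : ‖t - coeffToTLin f'‖ < r / 2) : contract φ f = contract φ f' := by
    rw [← sub_eq_zero, ← map_sub]
    refine contract_eq_zero hφ (v.mem_gaussBall_of_lt ?_)
    rw [← norm_coeffToTLin, map_sub]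
    have := norm_sub_le (t - coeffToTLin f') (t - coeffToTLin f)
    rw [sub_sub_sub_cancel_left] at this
    linarith
  have hg' (t : v.T) : ‖t - coeffToTLin (g t)‖ < r / 2 := (hg t).trans (by linarith)
  refine ⟨{ toFun := fun t => contract φ (g t), map_add' := fun t t' => ?_, map_smul' := fun a t => ?_ },
    fun t f hf => key (hg' t) hf⟩
  · rw [← map_add]
    refine key (hg' _) ?_
    rw [map_add, add_sub_add_comm]
    exact (norm_add_le _ _).trans_lt (by linarith [hg t, hg t'])
  · rw [RingHom.id_apply, ← map_smul]
    refine key (hg' _) ?_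
    rw [map_smul, ← smul_sub]
    exact (norm_smul_A_le a _).trans_lt (hg' t)

lemma norm_algebraMap_F_Cinf (c : F) : ‖algebraMap F v.Cinf c‖ ≤ 1 := by
  rw [IsScalarTower.algebraMap_apply F K v.Cinf, norm_algebraMap_Cinf]
  by_cases hc : c = 0
  · simp [hc]
  · exact (v.trivial_on_base c hc).le

/-- There are continuous `F`-linear forms on `ℂ_∞` which do not vanish at a given element. -/
lemma exists_form {l : v.Cinf} {r : ℝ} (hr : 0 < r) (hl : r < ‖l‖) :
    ∃ φ : v.Cinf →ₗ[F] F, φ l = 1 ∧ ∀ l', ‖l'‖ ≤ r → φ l' = 0 := by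
  let W : Submodule F v.Cinf :=
    { carrier := {l | ‖l‖ ≤ r}
      add_mem' := fun h h' => (IsUltrametricDist.norm_add_le_max _ _).trans (max_le h h')
      zero_mem' := by simpa using hr.le
      smul_mem' := fun c l' h => by
        change ‖c • l'‖ ≤ r
        rw [Algebra.smul_def, norm_mul]
        exact (mul_le_of_le_one_left (norm_nonneg _) (norm_algebraMap_F_Cinf c)).trans h }
  have hW : l ∉ W := fun h => (not_le.2 hl) h
  obtain ⟨φ, hφ, hφ'⟩ := W.exists_dual_map_eq_bot_of_notMem hW inferInstance
  refine ⟨(φ l)⁻¹ • φ, by simp [hφ], fun l' hl' => ?_⟩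
  have h : φ l' ∈ W.map φ := Submodule.mem_map_of_mem hl'
  rw [hφ', Submodule.mem_bot] at h
  rw [LinearMap.smul_apply, h, smul_zero]

/-- `A` is a direct summand of `ℂ_∞⟨A⟩`. -/
lemma exists_retraction : ∃ Φ : v.T →ₗ[v.A] v.A, Φ 1 = 1 := by
  obtain ⟨φ, h1, hφ⟩ := exists_form (v := v) (l := 1) (r := 1 / 2) (by norm_num) (by norm_num)
  obtain ⟨Φ, hΦ⟩ := exists_functional φ (by norm_num) hφ
  have h2 : coeffToTLin (v.tens 1 1) = (1 : v.T) := map_one (v.toTate v.Cinf 0)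
  refine ⟨Φ, (hΦ 1 (v.tens 1 1) (by rw [h2, sub_self, norm_zero]; norm_num)).trans ?_⟩
  rw [contract_tens, h1, one_smul]

lemma coordT_ext_T (x : v.Coordinates) {t : v.T}
    (h : ∀ j, x.coordT v.Cinf 0 j t = 0) : t = 0 :=
  x.coordT_ext (L := v.Cinf) (s := 0) (t' := 0) fun j => (h j).trans (map_zero _).symm

lemma norm_coordT_sub_le (x : v.Coordinates) (t : v.Tate v.Cinf 0) (f : v.Coeff v.Cinf)
    (j : Fin x.n × ℕ) :
    ‖x.coordT v.Cinf 0 j t - x.coord v.Cinf f j‖ ≤ ‖t - v.toTate v.Cinf 0 f‖ := by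
  have h3 := x.norm_coordT_le (L := v.Cinf) 0 j (t - v.toTate v.Cinf 0 f)
  rwa [map_sub, Coordinates.coordT_toTate, pow_zero, mul_one] at h3

lemma isTorsionFree_T (x : v.Coordinates) : Module.IsTorsionFree v.A v.T := by
  refine Module.isTorsionFree_iff_smul_eq_zero.2 fun a t hat => ?_
  by_contra! hcon
  obtain ⟨ha, ht⟩ := hcon
  have h1 : ∃ j, x.coordT v.Cinf 0 j t ≠ 0 := by
    by_contra! h
    exact ht (coordT_ext_T x h)
  obtain ⟨j, hj⟩ := h1
  have hpos := norm_pos_iff.2 hj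
  obtain ⟨φ, h1, hφ⟩ := exists_form (half_pos hpos) (half_lt_self hpos)
  obtain ⟨Φ, hΦ⟩ := exists_functional φ (half_pos hpos) hφ
  obtain ⟨f, hf⟩ := exists_coeffToTLin_near t (r := ‖x.coordT v.Cinf 0 j t‖ / 2 / 2) (by positivity)
  have h2 : x.basis.repr (Φ t) j = 1 := by
    rw [hΦ t f hf, repr_contract, ← h1, ← sub_eq_zero, ← map_sub]
    refine hφ _ ?_
    have h3 := norm_coordT_sub_le x t f j
    rw [norm_sub_rev]
    exact h3.trans (hf.le.trans (by linarith))
  have h4 : a * Φ t = 0 := by rw [← smul_eq_mul, ← map_smul, hat, map_zero]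
  rcases mul_eq_zero.1 h4 with h | h
  · exact ha h
  · rw [h, map_zero, Finsupp.zero_apply] at h2
    exact zero_ne_one h2

end Place
end HodgePink
end

noncomputable section
namespace HodgePink

set_option linter.unusedSectionVars false
set_option linter.unusedVariables false

section DualBasis

variable {S N : Type u} [CommSemiring S] [AddCommMonoid N] [Module S N]

/-- A dual basis of a finite projective module. -/
structure DualBasis (S N : Type u) [CommSemiring S] [AddCommMonoid N] [Module S N] where
  n : ℕ
  vec : Fin n → N
  form : Fin n → N →ₗ[S] S
  sum_eq : ∀ y, ∑ i, form i y • vec i = y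

lemma nonempty_dualBasis [Module.Finite S N] [Module.Projective S N] : Nonempty (DualBasis S N) := by
  obtain ⟨n, f, g, -, -, h⟩ := Module.Finite.exists_comp_eq_id_of_projective S N
  refine ⟨⟨n, fun i => f (Pi.single i 1), fun i => LinearMap.proj i ∘ₗ g, fun y => ?_⟩⟩
  conv_rhs => rw [← LinearMap.id_apply (R := S) y, ← h, LinearMap.comp_apply,
    LinearMap.pi_apply_eq_sum_univ f]
  refine Finset.sum_congr rfl fun i _ => ?_
  congr 2
  ext j
  simp [Pi.single_apply, eq_comm]

variable (Q : Type u) [CommSemiring Q] [Algebra S Q]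

/-- The base change of a linear form. -/
def formQ (l : N →ₗ[S] S) : Q ⊗[S] N →ₗ[Q] Q := (Algebra.linearMap S Q ∘ₗ l).liftBaseChange Q

lemma formQ_tmul (l : N →ₗ[S] S) (c : Q) (y : N) :
    formQ Q l (c ⊗ₜ[S] y) = c * algebraMap S Q (l y) := by
  simp [formQ]

lemma DualBasis.sum_formQ (e : DualBasis S N) (y : Q ⊗[S] N) :
    ∑ i, formQ Q (e.form i) y ⊗ₜ[S] e.vec i = y := by
  induction y using TensorProduct.induction_on with
  | zero => simp
  | tmul c y =>
    conv_rhs => rw [← e.sum_eq y, TensorProduct.tmul_sum]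
    refine Finset.sum_congr rfl fun i _ => ?_
    rw [formQ_tmul, mul_comm, ← Algebra.smul_def, TensorProduct.smul_tmul]
  | add y z hy hz =>
    conv_rhs => rw [← hy, ← hz]
    simp only [map_add, TensorProduct.add_tmul, Finset.sum_add_distrib]

lemma formQ_baseChange {N' : Type u} [AddCommMonoid N'] [Module S N'] (f : N →ₗ[S] N')
    (l : N' →ₗ[S] S) (y : Q ⊗[S] N) : formQ Q l (f.baseChange Q y) = formQ Q (l ∘ₗ f) y := by
  induction y using TensorProduct.induction_on with
  | zero => simp
  | tmul c y => rw [LinearMap.baseChange_tmul, formQ_tmul, formQ_tmul]; rfl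
  | add y z hy hz => simp only [map_add, hy, hz]

lemma ext_formQ [Module.Finite S N] [Module.Projective S N] {y z : Q ⊗[S] N}
    (h : ∀ l : N →ₗ[S] S, formQ Q l y = formQ Q l z) : y = z := by
  obtain ⟨e⟩ := nonempty_dualBasis (S := S) (N := N)
  rw [← e.sum_formQ Q y, ← e.sum_formQ Q z]
  simp only [h]

end DualBasis

namespace Place

variable {F K : Type u} [Field F] [Fintype F] [Field K] [Algebra F K] {v : Place F K}

lemma faithfullyFlat_T (hK : IsFunctionField F K) : Module.FaithfullyFlat v.A v.T := by
  obtain ⟨p, hp, _, _, _, _, x, -, -⟩ := hK.exists_coordinates_pBasis v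
  have := isTorsionFree_T x
  obtain ⟨Φ, hΦ⟩ := exists_retraction (v := v)
  refine (Module.FaithfullyFlat.iff_flat_and_proper_ideal v.A v.T).2 ⟨inferInstance, fun I hI h => ?_⟩
  refine (Ideal.ne_top_iff_one I).1 hI ?_
  have h1 : (1 : v.T) ∈ I • (⊤ : Submodule v.A v.T) := by rw [h]; exact Submodule.mem_top
  rw [← hΦ]
  refine Submodule.smul_induction_on h1 (fun a ha t _ => ?_) fun t t' ht ht' => ?_
  · rw [map_smul]; exact I.mul_mem_right _ ha
  · rw [map_add]; exact I.add_mem ht ht'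

lemma tauT_algebraMap_A (a : v.A) : v.tauT (algebraMap v.A v.T a) = algebraMap v.A v.T a := by
  rw [IsScalarTower.algebraMap_apply v.A v.B v.T, tauT_algebraMap, AlgHom.commutes]

namespace Period

variable (D : v.Period) (M : v.AMotive)

/-- The restriction to the closed unit disc as a linear map. -/
def evalLin : v.JInv →ₗ[v.B] v.T where
  toFun := D.eval
  map_add' := map_add _
  map_smul' c y := by
    rw [Algebra.smul_def, map_mul, eval_algebraMap, RingHom.id_apply, Algebra.smul_def]

/-- The map `M[𝔧⁻¹] → ℂ_∞⟨A⟩ ⊗ M`. -/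
def evalM (N : Type u) [AddCommGroup N] [Module v.B N] : v.JInv ⊗[v.B] N →ₗ[v.B] v.T ⊗[v.B] N :=
  D.evalLin.rTensor N

lemma evalM_tmul {N : Type u} [AddCommGroup N] [Module v.B N] (y : v.JInv) (m : N) :
    D.evalM N (y ⊗ₜ[v.B] m) = D.eval y ⊗ₜ[v.B] m := rfl

lemma evalM_smul {N : Type u} [AddCommGroup N] [Module v.B N] (y : v.JInv) (w : v.JInv ⊗[v.B] N) :
    D.evalM N (y • w) = D.eval y • D.evalM N w := by
  induction w using TensorProduct.induction_on with
  | zero => simp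
  | tmul y' m =>
    rw [TensorProduct.smul_tmul', evalM_tmul, evalM_tmul, smul_eq_mul, map_mul,
      TensorProduct.smul_tmul', smul_eq_mul]
  | add y z hy hz => simp only [smul_add, map_add, hy, hz]

lemma formQ_evalM {N : Type u} [AddCommGroup N] [Module v.B N] (l : N →ₗ[v.B] v.B)
    (w : v.JInv ⊗[v.B] N) : formQ v.T l (D.evalM N w) = D.eval (formQ v.JInv l w) := by
  induction w using TensorProduct.induction_on with
  | zero => simp
  | tmul y m => rw [evalM_tmul, formQ_tmul, formQ_tmul, map_mul, eval_algebraMap]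
  | add y z hy hz => simp only [map_add, hy, hz]

/-- The inverse of the map `T ⊗ M → T ⊗ M[𝔧⁻¹]`. -/
def inclInv : v.T ⊗[v.B] (v.JInv ⊗[v.B] M.carrier) →ₗ[v.T] v.T ⊗[v.B] M.carrier :=
  (D.evalM M.carrier).liftBaseChange v.T

lemma inclInv_tmul (t : v.T) (w : v.JInv ⊗[v.B] M.carrier) :
    D.inclInv M (t ⊗ₜ[v.B] w) = t • D.evalM _ w := by simp [inclInv]

lemma inclInv_inclT (y : v.T ⊗[v.B] M.carrier) : D.inclInv M (M.inclT y) = y := by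
  induction y using TensorProduct.induction_on with
  | zero => simp
  | tmul t m =>
    rw [AMotive.inclT_tmul, inclInv_tmul, evalM_tmul, map_one, TensorProduct.smul_tmul',
      smul_eq_mul, mul_one]
  | add y z hy hz => simp only [map_add, hy, hz]

/-- The semilinear endomorphism `ω ↦ τ_M (τ^* ω)` of `T ⊗ M`. -/
def sigma : v.T ⊗[v.B] M.carrier →+ v.T ⊗[v.B] M.carrier :=
  (D.inclInv M).toAddMonoidHom.comp M.tauMT

lemma sigma_tmul (t : v.T) (m : M.carrier) : D.sigma M (t ⊗ₜ[v.B] m) =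
    v.tauT t • D.evalM _ (M.tauM (1 ⊗ₜ[v.B] m)) := by
  change D.inclInv M (M.tauMT (t ⊗ₜ[v.B] m)) = _
  rw [AMotive.tauMT_tmul, inclInv_tmul]

lemma sigma_smul (t : v.T) (y : v.T ⊗[v.B] M.carrier) :
    D.sigma M (t • y) = v.tauT t • D.sigma M y := by
  induction y using TensorProduct.induction_on with
  | zero => simp
  | tmul t' m => rw [TensorProduct.smul_tmul', sigma_tmul, sigma_tmul, smul_eq_mul, map_mul, mul_smul]
  | add y z hy hz => simp only [smul_add, map_add, hy, hz]

variable {M} in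
lemma sigma_of_mem {y : v.T ⊗[v.B] M.carrier} (hy : y ∈ M.betti) : D.sigma M y = y := by
  rw [AMotive.mem_betti] at hy
  change D.inclInv M (M.tauMT y) = y
  rw [← hy, inclInv_inclT]

/-- The coordinates of an element of the Betti realization satisfy a system of Frobenius equations. -/
lemma betti_system (e : DualBasis v.B M.carrier) {y : v.T ⊗[v.B] M.carrier} (hy : y ∈ M.betti)
    (i : Fin e.n) : formQ v.T (e.form i) y =
      ∑ j, D.eval (formQ v.JInv (e.form i) (M.tauM (1 ⊗ₜ[v.B] e.vec j))) *
        v.tauT (formQ v.T (e.form j) y) := by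
  conv_lhs => rw [← D.sigma_of_mem hy, ← e.sum_formQ v.T y, map_sum, map_sum]
  refine Finset.sum_congr rfl fun j _ => ?_
  rw [sigma_tmul, map_smul, formQ_evalM, smul_eq_mul, mul_comm]

/-- The values of a Frobenius equivariant form satisfy a system of Frobenius equations. -/
lemma form_system (e : DualBasis v.B M.carrier) (ξ : v.T ⊗[v.B] M.carrier →ₗ[v.T] v.T)
    (hξ : ∀ y, ξ (D.sigma M y) = v.tauT (ξ y)) (j : Fin e.n) : ξ (1 ⊗ₜ[v.B] e.vec j) =
      ∑ l, D.eval (formQ v.JTau (e.form l) (M.tauM.symm (1 ⊗ₜ[v.B] e.vec j))) *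
        v.tauT (ξ (1 ⊗ₜ[v.B] e.vec l)) := by
  have h1 := e.sum_formQ v.JTau (M.tauM.symm (1 ⊗ₜ[v.B] e.vec j))
  set φ : Fin e.n → v.JTau := fun l => formQ v.JTau (e.form l) (M.tauM.symm (1 ⊗ₜ[v.B] e.vec j))
  have h2 (l : Fin e.n) : φ l ⊗ₜ[v.B] e.vec l =
      (show v.JInv from φ l) • ((1 : v.JTau) ⊗ₜ[v.B] e.vec l) := by
    rw [TensorProduct.smul_tmul']
    exact congrArg (· ⊗ₜ[v.B] e.vec l) (mul_one (M := v.JInv) (φ l)).symm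
  have h3 := congrArg (fun w => D.evalM _ (M.tauM w)) h1
  simp only [LinearEquiv.apply_symm_apply, map_sum, evalM_tmul, map_one] at h3
  rw [← h3, map_sum]
  refine Finset.sum_congr rfl fun l _ => ?_
  rw [← hξ, sigma_tmul, map_one, one_smul]
  change ξ (D.evalM _ (M.tauM (φ l ⊗ₜ[v.B] e.vec l))) = _
  rw [h2, map_smul, evalM_smul, map_smul]
  rfl

end Period

end Place
end HodgePink
end

noncomputable section
namespace HodgePink

set_option linter.unusedSectionVars false
set_option linter.unusedVariables false

lemma projective_of_isDedekindDomain (S N : Type*) [CommRing S] [IsDedekindDomain S]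
    [AddCommGroup N] [Module S N] [Module.Finite S N] [Module.IsTorsionFree S N] :
    Module.Projective S N :=
  have := Module.finitePresentation_of_finite S N
  Module.Flat.projective_of_finitePresentation

namespace Place

variable {F K : Type u} [Field F] [Fintype F] [Field K] [Algebra F K] {v : Place F K}
  {ν : v.Nu}

lemma HasGerm.sum (hK : IsFunctionField F K) {ι : Type*} (s : Finset ι) {t : ι → v.T}
    {g : ι → Laurent ν} (h : ∀ i, HasGerm ν (t i) (g i)) :
    HasGerm ν (∑ i ∈ s, t i) (∑ i ∈ s, g i) := by
  classical
  induction s using Finset.induction_on with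
  | empty => simpa using hasGerm_algebraMap (ν := ν) hK 0
  | insert a s has ih =>
    rw [Finset.sum_insert has, Finset.sum_insert has]
    exact (h a).add hK ih

namespace AMotive

variable {M N : v.AMotive}

lemma IsGerm.hasGerm (hK : IsFunctionField F K) {ω : v.T ⊗[v.B] M.carrier}
    {g : Laurent ν ⊗[v.B] M.carrier} (h : IsGerm ν ω g) (l : M.carrier →ₗ[v.B] v.B) :
    HasGerm ν (formQ v.T l ω) (formQ (Laurent ν) l g) := by
  obtain ⟨L, hL, d, d', k, f, f', m, h1, h2, h3, h4, h5⟩ := h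
  obtain ⟨D⟩ := nonempty_period (v := v) hK
  have := v.completeSpace_of_finiteDimensional L
  have hL' := v.norm_algebraMap_intermediate L
  have h4' := congrArg (formQ v.T l) h4
  have h5' := congrArg (formQ (Laurent ν) l) h5
  simp only [map_smul, map_sum, formQ_tmul, smul_eq_mul] at h4' h5'
  refine ⟨L, hL, d, ∑ i, f i * v.toEntire L (v.coeffMap (IsScalarTower.toAlgHom F K L) (l (m i))),
    d', ∑ i, f' i * algebraMap _ _ (v.coeffMap (IsScalarTower.toAlgHom F K L) (l (m i))),
    h1, h2, ?_, ?_, ?_⟩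
  · rw [isExpansion_iff hL' D.coords, map_sum]
    refine Finset.sum_congr rfl fun i _ => ?_
    rw [map_mul, expand_toEntire, (isExpansion_iff hL' D.coords).1 (h3 i)]
  · rw [h4', map_sum]
    refine Finset.sum_congr rfl fun i _ => ?_
    rw [map_mul, entireToT_algebraMap]
  · rw [h5', map_sum]
    refine Finset.sum_congr rfl fun i _ => ?_
    rw [map_mul, jetsToLaurent_algebraMap]

/-- Germs are determined by their coordinates. -/
lemma eq_of_hasGerm (hK : IsFunctionField F K) {ω : v.T ⊗[v.B] M.carrier}
    {g g' : Laurent ν ⊗[v.B] M.carrier}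
    (h : ∀ l : M.carrier →ₗ[v.B] v.B, HasGerm ν (formQ v.T l ω) (formQ (Laurent ν) l g))
    (h' : ∀ l : M.carrier →ₗ[v.B] v.B, HasGerm ν (formQ v.T l ω) (formQ (Laurent ν) l g')) :
    g = g' := ext_formQ _ fun l => (h l).unique hK (h' l)

lemma exists_isGerm (hK : IsFunctionField F K) (ν : v.Nu) {ω : v.T ⊗[v.B] M.carrier}
    (hω : ω ∈ M.betti) : ∃ g, IsGerm ν ω g := by
  obtain ⟨D⟩ := nonempty_period (v := v) hK
  obtain ⟨e⟩ := nonempty_dualBasis (S := v.B) (N := M.carrier)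
  obtain ⟨L, hL, d, d', f, f', g, h1, h2, h⟩ :=
    D.exists_germ_family hK ν _ _ (D.betti_system M e hω)
  refine ⟨∑ i, g i ⊗ₜ[v.B] e.vec i, L, hL, d, d', e.n, f, f', e.vec, h1, h2, fun i => (h i).1, ?_, ?_⟩
  · conv_lhs => rw [← e.sum_formQ v.T ω, Finset.smul_sum]
    refine Finset.sum_congr rfl fun i _ => ?_
    rw [TensorProduct.smul_tmul', smul_eq_mul, (h i).2.1]
  · rw [Finset.smul_sum]
    refine Finset.sum_congr rfl fun i _ => ?_
    rw [TensorProduct.smul_tmul', smul_eq_mul, (h i).2.2]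

variable (M) in
/-- The map which sends an element of the Betti realization to its germ at `𝔧`. -/
def germMap (hK : IsFunctionField F K) (ν : v.Nu) : GermMap ν M where
  toLin :=
    { toFun := fun ω => (exists_isGerm hK ν ω.2).choose
      map_add' := fun ω ω' => by
        refine eq_of_hasGerm hK ((exists_isGerm hK ν (ω + ω').2).choose_spec.hasGerm hK) fun l => ?_
        have h := ((exists_isGerm hK ν ω.2).choose_spec.hasGerm hK l).add hK
          ((exists_isGerm hK ν ω'.2).choose_spec.hasGerm hK l)
        rwa [← map_add, ← map_add] at h
      map_smul' := fun a ω => by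
        refine eq_of_hasGerm hK ((exists_isGerm hK ν (a • ω).2).choose_spec.hasGerm hK) fun l => ?_
        have h := (hasGerm_algebraMap (ν := ν) hK (algebraMap v.A v.B a)).mul hK
          ((exists_isGerm hK ν ω.2).choose_spec.hasGerm hK l)
        rw [← IsScalarTower.algebraMap_apply, ← IsScalarTower.algebraMap_apply] at h
        simp only [RingHom.id_apply, Submodule.coe_smul]
        rw [← algebraMap_smul v.T a, ← algebraMap_smul (Laurent ν) a, map_smul, map_smul]
        exact h }
  isGerm ω := (exists_isGerm hK ν ω.2).choose_spec

variable (hK : IsFunctionField F K)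
include hK

lemma isTorsionFree_betti : Module.IsTorsionFree v.A M.betti := by
  obtain ⟨p, hp, _, _, _, _, x, -, -⟩ := hK.exists_coordinates_pBasis v
  have := isTorsionFree_T x
  refine (Module.isTorsionFree_iff_smul_eq_zero (R := v.A) (M := M.betti)).2 fun a ω h => ?_
  rw [or_iff_not_imp_left]
  intro ha
  refine Subtype.ext (ext_formQ v.T fun l => ?_)
  have h1 := congrArg (fun ω : M.betti => formQ v.T l ω) h
  simp only [Submodule.coe_smul, Submodule.coe_zero, map_zero] at h1 ⊢
  rw [← algebraMap_smul v.T a, map_smul, algebraMap_smul] at h1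
  exact (smul_eq_zero.1 h1).resolve_left ha

lemma finite_betti (hM : M.IsRigidAnalyticallyTrivial) : Module.Finite v.A M.betti := by
  have := faithfullyFlat_T (v := v) hK
  have : Module.Finite v.T (v.T ⊗[v.A] M.betti) :=
    Module.Finite.equiv (LinearEquiv.ofBijective M.bettiMul hM).symm
  exact Module.Finite.of_finite_tensorProduct_of_faithfullyFlat (R := v.A) (M := M.betti) v.T

lemma projective_betti (hM : M.IsRigidAnalyticallyTrivial) : Module.Projective v.A M.betti := by
  obtain ⟨p, hp, _, _, _, _, x, -, -⟩ := hK.exists_coordinates_pBasis v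
  have := finite_betti hK hM
  have htf := isTorsionFree_betti (M := M) hK
  exact projective_of_isDedekindDomain v.A M.betti

end AMotive

end Place
end HodgePink
end

noncomputable section
namespace HodgePink

set_option linter.unusedSectionVars false
set_option linter.unusedVariables false

namespace Place

variable {F K : Type u} [Field F] [Fintype F] [Field K] [Algebra F K] {v : Place F K} {ν : v.Nu}

namespace AMotive

variable {M N : v.AMotive}

lemma bettiMul_tmul (t : v.T) (ω : M.betti) :
    M.bettiMul (t ⊗ₜ[v.A] ω) = t • (ω : v.T ⊗[v.B] M.carrier) := by
  simp [bettiMul]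

/-- A form on the Betti realization induces a form on `T ⊗ M`. -/
def bettiForm (hM : M.IsRigidAnalyticallyTrivial) (μ : M.betti →ₗ[v.A] v.A) :
    v.T ⊗[v.B] M.carrier →ₗ[v.T] v.T :=
  formQ v.T μ ∘ₗ (LinearEquiv.ofBijective M.bettiMul hM).symm.toLinearMap

variable (hM : M.IsRigidAnalyticallyTrivial) (μ : M.betti →ₗ[v.A] v.A)

lemma bettiForm_bettiMul (y : v.T ⊗[v.A] M.betti) :
    bettiForm hM μ (M.bettiMul y) = formQ v.T μ y :=
  congrArg (formQ v.T μ) ((LinearEquiv.ofBijective M.bettiMul hM).symm_apply_apply y)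

lemma bettiForm_coe (ω : M.betti) : bettiForm hM μ ω = algebraMap v.A v.T (μ ω) := by
  have h := bettiForm_bettiMul hM μ (1 ⊗ₜ ω)
  rwa [bettiMul_tmul, one_smul, formQ_tmul, one_mul] at h

lemma bettiForm_sigma (D : v.Period) (y : v.T ⊗[v.B] M.carrier) :
    bettiForm hM μ (D.sigma M y) = v.tauT (bettiForm hM μ y) := by
  obtain ⟨y, rfl⟩ := hM.2 y
  induction y using TensorProduct.induction_on with
  | zero => simp
  | tmul t ω =>
    rw [bettiMul_tmul, Period.sigma_smul, D.sigma_of_mem ω.2, map_smul, map_smul, bettiForm_coe,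
      smul_eq_mul, smul_eq_mul, map_mul, tauT_algebraMap_A]
  | add y z hy hz => simp only [map_add, hy, hz]

lemma sum_bettiForm (e : DualBasis v.A M.betti) (y : v.T ⊗[v.B] M.carrier) :
    ∑ i, bettiForm hM (e.form i) y • (e.vec i : v.T ⊗[v.B] M.carrier) = y := by
  obtain ⟨y, rfl⟩ := hM.2 y
  conv_rhs => rw [← e.sum_formQ v.T y, map_sum]
  refine Finset.sum_congr rfl fun i _ => ?_
  rw [bettiForm_bettiMul, bettiMul_tmul]

lemma exists_hasGerm_bettiForm (hK : IsFunctionField F K) (D : v.Period)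
    (e : DualBasis v.B M.carrier) (j : Fin e.n) :
    ∃ g, HasGerm ν (bettiForm hM μ (1 ⊗ₜ e.vec j)) g :=
  D.exists_hasGerm hK _ _ (D.form_system M e _ (bettiForm_sigma hM μ D)) j

lemma _root_.HodgePink.Place.GermMap.hasGerm (hK : IsFunctionField F K) (γ : GermMap ν M)
    (ω : M.betti) (l : M.carrier →ₗ[v.B] v.B) :
    HasGerm ν (formQ v.T l ω) (formQ (Laurent ν) l (γ.toLin ω)) := (γ.isGerm ω).hasGerm hK l

lemma _root_.HodgePink.Place.GermMap.gamma_tmul (γ : GermMap ν M) (c : Laurent ν) (ω : M.betti) :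
    γ.gamma (c ⊗ₜ ω) = c • γ.toLin ω := by simp [GermMap.gamma]

include hM in
lemma bijective_gamma (hK : IsFunctionField F K) (γ : GermMap ν M) :
    Function.Bijective γ.gamma := by
  obtain ⟨D⟩ := nonempty_period (v := v) hK
  obtain ⟨e⟩ := nonempty_dualBasis (S := v.B) (N := M.carrier)
  have := finite_betti hK hM
  have := projective_betti hK hM
  obtain ⟨w⟩ := nonempty_dualBasis (S := v.A) (N := M.betti)
  choose G hG using fun i j => exists_hasGerm_bettiForm (ν := ν) hM (w.form i) hK D e j
  have h1 (j : Fin e.n) : ∑ i, G i j • γ.toLin (w.vec i) = 1 ⊗ₜ e.vec j := by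
    refine eq_of_hasGerm (ω := 1 ⊗ₜ e.vec j) hK (fun l => ?_) fun l => ?_
    · conv => enter [2]; rw [← sum_bettiForm hM w (1 ⊗ₜ e.vec j)]
      simp only [map_sum, map_smul, smul_eq_mul]
      exact HasGerm.sum hK _ fun i => (hG i j).mul hK (γ.hasGerm hK _ l)
    · rw [formQ_tmul, formQ_tmul, one_mul, one_mul]
      exact hasGerm_algebraMap hK _
  have h2 (ω : M.betti) (i : Fin w.n) : ∑ j, formQ (Laurent ν) (e.form j) (γ.toLin ω) * G i j =
      algebraMap v.A (Laurent ν) (w.form i ω) := by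
    refine HasGerm.unique (t := algebraMap v.A v.T (w.form i ω)) hK ?_ ?_
    · have h3 : algebraMap v.A v.T (w.form i ω) =
          ∑ j, formQ v.T (e.form j) ω * bettiForm hM (w.form i) (1 ⊗ₜ e.vec j) := by
        conv_lhs => rw [← bettiForm_coe hM, ← e.sum_formQ v.T (ω : v.T ⊗[v.B] M.carrier), map_sum]
        refine Finset.sum_congr rfl fun j _ => ?_
        rw [← smul_eq_mul, ← map_smul, TensorProduct.smul_tmul', smul_eq_mul, mul_one]
      rw [h3]
      exact HasGerm.sum hK _ fun j => (γ.hasGerm hK ω _).mul hK (hG i j)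
    · rw [IsScalarTower.algebraMap_apply v.A v.B v.T, IsScalarTower.algebraMap_apply v.A v.B (Laurent ν)]
      exact hasGerm_algebraMap hK _
  let δ : Laurent ν ⊗[v.B] M.carrier →ₗ[Laurent ν] Laurent ν ⊗[v.A] M.betti :=
    ∑ i, ∑ j, (LinearMap.toSpanSingleton (Laurent ν) _ (G i j ⊗ₜ w.vec i)) ∘ₗ
      formQ (Laurent ν) (e.form j)
  have hδ (y : Laurent ν ⊗[v.B] M.carrier) :
      δ y = ∑ i, ∑ j, formQ (Laurent ν) (e.form j) y • (G i j ⊗ₜ[v.A] w.vec i) := by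
    simp [δ]
  refine Function.bijective_iff_has_inverse.2 ⟨δ, fun y => ?_, fun y => ?_⟩
  · change (δ ∘ₗ γ.gamma) y = (LinearMap.id : _ →ₗ[Laurent ν] _) y
    refine LinearMap.congr_fun (TensorProduct.AlgebraTensorModule.curry_injective ?_) y
    ext ω
    change δ (γ.gamma (1 ⊗ₜ ω)) = 1 ⊗ₜ ω
    rw [GermMap.gamma_tmul, one_smul, hδ]
    simp only [TensorProduct.smul_tmul', smul_eq_mul, ← TensorProduct.sum_tmul, h2]
    conv_rhs => rw [← w.sum_eq ω, TensorProduct.tmul_sum]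
    refine Finset.sum_congr rfl fun i _ => ?_
    rw [← mul_one (algebraMap v.A (Laurent ν) _), ← Algebra.smul_def, TensorProduct.smul_tmul]
  · rw [hδ, Finset.sum_comm, map_sum]
    conv_rhs => rw [← e.sum_formQ (Laurent ν) y]
    refine Finset.sum_congr rfl fun j _ => ?_
    rw [← Finset.smul_sum, map_smul, map_sum]
    simp only [GermMap.gamma_tmul]
    rw [h1, TensorProduct.smul_tmul', smul_eq_mul, mul_one]

/-- Germs are compatible with morphisms. -/
lemma toLin_bettiMap (hK : IsFunctionField F K) (γ : GermMap ν M) (γ' : GermMap ν N) (f : M ⟶ N)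
    (ω : M.betti) : γ'.toLin (bettiMap f ω) = f.toLin.baseChange (Laurent ν) (γ.toLin ω) := by
  refine eq_of_hasGerm (ω := f.toLin.baseChange v.T ω) hK (fun l => ?_) fun l => ?_
  · rw [← bettiMap_coe]
    exact γ'.hasGerm hK _ l
  · rw [formQ_baseChange, formQ_baseChange]
    exact γ.hasGerm hK ω _

/-- Germs are compatible with the action of `G_∞`. -/
lemma toLin_bettiGal (hK : IsFunctionField F K) (γ : GermMap ν M) (σ : v.Ginf) (ω : M.betti)
    (l : M.carrier →ₗ[v.B] v.B) : formQ (Laurent ν) l (γ.toLin (M.bettiGal σ ω)) =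
      σ • formQ (Laurent ν) l (γ.toLin ω) := by
  have h (y : v.T ⊗[v.B] M.carrier) : formQ v.T l (M.galTM σ y) = v.galT σ (formQ v.T l y) := by
    induction y using TensorProduct.induction_on with
    | zero => simp
    | tmul t m => rw [galTM_tmul, formQ_tmul, formQ_tmul, map_mul, galT_algebraMap]
    | add y z hy hz => simp only [map_add, hy, hz]
  refine HasGerm.unique (t := formQ v.T l (M.bettiGal σ ω)) hK (γ.hasGerm hK _ l) ?_
  rw [bettiGal_coe, h]
  exact (γ.hasGerm hK ω l).smul hK σ

lemma isLocallyConstant_bettiGal (hK : IsFunctionField F K) (ω : M.betti) :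
    IsLocallyConstant fun σ => M.bettiGal σ ω := by
  obtain ⟨D⟩ := nonempty_period (v := v) hK
  obtain ⟨e⟩ := nonempty_dualBasis (S := v.B) (N := M.carrier)
  obtain ⟨L, hL, h⟩ := D.exists_fixing _ _ (D.betti_system M e ω.2)
  have hfix (σ) (hσ : σ ∈ L.fixingSubgroup) : M.bettiGal σ ω = ω := by
    refine Subtype.ext ?_
    rw [bettiGal_coe]
    conv_lhs => rw [← e.sum_formQ v.T (ω : v.T ⊗[v.B] M.carrier), map_sum]
    conv_rhs => rw [← e.sum_formQ v.T (ω : v.T ⊗[v.B] M.carrier)]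
    refine Finset.sum_congr rfl fun i _ => ?_
    rw [galTM_tmul, h σ hσ]
  refine (IsLocallyConstant.iff_exists_open _).2 fun σ => ?_
  have ho : IsOpen (L.fixingSubgroup : Set v.Ginf) := L.fixingSubgroup_isOpen
  refine ⟨(fun x => σ⁻¹ * x) ⁻¹' L.fixingSubgroup, ho.preimage (continuous_const_mul σ⁻¹), ?_, ?_⟩
  · simp
  · intro x hx
    have h1 : M.bettiGal x ω = M.bettiGal σ (M.bettiGal (σ⁻¹ * x) ω) := by
      rw [← Module.End.mul_apply, ← map_mul, mul_inv_cancel_left]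
    rw [h1, hfix _ hx]

end AMotive

end Place
end HodgePink
end

noncomputable section
namespace HodgePink

set_option linter.unusedSectionVars false
set_option linter.unusedVariables false

section FiveLemma

variable {X Y Z X' Y' Z' : Type*} [AddCommGroup X] [AddCommGroup Y] [AddCommGroup Z]
  [AddCommGroup X'] [AddCommGroup Y'] [AddCommGroup Z'] {f : X →+ Y} {g : Y →+ Z}
  {f' : X' →+ Y'} {g' : Y' →+ Z'} {a : X →+ X'} {b : Y →+ Y'} {c : Z →+ Z'}

lemma bijective_middle (hg : Function.Surjective g) (hfg : Function.Exact f g)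
    (hf' : Function.Injective f') (hfg' : Function.Exact f' g')
    (h1 : ∀ x, b (f x) = f' (a x)) (h2 : ∀ y, c (g y) = g' (b y))
    (ha : Function.Bijective a) (hc : Function.Bijective c) : Function.Bijective b := by
  refine ⟨(injective_iff_map_eq_zero b).2 fun y hy => ?_, fun y' => ?_⟩
  · have h3 : g y = 0 := hc.1 (by rw [h2, hy, map_zero, map_zero])
    obtain ⟨x, rfl⟩ := (hfg y).1 h3
    rw [h1] at hy
    have h4 : a x = 0 := hf' (by rw [hy, map_zero])
    rw [ha.1 (h4.trans (map_zero a).symm), map_zero]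
  · obtain ⟨z, hz⟩ := hc.2 (g' y')
    obtain ⟨y, rfl⟩ := hg z
    rw [h2, ← sub_eq_zero, ← map_sub] at hz
    obtain ⟨x', hx'⟩ := (hfg' _).1 hz
    obtain ⟨x, rfl⟩ := ha.2 x'
    exact ⟨y - f x, by rw [map_sub, h1, hx', sub_sub_cancel]⟩

lemma bijective_left (hf : Function.Injective f) (hfg : Function.Exact f g)
    (hf' : Function.Injective f') (hfg' : Function.Exact f' g')
    (h1 : ∀ x, b (f x) = f' (a x)) (h2 : ∀ y, c (g y) = g' (b y))
    (hb : Function.Bijective b) (hc : Function.Injective c) : Function.Bijective a := by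
  refine ⟨(injective_iff_map_eq_zero a).2 fun x hx => ?_, fun x' => ?_⟩
  · refine hf (hb.1 ?_)
    rw [h1, hx, map_zero, map_zero, map_zero]
  · obtain ⟨y, hy⟩ := hb.2 (f' x')
    have h3 : g y = 0 := hc (by rw [h2, hy, map_zero]; exact (hfg' _).2 ⟨x', rfl⟩)
    obtain ⟨x, rfl⟩ := (hfg y).1 h3
    exact ⟨x, hf' (by rw [← h1, hy])⟩

end FiveLemma

section Split

variable {S X Y Z : Type*} [CommRing S] [AddCommGroup X] [AddCommGroup Y] [AddCommGroup Z]
  [Module S X] [Module S Y] [Module S Z] {f : X →ₗ[S] Y} {g : Y →ₗ[S] Z}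

/-- A short exact sequence with a projective quotient splits. -/
lemma exists_splitting [Module.Projective S Z] (hf : Function.Injective f)
    (hfg : Function.Exact f g) (hg : Function.Surjective g) :
    ∃ (r : Y →ₗ[S] X) (s : Z →ₗ[S] Y), r ∘ₗ f = LinearMap.id ∧ g ∘ₗ s = LinearMap.id := by
  obtain ⟨s, hs⟩ := Module.projective_lifting_property g LinearMap.id hg
  have h : (Function.Injective f ∧ ∃ l, g ∘ₗ l = LinearMap.id) ↔
      (Function.Surjective g ∧ ∃ l, l ∘ₗ f = LinearMap.id) := hfg.split_tfae'.out 0 1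
  obtain ⟨-, r, hr⟩ := h.1 ⟨hf, s, hs⟩
  exact ⟨r, s, hr, hs⟩

lemma baseChange_injective_of_retraction (Q : Type*) [CommRing Q] [Algebra S Q] {r : Y →ₗ[S] X}
    (hr : r ∘ₗ f = LinearMap.id) : Function.Injective (f.baseChange Q) :=
  Function.LeftInverse.injective (g := r.baseChange Q) fun y => by
    rw [← LinearMap.comp_apply, ← LinearMap.baseChange_comp, hr, LinearMap.baseChange_id]
    rfl

variable {T X' Y' Z' : Type*} [CommRing T] [Algebra S T] [AddCommGroup X'] [AddCommGroup Y']
  [AddCommGroup Z'] [Module T X'] [Module T Y'] [Module T Z'] {f' : X' →ₗ[T] Y'} {g' : Y' →ₗ[T] Z'}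
  {a : T ⊗[S] X →ₗ[T] X'} {b : T ⊗[S] Y →ₗ[T] Y'} {c : T ⊗[S] Z →ₗ[T] Z'}

lemma bijective_middle_of_tensor (hfg : Function.Exact f g) (hg : Function.Surjective g)
    (hf' : Function.Injective f') (hfg' : Function.Exact f' g')
    (h1 : ∀ x, b (f.lTensor T x) = f' (a x)) (h2 : ∀ y, c (g.lTensor T y) = g' (b y))
    (ha : Function.Bijective a) (hc : Function.Bijective c) : Function.Bijective b :=
  bijective_middle (f := (f.lTensor T).toAddMonoidHom) (g := (g.lTensor T).toAddMonoidHom)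
    (f' := f'.toAddMonoidHom) (g' := g'.toAddMonoidHom) (a := a.toAddMonoidHom)
    (b := b.toAddMonoidHom) (c := c.toAddMonoidHom) (LinearMap.lTensor_surjective T hg)
    (lTensor_exact T hfg hg) hf' hfg' h1 h2 ha hc

lemma bijective_left_of_tensor [Module.Flat S T] (hf : Function.Injective f)
    (hfg : Function.Exact f g) (hg : Function.Surjective g)
    (hf' : Function.Injective f') (hfg' : Function.Exact f' g')
    (h1 : ∀ x, b (f.lTensor T x) = f' (a x)) (h2 : ∀ y, c (g.lTensor T y) = g' (b y))
    (hb : Function.Bijective b) (hc : Function.Injective c) : Function.Bijective a :=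
  bijective_left (f := (f.lTensor T).toAddMonoidHom) (g := (g.lTensor T).toAddMonoidHom)
    (f' := f'.toAddMonoidHom) (g' := g'.toAddMonoidHom) (a := a.toAddMonoidHom)
    (b := b.toAddMonoidHom) (c := c.toAddMonoidHom)
    (Module.Flat.lTensor_preserves_injective_linearMap _ hf) (lTensor_exact T hfg hg) hf' hfg' h1 h2
    hb hc

end Split

namespace Place

variable {F K : Type u} [Field F] [Fintype F] [Field K] [Algebra F K] {v : Place F K} {ν : v.Nu}

namespace AMotive

variable {X Y Z : v.AMotive} {f : X ⟶ Y} {g : Y ⟶ Z}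

lemma inclT_baseChange (f : X ⟶ Y) (y : v.T ⊗[v.B] X.carrier) :
    Y.inclT (f.toLin.baseChange v.T y) = (f.toLin.lTensor v.JInv).lTensor v.T (X.inclT y) := by
  induction y using TensorProduct.induction_on with
  | zero => simp
  | tmul t m => rfl
  | add y z hy hz => simp only [map_add, hy, hz]

lemma tauMT_baseChange (f : X ⟶ Y) (y : v.T ⊗[v.B] X.carrier) :
    Y.tauMT (f.toLin.baseChange v.T y) = (f.toLin.lTensor v.JInv).lTensor v.T (X.tauMT y) := by
  induction y using TensorProduct.induction_on with
  | zero => simp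
  | tmul t m =>
    rw [LinearMap.baseChange_tmul, tauMT_tmul, tauMT_tmul, LinearMap.lTensor_tmul, f.comm,
      LinearMap.lTensor_tmul]
  | add y z hy hz => simp only [map_add, hy, hz]

lemma bettiMul_bettiMap (f : X ⟶ Y) (y : v.T ⊗[v.A] X.betti) :
    Y.bettiMul ((bettiMap f).lTensor v.T y) = f.toLin.baseChange v.T (X.bettiMul y) := by
  induction y using TensorProduct.induction_on with
  | zero => simp
  | tmul t ω => rw [LinearMap.lTensor_tmul, bettiMul_tmul, bettiMul_tmul, map_smul, bettiMap_coe]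
  | add y z hy hz => simp only [map_add, hy, hz]

lemma bettiMap_injective {r : Y.carrier →ₗ[v.B] X.carrier} (hr : r ∘ₗ f.toLin = LinearMap.id) :
    Function.Injective (bettiMap f) := fun ω ω' h =>
  Subtype.ext (baseChange_injective_of_retraction v.T hr (congrArg Subtype.val h))

lemma mem_betti_of_map {r : Y.carrier →ₗ[v.B] X.carrier} (hr : r ∘ₗ f.toLin = LinearMap.id)
    {y : v.T ⊗[v.B] X.carrier} (hy : f.toLin.baseChange v.T y ∈ Y.betti) : y ∈ X.betti := by
  rw [mem_betti, inclT_baseChange, tauMT_baseChange] at hy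
  rw [mem_betti]
  have h : Function.Injective ((f.toLin.lTensor v.JInv).lTensor v.T) :=
    Function.LeftInverse.injective (g := (r.lTensor v.JInv).lTensor v.T) fun y => by
      rw [← LinearMap.comp_apply, ← LinearMap.lTensor_comp, ← LinearMap.lTensor_comp, hr,
        LinearMap.lTensor_id, LinearMap.lTensor_id]
      rfl
  exact h hy

lemma bettiMap_exact (hf : Function.Injective f.toLin) (hfg : Function.Exact f.toLin g.toLin)
    (hg : Function.Surjective g.toLin) : Function.Exact (bettiMap f) (bettiMap g) := by
  obtain ⟨r, s, hr, hs⟩ := exists_splitting hf hfg hg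
  have h1 : Function.Exact (f.toLin.baseChange v.T) (g.toLin.baseChange v.T) :=
    lTensor_exact v.T hfg hg
  intro ω
  constructor
  · intro h
    obtain ⟨y, hy⟩ := (h1 ω).1 (congrArg Subtype.val h)
    exact ⟨⟨y, mem_betti_of_map hr (hy ▸ ω.2)⟩, Subtype.ext hy⟩
  · rintro ⟨ω', rfl⟩
    exact Subtype.ext ((h1 _).2 ⟨ω', rfl⟩)

variable (hK : IsFunctionField F K)
include hK

lemma bettiMap_surjective (hg : Function.Surjective g.toLin) (hY : Y.IsRigidAnalyticallyTrivial)
    (hZ : Z.IsRigidAnalyticallyTrivial) : Function.Surjective (bettiMap g) := by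
  have := faithfullyFlat_T (v := v) hK
  refine (Module.FaithfullyFlat.lTensor_surjective_iff_surjective v.A v.T (N := Y.betti) (N' := Z.betti)
    (bettiMap g)).1 fun z => ?_
  obtain ⟨y, hy⟩ := LinearMap.lTensor_surjective v.T hg (Z.bettiMul z)
  obtain ⟨y, rfl⟩ := hY.2 y
  exact ⟨y, hZ.1 ((bettiMul_bettiMap g y).trans hy)⟩

/-- Extensions of rigid analytically trivial motives are rigid analytically trivial if the Betti
realization is exact. -/
lemma isRigidAnalyticallyTrivial_middle (hf : Function.Injective f.toLin)
    (hfg : Function.Exact f.toLin g.toLin) (hg : Function.Surjective g.toLin)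
    (hX : X.IsRigidAnalyticallyTrivial) (hZ : Z.IsRigidAnalyticallyTrivial)
    (h : Function.Surjective (bettiMap g)) : Y.IsRigidAnalyticallyTrivial := by
  obtain ⟨r, s, hr, hs⟩ := exists_splitting hf hfg hg
  refine bijective_middle_of_tensor (S := v.A) (T := v.T) (X := X.betti) (Y := Y.betti) (Z := Z.betti)
    (f := bettiMap f) (g := bettiMap g) (f' := f.toLin.baseChange v.T)
    (g' := g.toLin.baseChange v.T) (a := X.bettiMul) (b := Y.bettiMul) (c := Z.bettiMul) (bettiMap_exact hf hfg hg) h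
    (baseChange_injective_of_retraction v.T hr) (lTensor_exact v.T hfg hg)
    ?_ ?_ ?_ ?_
  · exact bettiMul_bettiMap f
  · exact fun y => (bettiMul_bettiMap g y)
  · exact hX
  · exact hZ

/-- Kernels of epimorphisms of rigid analytically trivial motives are rigid analytically trivial. -/
lemma isRigidAnalyticallyTrivial_left (hf : Function.Injective f.toLin)
    (hfg : Function.Exact f.toLin g.toLin) (hg : Function.Surjective g.toLin)
    (hY : Y.IsRigidAnalyticallyTrivial) (hZ : Z.IsRigidAnalyticallyTrivial) :
    X.IsRigidAnalyticallyTrivial := by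
  obtain ⟨r, s, hr, hs⟩ := exists_splitting hf hfg hg
  have := faithfullyFlat_T (v := v) hK
  refine bijective_left_of_tensor (S := v.A) (T := v.T) (X := X.betti) (Y := Y.betti) (Z := Z.betti)
    (f := bettiMap f) (g := bettiMap g) (f' := f.toLin.baseChange v.T)
    (g' := g.toLin.baseChange v.T) (a := X.bettiMul) (b := Y.bettiMul) (c := Z.bettiMul) (bettiMap_injective hr) (bettiMap_exact hf hfg hg)
    (bettiMap_surjective hK hg hY hZ)
    (baseChange_injective_of_retraction v.T hr) (lTensor_exact v.T hfg hg)
    ?_ ?_ ?_ ?_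
  · exact bettiMul_bettiMap f
  · exact fun y => (bettiMul_bettiMap g y)
  · exact hY
  · exact hZ.1

end AMotive

end Place
end HodgePink
end

noncomputable section
namespace HodgePink

set_option linter.unusedSectionVars false
set_option linter.unusedVariables false

namespace Place

variable {F K : Type u} [Field F] [Fintype F] [Field K] [Algebra F K] {v : Place F K} {ν : v.Nu}

section Lattice

variable (ν) (M : v.AMotive)

/-- The lattice `K_∞^s[[𝔧]] ⊗ M` in `K_∞^s((𝔧)) ⊗ M`. -/
def stdLattice : Submodule v.O (Laurent ν ⊗[v.B] M.carrier) :=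
  LinearMap.range (TensorProduct.AlgebraTensorModule.map
    (Algebra.linearMap v.O (Laurent ν)) (LinearMap.id : M.carrier →ₗ[v.B] M.carrier))

variable {ν M}

lemma mem_stdLattice_iff (w : Laurent ν ⊗[v.B] M.carrier) : w ∈ stdLattice ν M ↔
    ∀ l : M.carrier →ₗ[v.B] v.B, formQ (Laurent ν) l w ∈ (algebraMap v.O (Laurent ν)).range := by
  constructor
  · rintro ⟨y, rfl⟩ l
    refine ⟨formQ v.O l y, ?_⟩
    induction y using TensorProduct.induction_on with
    | zero => simp
    | tmul c m =>
      rw [TensorProduct.AlgebraTensorModule.map_tmul, formQ_tmul, formQ_tmul, map_mul,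
        Algebra.linearMap_apply, ← IsScalarTower.algebraMap_apply]
      rfl
    | add y z hy hz => simp only [map_add, hy, hz]
  · intro h
    obtain ⟨e⟩ := nonempty_dualBasis (S := v.B) (N := M.carrier)
    choose o ho using fun i => h (e.form i)
    refine ⟨∑ i, o i ⊗ₜ e.vec i, ?_⟩
    conv_rhs => rw [← e.sum_formQ (Laurent ν) w]
    rw [map_sum]
    refine Finset.sum_congr rfl fun i _ => ?_
    rw [TensorProduct.AlgebraTensorModule.map_tmul, Algebra.linearMap_apply, ho]
    rfl

lemma baseChange_mem_stdLattice {N : v.AMotive} (f : M.carrier →ₗ[v.B] N.carrier)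
    {w : Laurent ν ⊗[v.B] M.carrier} (hw : w ∈ stdLattice ν M) :
    f.baseChange (Laurent ν) w ∈ stdLattice ν N := by
  rw [mem_stdLattice_iff] at hw ⊢
  intro l
  rw [formQ_baseChange]
  exact hw _

lemma fg_stdLattice : (stdLattice ν M).FG := by
  rw [stdLattice, LinearMap.range_eq_map]
  exact Module.Finite.fg_top.map _

lemma one_tmul_mem_stdLattice (m : M.carrier) : 1 ⊗ₜ m ∈ stdLattice ν M :=
  ⟨1 ⊗ₜ m, by rw [TensorProduct.AlgebraTensorModule.map_tmul, Algebra.linearMap_apply, map_one]; rfl⟩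

end Lattice

section Realization

variable (R : Subalgebra v.A v.Kinf) {M N : v.AMotive}

namespace GermMap

lemma gammaR_tmul (γ : GermMap ν M) (c : Laurent ν) (r : R) (ω : M.betti) :
    γ.gammaR R (c ⊗ₜ (r ⊗ₜ ω)) = (r • c) • γ.toLin ω := by
  change γ.gamma (TensorProduct.AlgebraTensorModule.cancelBaseChange v.A R (Laurent ν) (Laurent ν)
    M.betti (c ⊗ₜ (r ⊗ₜ ω))) = _
  rw [TensorProduct.AlgebraTensorModule.cancelBaseChange_tmul, gamma_tmul]

lemma mem_lattice_iff (γ : GermMap ν M) (y : Laurent ν ⊗[R] (R ⊗[v.A] M.betti)) :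
    y ∈ γ.lattice R ↔ γ.gammaR R y ∈ stdLattice ν M := Iff.rfl

@[elab_as_elim]
lemma gammaR_induction {p : Laurent ν ⊗[R] (R ⊗[v.A] M.betti) → Prop}
    (y : Laurent ν ⊗[R] (R ⊗[v.A] M.betti)) (h0 : p 0) (h1 : ∀ c r ω, p (c ⊗ₜ (r ⊗ₜ ω)))
    (h2 : ∀ y z, p y → p z → p (y + z)) : p y := by
  induction y using TensorProduct.induction_on with
  | zero => exact h0
  | tmul c z =>
    induction z using TensorProduct.induction_on with
    | zero => rwa [TensorProduct.tmul_zero]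
    | tmul r ω => exact h1 c r ω
    | add y z hy hz => rw [TensorProduct.tmul_add]; exact h2 _ _ hy hz
  | add y z hy hz => exact h2 y z hy hz

lemma gammaR_baseChange (hK : IsFunctionField F K) (γ : GermMap ν M) (γ' : GermMap ν N) (f : M ⟶ N)
    (y : Laurent ν ⊗[R] (R ⊗[v.A] M.betti)) :
    γ'.gammaR R (((AMotive.bettiMap f).baseChange R).baseChange (Laurent ν) y) =
      f.toLin.baseChange (Laurent ν) (γ.gammaR R y) := by
  induction y using gammaR_induction with
  | h0 => simp
  | h1 c r ω =>
    rw [LinearMap.baseChange_tmul, LinearMap.baseChange_tmul, gammaR_tmul, gammaR_tmul, map_smul,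
      AMotive.toLin_bettiMap hK γ]
  | h2 y z hy hz => simp only [map_add, hy, hz]

lemma formQ_gammaR_gal (hK : IsFunctionField F K) (γ : GermMap ν M) (σ : v.Ginf)
    (y : Laurent ν ⊗[R] (R ⊗[v.A] M.betti)) (l : M.carrier →ₗ[v.B] v.B) :
    formQ (Laurent ν) l (γ.gammaR R (TensorProduct.map (DistribSMul.toLinearMap R (Laurent ν) σ)
      ((M.bettiGal σ).baseChange R) y)) = σ • formQ (Laurent ν) l (γ.gammaR R y) := by
  induction y using gammaR_induction with
  | h0 => simp
  | h1 c r ω =>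
    rw [TensorProduct.map_tmul, LinearMap.baseChange_tmul, gammaR_tmul, gammaR_tmul, map_smul,
      map_smul, AMotive.toLin_bettiGal hK, smul_eq_mul, smul_eq_mul, smul_mul',
      DistribSMul.toLinearMap_apply, smul_comm σ r c]
  | h2 y z hy hz => simp only [map_add, smul_add, hy, hz]

variable (hM : M.IsRigidAnalyticallyTrivial) (hK : IsFunctionField F K) (γ : GermMap ν M)
include hM hK

lemma bijective_gammaR : Function.Bijective (γ.gammaR R) :=
  (AMotive.bijective_gamma hM hK γ).comp (LinearEquiv.bijective _)

lemma isLattice_lattice : IsLattice (Q := Laurent ν) (γ.lattice R) := by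
  let E := LinearEquiv.ofBijective (γ.gammaR R) (γ.bijective_gammaR R hM hK)
  have hE (w) : γ.gammaR R (E.symm w) = w := E.apply_symm_apply w
  refine ⟨?_, ?_⟩
  · have h : γ.lattice R = (stdLattice ν M).map (E.symm.toLinearMap.restrictScalars v.O) := by
      ext y
      constructor
      · intro hy
        exact ⟨γ.gammaR R y, hy, E.symm_apply_apply y⟩
      · rintro ⟨w, hw, rfl⟩
        rw [mem_lattice_iff]
        exact (hE w).symm ▸ hw
    rw [h]
    exact fg_stdLattice.map _
  · rw [eq_top_iff]
    rintro y -
    rw [← E.symm_apply_apply y]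
    generalize E y = w
    induction w using TensorProduct.induction_on with
    | zero => rw [map_zero]; exact zero_mem _
    | tmul c m =>
      rw [← mul_one c, ← smul_eq_mul, ← TensorProduct.smul_tmul', map_smul]
      refine Submodule.smul_mem _ _ (Submodule.subset_span ?_)
      rw [SetLike.mem_coe, mem_lattice_iff, hE]
      exact one_tmul_mem_stdLattice m
    | add y z hy hz => rw [map_add]; exact add_mem hy hz

end GermMap

variable (hK : IsFunctionField F K) (γ : ∀ M : v.AMotRat, GermMap ν M.obj)
include hK

lemma hodgePinkWellDefined : HodgePinkWellDefined γ R where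
  finite M := by
    have := AMotive.finite_betti hK M.property
    infer_instance
  isLattice M := (γ M).isLattice_lattice R M.property hK
  map_mem M N f y hy := by
    rw [GermMap.mem_lattice_iff] at hy ⊢
    refine Eq.mpr (congrArg (· ∈ _) (GermMap.gammaR_baseChange R hK (γ M) (γ N) f.hom y)) ?_
    exact baseChange_mem_stdLattice _ hy

lemma frobWellDefined : FrobWellDefined γ R where
  continuous M h := by
    induction h using TensorProduct.induction_on with
    | zero =>
      simp only [map_zero]
      exact IsLocallyConstant.const _
    | tmul r ω =>
      exact (AMotive.isLocallyConstant_bettiGal hK ω).comp (fun ω => r ⊗ₜ[v.A] ω)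
    | add y z hy hz =>
      simp only [map_add]
      exact hy.comp₂ hz (· + ·)
  mem M σ y hy := by
    rw [GermMap.mem_lattice_iff, mem_stdLattice_iff] at hy ⊢
    intro l
    obtain ⟨o, ho⟩ := hy l
    refine ⟨σ • o, ?_⟩
    rw [← smul_algebraMap_Laurent, ho]
    exact (GermMap.formQ_gammaR_gal R hK (γ M) σ y l).symm

end Realization
end Place
end HodgePink
end

noncomputable section
namespace HodgePink

/-! ### A criterion for exact categories -/

section Criterion

open Limits

variable {C : Type*} [Category C] [Preadditive C]

/-- The object `P` is the direct sum of `X` and `Y`. -/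
structure DirectSum (X Y P : C) where
  inl : X ⟶ P
  inr : Y ⟶ P
  fst : P ⟶ X
  snd : P ⟶ Y
  inl_fst : inl ≫ fst = 𝟙 X
  inr_snd : inr ≫ snd = 𝟙 Y
  inl_snd : inl ≫ snd = 0
  inr_fst : inr ≫ fst = 0
  total : fst ≫ inl + snd ≫ inr = 𝟙 P

lemma hasFiniteBiproducts_of_directSum (zero : ∃ Z : C, 𝟙 Z = 0)
    (sum : ∀ X Y : C, ∃ P : C, Nonempty (DirectSum X Y P)) : HasFiniteBiproducts C := by
  obtain ⟨Z, hZ⟩ := zero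
  have : HasZeroObject C := ⟨Z, (IsZero.iff_id_eq_zero Z).2 hZ⟩
  have : HasBinaryBiproducts C := ⟨fun X Y => by
    obtain ⟨P, ⟨s⟩⟩ := sum X Y
    exact hasBinaryBiproduct_of_total
      { pt := P, fst := s.fst, snd := s.snd, inl := s.inl, inr := s.inr, inl_fst := s.inl_fst,
        inl_snd := s.inl_snd, inr_fst := s.inr_fst, inr_snd := s.inr_snd } s.total⟩
  have : HasFiniteProducts C := hasFiniteProducts_of_has_binary_and_terminal
  exact HasFiniteBiproducts.of_hasFiniteProducts

namespace DirectSum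

variable {X Y X' Y' Z Z' P : C}

lemma isPushout (s : DirectSum Y X' P) (f : X ⟶ Y) (h : X ⟶ X') (p : P ⟶ Y')
    (w : (f ≫ s.inl - h ≫ s.inr) ≫ p = 0) (hp : IsColimit (CokernelCofork.ofπ p w)) :
    IsPushout f h (s.inl ≫ p) (s.inr ≫ p) := by
  have hk (t : PushoutCocone f h) :
      (f ≫ s.inl - h ≫ s.inr) ≫ (s.fst ≫ t.inl + s.snd ≫ t.inr) = 0 := by
    simp only [Preadditive.sub_comp, Preadditive.comp_add, Category.assoc, reassoc_of% s.inl_fst,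
      reassoc_of% s.inl_snd, reassoc_of% s.inr_fst, reassoc_of% s.inr_snd, zero_comp, comp_zero,
      t.condition]
    abel
  have fac (t : PushoutCocone f h) : p ≫ hp.desc (CokernelCofork.ofπ _ (hk t)) =
      s.fst ≫ t.inl + s.snd ≫ t.inr := hp.fac (CokernelCofork.ofπ _ (hk t)) .one
  refine ⟨⟨?_⟩, ⟨PushoutCocone.IsColimit.mk _ (fun t => hp.desc (CokernelCofork.ofπ _ (hk t)))
    (fun t => ?_) (fun t => ?_) (fun t m h1 h2 => ?_)⟩⟩
  · rw [← sub_eq_zero, ← Category.assoc, ← Category.assoc, ← Preadditive.sub_comp, w]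
  · rw [Category.assoc, fac]
    simp only [Preadditive.comp_add, reassoc_of% s.inl_fst, reassoc_of% s.inl_snd, zero_comp,
      add_zero]
  · rw [Category.assoc, fac]
    simp only [Preadditive.comp_add, reassoc_of% s.inr_fst, reassoc_of% s.inr_snd, zero_comp,
      zero_add]
  · refine Cofork.IsColimit.hom_ext hp ((?_ : p ≫ m = _).trans (fac t).symm)
    rw [← h1, ← h2, ← Category.id_comp (p ≫ m), ← s.total, Preadditive.add_comp]
    simp only [Category.assoc]

lemma isPullback (s : DirectSum Y Z' P) (g : Y ⟶ Z) (h : Z' ⟶ Z) (i : Y' ⟶ P)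
    (w : i ≫ (s.fst ≫ g - s.snd ≫ h) = 0) (hi : IsLimit (KernelFork.ofι i w)) :
    IsPullback (i ≫ s.fst) (i ≫ s.snd) g h := by
  have hk (t : PullbackCone g h) :
      (t.fst ≫ s.inl + t.snd ≫ s.inr) ≫ (s.fst ≫ g - s.snd ≫ h) = 0 := by
    simp only [Preadditive.add_comp, Preadditive.comp_sub, Category.assoc, reassoc_of% s.inl_fst,
      reassoc_of% s.inl_snd, reassoc_of% s.inr_fst, reassoc_of% s.inr_snd, zero_comp, comp_zero,
      t.condition]
    abel
  have fac (t : PullbackCone g h) : hi.lift (KernelFork.ofι _ (hk t)) ≫ i =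
      t.fst ≫ s.inl + t.snd ≫ s.inr := hi.fac (KernelFork.ofι _ (hk t)) .zero
  refine ⟨⟨?_⟩, ⟨PullbackCone.IsLimit.mk _ (fun t => hi.lift (KernelFork.ofι _ (hk t)))
    (fun t => ?_) (fun t => ?_) (fun t m h1 h2 => ?_)⟩⟩
  · rw [← sub_eq_zero, Category.assoc, Category.assoc, ← Preadditive.comp_sub, w]
  · rw [← Category.assoc, fac]
    simp only [Preadditive.add_comp, Category.assoc, s.inl_fst, s.inr_fst, comp_zero, add_zero,
      Category.comp_id]
  · rw [← Category.assoc, fac]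
    simp only [Preadditive.add_comp, Category.assoc, s.inl_snd, s.inr_snd, comp_zero, zero_add,
      Category.comp_id]
  · refine Fork.IsLimit.hom_ext hi ((?_ : m ≫ i = _).trans (fac t).symm)
    rw [← h1, ← h2, ← Category.comp_id (m ≫ i), ← s.total, Preadditive.comp_add]
    simp only [Category.assoc]

end DirectSum

lemma kernel_cokernel_of {X Y Z : C} (f : X ⟶ Y) (g : Y ⟶ Z) [Mono f] [Epi g] (w : f ≫ g = 0)
    (lift : ∀ {W : C} (t : W ⟶ Y), t ≫ g = 0 → ∃ l : W ⟶ X, l ≫ f = t)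
    (desc : ∀ {W : C} (t : Y ⟶ W), f ≫ t = 0 → ∃ l : Z ⟶ W, g ≫ l = t) : ∃ w : f ≫ g = 0,
      Nonempty (IsLimit (KernelFork.ofι f w)) ∧ Nonempty (IsColimit (CokernelCofork.ofπ g w)) :=
  ⟨w, ⟨KernelFork.IsLimit.ofι' f w fun t ht => ⟨(lift t ht).choose, (lift t ht).choose_spec⟩⟩,
    ⟨CokernelCofork.IsColimit.ofπ' g w fun t ht => ⟨(desc t ht).choose, (desc t ht).choose_spec⟩⟩⟩

/-- A class of sequences is an exact structure if inflations and deflations are closed under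
composition and cancellation and under pushout and pullback along morphisms from or to summands. -/
theorem isExactCategory_of (E : SeqClass C) (zero : ∃ Z : C, 𝟙 Z = 0)
    (sum : ∀ X Y : C, ∃ P : C, Nonempty (DirectSum X Y P))
    (iso_closed : ∀ ⦃X Y Z X' Y' Z' : C⦄ (f : X ⟶ Y) (g : Y ⟶ Z) (f' : X' ⟶ Y') (g' : Y' ⟶ Z')
      (a : X ≅ X') (b : Y ≅ Y') (c : Z ≅ Z'), f ≫ b.hom = a.hom ≫ f' → g ≫ c.hom = b.hom ≫ g' →
      E f g → E f' g')
    (kernel_cokernel : ∀ ⦃X Y Z : C⦄ (f : X ⟶ Y) (g : Y ⟶ Z), E f g → ∃ w : f ≫ g = 0,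
      Nonempty (IsLimit (KernelFork.ofι f w)) ∧ Nonempty (IsColimit (CokernelCofork.ofπ g w)))
    (inflation_id : ∀ X : C, E.Inflation (𝟙 X)) (deflation_id : ∀ X : C, E.Deflation (𝟙 X))
    (inflation_comp : ∀ ⦃X Y Z : C⦄ (f : X ⟶ Y) (g : Y ⟶ Z),
      E.Inflation f → E.Inflation g → E.Inflation (f ≫ g))
    (deflation_comp : ∀ ⦃X Y Z : C⦄ (f : X ⟶ Y) (g : Y ⟶ Z),
      E.Deflation f → E.Deflation g → E.Deflation (f ≫ g))
    (inflation_of_comp : ∀ ⦃X Y Z : C⦄ (f : X ⟶ Y) (g : Y ⟶ Z),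
      E.Inflation (f ≫ g) → E.Inflation f)
    (deflation_of_comp : ∀ ⦃X Y Z : C⦄ (f : X ⟶ Y) (g : Y ⟶ Z),
      E.Deflation (f ≫ g) → E.Deflation g)
    (pushout : ∀ ⦃X Y X' Y' P : C⦄ (s : DirectSum Y X' P) (j : X ⟶ P) (p : P ⟶ Y'), E j p →
      E.Inflation (j ≫ s.fst) → E.Inflation (s.inr ≫ p))
    (pullback : ∀ ⦃Y Z Z' Y' P : C⦄ (s : DirectSum Y Z' P) (i : Y' ⟶ P) (d : P ⟶ Z), E i d →
      E.Deflation (s.inl ≫ d) → E.Deflation (i ≫ s.snd)) : IsExactCategory E where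
  hasFiniteBiproducts := hasFiniteBiproducts_of_directSum zero sum
  iso_closed := iso_closed
  kernel_cokernel := kernel_cokernel
  inflation_id := inflation_id
  deflation_id := deflation_id
  inflation_comp := inflation_comp
  deflation_comp := deflation_comp
  pushout X Y X' f h hf := by
    obtain ⟨P, ⟨s⟩⟩ := sum Y X'
    have hj : (f ≫ s.inl - h ≫ s.inr) ≫ s.fst = f := by
      simp only [Preadditive.sub_comp, Category.assoc, s.inl_fst, s.inr_fst, comp_zero, sub_zero,
        Category.comp_id]
    obtain ⟨Y', p, hp⟩ := inflation_of_comp (f ≫ s.inl - h ≫ s.inr) s.fst (hj.symm ▸ hf)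
    obtain ⟨w, -, ⟨hc⟩⟩ := kernel_cokernel _ _ hp
    exact ⟨Y', s.inl ≫ p, s.inr ≫ p, s.isPushout f h p w hc, pushout s _ p hp (hj.symm ▸ hf)⟩
  pullback Y Z Z' g h hg := by
    obtain ⟨P, ⟨s⟩⟩ := sum Y Z'
    have hd : s.inl ≫ (s.fst ≫ g - s.snd ≫ h) = g := by
      simp only [Preadditive.comp_sub, reassoc_of% s.inl_fst, reassoc_of% s.inl_snd, zero_comp,
        sub_zero]
    obtain ⟨Y', i, hi⟩ := deflation_of_comp s.inl (s.fst ≫ g - s.snd ≫ h) (hd.symm ▸ hg)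
    obtain ⟨w, ⟨hk⟩, -⟩ := kernel_cokernel _ _ hi
    exact ⟨Y', i ≫ s.fst, i ≫ s.snd, s.isPullback g h i w hk, pullback s i _ hi (hd.symm ▸ hg)⟩

end Criterion

end HodgePink
end

noncomputable section
namespace HodgePink
set_option linter.unusedSectionVars false
set_option linter.unusedVariables false

/-! ### The exact category of Hodge–Pink structures -/

section HodgePinkExact

variable {R O Q : Type u} [CommRing R] [CommRing O] [CommRing Q] [Algebra R Q] [Algebra O Q]
  [SMulCommClass R O Q]

lemma IsLattice.map {V W : Type u} [AddCommGroup V] [Module Q V] [Module O V] [IsScalarTower O Q V]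
    [AddCommGroup W] [Module Q W] [Module O W] [IsScalarTower O Q W] {q : Submodule O V}
    (hq : IsLattice (Q := Q) q) (f : V →ₗ[Q] W) (hf : Function.Surjective f) :
    IsLattice (Q := Q) (q.map (f.restrictScalars O)) := by
  refine ⟨hq.1.map _, ?_⟩
  rw [Submodule.map_coe, LinearMap.coe_restrictScalars, Submodule.span_image, hq.2,
    Submodule.map_top, LinearMap.range_eq_top.2 hf]

lemma IsLattice.sup_map {U V W : Type u} [AddCommGroup U] [Module Q U] [Module O U]
    [IsScalarTower O Q U] [AddCommGroup V] [Module Q V] [Module O V] [IsScalarTower O Q V]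
    [AddCommGroup W] [Module Q W] [Module O W] [IsScalarTower O Q W] {p : Submodule O U}
    {q : Submodule O V} (hp : IsLattice (Q := Q) p) (hq : IsLattice (Q := Q) q)
    (f : U →ₗ[Q] W) (g : V →ₗ[Q] W) (hfg : LinearMap.range f ⊔ LinearMap.range g = ⊤) :
    IsLattice (Q := Q) (p.map (f.restrictScalars O) ⊔ q.map (g.restrictScalars O)) := by
  refine ⟨(hp.1.map _).sup (hq.1.map _), top_le_iff.1 ?_⟩
  rw [← hfg, LinearMap.range_eq_map, LinearMap.range_eq_map, ← hp.2, ← hq.2, ← Submodule.span_image,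
    ← Submodule.span_image, ← Submodule.span_union]
  refine Submodule.span_mono (Set.union_subset ?_ ?_)
  · rintro _ ⟨x, hx, rfl⟩
    exact Submodule.mem_sup_left ⟨x, hx, rfl⟩
  · rintro _ ⟨x, hx, rfl⟩
    exact Submodule.mem_sup_right ⟨x, hx, rfl⟩

lemma exists_smul_mem_of_mem_span [IsFractionRing O Q] {V : Type u} [AddCommGroup V] [Module Q V]
    [Module O V] [IsScalarTower O Q V] (q : Submodule O V) {x : V}
    (hx : x ∈ Submodule.span Q (q : Set V)) : ∃ c ∈ nonZeroDivisors O, c • x ∈ q := by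
  induction hx using Submodule.span_induction with
  | mem x hx => exact ⟨1, one_mem _, by rwa [one_smul]⟩
  | zero => exact ⟨1, one_mem _, by rw [smul_zero]; exact zero_mem _⟩
  | add x y _ _ hx hy =>
    obtain ⟨c, hc, h⟩ := hx
    obtain ⟨d, hd, h'⟩ := hy
    refine ⟨d * c, mul_mem hd hc, ?_⟩
    rw [smul_add]
    refine add_mem ?_ ?_
    · rw [mul_smul]
      exact q.smul_mem _ h
    · rw [mul_comm, mul_smul]
      exact q.smul_mem _ h'
  | smul a x _ hx =>
    obtain ⟨c, hc, h⟩ := hx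
    obtain ⟨⟨n, d⟩, hd⟩ := IsLocalization.surj (nonZeroDivisors O) a
    refine ⟨d * c, mul_mem d.2 hc, ?_⟩
    have : ((d : O) * c) • a • x = n • c • x := by
      rw [← algebraMap_smul Q ((d : O) * c) (a • x), ← algebraMap_smul Q n, ← algebraMap_smul Q c x,
        ← mul_smul, ← mul_smul, ← hd, map_mul]
      congr 1
      ring
    rw [this]
    exact q.smul_mem _ h

lemma IsLattice.comap [IsNoetherianRing O] [IsFractionRing O Q] {V W : Type u} [AddCommGroup V]
    [Module Q V] [Module O V] [IsScalarTower O Q V] [AddCommGroup W] [Module Q W] [Module O W]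
    [IsScalarTower O Q W] {q : Submodule O W} (hq : IsLattice (Q := Q) q) (f : V →ₗ[Q] W)
    (hf : Function.Injective f) : IsLattice (Q := Q) (q.comap (f.restrictScalars O)) := by
  constructor
  · have : IsNoetherian O q := isNoetherian_of_fg_of_noetherian q hq.1
    have : IsNoetherian O (q.comap (f.restrictScalars O)) := isNoetherian_of_injective
      ((f.restrictScalars O).restrict fun x hx => hx) (fun x y h => Subtype.ext (hf
        (congrArg Subtype.val h)))
    exact (Submodule.fg_top _).1 (IsNoetherian.noetherian ⊤)
  · refine eq_top_iff.2 fun x _ => ?_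
    obtain ⟨c, hc, h⟩ := exists_smul_mem_of_mem_span (Q := Q) q (x := f x) (hq.2 ▸ Submodule.mem_top)
    have h1 : c • x ∈ Submodule.span Q ((q.comap (f.restrictScalars O) : Submodule O V) : Set V) :=
      Submodule.subset_span (by
        change f.restrictScalars O (c • x) ∈ q
        rwa [map_smul])
    obtain ⟨u, hu⟩ := IsLocalization.map_units Q (⟨c, hc⟩ : nonZeroDivisors O)
    have h2 : x = (↑u⁻¹ : Q) • c • x := by
      rw [← algebraMap_smul Q c x, ← mul_smul]
      change x = ((↑u⁻¹ : Q) * algebraMap O Q ((⟨c, hc⟩ : nonZeroDivisors O) : O)) • x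
      rw [← hu, Units.inv_mul, one_smul]
    rw [h2]
    exact Submodule.smul_mem _ _ h1

namespace HPk

section Constructions

variable (H H' : HPk R O Q)

/-- The direct sum of two Hodge–Pink structures. -/
def prod : HPk R O Q where
  carrier := H.carrier × H'.carrier
  lattice := H.lattice.map (((LinearMap.inl R H.carrier H'.carrier).baseChange Q).restrictScalars O)
    ⊔ H'.lattice.map (((LinearMap.inr R H.carrier H'.carrier).baseChange Q).restrictScalars O)
  isLattice := H.isLattice.sup_map H'.isLattice _ _ (by
    refine eq_top_iff.2 fun x _ => ?_
    have h : (LinearMap.inl R H.carrier H'.carrier).baseChange Q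
        ((LinearMap.fst R H.carrier H'.carrier).baseChange Q x) +
        (LinearMap.inr R H.carrier H'.carrier).baseChange Q
        ((LinearMap.snd R H.carrier H'.carrier).baseChange Q x) = x := by
      rw [← LinearMap.comp_apply, ← LinearMap.comp_apply, ← LinearMap.baseChange_comp,
        ← LinearMap.baseChange_comp, ← LinearMap.add_apply, ← LinearMap.baseChange_add,
        show LinearMap.inl R H.carrier H'.carrier ∘ₗ LinearMap.fst R H.carrier H'.carrier +
          LinearMap.inr R H.carrier H'.carrier ∘ₗ LinearMap.snd R H.carrier H'.carrier =
          LinearMap.id by ext <;> simp, LinearMap.baseChange_id, LinearMap.id_apply]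
    rw [← h]
    exact Submodule.add_mem_sup ⟨_, rfl⟩ ⟨_, rfl⟩)

lemma exists_of_mem_prod {x : Q ⊗[R] (H.carrier × H'.carrier)} (hx : x ∈ (H.prod H').lattice) :
    ∃ y ∈ H.lattice, ∃ z ∈ H'.lattice, (LinearMap.inl R H.carrier H'.carrier).baseChange Q y +
      (LinearMap.inr R H.carrier H'.carrier).baseChange Q z = x := by
  obtain ⟨_, ⟨y, hy, rfl⟩, _, ⟨z, hz, rfl⟩, rfl⟩ := Submodule.mem_sup.1 hx
  exact ⟨y, hy, z, hz, rfl⟩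

lemma fst_mem {x : Q ⊗[R] (H.carrier × H'.carrier)} (hx : x ∈ (H.prod H').lattice) :
    (LinearMap.fst R H.carrier H'.carrier).baseChange Q x ∈ H.lattice := by
  obtain ⟨y, hy, z, hz, rfl⟩ := exists_of_mem_prod H H' hx
  rw [map_add, ← LinearMap.comp_apply, ← LinearMap.comp_apply, ← LinearMap.baseChange_comp,
    ← LinearMap.baseChange_comp, LinearMap.fst_comp_inl, LinearMap.fst_comp_inr,
    LinearMap.baseChange_id, LinearMap.baseChange_zero]
  exact (add_zero y).symm ▸ hy

lemma snd_mem {x : Q ⊗[R] (H.carrier × H'.carrier)} (hx : x ∈ (H.prod H').lattice) :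
    (LinearMap.snd R H.carrier H'.carrier).baseChange Q x ∈ H'.lattice := by
  obtain ⟨y, hy, z, hz, rfl⟩ := exists_of_mem_prod H H' hx
  rw [map_add, ← LinearMap.comp_apply, ← LinearMap.comp_apply, ← LinearMap.baseChange_comp,
    ← LinearMap.baseChange_comp, LinearMap.snd_comp_inl, LinearMap.snd_comp_inr,
    LinearMap.baseChange_id, LinearMap.baseChange_zero]
  exact (zero_add z).symm ▸ hz

lemma inl_add_inr_mem {y : Q ⊗[R] H.carrier} (hy : y ∈ H.lattice) {z : Q ⊗[R] H'.carrier}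
    (hz : z ∈ H'.lattice) : (LinearMap.inl R H.carrier H'.carrier).baseChange Q y +
      (LinearMap.inr R H.carrier H'.carrier).baseChange Q z ∈ (H.prod H').lattice :=
  (Submodule.add_mem_sup ⟨y, hy, rfl⟩ ⟨z, hz, rfl⟩ :
    (LinearMap.inl R H.carrier H'.carrier).baseChange Q y +
      (LinearMap.inr R H.carrier H'.carrier).baseChange Q z ∈
      H.lattice.map (((LinearMap.inl R H.carrier H'.carrier).baseChange Q).restrictScalars O) ⊔
      H'.lattice.map (((LinearMap.inr R H.carrier H'.carrier).baseChange Q).restrictScalars O))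

lemma inl_mem {x : Q ⊗[R] H.carrier} (hx : x ∈ H.lattice) :
    (LinearMap.inl R H.carrier H'.carrier).baseChange Q x ∈ (H.prod H').lattice := by
  have h := inl_add_inr_mem H H' hx (zero_mem H'.lattice)
  rwa [map_zero, add_zero] at h

lemma inr_mem {x : Q ⊗[R] H'.carrier} (hx : x ∈ H'.lattice) :
    (LinearMap.inr R H.carrier H'.carrier).baseChange Q x ∈ (H.prod H').lattice := by
  have h := inl_add_inr_mem H H' (zero_mem H.lattice) hx
  rwa [map_zero, zero_add] at h

/-- The inclusions and projections of the direct sum of two Hodge–Pink structures. -/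
def directSum : DirectSum H H' (prod H H') where
  inl := ⟨LinearMap.inl R _ _, fun _ hx => inl_mem H H' hx⟩
  inr := ⟨LinearMap.inr R _ _, fun _ hx => inr_mem H H' hx⟩
  fst := ⟨LinearMap.fst R _ _, fun _ hx => fst_mem H H' hx⟩
  snd := ⟨LinearMap.snd R _ _, fun _ hx => snd_mem H H' hx⟩
  inl_fst := rfl
  inr_snd := rfl
  inl_snd := rfl
  inr_fst := rfl
  total := Hom.ext (by
    change LinearMap.inl R H.carrier H'.carrier ∘ₗ LinearMap.fst R H.carrier H'.carrier +
          LinearMap.inr R H.carrier H'.carrier ∘ₗ LinearMap.snd R H.carrier H'.carrier =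
          LinearMap.id
    ext <;> simp)

lemma baseChange_surjective {M N : Type u} [AddCommGroup M] [Module R M] [AddCommGroup N]
    [Module R N] {f : M →ₗ[R] N} (hf : Function.Surjective f) :
    Function.Surjective (f.baseChange Q) := LinearMap.lTensor_surjective Q hf

/-- The quotient of a Hodge–Pink structure by a submodule. -/
def quotient (N : Submodule R H.carrier) : HPk R O Q where
  carrier := H.carrier ⧸ N
  lattice := H.lattice.map ((N.mkQ.baseChange Q).restrictScalars O)
  isLattice := H.isLattice.map _ (baseChange_surjective N.mkQ_surjective)

/-- The projection to a quotient. -/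
def quotientMk (N : Submodule R H.carrier) : H ⟶ H.quotient N :=
  Hom.mk N.mkQ fun x hx => ⟨x, hx, rfl⟩

variable [Module.Flat R Q]

lemma baseChange_injective {M N : Type u} [AddCommGroup M] [Module R M] [AddCommGroup N]
    [Module R N] {f : M →ₗ[R] N} (hf : Function.Injective f) :
    Function.Injective (f.baseChange Q) := Module.Flat.lTensor_preserves_injective_linearMap f hf

variable [IsNoetherianRing R] [IsNoetherianRing O] [IsFractionRing O Q]

/-- A submodule of a Hodge–Pink structure, with the induced lattice. -/
def sub (N : Submodule R H.carrier) : HPk R O Q where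
  carrier := N
  lattice := H.lattice.comap ((N.subtype.baseChange Q).restrictScalars O)
  isLattice := H.isLattice.comap _ (baseChange_injective N.subtype_injective)

/-- The inclusion of a submodule. -/
def subtype (N : Submodule R H.carrier) : H.sub N ⟶ H := Hom.mk N.subtype fun _ hx => hx

end Constructions

/-- The injective strict morphisms. -/
def IsStrictInjective {H H' : HPk R O Q} (f : H ⟶ H') : Prop :=
  Function.Injective f.toLin ∧ ∀ x, f.toLin.baseChange Q x ∈ H'.lattice → x ∈ H.lattice

/-- The surjective strict morphisms. -/
def IsStrictSurjective {H H' : HPk R O Q} (f : H ⟶ H') : Prop :=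
  Function.Surjective f.toLin ∧ ∀ y ∈ H'.lattice, ∃ x ∈ H.lattice, f.toLin.baseChange Q x = y

lemma comp_baseChange_apply {X Y Z : HPk R O Q} (f : X ⟶ Y) (g : Y ⟶ Z) (x : Q ⊗[R] X.carrier) :
    (Hom.toLin (f ≫ g)).baseChange Q x = g.toLin.baseChange Q (f.toLin.baseChange Q x) := by
  rw [comp_toLin, LinearMap.baseChange_comp, LinearMap.comp_apply]

lemma comp_toLin_apply {X Y Z : HPk R O Q} (f : X ⟶ Y) (g : Y ⟶ Z) (x : X.carrier) :
    Hom.toLin (f ≫ g) x = g.toLin (f.toLin x) := rfl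

lemma id_baseChange_apply {X : HPk R O Q} (x : Q ⊗[R] X.carrier) :
    (Hom.toLin (𝟙 X)).baseChange Q x = x := by
  rw [id_toLin, LinearMap.baseChange_id, LinearMap.id_apply]

variable {X Y Z W X' Y' Z' P : HPk R O Q}

lemma isStrict_iff_of_surjective {f : X ⟶ Y} (hf : Function.Surjective f.toLin) :
    IsStrict f ↔ ∀ y ∈ Y.lattice, ∃ x ∈ X.lattice, f.toLin.baseChange Q x = y := by
  rw [IsStrict, (baseChange_surjective hf).range_eq, Set.inter_univ]
  refine ⟨fun h y hy => ?_, fun h => Set.Subset.antisymm ?_ fun y hy => h y hy⟩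
  · rw [← SetLike.mem_coe, ← h] at hy
    exact hy
  · rintro _ ⟨x, hx, rfl⟩
    exact f.map_mem x hx

lemma isStrictInjective_id (X : HPk R O Q) : IsStrictInjective (𝟙 X) :=
  ⟨fun _ _ h => h, fun x hx => by rwa [id_baseChange_apply] at hx⟩

lemma isStrictSurjective_id (X : HPk R O Q) : IsStrictSurjective (𝟙 X) :=
  ⟨fun x => ⟨x, rfl⟩, fun x hx => ⟨x, hx, id_baseChange_apply x⟩⟩

lemma IsStrictInjective.comp {f : X ⟶ Y} {g : Y ⟶ Z} (hf : IsStrictInjective f)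
    (hg : IsStrictInjective g) : IsStrictInjective (f ≫ g) :=
  ⟨hg.1.comp hf.1, fun x hx => hf.2 _ (hg.2 _ (by rwa [comp_baseChange_apply] at hx))⟩

lemma IsStrictSurjective.comp {f : X ⟶ Y} {g : Y ⟶ Z} (hf : IsStrictSurjective f)
    (hg : IsStrictSurjective g) : IsStrictSurjective (f ≫ g) :=
  ⟨hg.1.comp hf.1, fun z hz => by
    obtain ⟨y, hy, rfl⟩ := hg.2 z hz
    obtain ⟨x, hx, rfl⟩ := hf.2 y hy
    exact ⟨x, hx, comp_baseChange_apply f g x⟩⟩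

lemma IsStrictInjective.of_comp {f : X ⟶ Y} {g : Y ⟶ Z} (h : IsStrictInjective (f ≫ g)) :
    IsStrictInjective f :=
  ⟨Function.Injective.of_comp (f := g.toLin) h.1, fun x hx => h.2 x (by
    rw [comp_baseChange_apply]
    exact g.map_mem _ hx)⟩

lemma IsStrictSurjective.of_comp {f : X ⟶ Y} {g : Y ⟶ Z} (h : IsStrictSurjective (f ≫ g)) :
    IsStrictSurjective g :=
  ⟨Function.Surjective.of_comp (g := f.toLin) h.1, fun z hz => by
    obtain ⟨x, hx, rfl⟩ := h.2 z hz
    exact ⟨_, f.map_mem x hx, (comp_baseChange_apply f g x).symm⟩⟩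

lemma mono_of_injective {f : X ⟶ Y} (hf : Function.Injective f.toLin) : Mono f :=
  ⟨fun a b h => Hom.ext (LinearMap.ext fun x =>
    hf (LinearMap.congr_fun (congrArg Hom.toLin h) x))⟩

lemma epi_of_surjective {f : X ⟶ Y} (hf : Function.Surjective f.toLin) : Epi f :=
  ⟨fun a b h => Hom.ext (LinearMap.ext fun y => by
    obtain ⟨x, rfl⟩ := hf y
    exact LinearMap.congr_fun (congrArg Hom.toLin h) x)⟩

lemma isStrictSurjective_quotientMk (N : Submodule R X.carrier) :
    IsStrictSurjective (X.quotientMk N) :=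
  ⟨N.mkQ_surjective, fun _ ⟨x, hx, h⟩ => ⟨x, hx, h⟩⟩

lemma IsStrictInjective.exists_lift {f : X ⟶ Y} (hf : IsStrictInjective f) (t : W ⟶ Y)
    (ht : ∀ w, t.toLin w ∈ LinearMap.range f.toLin) : ∃ l : W ⟶ X, l ≫ f = t := by
  obtain ⟨m, h⟩ : ∃ m : W.carrier →ₗ[R] X.carrier, f.toLin ∘ₗ m = t.toLin :=
    ⟨(LinearEquiv.ofInjective f.toLin hf.1).symm.toLinearMap ∘ₗ t.toLin.codRestrict _ ht,
      LinearMap.ext fun w => congrArg Subtype.val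
        ((LinearEquiv.ofInjective f.toLin hf.1).apply_symm_apply (t.toLin.codRestrict _ ht w))⟩
  refine ⟨⟨m, fun w hw => hf.2 _ ?_⟩, Hom.ext h⟩
  rw [← LinearMap.comp_apply, ← LinearMap.baseChange_comp, h]
  exact t.map_mem w hw

lemma IsStrictSurjective.exists_desc {g : Y ⟶ Z} (hg : IsStrictSurjective g) (t : Y ⟶ W)
    (ht : LinearMap.ker g.toLin ≤ LinearMap.ker t.toLin) : ∃ l : Z ⟶ W, g ≫ l = t := by
  obtain ⟨m, h⟩ : ∃ m : Z.carrier →ₗ[R] W.carrier, m ∘ₗ g.toLin = t.toLin := by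
    refine ⟨(LinearMap.ker g.toLin).liftQ t.toLin ht ∘ₗ
      (g.toLin.quotKerEquivOfSurjective hg.1).symm.toLinearMap, LinearMap.ext fun y => ?_⟩
    have : (g.toLin.quotKerEquivOfSurjective hg.1).symm (g.toLin y) =
        (LinearMap.ker g.toLin).mkQ y := by
      rw [LinearEquiv.symm_apply_eq]
      rfl
    rw [LinearMap.comp_apply, LinearMap.comp_apply, LinearEquiv.coe_coe, this]
    rfl
  refine ⟨⟨m, fun z hz => ?_⟩, Hom.ext h⟩
  obtain ⟨y, hy, rfl⟩ := hg.2 z hz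
  rw [← LinearMap.comp_apply, ← LinearMap.baseChange_comp, h]
  exact t.map_mem y hy

section Flat

variable [Module.Flat R Q]

lemma isStrict_iff_of_injective {f : X ⟶ Y} (hf : Function.Injective f.toLin) :
    IsStrict f ↔ ∀ x, f.toLin.baseChange Q x ∈ Y.lattice → x ∈ X.lattice := by
  refine ⟨fun h x hx => ?_, fun h => Set.Subset.antisymm ?_ ?_⟩
  · have : f.toLin.baseChange Q x ∈ f.toLin.baseChange Q '' (X.lattice : Set _) :=
      h.symm ▸ ⟨hx, x, rfl⟩
    obtain ⟨y, hy, hxy⟩ := this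
    exact baseChange_injective hf hxy ▸ hy
  · rintro _ ⟨x, hx, rfl⟩
    exact ⟨f.map_mem x hx, x, rfl⟩
  · rintro _ ⟨hy, x, rfl⟩
    exact ⟨x, h x hy, rfl⟩

lemma strictExact_iff {f : X ⟶ Y} {g : Y ⟶ Z} : strictExact R O Q f g ↔
    IsStrictInjective f ∧ Function.Exact f.toLin g.toLin ∧ IsStrictSurjective g := by
  constructor
  · rintro ⟨⟨h1, h2, h3⟩, h4, h5⟩
    exact ⟨⟨h1, (isStrict_iff_of_injective h1).1 h4⟩, h2, h3, (isStrict_iff_of_surjective h3).1 h5⟩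
  · rintro ⟨⟨h1, h4⟩, h2, h3, h5⟩
    exact ⟨⟨h1, h2, h3⟩, (isStrict_iff_of_injective h1).2 h4, (isStrict_iff_of_surjective h3).2 h5⟩

lemma strictExact_quotientMk {f : X ⟶ Y} (hf : IsStrictInjective f) :
    strictExact R O Q f (Y.quotientMk (LinearMap.range f.toLin)) :=
  strictExact_iff.2 ⟨hf, fun y => by
    change Submodule.Quotient.mk y = 0 ↔ _
    rw [Submodule.Quotient.mk_eq_zero]
    rfl, isStrictSurjective_quotientMk _⟩

lemma strictExact_subtype [IsNoetherianRing R] [IsNoetherianRing O] [IsFractionRing O Q] {g : Y ⟶ Z}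
    (hg : IsStrictSurjective g) : strictExact R O Q (Y.subtype (LinearMap.ker g.toLin)) g :=
  strictExact_iff.2 ⟨⟨Submodule.subtype_injective _, fun _ hx => hx⟩,
    fun y => ⟨fun h => ⟨⟨y, h⟩, rfl⟩, by rintro ⟨x, rfl⟩; exact x.2⟩, hg⟩

lemma strictExact_of_iso {f : X ⟶ Y} {g : Y ⟶ Z} {f' : X' ⟶ Y'} {g' : Y' ⟶ Z'} (a : X ≅ X')
    (b : Y ≅ Y') (c : Z ≅ Z') (h1 : f ≫ b.hom = a.hom ≫ f') (h2 : g ≫ c.hom = b.hom ≫ g')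
    (h : strictExact R O Q f g) : strictExact R O Q f' g' := by
  obtain ⟨hf, hfg, hg⟩ := strictExact_iff.1 h
  have inj {U V : HPk R O Q} (e : U ≅ V) : IsStrictInjective e.hom :=
    IsStrictInjective.of_comp (g := e.inv) (e.hom_inv_id ▸ isStrictInjective_id U)
  have surj {U V : HPk R O Q} (e : U ≅ V) : IsStrictSurjective e.hom :=
    IsStrictSurjective.of_comp (f := e.inv) (e.inv_hom_id ▸ isStrictSurjective_id V)
  have hf' : f' = a.inv ≫ f ≫ b.hom := by rw [h1, a.inv_hom_id_assoc]
  have hg' : g' = b.inv ≫ g ≫ c.hom := by rw [h2, b.inv_hom_id_assoc]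
  refine strictExact_iff.2 ⟨hf' ▸ (inj a.symm).comp (hf.comp (inj b)), fun y => ?_,
    hg' ▸ (surj b.symm).comp (hg.comp (surj c))⟩
  obtain ⟨y, rfl⟩ := (surj b).1 y
  rw [← comp_toLin_apply, ← h2, comp_toLin_apply, map_eq_zero_iff _ (inj c).1, hfg y]
  constructor
  · rintro ⟨x, rfl⟩
    exact ⟨a.hom.toLin x, by rw [← comp_toLin_apply, ← h1, comp_toLin_apply]⟩
  · rintro ⟨x, hx⟩
    obtain ⟨x, rfl⟩ := (surj a).1 x
    refine ⟨x, (inj b).1 ?_⟩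
    rw [← comp_toLin_apply, h1, comp_toLin_apply, hx]

lemma isStrictInjective_pushout {fst : P ⟶ Y} {snd : P ⟶ X'} {inr : X' ⟶ P} (h1 : inr ≫ snd = 𝟙 X')
    (h2 : inr ≫ fst = 0) {j : X ⟶ P} {p : P ⟶ Y'} (hjp : strictExact R O Q j p)
    (hf : IsStrictInjective (j ≫ fst)) : IsStrictInjective (inr ≫ p) := by
  obtain ⟨hj, he, hp⟩ := strictExact_iff.1 hjp
  have hsnd (x) : snd.toLin (inr.toLin x) = x := LinearMap.congr_fun (congrArg Hom.toLin h1) x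
  have hsndQ (x) : snd.toLin.baseChange Q (inr.toLin.baseChange Q x) = x := by
    rw [← comp_baseChange_apply, h1, id_baseChange_apply]
  have hfst (x) : fst.toLin (inr.toLin x) = 0 := LinearMap.congr_fun (congrArg Hom.toLin h2) x
  have hfstQ (x) : fst.toLin.baseChange Q (inr.toLin.baseChange Q x) = 0 := by
    rw [← comp_baseChange_apply, h2]
    exact LinearMap.congr_fun (LinearMap.baseChange_zero) x
  have heQ : Function.Exact (j.toLin.baseChange Q) (p.toLin.baseChange Q) :=
    lTensor_exact Q he hp.1
  constructor
  · refine (injective_iff_map_eq_zero _).2 fun x hx => ?_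
    obtain ⟨w, hw⟩ := (he (inr.toLin x)).1 hx
    have h0 : w = 0 := hf.1 (by rw [comp_toLin_apply, hw, hfst, map_zero])
    rw [← hsnd x, ← hw, h0, map_zero, map_zero]
  · intro x hx
    rw [comp_baseChange_apply] at hx
    obtain ⟨w, hw, hwx⟩ := hp.2 _ hx
    obtain ⟨y, hy⟩ := (heQ (inr.toLin.baseChange Q x - w)).1 (by rw [map_sub, hwx, sub_self])
    have h3 : y ∈ X.lattice := hf.2 y (by
      rw [comp_baseChange_apply, hy, map_sub, hfstQ, zero_sub]
      exact neg_mem (fst.map_mem w hw))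
    rw [← hsndQ x, ← sub_add_cancel (inr.toLin.baseChange Q x) w, ← hy]
    exact snd.map_mem _ (add_mem (j.map_mem y h3) hw)

lemma isStrictSurjective_pullback {inl : Y ⟶ P} {inr : Z' ⟶ P} {snd : P ⟶ Z'}
    (h1 : inr ≫ snd = 𝟙 Z') (h2 : inl ≫ snd = 0) {i : Y' ⟶ P} {d : P ⟶ Z}
    (hid : strictExact R O Q i d) (hg : IsStrictSurjective (inl ≫ d)) :
    IsStrictSurjective (i ≫ snd) := by
  obtain ⟨hi, he, hd⟩ := strictExact_iff.1 hid
  have hsnd (x) : snd.toLin (inr.toLin x) = x := LinearMap.congr_fun (congrArg Hom.toLin h1) x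
  have hsndQ (x) : snd.toLin.baseChange Q (inr.toLin.baseChange Q x) = x := by
    rw [← comp_baseChange_apply, h1, id_baseChange_apply]
  have hinl (x) : snd.toLin (inl.toLin x) = 0 := LinearMap.congr_fun (congrArg Hom.toLin h2) x
  have hinlQ (x) : snd.toLin.baseChange Q (inl.toLin.baseChange Q x) = 0 := by
    rw [← comp_baseChange_apply, h2]
    exact LinearMap.congr_fun (LinearMap.baseChange_zero) x
  have heQ : Function.Exact (i.toLin.baseChange Q) (d.toLin.baseChange Q) :=
    lTensor_exact Q he hd.1
  constructor
  · intro z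
    obtain ⟨y, hy⟩ := hg.1 (d.toLin (inr.toLin z))
    obtain ⟨x, hx⟩ := (he (inr.toLin z - inl.toLin y)).1 (by
      rw [map_sub, ← hy, comp_toLin_apply, sub_self])
    exact ⟨x, by rw [comp_toLin_apply, hx, map_sub, hsnd, hinl, sub_zero]⟩
  · intro z hz
    have hz' := inr.map_mem z hz
    obtain ⟨y, hy, hyz⟩ := hg.2 _ (d.map_mem _ hz')
    obtain ⟨x, hx⟩ := (heQ (inr.toLin.baseChange Q z - inl.toLin.baseChange Q y)).1 (by
      rw [map_sub, ← hyz, comp_baseChange_apply, sub_self])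
    refine ⟨x, hi.2 x ?_, ?_⟩
    · rw [hx]
      exact sub_mem hz' (inl.map_mem y hy)
    · rw [comp_baseChange_apply, hx, map_sub, hsndQ, hinlQ, sub_zero]

variable [IsNoetherianRing R] [IsNoetherianRing O] [IsFractionRing O Q]

lemma inflation_iff {f : X ⟶ Y} : (strictExact R O Q).Inflation f ↔ IsStrictInjective f :=
  ⟨fun ⟨_, _, h⟩ => (strictExact_iff.1 h).1, fun h => ⟨_, _, strictExact_quotientMk h⟩⟩

lemma deflation_iff {g : Y ⟶ Z} : (strictExact R O Q).Deflation g ↔ IsStrictSurjective g :=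
  ⟨fun ⟨_, _, h⟩ => (strictExact_iff.1 h).2.2, fun h => ⟨_, _, strictExact_subtype h⟩⟩

variable (R O Q) in
lemma exists_id_eq_zero : ∃ Z : HPk R O Q, 𝟙 Z = 0 :=
  ⟨{ carrier := PUnit
     lattice := ⊥
     isLattice := ⟨Submodule.fg_bot, Subsingleton.elim _ _⟩ }, rfl⟩

variable (R O Q) in
theorem isExactCategory : IsExactCategory (strictExact R O Q) := by
  refine isExactCategory_of _ (exists_id_eq_zero R O Q) (fun X Y => ⟨_, ⟨directSum X Y⟩⟩)
    (fun X Y Z X' Y' Z' f g f' g' a b c => strictExact_of_iso a b c) (fun X Y Z f g h => ?_)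
    (fun X => inflation_iff.2 (isStrictInjective_id X))
    (fun X => deflation_iff.2 (isStrictSurjective_id X))
    (fun X Y Z f g hf hg => inflation_iff.2 ((inflation_iff.1 hf).comp (inflation_iff.1 hg)))
    (fun X Y Z f g hf hg => deflation_iff.2 ((deflation_iff.1 hf).comp (deflation_iff.1 hg)))
    (fun X Y Z f g h => inflation_iff.2 (inflation_iff.1 h).of_comp)
    (fun X Y Z f g h => deflation_iff.2 (deflation_iff.1 h).of_comp)
    (fun X Y X' Y' P s j p hjp hf => inflation_iff.2
      (isStrictInjective_pushout s.inr_snd s.inr_fst hjp (inflation_iff.1 hf)))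
    (fun Y Z Z' Y' P s i d hid hg => deflation_iff.2
      (isStrictSurjective_pullback s.inr_snd s.inl_snd hid (deflation_iff.1 hg)))
  obtain ⟨hf, he, hg⟩ := strictExact_iff.1 h
  have := mono_of_injective hf.1
  have := epi_of_surjective hg.1
  exact kernel_cokernel_of f g (Hom.ext (LinearMap.ext he.apply_apply_eq_zero))
    (fun t ht => hf.exists_lift t fun w => (he _).1 (LinearMap.congr_fun (congrArg Hom.toLin ht) w))
    (fun t ht => hg.exists_desc t fun y hy => by
      obtain ⟨x, rfl⟩ := (he y).1 hy
      exact LinearMap.congr_fun (congrArg Hom.toLin ht) x)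

end Flat

end HPk

end HodgePinkExact

end HodgePink
end

noncomputable section
namespace HodgePink
set_option linter.unusedSectionVars false
set_option linter.unusedVariables false

/-! ### The exact category of Hodge–Pink structures with an infinite Frobenius -/

section HodgePinkFrobExact

variable {R O Q : Type u} [CommRing R] [CommRing O] [CommRing Q] [Algebra R Q] [Algebra O Q]
  [SMulCommClass R O Q] {G : Type u} [Group G] [TopologicalSpace G] [MulSemiringAction G Q]
  [SMulCommClass G R Q]

lemma baseChange_map_smul {M N : Type u} [AddCommGroup M] [Module R M] [AddCommGroup N] [Module R N]
    (f : M →ₗ[R] N) (a : Module.End R M) (b : Module.End R N) (h : f ∘ₗ a = b ∘ₗ f) (σ : G)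
    (x : Q ⊗[R] M) :
    f.baseChange Q (TensorProduct.map (DistribSMul.toLinearMap R Q σ) a x) =
      TensorProduct.map (DistribSMul.toLinearMap R Q σ) b (f.baseChange Q x) := by
  induction x using TensorProduct.induction_on with
  | zero => simp only [map_zero]
  | tmul q m =>
    rw [TensorProduct.map_tmul, LinearMap.baseChange_tmul, LinearMap.baseChange_tmul,
      TensorProduct.map_tmul, ← LinearMap.comp_apply, h, LinearMap.comp_apply]
  | add x y hx hy => simp only [map_add, hx, hy]

namespace HPkFrob

section Constructions

variable (H H' : HPkFrob R O Q G)

/-- The direct sum of two Hodge–Pink structures with an infinite Frobenius. -/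
def prod : HPkFrob R O Q G where
  toHPk := HPk.prod H.toHPk H'.toHPk
  frob :=
    { toFun := fun σ => (H.frob σ).prodMap (H'.frob σ)
      map_one' := by rw [map_one, map_one]; rfl
      map_mul' := fun σ σ' => by rw [map_mul, map_mul]; rfl }
  continuous_frob h := (H.continuous_frob h.1).prodMk (H'.continuous_frob h.2)
  frob_mem σ x hx := by
    obtain ⟨y, hy, z, hz, rfl⟩ := HPk.exists_of_mem_prod _ _ hx
    have h1 := baseChange_map_smul (Q := Q) (LinearMap.inl R H.carrier H'.carrier) (H.frob σ)
      ((H.frob σ).prodMap (H'.frob σ)) (by ext <;> simp) σ y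
    have h2 := baseChange_map_smul (Q := Q) (LinearMap.inr R H.carrier H'.carrier) (H'.frob σ)
      ((H.frob σ).prodMap (H'.frob σ)) (by ext <;> simp) σ z
    have h3 := HPk.inl_add_inr_mem _ _ (H.frob_mem σ y hy) (H'.frob_mem σ z hz)
    rw [h1, h2, ← map_add] at h3
    exact h3

/-- The inclusions and projections of the direct sum. -/
def directSum : DirectSum H H' (prod H H') where
  inl := ⟨(HPk.directSum H.toHPk H'.toHPk).inl, fun σ => by
    change LinearMap.inl R H.carrier H'.carrier ∘ₗ H.frob σ =
      (H.frob σ).prodMap (H'.frob σ) ∘ₗ LinearMap.inl R H.carrier H'.carrier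
    ext <;> simp⟩
  inr := ⟨(HPk.directSum H.toHPk H'.toHPk).inr, fun σ => by
    change LinearMap.inr R H.carrier H'.carrier ∘ₗ H'.frob σ =
      (H.frob σ).prodMap (H'.frob σ) ∘ₗ LinearMap.inr R H.carrier H'.carrier
    ext <;> simp⟩
  fst := ⟨(HPk.directSum H.toHPk H'.toHPk).fst, fun σ => rfl⟩
  snd := ⟨(HPk.directSum H.toHPk H'.toHPk).snd, fun σ => rfl⟩
  inl_fst := rfl
  inr_snd := rfl
  inl_snd := rfl
  inr_fst := rfl
  total := Hom.ext (HPk.directSum H.toHPk H'.toHPk).total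

/-- The quotient by an invariant submodule. -/
def quotient (N : Submodule R H.carrier) (hN : ∀ σ, N ≤ N.comap (H.frob σ)) : HPkFrob R O Q G where
  toHPk := H.toHPk.quotient N
  frob :=
    { toFun := fun σ => N.mapQ N (H.frob σ) (hN σ)
      map_one' := Submodule.linearMap_qext _ (by
        ext x
        change N.mkQ (H.frob 1 x) = N.mkQ x
        rw [map_one]
        rfl)
      map_mul' := fun σ σ' => Submodule.linearMap_qext _ (by
        ext x
        change N.mkQ (H.frob (σ * σ') x) = N.mkQ (H.frob σ (H.frob σ' x))
        rw [map_mul]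
        rfl) }
  continuous_frob h := by
    obtain ⟨h, rfl⟩ := N.mkQ_surjective h
    exact (H.continuous_frob h).comp N.mkQ
  frob_mem σ x hx := by
    obtain ⟨y, hy, rfl⟩ := hx
    exact ⟨_, H.frob_mem σ y hy, baseChange_map_smul (Q := Q) N.mkQ (H.frob σ)
      (N.mapQ N (H.frob σ) (hN σ)) rfl σ y⟩

variable [Module.Flat R Q] [IsNoetherianRing R] [IsNoetherianRing O] [IsFractionRing O Q]

/-- An invariant submodule, with the induced lattice. -/
def sub (N : Submodule R H.carrier) (hN : ∀ σ, N ≤ N.comap (H.frob σ)) : HPkFrob R O Q G where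
  toHPk := H.toHPk.sub N
  frob :=
    { toFun := fun σ => (H.frob σ).restrict (hN σ)
      map_one' := LinearMap.ext fun x => Subtype.ext (by
        change H.frob 1 x = x
        rw [map_one]
        rfl)
      map_mul' := fun σ σ' => LinearMap.ext fun x => Subtype.ext (by
        change H.frob (σ * σ') x = H.frob σ (H.frob σ' x)
        rw [map_mul]
        rfl) }
  continuous_frob h := by
    exact IsLocallyConstant.desc _ Subtype.val (H.continuous_frob (N.subtype h))
      Subtype.val_injective
  frob_mem σ x hx := by
    have h := baseChange_map_smul (Q := Q) N.subtype ((H.frob σ).restrict (hN σ)) (H.frob σ) rfl σ x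
    have h' : N.subtype.baseChange Q (TensorProduct.map (DistribSMul.toLinearMap R Q σ)
        ((H.frob σ).restrict (hN σ)) x) ∈ H.lattice := by
      rw [h]
      exact H.frob_mem σ _ hx
    exact h'

end Constructions

variable {X Y Z W X' Y' Z' : HPkFrob R O Q G}

lemma comm_apply (f : X ⟶ Y) (σ : G) (x : X.carrier) :
    f.toHom.toLin (X.frob σ x) = Y.frob σ (f.toHom.toLin x) := LinearMap.congr_fun (f.comm σ) x

lemma mono_of_injective {f : X ⟶ Y} (hf : Function.Injective f.toHom.toLin) : Mono f :=
  ⟨fun a b h => Hom.ext ((HPk.mono_of_injective hf).right_cancellation a.toHom b.toHom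
    (congrArg Hom.toHom h))⟩

lemma epi_of_surjective {f : X ⟶ Y} (hf : Function.Surjective f.toHom.toLin) : Epi f :=
  ⟨fun a b h => Hom.ext ((HPk.epi_of_surjective hf).left_cancellation a.toHom b.toHom
    (congrArg Hom.toHom h))⟩

lemma exists_lift {f : X ⟶ Y} (hf : HPk.IsStrictInjective f.toHom) (t : W ⟶ Y)
    (ht : ∀ w, t.toHom.toLin w ∈ LinearMap.range f.toHom.toLin) : ∃ l : W ⟶ X, l ≫ f = t := by
  obtain ⟨l, hl⟩ := hf.exists_lift t.toHom ht
  have h (w) : f.toHom.toLin (l.toLin w) = t.toHom.toLin w :=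
    LinearMap.congr_fun (congrArg HPk.Hom.toLin hl) w
  refine ⟨⟨l, fun σ => LinearMap.ext fun w => hf.1 ?_⟩, Hom.ext hl⟩
  rw [LinearMap.comp_apply, h, LinearMap.comp_apply, comm_apply, comm_apply, h]

lemma exists_desc {g : Y ⟶ Z} (hg : HPk.IsStrictSurjective g.toHom) (t : Y ⟶ W)
    (ht : LinearMap.ker g.toHom.toLin ≤ LinearMap.ker t.toHom.toLin) :
    ∃ l : Z ⟶ W, g ≫ l = t := by
  obtain ⟨l, hl⟩ := hg.exists_desc t.toHom ht
  have h (y) : l.toLin (g.toHom.toLin y) = t.toHom.toLin y :=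
    LinearMap.congr_fun (congrArg HPk.Hom.toLin hl) y
  refine ⟨⟨l, fun σ => LinearMap.ext fun z => ?_⟩, Hom.ext hl⟩
  obtain ⟨y, rfl⟩ := hg.1 z
  rw [LinearMap.comp_apply, LinearMap.comp_apply, ← comm_apply, h, h, comm_apply]

/-- The functor that forgets the infinite Frobenius, on isomorphisms. -/
def isoToHPk (e : X ≅ Y) : X.toHPk ≅ Y.toHPk where
  hom := e.hom.toHom
  inv := e.inv.toHom
  hom_inv_id := congrArg Hom.toHom e.hom_inv_id
  inv_hom_id := congrArg Hom.toHom e.inv_hom_id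

section Flat

variable [Module.Flat R Q]

lemma inflation_iff {f : X ⟶ Y} :
    (strictExact R O Q G).Inflation f ↔ HPk.IsStrictInjective f.toHom := by
  refine ⟨fun ⟨_, _, h⟩ => (HPk.strictExact_iff.1 h).1, fun h => ?_⟩
  let N : Submodule R Y.carrier := LinearMap.range f.toHom.toLin
  have hN (σ) : N ≤ N.comap (Y.frob σ) := by
    rintro _ ⟨x, rfl⟩
    exact ⟨X.frob σ x, comm_apply f σ x⟩
  exact ⟨Y.quotient N hN, ⟨Y.toHPk.quotientMk N, fun σ => rfl⟩, HPk.strictExact_quotientMk h⟩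

variable [IsNoetherianRing R] [IsNoetherianRing O] [IsFractionRing O Q]

lemma deflation_iff {g : Y ⟶ Z} :
    (strictExact R O Q G).Deflation g ↔ HPk.IsStrictSurjective g.toHom := by
  refine ⟨fun ⟨_, _, h⟩ => (HPk.strictExact_iff.1 h).2.2, fun h => ?_⟩
  let N : Submodule R Y.carrier := LinearMap.ker g.toHom.toLin
  have hN (σ) : N ≤ N.comap (Y.frob σ) := fun y hy => by
    change g.toHom.toLin (Y.frob σ y) = 0
    rw [comm_apply, LinearMap.mem_ker.1 hy, map_zero]
  exact ⟨Y.sub N hN, ⟨Y.toHPk.subtype N, fun σ => rfl⟩, HPk.strictExact_subtype h⟩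

variable (R O Q G) in
lemma exists_id_eq_zero : ∃ Z : HPkFrob R O Q G, 𝟙 Z = 0 := by
  obtain ⟨Z, hZ⟩ := HPk.exists_id_eq_zero R O Q
  have h (z : Z.carrier) : z = 0 := LinearMap.congr_fun (congrArg HPk.Hom.toLin hZ) z
  exact ⟨{ Z with
    frob := 1
    continuous_frob := fun h => IsLocallyConstant.const _
    frob_mem := fun σ x _ => by
      have h0 : x = 0 := by
        rw [← HPk.id_baseChange_apply (X := Z) x, hZ]
        exact LinearMap.congr_fun LinearMap.baseChange_zero x
      rw [h0, map_zero]
      exact zero_mem _ }, Hom.ext hZ⟩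

variable (R O Q G) in
theorem isExactCategory : IsExactCategory (strictExact R O Q G) := by
  refine isExactCategory_of _ (exists_id_eq_zero R O Q G) (fun X Y => ⟨_, ⟨directSum X Y⟩⟩)
    (fun X Y Z X' Y' Z' f g f' g' a b c h1 h2 => HPk.strictExact_of_iso (isoToHPk a) (isoToHPk b)
      (isoToHPk c) (congrArg Hom.toHom h1) (congrArg Hom.toHom h2)) (fun X Y Z f g h => ?_)
    (fun X => inflation_iff.2 (HPk.isStrictInjective_id _))
    (fun X => deflation_iff.2 (HPk.isStrictSurjective_id _))
    (fun X Y Z f g hf hg => inflation_iff.2 ((inflation_iff.1 hf).comp (inflation_iff.1 hg)))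
    (fun X Y Z f g hf hg => deflation_iff.2 ((deflation_iff.1 hf).comp (deflation_iff.1 hg)))
    (fun X Y Z f g h => inflation_iff.2 (HPk.IsStrictInjective.of_comp (inflation_iff.1 h)))
    (fun X Y Z f g h => deflation_iff.2 (HPk.IsStrictSurjective.of_comp (deflation_iff.1 h)))
    (fun X Y X' Y' P s j p hjp hf => inflation_iff.2
      (HPk.isStrictInjective_pushout (congrArg Hom.toHom s.inr_snd) (congrArg Hom.toHom s.inr_fst)
        hjp (inflation_iff.1 hf)))
    (fun Y Z Z' Y' P s i d hid hg => deflation_iff.2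
      (HPk.isStrictSurjective_pullback (congrArg Hom.toHom s.inr_snd) (congrArg Hom.toHom s.inl_snd)
        hid (deflation_iff.1 hg)))
  obtain ⟨hf, he, hg⟩ := HPk.strictExact_iff.1 h
  have := mono_of_injective hf.1
  have := epi_of_surjective hg.1
  exact kernel_cokernel_of f g (Hom.ext (HPk.Hom.ext (LinearMap.ext he.apply_apply_eq_zero)))
    (fun t ht => exists_lift hf t fun w =>
      (he _).1 (LinearMap.congr_fun (congrArg (fun f => f.toHom.toLin) ht) w))
    (fun t ht => exists_desc hg t fun y hy => by
      obtain ⟨x, rfl⟩ := (he y).1 hy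
      exact LinearMap.congr_fun (congrArg (fun f => f.toHom.toLin) ht) x)

end Flat

end HPkFrob

end HodgePinkFrobExact

end HodgePink
end

noncomputable section
namespace HodgePink
set_option linter.unusedSectionVars false
set_option linter.unusedVariables false

/-- The elements of an extension of a finite field that are fixed by the Frobenius. -/
lemma mem_range_of_pow_card_eq {F E : Type*} [Field F] [Fintype F] [Field E] [Algebra F E] {x : E}
    (h : x ^ Fintype.card F = x) : ∃ c, algebraMap F E c = x := by
  classical
  have h1 := FiniteField.X_pow_card_sub_X_natDegree_eq E (Fintype.one_lt_card (α := F))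
  have h0 := FiniteField.X_pow_card_sub_X_ne_zero E (Fintype.one_lt_card (α := F))
  set P : Polynomial E := Polynomial.X ^ Fintype.card F - Polynomial.X
  have h2 : Finset.univ.image (algebraMap F E) = P.roots.toFinset := by
    refine Finset.eq_of_subset_of_card_le (fun y hy => ?_) ?_
    · obtain ⟨c, -, rfl⟩ := Finset.mem_image.1 hy
      rw [Multiset.mem_toFinset, Polynomial.mem_roots h0]
      simp [P, Polynomial.IsRoot, ← map_pow, FiniteField.pow_card]
    · rw [Finset.card_image_of_injective _ (algebraMap F E).injective, Finset.card_univ, ← h1]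
      exact (Multiset.toFinset_card_le _).trans (Polynomial.card_roots' P)
  have h3 : x ∈ P.roots.toFinset := by
    rw [Multiset.mem_toFinset, Polynomial.mem_roots h0]
    simp [P, Polynomial.IsRoot, h]
  rw [← h2] at h3
  obtain ⟨c, -, hc⟩ := Finset.mem_image.1 h3
  exact ⟨c, hc⟩

section FiveLemma

variable {X Y Z X' Y' Z' : Type*} [AddCommGroup X] [AddCommGroup Y] [AddCommGroup Z]
  [AddCommGroup X'] [AddCommGroup Y'] [AddCommGroup Z'] {f : X →+ Y} {g : Y →+ Z}
  {f' : X' →+ Y'} {g' : Y' →+ Z'} {a : X →+ X'} {b : Y →+ Y'} {c : Z →+ Z'}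

lemma bijective_right (hg : Function.Surjective g) (hfg : Function.Exact f g)
    (hg' : Function.Surjective g') (hfg' : Function.Exact f' g')
    (h1 : ∀ x, b (f x) = f' (a x)) (h2 : ∀ y, c (g y) = g' (b y))
    (ha : Function.Surjective a) (hb : Function.Bijective b) : Function.Bijective c := by
  refine ⟨(injective_iff_map_eq_zero c).2 fun z hz => ?_, fun z' => ?_⟩
  · obtain ⟨y, rfl⟩ := hg z
    rw [h2] at hz
    obtain ⟨x', hx'⟩ := (hfg' _).1 hz
    obtain ⟨x, rfl⟩ := ha x'
    rw [← h1] at hx'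
    rw [← hb.1 hx']
    exact hfg.apply_apply_eq_zero x
  · obtain ⟨y', rfl⟩ := hg' z'
    obtain ⟨y, rfl⟩ := hb.2 y'
    exact ⟨g y, h2 y⟩

variable {S T : Type*} [CommRing S] [CommRing T] [Algebra S T] [Module S X] [Module S Y] [Module S Z]
  [Module T X'] [Module T Y'] [Module T Z'] {f : X →ₗ[S] Y} {g : Y →ₗ[S] Z} {f' : X' →ₗ[T] Y'}
  {g' : Y' →ₗ[T] Z'} {a : T ⊗[S] X →ₗ[T] X'} {b : T ⊗[S] Y →ₗ[T] Y'} {c : T ⊗[S] Z →ₗ[T] Z'}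

lemma bijective_right_of_tensor (hfg : Function.Exact f g) (hg : Function.Surjective g)
    (hg' : Function.Surjective g') (hfg' : Function.Exact f' g')
    (h1 : ∀ x, b (f.lTensor T x) = f' (a x)) (h2 : ∀ y, c (g.lTensor T y) = g' (b y))
    (ha : Function.Surjective a) (hb : Function.Bijective b) : Function.Bijective c :=
  bijective_right (f := (f.lTensor T).toAddMonoidHom) (g := (g.lTensor T).toAddMonoidHom)
    (f' := f'.toAddMonoidHom) (g' := g'.toAddMonoidHom) (a := a.toAddMonoidHom)
    (b := b.toAddMonoidHom) (c := c.toAddMonoidHom) (LinearMap.lTensor_surjective T hg)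
    (lTensor_exact T hfg hg) hg' hfg' h1 h2 ha hb

end FiveLemma

namespace Place

variable {F K : Type u} [Field F] [Fintype F] [Field K] [Algebra F K] {v : Place F K}

lemma exists_eq_toTate_of_tauTate_eq (x : v.Coordinates) {t : v.Tate v.Cinf 0}
    (h : tauTate v.Cinf 0 t = t) : ∃ a : v.A, v.toTate v.Cinf 0 (v.tens a 1) = t := by
  have h1 (j) : x.coordT v.Cinf 0 j t ^ Fintype.card F = x.coordT v.Cinf 0 j t := by
    have h2 : x.coordT v.Cinf 0 j (tauTate v.Cinf 0 t) = x.coordT v.Cinf 0 j t ^ Fintype.card F :=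
      (x.coordT_tateMap _ (norm_frobenius_le v.Cinf) (le_refl 0) t j).trans
        (congrFun (FiniteField.coe_frobeniusAlgHom F v.Cinf) _)
    rw [← h2, h]
  choose c hc using fun j => mem_range_of_pow_card_eq (h1 j)
  obtain ⟨f, hf⟩ := (denseRange_toTate (v := v) (L := v.Cinf) 0).exists_dist_lt t one_pos
  rw [dist_eq_norm] at hf
  have h3 (j) (hj : x.coord v.Cinf f j = 0) : c j = 0 := by
    by_contra hne
    have h4 := x.norm_coordT_le 0 j (t - v.toTate v.Cinf 0 f)
    rw [pow_zero, mul_one, map_sub, x.coordT_toTate, hj, sub_zero, ← hc j,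
      IsScalarTower.algebraMap_apply F K v.Cinf, norm_algebraMap_Cinf, v.trivial_on_base _ hne] at h4
    linarith
  have hfin : (Function.support c).Finite := (x.coord v.Cinf f).hasFiniteSupport.subset fun j hj h0 =>
    hj (h3 j h0)
  refine ⟨x.basis.repr.symm (Finsupp.ofSupportFinite c hfin), x.coordT_ext fun j => ?_⟩
  rw [x.coordT_toTate, Coordinates.coord_tens, LinearEquiv.apply_symm_apply, ← hc j,
    Algebra.smul_def, mul_one]
  rfl

/-- The invariants of `τ` on `ℂ_∞⟨A⟩` are the elements of `A`. -/
lemma exists_algebraMap_eq_of_tauT_eq (hK : IsFunctionField F K) {t : v.T} (h : v.tauT t = t) :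
    ∃ a : v.A, algebraMap v.A v.T a = t := by
  obtain ⟨p, hp, _, _, _, _, x, -, -⟩ := hK.exists_coordinates_pBasis v
  obtain ⟨a, ha⟩ := exists_eq_toTate_of_tauTate_eq x (t := t) h
  refine ⟨a, Eq.trans ?_ ha⟩
  change v.toTate v.Cinf 0 (v.coeffMap (IsScalarTower.toAlgHom F K v.Cinf) (v.tens a 1)) = _
  rw [coeffMap_tens, map_one]

namespace AMotive

variable {X Y Z : v.AMotive} {f : X ⟶ Y} {g : Y ⟶ Z} (hK : IsFunctionField F K)
include hK

/-- If a finitely generated module of `τ`-invariants spans `ℂ_∞⟨A⟩ ⊗ M` freely, then it consists of all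
invariants. -/
lemma mem_of_bijective_liftBaseChange {M : v.AMotive} (Q : Submodule v.A (v.T ⊗[v.B] M.carrier))
    (hQ : Q ≤ M.betti) [Module.Finite v.A Q] [Module.Projective v.A Q]
    (h : Function.Bijective (Q.subtype.liftBaseChange v.T)) : M.betti ≤ Q := by
  obtain ⟨D⟩ := nonempty_period (v := v) hK
  obtain ⟨e⟩ := nonempty_dualBasis (S := v.A) (N := Q)
  let E := LinearEquiv.ofBijective _ h
  have key (l : Q →ₗ[v.A] v.A) (y : v.T ⊗[v.A] Q) :
      formQ v.T l (E.symm (D.sigma M (E y))) = v.tauT (formQ v.T l y) := by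
    induction y using TensorProduct.induction_on with
    | zero => simp
    | tmul t y =>
      have h1 (t : v.T) (y : Q) : E (t ⊗ₜ y) = t • (y : v.T ⊗[v.B] M.carrier) := by simp [E]
      rw [h1, D.sigma_smul, D.sigma_of_mem (hQ y.2), ← h1, LinearEquiv.symm_apply_apply,
        formQ_tmul, formQ_tmul, map_mul, tauT_algebraMap_A]
    | add y z hy hz => simp only [map_add, hy, hz]
  intro ω hω
  have h2 (i) : ∃ a : v.A, algebraMap v.A v.T a = formQ v.T (e.form i) (E.symm ω) := by
    refine exists_algebraMap_eq_of_tauT_eq hK ?_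
    rw [← key, LinearEquiv.apply_symm_apply, D.sigma_of_mem hω]
  choose a ha using h2
  have h3 : ω = ∑ i, a i • (e.vec i : v.T ⊗[v.B] M.carrier) := by
    rw [← E.apply_symm_apply ω, ← e.sum_formQ v.T (E.symm ω), map_sum]
    refine Finset.sum_congr rfl fun i _ => ?_
    rw [← ha i, ← algebraMap_smul v.T (a i)]
    simp [E]
  rw [h3]
  exact sum_mem fun i _ => Q.smul_mem _ (e.vec i).2

lemma bettiMap_surjective_of_exact (hf : Function.Injective f.toLin)
    (hfg : Function.Exact f.toLin g.toLin) (hg : Function.Surjective g.toLin)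
    (hX : X.IsRigidAnalyticallyTrivial) (hY : Y.IsRigidAnalyticallyTrivial) :
    Function.Surjective (bettiMap g) := by
  let q : Y.betti →ₗ[v.A] v.T ⊗[v.B] Z.carrier := Z.betti.subtype ∘ₗ bettiMap g
  let Q : Submodule v.A (v.T ⊗[v.B] Z.carrier) := LinearMap.range q
  have hQ : Q ≤ Z.betti := by
    rintro _ ⟨y, rfl⟩
    exact (bettiMap g y).2
  obtain ⟨p, hp, _, _, _, _, x, -, -⟩ := hK.exists_coordinates_pBasis v
  have := finite_betti hK hY
  have : Module.Finite v.A Q := Module.Finite.range q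
  have htf := isTorsionFree_betti (M := Z) hK
  have : Module.IsTorsionFree v.A Q :=
    (Submodule.inclusion_injective hQ).moduleIsTorsionFree _ fun _ _ => rfl
  have : Module.Projective v.A Q := projective_of_isDedekindDomain v.A Q
  have hex : Function.Exact (bettiMap f) q.rangeRestrict := fun y => by
    rw [← bettiMap_exact hf hfg hg y]
    constructor
    · intro h
      have h' : q y = 0 := congrArg Subtype.val h
      exact Subtype.ext h'
    · intro h
      have h' : q y = 0 := congrArg Subtype.val h
      exact Subtype.ext h'
  have h := mem_of_bijective_liftBaseChange hK Q hQ (by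
    refine bijective_right_of_tensor (S := v.A) (T := v.T) (X := X.betti) (Y := Y.betti) (Z := Q)
      (f := bettiMap f) (g := q.rangeRestrict) (f' := f.toLin.baseChange v.T)
      (g' := g.toLin.baseChange v.T) (a := X.bettiMul) (b := Y.bettiMul)
      (c := Q.subtype.liftBaseChange v.T) hex
      q.surjective_rangeRestrict (LinearMap.lTensor_surjective v.T hg) (lTensor_exact v.T hfg hg)
      ?_ (fun y => ?_) ?_ ?_
    · exact bettiMul_bettiMap f
    rotate_left
    · exact hX.2
    · exact hY
    refine Eq.trans ?_ (bettiMul_bettiMap g y)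
    induction y using TensorProduct.induction_on with
    | zero => simp
    | tmul t ω =>
      rw [LinearMap.lTensor_tmul, LinearMap.lTensor_tmul, bettiMul_tmul,
        LinearMap.liftBaseChange_tmul]
      rfl
    | add y z hy hz => simp only [map_add, hy, hz])
  intro ω
  obtain ⟨y, hy⟩ := h ω.2
  exact ⟨y, Subtype.ext hy⟩

/-- Cokernels of monomorphisms of rigid analytically trivial motives are rigid analytically trivial. -/
lemma isRigidAnalyticallyTrivial_right (hf : Function.Injective f.toLin)
    (hfg : Function.Exact f.toLin g.toLin) (hg : Function.Surjective g.toLin)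
    (hX : X.IsRigidAnalyticallyTrivial) (hY : Y.IsRigidAnalyticallyTrivial) :
    Z.IsRigidAnalyticallyTrivial := by
  refine bijective_right_of_tensor (S := v.A) (T := v.T) (X := X.betti) (Y := Y.betti) (Z := Z.betti)
    (f := bettiMap f) (g := bettiMap g) (f' := f.toLin.baseChange v.T)
    (g' := g.toLin.baseChange v.T) (a := X.bettiMul) (b := Y.bettiMul) (c := Z.bettiMul)
    (bettiMap_exact hf hfg hg) (bettiMap_surjective_of_exact hK hf hfg hg hX hY)
    (LinearMap.lTensor_surjective v.T hg) (lTensor_exact v.T hfg hg) ?_ ?_ ?_ ?_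
  · exact bettiMul_bettiMap f
  · exact fun y => bettiMul_bettiMap g y
  · exact hX.2
  · exact hY

end AMotive
end Place
end HodgePink
end

noncomputable section
namespace HodgePink
set_option linter.unusedSectionVars false
set_option linter.unusedVariables false

lemma lTensor_comp_apply_of_eq {S : Type*} [CommRing S] (P : Type*) [AddCommGroup P] [Module S P]
    {X Y Z : Type*} [AddCommGroup X] [AddCommGroup Y] [AddCommGroup Z] [Module S X] [Module S Y]
    [Module S Z] {f : X →ₗ[S] Y} {g : Y →ₗ[S] Z} {h : X →ₗ[S] Z} (e : g ∘ₗ f = h) (x : P ⊗[S] X) :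
    g.lTensor P (f.lTensor P x) = h.lTensor P x := by
  rw [← LinearMap.comp_apply, ← LinearMap.lTensor_comp, e]

namespace Place

variable {F K : Type u} [Field F] [Fintype F] [Field K] [Algebra F K] {v : Place F K}

namespace AMotive

/-- The isomorphism `τ_N` given by mutually inverse maps. -/
def ofInverse (N : Type u) [AddCommGroup N] [Module v.B N] [Module.Finite v.B N]
    [Module.Projective v.B N] (a : v.JTau ⊗[v.B] N →ₗ[v.JInv] v.JInv ⊗[v.B] N)
    (b : v.JInv ⊗[v.B] N →ₗ[v.JInv] v.JTau ⊗[v.B] N) (hab : ∀ x, a (b x) = x)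
    (hba : ∀ x, b (a x) = x) : v.AMotive where
  carrier := N
  tauM := LinearEquiv.ofLinearMap a b (LinearMap.ext hab) (LinearMap.ext hba)

variable {X Y Z : v.AMotive}

lemma comm_symm (f : X ⟶ Y) (x : v.JInv ⊗[v.B] X.carrier) :
    f.toLin.lTensor v.JTau (X.tauM.symm x) = Y.tauM.symm (f.toLin.lTensor v.JInv x) := by
  rw [LinearEquiv.eq_symm_apply, ← f.comm, LinearEquiv.apply_symm_apply]

section Retract

variable (Y) {N : Type u} [AddCommGroup N] [Module v.B N] (i : N →ₗ[v.B] Y.carrier)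
  (p : Y.carrier →ₗ[v.B] N)

/-- The map `JTau ⊗ i`, linear over `JInv`. -/
def lTensorJTau {N' : Type u} [AddCommGroup N'] [Module v.B N'] (i : N →ₗ[v.B] N') :
    v.JTau ⊗[v.B] N →ₗ[v.JInv] v.JTau ⊗[v.B] N' :=
  { i.lTensor v.JTau with
    map_smul' := fun c x => by
      change i.lTensor v.JTau (c • x) = c • i.lTensor v.JTau x
      induction x using TensorProduct.induction_on with
      | zero => simp
      | tmul t m => rfl
      | add y z hy hz => simp only [smul_add, map_add, hy, hz] }

/-- The map induced by `τ_Y` on a retract. -/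
def retractTau : v.JTau ⊗[v.B] N →ₗ[v.JInv] v.JInv ⊗[v.B] N :=
  p.baseChange v.JInv ∘ₗ Y.tauM.toLinearMap ∘ₗ
    lTensorJTau i

/-- The map induced by the inverse of `τ_Y` on a retract. -/
def retractTauInv : v.JInv ⊗[v.B] N →ₗ[v.JInv] v.JTau ⊗[v.B] N :=
  lTensorJTau p ∘ₗ Y.tauM.symm.toLinearMap ∘ₗ
    i.baseChange v.JInv

lemma retractTau_apply (x : v.JTau ⊗[v.B] N) :
    Y.retractTau i p x = p.lTensor v.JInv (Y.tauM (i.lTensor v.JTau x)) := rfl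

lemma retractTauInv_apply (x : v.JInv ⊗[v.B] N) :
    Y.retractTauInv i p x = p.lTensor v.JTau (Y.tauM.symm (i.lTensor v.JInv x)) := rfl

end Retract

lemma exists_cokernel (f : X ⟶ Y) {r : Y.carrier →ₗ[v.B] X.carrier}
    (hr : r ∘ₗ f.toLin = LinearMap.id) :
    ∃ (Z : v.AMotive) (g : Y ⟶ Z), Function.Exact f.toLin g.toLin ∧ Function.Surjective g.toLin := by
  let R : Submodule v.B Y.carrier := LinearMap.range f.toLin
  let s : Y.carrier ⧸ R →ₗ[v.B] Y.carrier := R.liftQ (LinearMap.id - f.toLin ∘ₗ r) (by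
    rintro _ ⟨x, rfl⟩
    have : r (f.toLin x) = x := LinearMap.congr_fun hr x
    simp [this])
  have hsg : s ∘ₗ R.mkQ = LinearMap.id - f.toLin ∘ₗ r := rfl
  have hgf : R.mkQ ∘ₗ f.toLin = 0 := LinearMap.range_le_ker_iff.1 (by rw [Submodule.ker_mkQ])
  have hgs : R.mkQ ∘ₗ s = LinearMap.id := by
    refine Submodule.linearMap_qext _ ?_
    rw [LinearMap.comp_assoc, hsg, LinearMap.comp_sub, ← LinearMap.comp_assoc, hgf]
    simp
  have : Module.Projective v.B (Y.carrier ⧸ R) := Module.Projective.of_split s R.mkQ hgs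
  have hgs' (P : Type u) [AddCommGroup P] [Module v.B P] (x : P ⊗[v.B] (Y.carrier ⧸ R)) :
      R.mkQ.lTensor P (s.lTensor P x) = x := by
    rw [lTensor_comp_apply_of_eq P hgs, LinearMap.lTensor_id, LinearMap.id_apply]
  have hsg' (P : Type u) [AddCommGroup P] [Module v.B P] (x : P ⊗[v.B] Y.carrier) :
      s.lTensor P (R.mkQ.lTensor P x) = x - f.toLin.lTensor P (r.lTensor P x) := by
    rw [lTensor_comp_apply_of_eq P hsg, LinearMap.lTensor_sub, LinearMap.lTensor_id,
      LinearMap.lTensor_comp]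
    rfl
  have hgf' (P : Type u) [AddCommGroup P] [Module v.B P] (x : P ⊗[v.B] X.carrier) :
      R.mkQ.lTensor P (f.toLin.lTensor P x) = 0 := by
    rw [lTensor_comp_apply_of_eq P hgf, LinearMap.lTensor_zero, LinearMap.zero_apply]
  have key (y : v.JTau ⊗[v.B] Y.carrier) : R.mkQ.lTensor v.JInv (Y.tauM y) =
      Y.retractTau s R.mkQ (R.mkQ.lTensor v.JTau y) := by
    rw [retractTau_apply, hsg', map_sub, map_sub, ← f.comm, hgf', sub_zero]
  refine ⟨ofInverse (Y.carrier ⧸ R) (Y.retractTau s R.mkQ) (Y.retractTauInv s R.mkQ) (fun x => ?_)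
    (fun x => ?_), ⟨R.mkQ, key⟩, ?_, R.mkQ_surjective⟩
  · rw [retractTauInv_apply, ← key, LinearEquiv.apply_symm_apply, hgs']
  · rw [retractTau_apply, retractTauInv_apply, hsg', map_sub, LinearEquiv.symm_apply_apply, map_sub,
      hgs', ← comm_symm, hgf', sub_zero]
  · intro y
    change R.mkQ y = 0 ↔ y ∈ R
    rw [Submodule.mkQ_apply, Submodule.Quotient.mk_eq_zero]

lemma exists_kernel (g : Y ⟶ Z) (hg : Function.Surjective g.toLin) :
    ∃ (X : v.AMotive) (f : X ⟶ Y), Function.Injective f.toLin ∧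
      Function.Exact f.toLin g.toLin := by
  obtain ⟨s, hs⟩ := Module.projective_lifting_property g.toLin LinearMap.id hg
  let N : Submodule v.B Y.carrier := LinearMap.ker g.toLin
  have hs' (z) : g.toLin (s z) = z := LinearMap.congr_fun hs z
  let p : Y.carrier →ₗ[v.B] N := (LinearMap.id - s ∘ₗ g.toLin).codRestrict N fun y => by
    simp [N, hs']
  have hip : N.subtype ∘ₗ p = LinearMap.id - s ∘ₗ g.toLin := rfl
  have hgi : g.toLin ∘ₗ N.subtype = 0 := LinearMap.ext fun n => n.2
  have hpi : p ∘ₗ N.subtype = LinearMap.id := LinearMap.ext fun n => Subtype.ext (by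
    have : g.toLin n = 0 := n.2
    simp [p, this])
  have hp : Function.Surjective p := fun n => ⟨n, LinearMap.congr_fun hpi n⟩
  have : Module.Finite v.B N := Module.Finite.of_surjective p hp
  have : Module.Projective v.B N := Module.Projective.of_split N.subtype p hpi
  have hpi' (P : Type u) [AddCommGroup P] [Module v.B P] (x : P ⊗[v.B] N) :
      p.lTensor P (N.subtype.lTensor P x) = x := by
    rw [lTensor_comp_apply_of_eq P hpi, LinearMap.lTensor_id, LinearMap.id_apply]
  have hip' (P : Type u) [AddCommGroup P] [Module v.B P] (x : P ⊗[v.B] Y.carrier) :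
      N.subtype.lTensor P (p.lTensor P x) = x - s.lTensor P (g.toLin.lTensor P x) := by
    rw [lTensor_comp_apply_of_eq P hip, LinearMap.lTensor_sub, LinearMap.lTensor_id,
      LinearMap.lTensor_comp]
    rfl
  have hgi' (P : Type u) [AddCommGroup P] [Module v.B P] (x : P ⊗[v.B] N) :
      g.toLin.lTensor P (N.subtype.lTensor P x) = 0 := by
    rw [lTensor_comp_apply_of_eq P hgi, LinearMap.lTensor_zero, LinearMap.zero_apply]
  have key (x : v.JTau ⊗[v.B] N) : N.subtype.lTensor v.JInv (Y.retractTau N.subtype p x) =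
      Y.tauM (N.subtype.lTensor v.JTau x) := by
    rw [retractTau_apply, hip', g.comm, hgi', map_zero, map_zero, sub_zero]
  refine ⟨ofInverse N (Y.retractTau N.subtype p) (Y.retractTauInv N.subtype p) (fun x => ?_)
    (fun x => ?_), ⟨N.subtype, key⟩, N.subtype_injective, ?_⟩
  · rw [retractTau_apply, retractTauInv_apply, hip', map_sub, LinearEquiv.apply_symm_apply, map_sub,
      hpi', comm_symm, hgi', map_zero, map_zero, map_zero, map_zero, sub_zero]
  · rw [retractTauInv_apply, key, LinearEquiv.symm_apply_apply, hpi']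
  · intro y
    exact ⟨fun h => ⟨⟨y, h⟩, rfl⟩, by rintro ⟨x, rfl⟩; exact x.2⟩

lemma exists_directSum (X Y : v.AMotive) : ∃ P : v.AMotive, Nonempty (DirectSum X Y P) := by
  let iX := LinearMap.inl v.B X.carrier Y.carrier
  let iY := LinearMap.inr v.B X.carrier Y.carrier
  let pX := LinearMap.fst v.B X.carrier Y.carrier
  let pY := LinearMap.snd v.B X.carrier Y.carrier
  have h1 (P : Type u) [AddCommGroup P] [Module v.B P] (x : P ⊗[v.B] X.carrier) :
      pX.lTensor P (iX.lTensor P x) = x := by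
    rw [lTensor_comp_apply_of_eq P (h := LinearMap.id) rfl, LinearMap.lTensor_id,
      LinearMap.id_apply]
  have h2 (P : Type u) [AddCommGroup P] [Module v.B P] (x : P ⊗[v.B] Y.carrier) :
      pY.lTensor P (iY.lTensor P x) = x := by
    rw [lTensor_comp_apply_of_eq P (h := LinearMap.id) rfl, LinearMap.lTensor_id,
      LinearMap.id_apply]
  have h3 (P : Type u) [AddCommGroup P] [Module v.B P] (x : P ⊗[v.B] X.carrier) :
      pY.lTensor P (iX.lTensor P x) = 0 := by
    rw [lTensor_comp_apply_of_eq P (h := 0) rfl, LinearMap.lTensor_zero, LinearMap.zero_apply]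
  have h4 (P : Type u) [AddCommGroup P] [Module v.B P] (x : P ⊗[v.B] Y.carrier) :
      pX.lTensor P (iY.lTensor P x) = 0 := by
    rw [lTensor_comp_apply_of_eq P (h := 0) rfl, LinearMap.lTensor_zero, LinearMap.zero_apply]
  have htot : iX ∘ₗ pX + iY ∘ₗ pY = LinearMap.id := by ext <;> simp [iX, iY, pX, pY]
  have h5 (P : Type u) [AddCommGroup P] [Module v.B P] (x : P ⊗[v.B] (X.carrier × Y.carrier)) :
      iX.lTensor P (pX.lTensor P x) + iY.lTensor P (pY.lTensor P x) = x := by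
    rw [lTensor_comp_apply_of_eq P rfl, lTensor_comp_apply_of_eq P rfl, ← LinearMap.add_apply,
      ← LinearMap.lTensor_add, htot, LinearMap.lTensor_id, LinearMap.id_apply]
  let a := X.retractTau pX iX + Y.retractTau pY iY
  let b := X.retractTauInv pX iX + Y.retractTauInv pY iY
  have ha (x) : a x = iX.lTensor v.JInv (X.tauM (pX.lTensor v.JTau x)) +
    iY.lTensor v.JInv (Y.tauM (pY.lTensor v.JTau x)) := rfl
  have hb (x) : b x = iX.lTensor v.JTau (X.tauM.symm (pX.lTensor v.JInv x)) +
    iY.lTensor v.JTau (Y.tauM.symm (pY.lTensor v.JInv x)) := rfl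
  have hab (x) : a (b x) = x := by
    simp only [ha, hb, map_add, h1, h2, h3, h4, add_zero, zero_add,
      LinearEquiv.apply_symm_apply, h5]
  have hba (x) : b (a x) = x := by
    simp only [ha, hb, map_add, h1, h2, h3, h4, add_zero, zero_add,
      LinearEquiv.symm_apply_apply, h5]
  have c1 (x) : iX.lTensor v.JInv (X.tauM x) = a (iX.lTensor v.JTau x) := by
    rw [ha, h1, h3, map_zero, map_zero, add_zero]
  have c2 (x) : iY.lTensor v.JInv (Y.tauM x) = a (iY.lTensor v.JTau x) := by
    rw [ha, h2, h4, map_zero, map_zero, zero_add]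
  have c3 (x) : pX.lTensor v.JInv (a x) = X.tauM (pX.lTensor v.JTau x) := by
    rw [ha, map_add, h1, h4, add_zero]
  have c4 (x) : pY.lTensor v.JInv (a x) = Y.tauM (pY.lTensor v.JTau x) := by
    rw [ha, map_add, h2, h3, zero_add]
  let P : v.AMotive := ofInverse (X.carrier × Y.carrier) a b hab hba
  exact ⟨P, ⟨{
    inl := (⟨iX, c1⟩ : Hom X P)
    inr := (⟨iY, c2⟩ : Hom Y P)
    fst := (⟨pX, c3⟩ : Hom P X)
    snd := (⟨pY, c4⟩ : Hom P Y)
    inl_fst := rfl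
    inr_snd := rfl
    inl_snd := rfl
    inr_fst := rfl
    total := Hom.ext htot }⟩⟩

end AMotive
end Place
end HodgePink
end

noncomputable section
namespace HodgePink
set_option linter.unusedSectionVars false
set_option linter.unusedVariables false

/-! ### The exact category of rigid analytically trivial motives -/

namespace Place

variable {F K : Type u} [Field F] [Fintype F] [Field K] [Algebra F K] {v : Place F K}

namespace AMotive

variable {X Y Z W : v.AMotive}

lemma exists_lift {f : X ⟶ Y} {g : Y ⟶ Z} {r : Y.carrier →ₗ[v.B] X.carrier}
    (hr : r ∘ₗ f.toLin = LinearMap.id) (hfg : Function.Exact f.toLin g.toLin) (t : W ⟶ Y)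
    (ht : t ≫ g = 0) : ∃ l : W ⟶ X, l ≫ f = t := by
  have h : f.toLin ∘ₗ (r ∘ₗ t.toLin) = t.toLin := LinearMap.ext fun w => by
    obtain ⟨x, hx⟩ := (hfg (t.toLin w)).1 (LinearMap.congr_fun (congrArg Hom.toLin ht) w)
    have : r (f.toLin x) = x := LinearMap.congr_fun hr x
    rw [LinearMap.comp_apply, LinearMap.comp_apply, ← hx, this]
  refine ⟨⟨r ∘ₗ t.toLin, fun w => ?_⟩, Hom.ext h⟩
  refine Function.LeftInverse.injective (g := r.lTensor v.JInv) (fun x => ?_)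
    (?_ : f.toLin.lTensor v.JInv _ = f.toLin.lTensor v.JInv _)
  · rw [lTensor_comp_apply_of_eq _ hr, LinearMap.lTensor_id, LinearMap.id_apply]
  · rw [lTensor_comp_apply_of_eq _ h, f.comm, lTensor_comp_apply_of_eq _ h, t.comm]

lemma exists_desc {f : X ⟶ Y} {g : Y ⟶ Z} (hg : Function.Surjective g.toLin)
    (hfg : Function.Exact f.toLin g.toLin) (t : Y ⟶ W) (ht : f ≫ t = 0) :
    ∃ l : Z ⟶ W, g ≫ l = t := by
  obtain ⟨s, hs⟩ := Module.projective_lifting_property g.toLin LinearMap.id hg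
  have h : (t.toLin ∘ₗ s) ∘ₗ g.toLin = t.toLin := LinearMap.ext fun y => by
    have h1 : g.toLin (s (g.toLin y)) = g.toLin y := LinearMap.congr_fun hs _
    obtain ⟨x, hx⟩ := (hfg (s (g.toLin y) - y)).1 (by rw [map_sub, h1, sub_self])
    have h2 : t.toLin (f.toLin x) = 0 := LinearMap.congr_fun (congrArg Hom.toLin ht) x
    rw [hx, map_sub, sub_eq_zero] at h2
    exact h2
  refine ⟨⟨t.toLin ∘ₗ s, fun z => ?_⟩, Hom.ext h⟩
  obtain ⟨y, rfl⟩ := LinearMap.lTensor_surjective v.JTau hg z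
  rw [← g.comm, lTensor_comp_apply_of_eq _ h, lTensor_comp_apply_of_eq _ h, t.comm]

end AMotive

namespace AMotRat

variable {X Y Z X' Y' Z' P : v.AMotRat}

lemma comp_apply (f : X ⟶ Y) (g : Y ⟶ Z) (x : X.obj.carrier) :
    (f ≫ g).hom.toLin x = g.hom.toLin (f.hom.toLin x) := rfl

lemma hom_ext {f g : X ⟶ Y} (h : f.hom.toLin = g.hom.toLin) : f = g :=
  ObjectProperty.hom_ext _ (AMotive.Hom.ext h)

lemma mono_of_injective {f : X ⟶ Y} (hf : Function.Injective f.hom.toLin) : Mono f :=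
  ⟨fun a b h => hom_ext (LinearMap.ext fun x =>
    hf (LinearMap.congr_fun (congrArg (fun f => f.hom.toLin) h) x))⟩

lemma epi_of_surjective {f : X ⟶ Y} (hf : Function.Surjective f.hom.toLin) : Epi f :=
  ⟨fun a b h => hom_ext (LinearMap.ext fun y => by
    obtain ⟨x, rfl⟩ := hf y
    exact LinearMap.congr_fun (congrArg (fun f => f.hom.toLin) h) x)⟩

lemma bijective_of_iso (e : X ≅ Y) : Function.Bijective e.hom.hom.toLin :=
  Function.bijective_iff_has_inverse.2 ⟨e.inv.hom.toLin,
    fun x => LinearMap.congr_fun (congrArg (fun f => f.hom.toLin) e.hom_inv_id) x,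
    fun x => LinearMap.congr_fun (congrArg (fun f => f.hom.toLin) e.inv_hom_id) x⟩

lemma exact_of_iso {f : X ⟶ Y} {g : Y ⟶ Z} {f' : X' ⟶ Y'} {g' : Y' ⟶ Z'} (a : X ≅ X')
    (b : Y ≅ Y') (c : Z ≅ Z') (h1 : f ≫ b.hom = a.hom ≫ f') (h2 : g ≫ c.hom = b.hom ≫ g')
    (h : exact v f g) : exact v f' g' := by
  obtain ⟨hf, hfg, hg⟩ := h
  have ha := bijective_of_iso a
  have hb := bijective_of_iso b
  have hc := bijective_of_iso c
  have h1' (x) : b.hom.hom.toLin (f.hom.toLin x) = f'.hom.toLin (a.hom.hom.toLin x) :=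
    LinearMap.congr_fun (congrArg (fun f => f.hom.toLin) h1) x
  have h2' (x) : c.hom.hom.toLin (g.hom.toLin x) = g'.hom.toLin (b.hom.hom.toLin x) :=
    LinearMap.congr_fun (congrArg (fun f => f.hom.toLin) h2) x
  refine ⟨(injective_iff_map_eq_zero _).2 fun x hx => ?_, fun y => ?_, fun z => ?_⟩
  · obtain ⟨x, rfl⟩ := ha.2 x
    rw [← h1', map_eq_zero_iff _ hb.1, map_eq_zero_iff _ hf] at hx
    rw [hx, map_zero]
  · obtain ⟨y, rfl⟩ := hb.2 y
    rw [← h2', map_eq_zero_iff _ hc.1, hfg y]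
    constructor
    · rintro ⟨x, rfl⟩
      exact ⟨_, (h1' x).symm⟩
    · rintro ⟨x, hx⟩
      obtain ⟨x, rfl⟩ := ha.2 x
      exact ⟨x, hb.1 ((h1' x).trans hx)⟩
  · obtain ⟨z, rfl⟩ := hc.2 z
    obtain ⟨y, rfl⟩ := hg z
    exact ⟨_, (h2' y).symm⟩

variable (v) in
lemma exists_id_eq_zero : ∃ Z : v.AMotRat, 𝟙 Z = 0 := by
  let M : v.AMotive := AMotive.ofInverse PUnit.{u + 1} 0 0 (fun x => Subsingleton.elim _ _)
    (fun x => Subsingleton.elim _ _)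
  have h0 : Subsingleton (v.T ⊗[v.B] M.carrier) := inferInstanceAs (Subsingleton (v.T ⊗[v.B] PUnit.{u + 1}))
  have h1 : Subsingleton M.betti := inferInstance
  have h2 : Subsingleton (v.T ⊗[v.A] M.betti) := inferInstance
  have hM : M.IsRigidAnalyticallyTrivial :=
    ⟨fun _ _ _ => Subsingleton.elim _ _, fun y => ⟨0, Subsingleton.elim _ _⟩⟩
  exact ⟨⟨M, hM⟩, hom_ext rfl⟩

variable (hK : IsFunctionField F K)
include hK

lemma inflation_iff {f : X ⟶ Y} : (exact v).Inflation f ↔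
    ∃ r : Y.obj.carrier →ₗ[v.B] X.obj.carrier, r ∘ₗ f.hom.toLin = LinearMap.id := by
  constructor
  · rintro ⟨Z, g, hf, hfg, hg⟩
    obtain ⟨r, -, hr, -⟩ := exists_splitting hf hfg hg
    exact ⟨r, hr⟩
  · rintro ⟨r, hr⟩
    obtain ⟨Z, g, hfg, hg⟩ := AMotive.exists_cokernel f.hom hr
    have hf : Function.Injective f.hom.toLin :=
      Function.LeftInverse.injective (LinearMap.congr_fun hr)
    exact ⟨⟨Z, AMotive.isRigidAnalyticallyTrivial_right hK hf hfg hg X.property Y.property⟩,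
      ObjectProperty.homMk g, hf, hfg, hg⟩

lemma deflation_iff {g : Y ⟶ Z} : (exact v).Deflation g ↔ Function.Surjective g.hom.toLin := by
  refine ⟨fun ⟨_, _, h⟩ => h.2.2, fun hg => ?_⟩
  obtain ⟨X, f, hf, hfg⟩ := AMotive.exists_kernel g.hom hg
  exact ⟨⟨X, AMotive.isRigidAnalyticallyTrivial_left hK hf hfg hg Y.property Z.property⟩,
    ObjectProperty.homMk f, hf, hfg, hg⟩

lemma exists_directSum (X Y : v.AMotRat) : ∃ P : v.AMotRat, Nonempty (DirectSum X Y P) := by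
  obtain ⟨P, ⟨s⟩⟩ := AMotive.exists_directSum X.obj Y.obj
  have e1 (x) : s.fst.toLin (s.inl.toLin x) = x :=
    LinearMap.congr_fun (congrArg AMotive.Hom.toLin s.inl_fst) x
  have e2 (x) : s.snd.toLin (s.inr.toLin x) = x :=
    LinearMap.congr_fun (congrArg AMotive.Hom.toLin s.inr_snd) x
  have e3 (x) : s.snd.toLin (s.inl.toLin x) = 0 :=
    LinearMap.congr_fun (congrArg AMotive.Hom.toLin s.inl_snd) x
  have e4 (x) : s.inl.toLin (s.fst.toLin x) + s.inr.toLin (s.snd.toLin x) = x :=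
    LinearMap.congr_fun (congrArg AMotive.Hom.toLin s.total) x
  have hP : P.IsRigidAnalyticallyTrivial := by
    refine AMotive.isRigidAnalyticallyTrivial_middle (f := s.inl) (g := s.snd) hK
      (Function.LeftInverse.injective e1) (fun x => ⟨fun h => ⟨s.fst.toLin x, ?_⟩, ?_⟩)
      (Function.RightInverse.surjective e2) X.property Y.property (fun ω => ⟨AMotive.bettiMap s.inr ω, ?_⟩)
    · conv_rhs => rw [← e4 x, h, map_zero, add_zero]
    · rintro ⟨x, rfl⟩
      exact e3 x
    · rw [← LinearMap.comp_apply, ← AMotive.bettiMap_comp, s.inr_snd, AMotive.bettiMap_id,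
        LinearMap.id_apply]
  exact ⟨⟨P, hP⟩, ⟨{
    inl := ObjectProperty.homMk s.inl
    inr := ObjectProperty.homMk s.inr
    fst := ObjectProperty.homMk s.fst
    snd := ObjectProperty.homMk s.snd
    inl_fst := ObjectProperty.hom_ext _ s.inl_fst
    inr_snd := ObjectProperty.hom_ext _ s.inr_snd
    inl_snd := ObjectProperty.hom_ext _ s.inl_snd
    inr_fst := ObjectProperty.hom_ext _ s.inr_fst
    total := ObjectProperty.hom_ext _ s.total }⟩⟩

theorem isExactCategory : IsExactCategory (exact v) := by
  refine isExactCategory_of _ (exists_id_eq_zero v) (exists_directSum hK)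
    (fun X Y Z X' Y' Z' f g f' g' a b c => exact_of_iso a b c) (fun X Y Z f g h => ?_)
    (fun X => (inflation_iff hK).2 ⟨LinearMap.id, rfl⟩)
    (fun X => (deflation_iff hK).2 fun x => ⟨x, rfl⟩) (fun X Y Z f g hf hg => ?_)
    (fun X Y Z f g hf hg => (deflation_iff hK).2
      (((deflation_iff hK).1 hg).comp ((deflation_iff hK).1 hf))) (fun X Y Z f g h => ?_)
    (fun X Y Z f g h => (deflation_iff hK).2
      (Function.Surjective.of_comp (g := f.hom.toLin) ((deflation_iff hK).1 h)))
    (fun X Y X' Y' P s j p hjp hf => ?_) (fun Y Z Z' Y' P s i d hid hg => ?_)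
  · obtain ⟨hf, hfg, hg⟩ := h
    have := mono_of_injective hf
    have := epi_of_surjective hg
    obtain ⟨r, -, hr, -⟩ := exists_splitting hf hfg hg
    refine kernel_cokernel_of f g (hom_ext (LinearMap.ext hfg.apply_apply_eq_zero))
      (fun t ht => ?_) (fun t ht => ?_)
    · obtain ⟨l, hl⟩ := AMotive.exists_lift hr hfg t.hom
        (congrArg (fun f => f.hom) ht)
      exact ⟨ObjectProperty.homMk l, ObjectProperty.hom_ext _ hl⟩
    · obtain ⟨l, hl⟩ := AMotive.exists_desc hg hfg t.hom
        (congrArg (fun f => f.hom) ht)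
      exact ⟨ObjectProperty.homMk l, ObjectProperty.hom_ext _ hl⟩
  · obtain ⟨r, hr⟩ := (inflation_iff hK).1 hf
    obtain ⟨r', hr'⟩ := (inflation_iff hK).1 hg
    refine (inflation_iff hK).2 ⟨r ∘ₗ r', LinearMap.ext fun x => ?_⟩
    exact (congrArg r (LinearMap.congr_fun hr' _)).trans (LinearMap.congr_fun hr x)
  · obtain ⟨r, hr⟩ := (inflation_iff hK).1 h
    exact (inflation_iff hK).2 ⟨r ∘ₗ g.hom.toLin, hr⟩
  · obtain ⟨hj, he, hp⟩ := hjp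
    obtain ⟨r, hr⟩ := (inflation_iff hK).1 hf
    have hr' (x) : r (s.fst.hom.toLin (j.hom.toLin x)) = x := LinearMap.congr_fun hr x
    let ρ : P.obj.carrier →ₗ[v.B] X'.obj.carrier :=
      s.snd.hom.toLin - s.snd.hom.toLin ∘ₗ j.hom.toLin ∘ₗ r ∘ₗ s.fst.hom.toLin
    obtain ⟨t, ht⟩ := Module.projective_lifting_property p.hom.toLin LinearMap.id hp
    refine (inflation_iff hK).2 ⟨ρ ∘ₗ t, LinearMap.ext fun x => ?_⟩
    have ht' (y) : p.hom.toLin (t y) = y := LinearMap.congr_fun ht y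
    have h1 : s.snd.hom.toLin (s.inr.hom.toLin x) = x :=
      LinearMap.congr_fun (congrArg (fun f => f.hom.toLin) s.inr_snd) x
    have h2 : s.fst.hom.toLin (s.inr.hom.toLin x) = 0 :=
      LinearMap.congr_fun (congrArg (fun f => f.hom.toLin) s.inr_fst) x
    obtain ⟨w, hw⟩ := (he (t (p.hom.toLin (s.inr.hom.toLin x)) - s.inr.hom.toLin x)).1
      (by rw [map_sub, ht', sub_self])
    have h3 : ρ (j.hom.toLin w) = 0 := by simp [ρ, hr']
    rw [hw, map_sub, sub_eq_zero] at h3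
    refine h3.trans ?_
    simp [ρ, h1, h2]
  · obtain ⟨hi, he, hd⟩ := hid
    have hg' := (deflation_iff hK).1 hg
    refine (deflation_iff hK).2 fun z => ?_
    obtain ⟨y, hy⟩ := hg' (d.hom.toLin (s.inr.hom.toLin z))
    obtain ⟨x, hx⟩ := (he (s.inr.hom.toLin z - s.inl.hom.toLin y)).1 (by
      rw [map_sub, ← hy, comp_apply, sub_self])
    have h1 : s.snd.hom.toLin (s.inr.hom.toLin z) = z :=
      LinearMap.congr_fun (congrArg (fun f => f.hom.toLin) s.inr_snd) z
    have h2 : s.snd.hom.toLin (s.inl.hom.toLin y) = 0 :=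
      LinearMap.congr_fun (congrArg (fun f => f.hom.toLin) s.inl_snd) y
    exact ⟨x, by rw [comp_apply, hx, map_sub, h1, h2, sub_zero]⟩

end AMotRat
end Place
end HodgePink
end

noncomputable section
namespace HodgePink
set_option linter.unusedSectionVars false
set_option linter.unusedVariables false

/-! ### Exactness of the Hodge–Pink realization -/

/-- Fields are flat over their subrings. -/
lemma flat_of_faithfulSMul (S L : Type*) [CommRing S] [IsDomain S] [Field L] [Algebra S L]
    [FaithfulSMul S L] : Module.Flat S L := by
  let : Algebra (FractionRing S) L := FractionRing.liftAlgebra S L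
  have : IsScalarTower S (FractionRing S) L := FractionRing.isScalarTower_liftAlgebra S L
  have : Module.Flat S (FractionRing S) := IsLocalization.flat _ (nonZeroDivisors S)
  exact Module.Flat.trans S (FractionRing S) L

lemma baseChange_exact {S X Y Z : Type*} (Q : Type*) [CommRing S] [CommRing Q] [Algebra S Q]
    [AddCommGroup X] [AddCommGroup Y] [AddCommGroup Z] [Module S X] [Module S Y] [Module S Z]
    [Module.Projective S Z] (f : X →ₗ[S] Y) (g : Y →ₗ[S] Z) (hf : Function.Injective f)
    (hfg : Function.Exact f g) (hg : Function.Surjective g) :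
    Function.Injective (f.baseChange Q) ∧ Function.Exact (f.baseChange Q) (g.baseChange Q) ∧
      Function.Surjective (g.baseChange Q) := by
  obtain ⟨r, -, hr, -⟩ := exists_splitting hf hfg hg
  exact ⟨baseChange_injective_of_retraction Q hr, lTensor_exact Q hfg hg,
    LinearMap.lTensor_surjective Q hg⟩

namespace Place

variable {F K : Type u} [Field F] [Fintype F] [Field K] [Algebra F K] {v : Place F K} {ν : v.Nu}
  (R : Subalgebra v.A v.Kinf) (hK : IsFunctionField F K) (γ : ∀ M : v.AMotRat, GermMap ν M.obj)
include hK

lemma flat_Laurent : Module.Flat R (Laurent ν) := by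
  let := (isField_Laurent hK ν).toField
  have : Module.Flat v.Kinf (Laurent ν) := inferInstance
  have : Module.Flat R v.Kinf := flat_of_faithfulSMul R v.Kinf
  exact Module.Flat.trans R v.Kinf (Laurent ν)

variable {X Y Z : v.AMotRat} {f : X ⟶ Y} {g : Y ⟶ Z}

lemma hodgePinkMap_exact (h : AMotRat.exact v f g) :
    Function.Injective (hodgePinkMap R f) ∧ Function.Exact (hodgePinkMap R f) (hodgePinkMap R g) ∧
      Function.Surjective (hodgePinkMap R g) := by
  obtain ⟨hf, hfg, hg⟩ := h
  obtain ⟨r, -, hr, -⟩ := exists_splitting hf hfg hg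
  have := AMotive.projective_betti hK Z.property
  have h1 := AMotive.bettiMap_exact hf hfg hg
  have h2 := AMotive.bettiMap_surjective hK hg Y.property Z.property
  have h3 := baseChange_exact (S := v.A) (X := X.obj.betti) (Y := Y.obj.betti) (Z := Z.obj.betti) R
    (AMotive.bettiMap f.hom) (AMotive.bettiMap g.hom) (AMotive.bettiMap_injective hr) h1 h2
  refine ⟨?_, ?_, ?_⟩
  · exact h3.1
  · exact fun y => h3.2.1 y
  · exact h3.2.2

lemma mem_lattice_of_hodgePinkMap_mem (h : AMotRat.exact v f g)
    {y : Laurent ν ⊗[R] (R ⊗[v.A] X.obj.betti)}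
    (hy : (hodgePinkMap R f).baseChange (Laurent ν) y ∈ (γ Y).lattice R) :
    y ∈ (γ X).lattice R := by
  obtain ⟨r, -, hr, -⟩ := exists_splitting h.1 h.2.1 h.2.2
  have h1 := GermMap.gammaR_baseChange R hK (γ X) (γ Y) f.hom y
  have h2 : f.hom.toLin.baseChange (Laurent ν) ((γ X).gammaR R y) ∈ stdLattice ν Y.obj := h1 ▸ hy
  have h3 := baseChange_mem_stdLattice r h2
  rw [← LinearMap.comp_apply, ← LinearMap.baseChange_comp, hr, LinearMap.baseChange_id] at h3
  exact h3

lemma exists_mem_lattice (h : AMotRat.exact v f g) {z : Laurent ν ⊗[R] (R ⊗[v.A] Z.obj.betti)}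
    (hz : z ∈ (γ Z).lattice R) :
    ∃ y ∈ (γ Y).lattice R, (hodgePinkMap R g).baseChange (Laurent ν) y = z := by
  obtain ⟨-, s, -, hs⟩ := exists_splitting h.1 h.2.1 h.2.2
  obtain ⟨y, hy⟩ := ((γ Y).bijective_gammaR R Y.property hK).2
    (s.baseChange (Laurent ν) ((γ Z).gammaR R z))
  refine ⟨y, ?_, ((γ Z).bijective_gammaR R Z.property hK).1 ?_⟩
  · rw [GermMap.mem_lattice_iff, hy]
    exact baseChange_mem_stdLattice s hz
  · refine (GermMap.gammaR_baseChange R hK (γ Y) (γ Z) g.hom y).trans ?_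
    rw [hy, ← LinearMap.comp_apply, ← LinearMap.baseChange_comp, hs, LinearMap.baseChange_id]
    rfl

variable {γ R} (h : HodgePinkWellDefined γ R) (h' : FrobWellDefined γ R)

lemma strictExact_hodgePink (hfg : AMotRat.exact v f g) :
    HPk.strictExact R v.O (Laurent ν) ((hodgePink h).map f) ((hodgePink h).map g) := by
  have := flat_Laurent (ν := ν) R hK
  obtain ⟨h1, h2, h3⟩ := hodgePinkMap_exact R hK hfg
  exact HPk.strictExact_iff.2 ⟨⟨h1, fun _ hy => mem_lattice_of_hodgePinkMap_mem R hK γ hfg hy⟩, h2, h3,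
    fun _ hz => exists_mem_lattice R hK γ hfg hz⟩

omit hK in
lemma hodgePink_map_add (f f' : X ⟶ Y) :
    (hodgePink h).map (f + f') = (hodgePink h).map f + (hodgePink h).map f' :=
  HPk.Hom.ext (by
    change (AMotive.bettiMap (f.hom + f'.hom)).baseChange R = _
    rw [AMotive.bettiMap_add, LinearMap.baseChange_add]
    rfl)

theorem isExactFunctor_hodgePink : IsExactFunctor (AMotRat.exact v)
    (HPk.strictExact R v.O (Laurent ν)) (hodgePink h) where
  additive := ⟨hodgePink_map_add h _ _⟩
  map_exact _ _ _ _ _ hfg := strictExact_hodgePink hK h hfg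

theorem isExactFunctor_hodgePinkFrob : IsExactFunctor (AMotRat.exact v)
    (HPkFrob.strictExact R v.O (Laurent ν) v.Ginf) (hodgePinkFrob h h') where
  additive := ⟨HPkFrob.Hom.ext (hodgePink_map_add h _ _)⟩
  map_exact _ _ _ _ _ hfg := strictExact_hodgePink hK h hfg

end Place
end HodgePink
end

theorem mainTheorem10 {F K : Type u} [Field F] [Fintype F] [Field K] [Algebra F K]
    (hK : HodgePink.IsFunctionField F K) (v : HodgePink.Place F K)
    (R : Subalgebra v.A v.Kinf) [IsNoetherianRing R] :
    ∃ (ν : v.Nu) (γ : ∀ M : v.AMotRat, HodgePink.Place.GermMap ν M.obj),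
      (∀ ν' : v.Kinf →+* v.O, v.IsNu ν' → ν' = ν.toRingHom) ∧
      (∀ (M : v.AMotRat) (ω : M.obj.betti)
        (g : HodgePink.Place.Laurent ν ⊗[v.B] M.obj.carrier),
        HodgePink.Place.AMotive.IsGerm ν (ω : v.T ⊗[v.B] M.obj.carrier) g →
          g = (γ M).toLin ω) ∧
      (∀ M : v.AMotRat, Function.Bijective (γ M).gamma) ∧
      HodgePink.IsExactCategory (HodgePink.Place.AMotRat.exact v) ∧
      HodgePink.IsExactCategory
        (HodgePink.HPk.strictExact R v.O (HodgePink.Place.Laurent ν)) ∧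
      HodgePink.IsExactCategory
        (HodgePink.HPkFrob.strictExact R v.O (HodgePink.Place.Laurent ν) v.Ginf) ∧
      ∃ (h : HodgePink.Place.HodgePinkWellDefined γ R)
        (h' : HodgePink.Place.FrobWellDefined γ R),
        HodgePink.IsExactFunctor (HodgePink.Place.AMotRat.exact v)
          (HodgePink.HPk.strictExact R v.O (HodgePink.Place.Laurent ν))
          (HodgePink.Place.hodgePink h) ∧
        HodgePink.IsExactFunctor (HodgePink.Place.AMotRat.exact v)
          (HodgePink.HPkFrob.strictExact R v.O (HodgePink.Place.Laurent ν) v.Ginf)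
          (HodgePink.Place.hodgePinkFrob h h') := by
  open HodgePink Place in
  obtain ⟨ν⟩ := exists_nu (v := v) hK
  let γ (M : v.AMotRat) : GermMap ν M.obj := AMotive.germMap M.obj hK ν
  have := isDomain_O (v := v) hK
  have := isNoetherianRing_O (v := v) hK
  have := flat_Laurent (ν := ν) R hK
  exact ⟨ν, γ, fun ν' h => nu_unique hK h ν.isNu,
    fun M ω g hg => AMotive.eq_of_hasGerm hK (hg.hasGerm hK) (((γ M).isGerm ω).hasGerm hK),
    fun M => AMotive.bijective_gamma M.property hK (γ M), AMotRat.isExactCategory hK,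
    HPk.isExactCategory R v.O (Laurent ν), HPkFrob.isExactCategory R v.O (Laurent ν) v.Ginf,
    hodgePinkWellDefined R hK γ, frobWellDefined R hK γ, isExactFunctor_hodgePink hK _,
    isExactFunctor_hodgePinkFrob hK _ _⟩
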